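/- Let $\tau\in\mathbb C$ with $\operatorname{Im}\tau>0$, $q=e^{2i\pi\tau}$, $\varpi=\arg\tau\in\,]0,\pi[$, $C=\mathbb C^*_z/\langle z\mapsto qz\rangle$, and let $F_{1,0,0}(z,y)=\bigl(qz,\tfrac{y}{1-y}\bigr)$, i.e. $(z,\xi)\mapsto(qz,\xi-1)$ with $\xi=1/y$. **The neighborhood $(U_\varphi,C)$.** Let $F$ be a germ of biholomorphism of $\mathbb C^*_z\times\mathbb C_y$ along $\{y=0\}$ with $F(z,0)=(qz,0)$, and $(U,C)=(\mathbb C^*\times\mathbb C,\{y=0\})/\langle F\rangle$. Let $\hat\Psi=\bigl(z+\sum_{n\ge1}a_n(z)y^n,\;y+\sum_{n\ge2}b_n(z)y^n\bigr)$, $a_n,b_n\in\mathcal O(\mathbb C^*)$, be a formal diffeomorphism with $\hat\Psi\circ F=F_{1,0,0}\circ\hat\Psi$. For $i\in\mathbb Z/4$ let $\Psi_i$ be a holomorphic map on a transversely sectorial domain $U_i$ of opening $I_i$ (for $\arg y$), where $I_1=]\varpi-\pi,\varpi[$, $I_2=]0,\pi[$, $I_3=I_1+\pi$, $I_4=I_2+\pi$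 (for all $c,\varepsilon>0$ the domain contains $\{e^{-c}<|z|<e^c,\ 0<|y|<r,\ \arg y\in I_i \text{ shrunk by }\varepsilon\text{ at both ends}\}$ for some $r>0$), with asymptotic expansion $\hat\Psi$ along $C$ and $\Psi_i\circ F=F_{1,0,0}\circ\Psi_i$. Let $\Pi(z,y)=(X,Y)=(e^{2i\pi/y},ze^{2i\pi\tau/y})$ and $\Pi_i=\Pi\circ\Psi_i$. In $\mathbb P^1_X\times\mathbb P^1_Y$ let $L_1=\{Y=0\}$, $L_2=\{X=\infty\}$, $L_3=\{Y=\infty\}$, $L_4=\{X=0\}$, $D=\bigcup L_i$, $p_{i,i+1}=L_i\cap L_{i+1}$. Let $\varphi=(\varphi_{i,i+1})_{i\in\mathbb Z/4}$ be the cocycle of $(U,C)$: germs of biholomorphisms at $p_{i,i+1}$, preserving each of the two branches of $D$ and tangent to the identity at $p_{i,i+1}$, with $\Pi_i=\varphi_{i,i+1}\circ\Pi_{i+1}$ on $U_i\cap U_{i+1}$. So $(U,C)=(U_\varphi,C)$; the $\Pi_i$ are the charts of the isomorphism $U\setminus C\simeq V_\varphi\setminus D$, where $V_\varphi$ is obtained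 by gluing neighborhoods $V_i$ of the $L_i$ by the $\varphi_{i,i+1}$. **The pencil and the equivalence of cocycles.** For $t=u/v=[u:v]\in\mathbb P^1$ let $\hat{\mathcal F}_t$ be the formal foliation on $(U_\varphi,C)$ which is the pull-back by $\hat\Psi$ of the foliation $v\,\omega_0+u\,\omega_\infty=0$, $\omega_0=d\xi$, $\omega_\infty=\frac1{2i\pi\tau}\frac{dz}z$; it is convergent if it is the formal completion along $C$ of a germ of regular holomorphic foliation on $(U_\varphi,C)$. Put $\theta^0=(v-u)\tau\frac{dX}X+u\frac{dY}Y$ (for $v=1$, $u=t$: $(1-t)\tau\frac{dX}X+t\frac{dY}Y$). Let $\mathrm{Diff}(V_i,L_i)$ be the group of germs of biholomorphisms $(X,Y)\mapsto(Xf(\ell_i),Yg(\ell_i))$, with $f,g$ holomorphic and non-zero at $0$ and $\ell_1=Y$, $\ell_2=1/X$, $\ell_3=1/Y$, $\ell_4=X$, and $\mathrm{Diff}^1(V_i,L_i)$ the subgroup where $f(0)=g(0)=1$. For two cocycles write $\varphi\sim\varphi'$ if there are $\psi_i\in\mathrm{Diff}(V_i,L_i)$ with $\psi_i\circ\varphi_{i,i+1}=\varphi'_{i,i+1}\circ\psi_{i+1}$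 for all $i$, and $\varphi\approx\varphi'$ if one can take $\psi_i=\phi^s\circ\varphi_i$ with $\varphi_i\in\mathrm{Diff}^1(V_i,L_i)$ and $\phi^s(X,Y)=(e^{2i\pi s}X,e^{2i\pi\tau s}Y)$, $s\in\mathbb C$ independent of $i$. **Theorem.** For every $t=[u:v]\in\mathbb P^1$ the following are equivalent: 1. the formal foliation $\hat{\mathcal F}_t$ of $(U_\varphi,C)$ is convergent; 2. there are closed holomorphic $1$-forms $\eta_i$ on germs of neighborhoods $(V_i,L_i)$ such that $\theta_i=\theta^0+\eta_i$ satisfy $(\varphi_{i,i+1}^*\theta_i)\wedge\theta_{i+1}=0$ for all $i$; 3. there is a cocycle $\varphi'\sim\varphi$ (germs of biholomorphisms at $p_{i,i+1}$ preserving the two branches of $D$) such that every $\varphi'_{i,i+1}$ preserves the foliation $\theta^0=0$, i.e. $(\varphi'^*_{i,i+1}\theta^0)\wedge\theta^0=0$; 4. there is a cocycle $\varphi'\approx\varphi$ of germs tangent to the identity with the same property. In that case the holomorphic foliation $\mathcal F$ on $(U_\varphi,C)$ with formal completion $\hat{\mathcal F}_t$ corresponds to the logarithmic foliation under $U_\varphi\setminus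 C\simeq V_\varphi\setminus D$: for every family $\eta_i$ as in 2, $\mathcal F$ is given by $\Pi_i^*\theta_i=0$ on $U_i$ near $C$; and for every $\varphi'$ and $\psi_i$ as in 3, $\mathcal F$ is given by $(\psi_i\circ\Pi_i)^*\theta^0=0$ on $U_i$ near $C$. -/

import Mathlib

open Filter Topology Asymptotics

namespace EllipticNbhd

noncomputable section

/-! ### Differential forms in two complex variables -/

/-- A differential form of degree one on (an open subset of) `ℂ × ℂ`. -/
abbrev OneForm : Type := ℂ × ℂ → (ℂ × ℂ →L[ℂ] ℂ)

/-- Pull-back of a one-form by a map. -/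
def pullback (f : ℂ × ℂ → ℂ × ℂ) (ω : OneForm) : OneForm :=
  fun p => (ω (f p)).comp (fderiv ℂ f p)

/-- The coefficient of the wedge product of two covectors; it vanishes iff they are collinear. -/
def wedge (ω₁ ω₂ : ℂ × ℂ →L[ℂ] ℂ) : ℂ :=
  ω₁ (1, 0) * ω₂ (0, 1) - ω₁ (0, 1) * ω₂ (1, 0)

/-- The one-form `ω` is closed at the point `p`. -/
def ClosedAt (ω : OneForm) (p : ℂ × ℂ) : Prop :=
  ∀ v w : ℂ × ℂ, fderiv ℂ ω p v w = fderiv ℂ ω p w v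

/-! ### Neighborhoods of the elliptic curve

The curve is `C = ℂ* / (z ↦ q z)` with `q = exp (2 i π τ)`, and a neighborhood `(U, C)` is
the quotient of the germ of `ℂ* × ℂ` (coordinates `(z, y)`) along `{y = 0}` by a germ `F`
of biholomorphism. The relation with the coordinate `ξ` is `ξ = 1 / y`. -/

/-- The gluing map `(z, y) ↦ (q z, y / (1 - y))` of the model, i.e. `(z, ξ) ↦ (q z, ξ - 1)`. -/
def modelMap (τ : ℂ) (p : ℂ × ℂ) : ℂ × ℂ :=
  (Complex.exp (2 * Real.pi * Complex.I * τ) * p.1, p.2 / (1 - p.2))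

/-- The jet of order `N` of the formal diffeomorphism
`(z + ∑_{n ≥ 1} a n z * y ^ n, y + ∑_{n ≥ 2} b n z * y ^ n)`, tangent to the identity
along `{y = 0}`. -/
def jet (a b : ℕ → ℂ → ℂ) (N : ℕ) (p : ℂ × ℂ) : ℂ × ℂ :=
  (p.1 + ∑ n ∈ Finset.Icc 1 N, a n p.1 * p.2 ^ n,
   p.2 + ∑ n ∈ Finset.Icc 2 N, b n p.1 * p.2 ^ n)

/-- `F` is a germ along `{y = 0}` of biholomorphism inducing `z ↦ q z` on `{y = 0}`, and the
formal diffeomorphism with coefficients `a n`, `b n` (holomorphic on `ℂ*`) conjugates `F` to the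
model map; the identity of formal power series in `y` is stated modulo `y ^ (N + 1)` for
every `N`. -/
structure IsFormalNormalization (τ : ℂ) (F : ℂ × ℂ → ℂ × ℂ) (a b : ℕ → ℂ → ℂ) : Prop where
  analytic : ∀ z : ℂ, z ≠ 0 → AnalyticAt ℂ F (z, 0)
  on_curve : ∀ z : ℂ, z ≠ 0 → F (z, 0) = (Complex.exp (2 * Real.pi * Complex.I * τ) * z, 0)
  coeff_fst : ∀ n, ∀ z : ℂ, z ≠ 0 → AnalyticAt ℂ (a n) z
  coeff_snd : ∀ n, ∀ z : ℂ, z ≠ 0 → AnalyticAt ℂ (b n) z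
  conj : ∀ N, ∀ z : ℂ, z ≠ 0 →
    (fun y : ℂ => jet a b N (F (z, y)) - modelMap τ (jet a b N (z, y)))
      =O[𝓝 0] (fun y : ℂ => y ^ (N + 1))

/-! ### The formal pencil of foliations and its convergent members -/

/-- The member of parameter `t = u / v` of the pencil of the model: the form
`v ω₀ + u ω_∞`, with `ω₀ = dξ = - dy / y ^ 2` and `ω_∞ = dz / (2 i π τ z)`, multiplied by
`2 i π τ z y ^ 2` in order to clear the denominators. -/
def pencilForm (τ u v : ℂ) : OneForm := fun p =>
  (u * p.2 ^ 2) • ContinuousLinearMap.fst ℂ ℂ ℂ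
    - (2 * Real.pi * Complex.I * τ * v * p.1) • ContinuousLinearMap.snd ℂ ℂ ℂ

/-- `ω` defines a germ along `{y = 0}` of regular holomorphic foliation which is invariant
under `F`, i.e. a germ of regular foliation on `(U, C)`. -/
structure IsFoliation (F : ℂ × ℂ → ℂ × ℂ) (ω : OneForm) : Prop where
  analytic : ∀ z : ℂ, z ≠ 0 → AnalyticAt ℂ ω (z, 0)
  regular : ∀ z : ℂ, z ≠ 0 → ω (z, 0) ≠ 0
  invariant : ∀ z : ℂ, z ≠ 0 → ∀ᶠ p in 𝓝 ((z, 0) : ℂ × ℂ), wedge (pullback F ω p) (ω p) = 0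

/-- The foliation `ω = 0` has, as formal completion along `{y = 0}`, the pull-back of the member
of parameter `u / v` of the model pencil by the formal diffeomorphism with coefficients `a`, `b`:
the wedge product of the two defining forms vanishes modulo `y ^ N` for every `N`. -/
def HasFormalCompletion (τ u v : ℂ) (a b : ℕ → ℂ → ℂ) (ω : OneForm) : Prop :=
  ∀ N : ℕ, ∀ z : ℂ, z ≠ 0 →
    (fun y : ℂ => wedge (ω (z, y)) (pullback (jet a b N) (pencilForm τ u v) (z, y)))
      =O[𝓝 0] (fun y : ℂ => y ^ N)

/-- The formal foliation of parameter `u / v` of the neighborhood is convergent. -/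
def FormalFoliationConverges (τ u v : ℂ) (F : ℂ × ℂ → ℂ × ℂ) (a b : ℕ → ℂ → ℂ) : Prop :=
  ∃ ω : OneForm, IsFoliation F ω ∧ HasFormalCompletion τ u v a b ω

/-! ### Transversely sectorial domains -/

/-- The sector `θ₁ < arg y < θ₂`, `0 < |y| < r`, `exp (-c) < |z| < exp c`. -/
def sector (θ₁ θ₂ r c : ℝ) : Set (ℂ × ℂ) :=
  {p | Real.exp (-c) < ‖p.1‖ ∧ ‖p.1‖ < Real.exp c ∧
    ∃ ρ θ : ℝ, 0 < ρ ∧ ρ < r ∧ θ₁ < θ ∧ θ < θ₂ ∧ p.2 = ρ * Complex.exp (θ * Complex.I)}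

theorem sector_mono {θ₁ θ₂ r r' c : ℝ} (h : r ≤ r') :
    sector θ₁ θ₂ r c ⊆ sector θ₁ θ₂ r' c := by
  rintro p ⟨h1, h2, ρ, θ, h3, h4, h5⟩
  exact ⟨h1, h2, ρ, θ, h3, h4.trans_le h, h5⟩

/-- The filter of the sets which contain a transversely sectorial domain of opening
`]θ₁, θ₂[`: for all `c, ε > 0` they contain a sector of opening `]θ₁ + ε, θ₂ - ε[`,
of some radius `r > 0`, over `exp (-c) < |z| < exp c`. -/
def sectorGerm (θ₁ θ₂ : ℝ) : Filter (ℂ × ℂ) where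
  sets := {s | ∀ c > 0, ∀ ε > 0, ∃ r > 0, sector (θ₁ + ε) (θ₂ - ε) r c ⊆ s}
  univ_sets := fun _ _ _ _ => ⟨1, one_pos, Set.subset_univ _⟩
  sets_of_superset := by
    intro s t hs hst c hc ε hε
    obtain ⟨r, hr, h⟩ := hs c hc ε hε
    exact ⟨r, hr, h.trans hst⟩
  inter_sets := by
    intro s t hs ht c hc ε hε
    obtain ⟨r, hr, h⟩ := hs c hc ε hε
    obtain ⟨r', hr', h'⟩ := ht c hc ε hε
    exact ⟨min r r', lt_min hr hr', Set.subset_inter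
      ((sector_mono (min_le_left _ _)).trans h) ((sector_mono (min_le_right _ _)).trans h')⟩

/-- Lower end of the interval `I_i` of values of `arg y`, where `ϖ = arg τ`:
`I_1 = ]ϖ - π, ϖ[`, `I_2 = ]0, π[`, `I_3 = ]ϖ, ϖ + π[`, `I_4 = ]π, 2 π[`.
The four indices are cyclic, and `0 : Fin 4` stands for the index four. -/
def sectorStart (τ : ℂ) : Fin 4 → ℝ
  | 0 => Real.pi
  | 1 => τ.arg - Real.pi
  | 2 => 0
  | 3 => τ.arg

/-- Germs of transversely sectorial domains of opening `I_i`. -/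
def sectorFilter (τ : ℂ) (i : Fin 4) : Filter (ℂ × ℂ) :=
  sectorGerm (sectorStart τ i) (sectorStart τ i + Real.pi)

/-- `Ψ i` is a holomorphic map on a transversely sectorial domain of opening `I_i`, it has the
formal diffeomorphism with coefficients `a`, `b` as asymptotic expansion along `{y = 0}`, and it
conjugates `F` to the model map. -/
structure IsSectorialNormalization (τ : ℂ) (F : ℂ × ℂ → ℂ × ℂ) (a b : ℕ → ℂ → ℂ)
    (Ψ : Fin 4 → ℂ × ℂ → ℂ × ℂ) : Prop where
  holomorphic : ∀ i, ∀ᶠ p in sectorFilter τ i, AnalyticAt ℂ (Ψ i) p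
  asymptotic : ∀ i, ∀ N : ℕ, ∀ c > 0, ∀ ε > 0, ∃ K : ℝ, ∃ r > 0,
    ∀ p ∈ sector (sectorStart τ i + ε) (sectorStart τ i + Real.pi - ε) r c,
      ‖Ψ i p - jet a b N p‖ ≤ K * ‖p.2‖ ^ (N + 1)
  conj : ∀ i, ∀ᶠ p in sectorFilter τ i, Ψ i (F p) = modelMap τ (Ψ i p)

/-! ### The cycle of four lines in `ℙ¹ × ℙ¹`

`L_1 = {Y = 0}`, `L_2 = {X = ∞}`, `L_3 = {Y = ∞}`, `L_4 = {X = 0}` (index `0 : Fin 4`), with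
union `D`, and `p_{i,i+1} = L_i ∩ L_{i+1}`. Germs of maps and forms near `L_i` or `p_{i,i+1}`
are described on the complement of `D`, in the coordinates `(X, Y)`. -/

/-- The complement `ℂ* × ℂ*` of `D` in `ℙ¹ × ℙ¹`. -/
def torus : Set (ℂ × ℂ) := {p | p.1 ≠ 0 ∧ p.2 ≠ 0}

/-- The coordinate that vanishes on `L_i`. -/
def lineCoord : Fin 4 → ℂ × ℂ → ℂ
  | 0, p => p.1
  | 1, p => p.2
  | 2, p => p.1⁻¹
  | 3, p => p.2⁻¹

/-- The coordinates centered at the corner `p_{i,i+1}`, as a function of `(X, Y)`; in these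
coordinates the corner is the origin. This map is an involution. -/
def cornerChart : Fin 4 → ℂ × ℂ → ℂ × ℂ
  | 0, p => (p.1, p.2)
  | 1, p => (p.1⁻¹, p.2)
  | 2, p => (p.1⁻¹, p.2⁻¹)
  | 3, p => (p.1, p.2⁻¹)

/-- Germs of neighborhoods of `L_i`, with `D` removed. -/
def lineGerm (i : Fin 4) : Filter (ℂ × ℂ) := comap (lineCoord i) (𝓝 0) ⊓ 𝓟 torus

/-- Germs of neighborhoods of `p_{i,i+1}`, with `D` removed. -/
def cornerGerm (i : Fin 4) : Filter (ℂ × ℂ) := comap (cornerChart i) (𝓝 0) ⊓ 𝓟 torus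

/-- The group `Diff(V_{i,i+1}, p_{i,i+1})` of germs of biholomorphisms at the corner that
preserve each of the two branches of `D`. -/
def DiffCorner (i : Fin 4) (φ : ℂ × ℂ → ℂ × ℂ) : Prop :=
  ∃ f g : ℂ × ℂ → ℂ, AnalyticAt ℂ f 0 ∧ AnalyticAt ℂ g 0 ∧ f 0 ≠ 0 ∧ g 0 ≠ 0 ∧
    ∀ᶠ p in cornerGerm i, φ p = (p.1 * f (cornerChart i p), p.2 * g (cornerChart i p))

/-- The subgroup `Diff¹(V_{i,i+1}, p_{i,i+1})` of germs tangent to the identity at the corner. -/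
def DiffCornerOne (i : Fin 4) (φ : ℂ × ℂ → ℂ × ℂ) : Prop :=
  ∃ f g : ℂ × ℂ → ℂ, AnalyticAt ℂ f 0 ∧ AnalyticAt ℂ g 0 ∧ f 0 = 1 ∧ g 0 = 1 ∧
    ∀ᶠ p in cornerGerm i, φ p = (p.1 * f (cornerChart i p), p.2 * g (cornerChart i p))

/-- The group `Diff(V_i, L_i)` of germs of biholomorphisms along `L_i` that preserve each
component of `D`; for instance `(X f(Y), Y g(Y))` along `L_1 = {Y = 0}`. -/
def DiffLine (i : Fin 4) (ψ : ℂ × ℂ → ℂ × ℂ) : Prop :=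
  ∃ f g : ℂ → ℂ, AnalyticAt ℂ f 0 ∧ AnalyticAt ℂ g 0 ∧ f 0 ≠ 0 ∧ g 0 ≠ 0 ∧
    ∀ᶠ p in lineGerm i, ψ p = (p.1 * f (lineCoord i p), p.2 * g (lineCoord i p))

/-- The subgroup `Diff¹(V_i, L_i)` of germs tangent to the identity along `L_i`. -/
def DiffLineOne (i : Fin 4) (ψ : ℂ × ℂ → ℂ × ℂ) : Prop :=
  ∃ f g : ℂ → ℂ, AnalyticAt ℂ f 0 ∧ AnalyticAt ℂ g 0 ∧ f 0 = 1 ∧ g 0 = 1 ∧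
    ∀ᶠ p in lineGerm i, ψ p = (p.1 * f (lineCoord i p), p.2 * g (lineCoord i p))

/-- The Serre isomorphism `(z, ξ) ↦ (exp (2 i π ξ), z exp (2 i π τ ξ))`, with `ξ = 1 / y`. -/
def serreMap (τ : ℂ) (p : ℂ × ℂ) : ℂ × ℂ :=
  (Complex.exp (2 * Real.pi * Complex.I / p.2),
   p.1 * Complex.exp (2 * Real.pi * Complex.I * τ / p.2))

/-- The sectorial charts `Π_i = Π ∘ Ψ_i` of the isomorphism between `U ∖ C` and `V_φ ∖ D`. -/
def sectorialChart (τ : ℂ) (Ψ : Fin 4 → ℂ × ℂ → ℂ × ℂ) (i : Fin 4) : ℂ × ℂ → ℂ × ℂ :=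
  fun p => serreMap τ (Ψ i p)

/-- `φ i` stands for `φ_{i,i+1}`. The cocycle `φ` is the one defined by the sectorial
normalizations `Ψ`: the germs are tangent to the identity and `Π_i = φ_{i,i+1} ∘ Π_{i+1}`
on the intersections of sectors. -/
structure IsCocycleOf (τ : ℂ) (Ψ φ : Fin 4 → ℂ × ℂ → ℂ × ℂ) : Prop where
  tangent : ∀ i, DiffCornerOne i (φ i)
  transition : ∀ i, ∀ᶠ p in sectorFilter τ i ⊓ sectorFilter τ (i + 1),
    sectorialChart τ Ψ i p = φ i (sectorialChart τ Ψ (i + 1) p)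

/-- The germs `ψ i` along `L_i` conjugate the cocycle `φ` to the cocycle `χ`:
`ψ_i ∘ φ_{i,i+1} = χ_{i,i+1} ∘ ψ_{i+1}`. -/
def Conjugates (ψ φ χ : Fin 4 → ℂ × ℂ → ℂ × ℂ) : Prop :=
  ∀ i, ∀ᶠ p in cornerGerm i, ψ i (φ i p) = χ i (ψ (i + 1) p)

/-- The relation `φ ∼ χ` between cocycles: conjugacy by germs in `Diff(V_i, L_i)`. -/
def CocycleEquiv (φ χ : Fin 4 → ℂ × ℂ → ℂ × ℂ) : Prop :=
  ∃ ψ : Fin 4 → ℂ × ℂ → ℂ × ℂ, (∀ i, DiffLine i (ψ i)) ∧ Conjugates ψ φ χ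

/-- The flow `(exp (2 i π s) X, exp (2 i π τ s) Y)` of the vector field `∂_ξ`. -/
def torusFlow (τ s : ℂ) (p : ℂ × ℂ) : ℂ × ℂ :=
  (Complex.exp (2 * Real.pi * Complex.I * s) * p.1,
   Complex.exp (2 * Real.pi * Complex.I * τ * s) * p.2)

/-- The finer relation `φ ≈ χ` between cocycles: conjugacy by germs `ϕ^s ∘ ψ_i`, where `ψ_i` is
in `Diff¹(V_i, L_i)` and `ϕ^s` is the flow above, with the same `s` for all `i`. -/
def CocycleEquivOne (τ : ℂ) (φ χ : Fin 4 → ℂ × ℂ → ℂ × ℂ) : Prop :=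
  ∃ s : ℂ, ∃ ψ : Fin 4 → ℂ × ℂ → ℂ × ℂ, (∀ i, DiffLineOne i (ψ i)) ∧
    Conjugates (fun i p => torusFlow τ s (ψ i p)) φ χ

/-! ### Logarithmic forms -/

/-- The logarithmic form `(v - u) τ dX / X + u dY / Y`; for `u = t`, `v = 1` it is
`(1 - t) τ dX / X + t dY / Y`. -/
def logForm (τ u v : ℂ) : OneForm := fun p =>
  ((v - u) * τ / p.1) • ContinuousLinearMap.fst ℂ ℂ ℂ
    + (u / p.2) • ContinuousLinearMap.snd ℂ ℂ ℂ

/-- `η` is the germ of a closed holomorphic one-form along `L_i`: in the chart centered at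
either of the two corners `p_{i-1,i}` and `p_{i,i+1}` of `L_i` (these two charts cover `L_i`),
it is given by a form which is holomorphic and closed near every point of `L_i`. -/
def IsClosedHolomorphic (i : Fin 4) (η : OneForm) : Prop :=
  ∀ j : Fin 4, (j = i ∨ j + 1 = i) → ∃ η' : OneForm,
    (∀ x : ℂ × ℂ, lineCoord i (cornerChart j x) = 0 →
      AnalyticAt ℂ η' x ∧ ∀ᶠ x' in 𝓝 x, ClosedAt η' x') ∧
    ∀ᶠ p in lineGerm i, η p = pullback (cornerChart j) η' p

/-- The foliations `θ_i = 0` on the neighborhoods of the lines `L_i` patch together under the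
gluing maps: `(φ_{i,i+1})^* θ_i ∧ θ_{i+1} = 0`. -/
def FoliationsPatch (φ : Fin 4 → ℂ × ℂ → ℂ × ℂ) (θ : Fin 4 → OneForm) : Prop :=
  ∀ i, ∀ᶠ p in cornerGerm i, wedge (pullback (φ i) (θ i) p) (θ (i + 1) p) = 0

/-- Every `φ_{i,i+1}` preserves the foliation `(v - u) τ dX / X + u dY / Y = 0`. -/
def PreservesLogFoliation (τ u v : ℂ) (φ : Fin 4 → ℂ × ℂ → ℂ × ℂ) : Prop :=
  FoliationsPatch φ (fun _ => logForm τ u v)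

end

end EllipticNbhd

open EllipticNbhd

/-!
Let `Π_i = Π ∘ Ψ_i` be the sectorial charts. As `Π` is invariant under the model map, `Π_i` is
invariant under `F`, and the pull-back by `Π_i` of any form is invariant under `F`. The modulus of
the coordinate `ℓ` vanishing on `L_i` is exponentially small in the sector `I_i`
(`norm_lineCoord_serreMap`, `flat_lineCoord`). So everything holomorphic along `L_i` differs, once
pulled back, by a flat quantity from what it is on `L_i`, and the formal completion along the curve
sees the residues only. The proof goes both ways between flat data in the sectors and holomorphic
data along the lines.

*From a convergent foliation to logarithmic forms.* Let `ω = 0` be the convergent foliation, let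
`θ⁰ = (v - u) τ dX / X + u dY / Y`, and let `L₁` be a logarithmic form with constant coefficients
which is independent of `θ⁰`. The quotient `(ω ∧ Π_i^* θ⁰) / (ω ∧ Π_i^* L₁)` is a holomorphic
function in a sector; it is invariant under `F`, and it is flat by `flat_ratio`. The main step
(`exists_eq_comp_lineCoord`) says that such a function is `k(ℓ)` with `k` holomorphic at `0` and
`k(0) = 0`. It descends to the image of the sector under `Π_i`, which is a neighborhood of
`L_i ∖ {two corners}` with cuspidal ends: it contains `|ℓ| ^ K < |x| < |ℓ| ^ (-K)` for all `K` and
`ℓ` small, where `x` is the coordinate on `L_i`. These annuli are so thick that Cauchy's formula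
bounds the derivative in `x` by any power of `ℓ`, and by the identity principle in `ℓ` the function
does not depend on `x` (`exists_analytic_of_cuspGerm`). Hence `ω` is collinear to
`Π_i^*(θ⁰ - k(ℓ) L₁)`. For `L₁` proportional to `dℓ / ℓ` this is `θ⁰` plus a closed holomorphic
form. This choice is impossible exactly when `θ⁰` is itself proportional to `dℓ / ℓ`; then the
compatibility with the neighboring line at a corner forces `k = 0` (`eq_zero_of_patchNum`). The
forms patch in the images of the sectors, hence near the corners by the identity principle.

*From logarithmic forms to a convergent foliation.* By Liouville's theorem on the lines, the closed
holomorphic forms along `L_i` are the forms `k(ℓ) dℓ` (`IsClosedHolomorphic.exists_axisForm`). If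
`θ_i = θ⁰ + k_i(ℓ) dℓ` patch under the cocycle, then the slopes of the foliations `Π_i^* θ_i = 0`
agree on the intersections of the sectors, and they are bounded because they are flat perturbations
of the slopes of the pull-back of the pencil. By Riemann's theorem on removable singularities they
are the restrictions of one function which is holomorphic along the curve
(`exists_analytic_of_sectors`), and it defines the foliation (`exists_foliation_of_patch`).
A foliation is determined by its formal completion, since a function which is analytic along the
curve and flat in one sector is zero (`Flat.eventually_eq_zero`). This gives the description of the
foliation in the charts as well.

*Cocycles.* A primitive of `k(ℓ)` gives a shear along `L_i`, tangent to the identity, which carries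
`θ⁰ = 0` to `θ⁰ + k(ℓ) dℓ = 0` (`exists_shear`). Conjugating by these shears yields a cocycle that
preserves `θ⁰ = 0` (`exists_preserving_cocycle`). Conversely the pull-back of `θ⁰` by a germ
in `Diff(V_i, L_i)` is `θ⁰ + k(ℓ) dℓ` (`DiffLine.exists_pullback`).
-/

namespace EllipticNbhd

/-! ### Sectors as cones -/

/-- The unit complex number whose argument is the upper end of the interval `I_i`; the point `y`
has its argument in `I_i` if and only if `dir τ i / y` lies in the upper half plane. -/
noncomputable def dir (τ : ℂ) (i : Fin 4) : ℂ :=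
  Complex.exp (((sectorStart τ i + Real.pi : ℝ) : ℂ) * Complex.I)

theorem norm_dir (τ : ℂ) (i : Fin 4) : ‖dir τ i‖ = 1 := by
  simpa [dir] using Complex.norm_exp_ofReal_mul_I (sectorStart τ i + Real.pi)

theorem dir_ne_zero (τ : ℂ) (i : Fin 4) : dir τ i ≠ 0 := Complex.exp_ne_zero _

theorem dir_zero (τ : ℂ) : dir τ 0 = 1 := by
  simp only [dir, sectorStart]
  rw [← Complex.exp_two_pi_mul_I]
  push_cast
  ring_nf

theorem dir_two (τ : ℂ) : dir τ 2 = -1 := by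
  simp only [dir, sectorStart]
  rw [← Complex.exp_pi_mul_I]
  push_cast
  ring_nf

theorem norm_mul_dir_one (τ : ℂ) : ‖τ‖ * dir τ 1 = τ := by
  simp only [dir, sectorStart, sub_add_cancel]
  exact Complex.norm_mul_exp_arg_mul_I τ

theorem dir_three (τ : ℂ) : dir τ 3 = -dir τ 1 := by
  simp only [dir, sectorStart, sub_add_cancel]
  push_cast
  rw [add_mul, Complex.exp_add, Complex.exp_pi_mul_I]
  ring

theorem norm_mul_dir_three (τ : ℂ) : ‖τ‖ * dir τ 3 = -τ := by
  rw [dir_three, mul_neg, norm_mul_dir_one]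

theorem dir_add_two (τ : ℂ) (i : Fin 4) : dir τ (i + 2) = -dir τ i := by
  fin_cases i <;> simp [dir_zero, dir_two, dir_three, Fin.add_def]

theorem dir_one_im_pos {τ : ℂ} (hτ : 0 < τ.im) : 0 < (dir τ 1).im := by
  have h := congrArg Complex.im (norm_mul_dir_one τ)
  rw [Complex.im_ofReal_mul] at h
  rw [← h] at hτ
  exact pos_of_mul_pos_right hτ (norm_nonneg τ)

/-- The truncated cone of points `(z, y)` with `exp (-c) < |z| < exp c`, `0 < |y| < r` and
`δ < |y| Im (dir τ i / y)` for all `i ∈ S`. -/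
def cone (τ : ℂ) (S : Set (Fin 4)) (c δ r : ℝ) : Set (ℂ × ℂ) :=
  {p | Real.exp (-c) < ‖p.1‖ ∧ ‖p.1‖ < Real.exp c ∧ p.2 ≠ 0 ∧ ‖p.2‖ < r ∧
    ∀ i ∈ S, δ < ‖p.2‖ * (dir τ i / p.2).im}

theorem cone_mono {τ : ℂ} {S T : Set (Fin 4)} {c c' δ δ' r r' : ℝ} (hS : T ⊆ S) (hc : c ≤ c')
    (hδ : δ' ≤ δ) (hr : r ≤ r') : cone τ S c δ r ⊆ cone τ T c' δ' r' := by
  rintro p ⟨h1, h2, h3, h4, h5⟩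
  exact ⟨(Real.exp_le_exp.2 (neg_le_neg hc)).trans_lt h1, h2.trans_le (Real.exp_le_exp.2 hc), h3,
    h4.trans_le hr, fun i hi => hδ.trans_lt (h5 i (hS hi))⟩

/-- Germs along the curve `y = 0` of domains which are bounded transversely by the half planes
of index in `S`: for `S = {i}` this is `sectorFilter τ i`, and for `S = ∅` these are the punctured
neighborhoods of the curve. -/
def coneGerm (τ : ℂ) (S : Set (Fin 4)) : Filter (ℂ × ℂ) where
  sets := {s | ∀ c > 0, ∀ δ > 0, ∃ r > 0, cone τ S c δ r ⊆ s}
  univ_sets := fun _ _ _ _ => ⟨1, one_pos, Set.subset_univ _⟩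
  sets_of_superset := by
    intro s t hs hst c hc ε hε
    obtain ⟨r, hr, h⟩ := hs c hc ε hε
    exact ⟨r, hr, h.trans hst⟩
  inter_sets := by
    intro s t hs ht c hc ε hε
    obtain ⟨r, hr, h⟩ := hs c hc ε hε
    obtain ⟨r', hr', h'⟩ := ht c hc ε hε
    exact ⟨min r r', lt_min hr hr', Set.subset_inter
      ((cone_mono subset_rfl le_rfl le_rfl (min_le_left _ _)).trans h)
      ((cone_mono subset_rfl le_rfl le_rfl (min_le_right _ _)).trans h')⟩

theorem eventually_coneGerm {τ : ℂ} {S : Set (Fin 4)} {P : ℂ × ℂ → Prop} :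
    (∀ᶠ p in coneGerm τ S, P p) ↔
      ∀ c > 0, ∀ δ > 0, ∃ r > 0, ∀ p ∈ cone τ S c δ r, P p := Iff.rfl

theorem coneGerm_mono {τ : ℂ} {S T : Set (Fin 4)} (h : S ⊆ T) :
    coneGerm τ T ≤ coneGerm τ S := by
  intro s hs c hc δ hδ
  obtain ⟨r, hr, h'⟩ := hs c hc δ hδ
  exact ⟨r, hr, (cone_mono h le_rfl le_rfl le_rfl).trans h'⟩

theorem im_dir_div (τ : ℂ) (i : Fin 4) (ρ θ : ℝ) :
    (dir τ i / (ρ * Complex.exp (θ * Complex.I))).im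
      = Real.sin (sectorStart τ i + Real.pi - θ) / ρ := by
  have : dir τ i / (ρ * Complex.exp (θ * Complex.I))
      = ((ρ⁻¹ : ℝ) : ℂ) *
        Complex.exp (((sectorStart τ i + Real.pi - θ : ℝ) : ℂ) * Complex.I) := by
    rw [dir, mul_comm (ρ : ℂ), ← div_div, ← Complex.exp_sub, ← sub_mul]
    push_cast
    field_simp
  rw [this, Complex.im_ofReal_mul, Complex.exp_ofReal_mul_I_im]
  ring

/-- The sectors defined by the argument of `y` and the cones generate the same germs of domains. -/
theorem sectorFilter_eq (τ : ℂ) (i : Fin 4) : sectorFilter τ i = coneGerm τ {i} := by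
  ext s
  constructor
  · intro hs c hc δ hδ
    rcases lt_or_ge δ 1 with hδ1 | hδ1
    · obtain ⟨r, hr, h⟩ := hs c hc (Real.arcsin δ) (Real.arcsin_pos.2 hδ)
      refine ⟨r, hr, fun p hp => h ?_⟩
      obtain ⟨h1, h2, h3, h4, h5⟩ := hp
      have h5 := h5 i rfl
      have hy : 0 < ‖p.2‖ := norm_pos_iff.2 h3
      set w := dir τ i / p.2 with hw
      have hw0 : w ≠ 0 := div_ne_zero (dir_ne_zero τ i) h3
      have hwn : ‖w‖ = ‖p.2‖⁻¹ := by rw [hw, norm_div, norm_dir, one_div]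
      have hsin : δ < Real.sin w.arg := by
        rw [Complex.sin_arg, hwn, div_inv_eq_mul, mul_comm]; exact h5
      have harg : 0 < w.arg ∧ w.arg < Real.pi := by
        have h0 : 0 < w.im := by
          by_contra hcon
          nlinarith
        refine ⟨?_, ?_⟩
        · refine lt_of_le_of_ne (Complex.arg_nonneg_iff.2 h0.le) fun hcon => ?_
          rw [← hcon, Real.sin_zero] at hsin; linarith
        · refine lt_of_le_of_ne (Complex.arg_le_pi w) fun hcon => ?_
          rw [hcon, Real.sin_pi] at hsin; linarith
      have hrange : Real.arcsin δ < w.arg ∧ w.arg < Real.pi - Real.arcsin δ := by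
        have hpi := Real.pi_pos
        constructor
        · by_contra hcon
          push Not at hcon
          have := Real.sin_le_sin_of_le_of_le_pi_div_two (by linarith)
            (Real.arcsin_le_pi_div_two δ) hcon
          rw [Real.sin_arcsin (by linarith) hδ1.le] at this
          linarith
        · by_contra hcon
          push Not at hcon
          have := Real.sin_le_sin_of_le_of_le_pi_div_two (x := Real.pi - w.arg) (by linarith)
            (Real.arcsin_le_pi_div_two δ) (by linarith)
          rw [Real.sin_arcsin (by linarith) hδ1.le, Real.sin_pi_sub] at this
          linarith
      refine ⟨h1, h2, ‖p.2‖, sectorStart τ i + Real.pi - w.arg, hy, h4, by linarith,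
        by linarith, ?_⟩
      have hpol := Complex.norm_mul_exp_arg_mul_I w
      have hp2 : p.2 = dir τ i / w := by
        rw [hw]; field_simp [dir_ne_zero τ i]
      have hpol' : w = (‖p.2‖⁻¹ : ℝ) * Complex.exp (w.arg * Complex.I) := by
        rw [← hwn]; exact hpol.symm
      have hne : (‖p.2‖ : ℂ) ≠ 0 := by exact_mod_cast hy.ne'
      calc p.2 = dir τ i / w := hp2
        _ = dir τ i / ((‖p.2‖⁻¹ : ℝ) * Complex.exp (w.arg * Complex.I)) := by rw [← hpol']
        _ = _ := by
          rw [dir]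
          push_cast
          rw [sub_mul, Complex.exp_sub]
          field_simp
    · refine ⟨1, one_pos, fun p hp => ?_⟩
      obtain ⟨h1, h2, h3, h4, h5⟩ := hp
      have h5 := h5 i rfl
      have hy : 0 < ‖p.2‖ := norm_pos_iff.2 h3
      have : (dir τ i / p.2).im ≤ ‖p.2‖⁻¹ := by
        refine (Complex.im_le_norm _).trans ?_
        rw [norm_div, norm_dir, one_div]
      have := mul_le_mul_of_nonneg_left this hy.le
      rw [mul_inv_cancel₀ hy.ne'] at this
      linarith
  · intro hs c hc ε hε
    rcases lt_or_ge ε (Real.pi / 2) with hε2 | hε2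
    · obtain ⟨r, hr, h⟩ := hs c hc (Real.sin ε)
        (Real.sin_pos_of_pos_of_lt_pi hε (by linarith [Real.pi_pos]))
      refine ⟨r, hr, fun p hp => h ?_⟩
      obtain ⟨h1, h2, ρ, θ, h3, h4, h5, h6, h7⟩ := hp
      have hnorm : ‖p.2‖ = ρ := by
        rw [h7, norm_mul, Complex.norm_exp_ofReal_mul_I, mul_one, Complex.norm_real,
          Real.norm_of_nonneg h3.le]
      refine ⟨h1, h2, norm_pos_iff.1 (hnorm ▸ h3), hnorm ▸ h4, ?_⟩
      rintro j rfl
      rw [hnorm, h7, im_dir_div τ j, mul_div_cancel₀ _ h3.ne']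
      rcases le_or_gt (sectorStart τ j + Real.pi - θ) (Real.pi / 2) with hle | hlt
      · exact Real.sin_lt_sin_of_lt_of_le_pi_div_two (by linarith [Real.pi_pos]) hle (by linarith)
      · rw [← Real.sin_pi_sub (sectorStart τ j + Real.pi - θ)]
        exact Real.sin_lt_sin_of_lt_of_le_pi_div_two (by linarith [Real.pi_pos]) (by linarith)
          (by linarith)
    · refine ⟨1, one_pos, fun p hp => ?_⟩
      obtain ⟨h1, h2, ρ, θ, h3, h4, h5, h6, h7⟩ := hp
      linarith

/-- Relative size of a polydisc around a point of `cone τ S c δ r` which stays in a larger cone. -/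
noncomputable def polyRadius (c δ : ℝ) : ℝ := min (Real.exp (-c) / 2) (min (δ / 8) (1 / 8))

theorem polyRadius_pos {c δ : ℝ} (hδ : 0 < δ) : 0 < polyRadius c δ :=
  lt_min (by positivity) (lt_min (by positivity) (by norm_num))

theorem polyRadius_le (c δ : ℝ) : polyRadius c δ ≤ 1 / 8 :=
  (min_le_right _ _).trans (min_le_right _ _)

/-- A point close to a point of a cone, where closeness is relative to `y` in the second
coordinate, belongs to a larger cone. -/
theorem cone_perturb {τ : ℂ} {S : Set (Fin 4)} {c δ r : ℝ} (hc : 0 < c) (hδ : 0 < δ)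
    {p : ℂ × ℂ} (hp : p ∈ cone τ S c δ r) {x : ℂ × ℂ} (hx : ‖x‖ ≤ polyRadius c δ) :
    (p.1 + x.1, p.2 * (1 + x.2)) ∈ cone τ S (c + 1) (δ / 2) (2 * r) := by
  obtain ⟨h1, h2, h3, h4, h5⟩ := hp
  have hx1 : ‖x.1‖ ≤ polyRadius c δ := (norm_fst_le x).trans hx
  have hx2 : ‖x.2‖ ≤ polyRadius c δ := (norm_snd_le x).trans hx
  have e1 : polyRadius c δ ≤ Real.exp (-c) / 2 := min_le_left _ _
  have e2 : polyRadius c δ ≤ δ / 8 := (min_le_right _ _).trans (min_le_left _ _)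
  have e3 := polyRadius_le c δ
  have hy : 0 < ‖p.2‖ := norm_pos_iff.2 h3
  have hexp1 : Real.exp (-(c + 1)) ≤ Real.exp (-c) / 2 := by
    rw [neg_add, Real.exp_add, div_eq_mul_inv, Real.exp_neg 1]
    gcongr
    linarith [Real.add_one_le_exp (1 : ℝ)]
  have hexp2 : Real.exp c + 1 ≤ Real.exp (c + 1) := by
    rw [Real.exp_add]
    nlinarith [Real.add_one_le_exp (1 : ℝ), Real.add_one_le_exp c]
  have hone : 1 - ‖x.2‖ ≤ ‖1 + x.2‖ := by
    have := norm_sub_le (1 + x.2) x.2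
    simp only [add_sub_cancel_right, norm_one] at this
    linarith
  have hone' : ‖1 + x.2‖ ≤ 1 + ‖x.2‖ := (norm_add_le _ _).trans (by simp)
  have hpos : 0 < ‖1 + x.2‖ := by linarith
  refine ⟨?_, ?_, ?_, ?_, ?_⟩
  · have := norm_sub_le (p.1 + x.1) x.1
    simp only [add_sub_cancel_right] at this
    simp only
    linarith
  · have := norm_add_le p.1 x.1
    simp only
    linarith
  · exact mul_ne_zero h3 (norm_pos_iff.1 hpos)
  · simp only [norm_mul]
    nlinarith
  · intro i hi
    have h5 := h5 i hi
    simp only [norm_mul]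
    set w := dir τ i / p.2 with hw
    have hwn : ‖w‖ = ‖p.2‖⁻¹ := by rw [hw, norm_div, norm_dir, one_div]
    have hne : 1 + x.2 ≠ 0 := norm_pos_iff.1 hpos
    have hd : dir τ i / (p.2 * (1 + x.2)) = w - w * (x.2 / (1 + x.2)) := by
      rw [hw]; field_simp; ring
    have hb : (w * (x.2 / (1 + x.2))).im ≤ ‖p.2‖⁻¹ * (δ / 8 / ‖1 + x.2‖) := by
      refine (Complex.im_le_norm _).trans ?_
      rw [norm_mul, hwn, norm_div]
      gcongr
      exact hx2.trans e2
    rw [hd, Complex.sub_im]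
    have hkey : ‖p.2‖ * ‖1 + x.2‖ * (‖p.2‖⁻¹ * (δ / 8 / ‖1 + x.2‖)) = δ / 8 := by
      field_simp
    have hA : 7 / 8 ≤ ‖1 + x.2‖ := by linarith
    have hB : ‖p.2‖ * ‖1 + x.2‖ * (w * (x.2 / (1 + x.2))).im ≤ δ / 8 := by
      rw [← hkey]; gcongr
    have hC : 7 / 8 * δ ≤ ‖p.2‖ * ‖1 + x.2‖ * w.im := by
      calc 7 / 8 * δ ≤ ‖1 + x.2‖ * (‖p.2‖ * w.im) := by gcongr
        _ = _ := by ring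
    nlinarith

theorem isOpen_cone (τ : ℂ) (S : Set (Fin 4)) (c δ r : ℝ) : IsOpen (cone τ S c δ r) := by
  rw [isOpen_iff_mem_nhds]
  rintro p ⟨h1, h2, h3, h4, h5⟩
  have hc1 : ContinuousAt (fun p : ℂ × ℂ => ‖p.1‖) p := by fun_prop
  have hc2 : ContinuousAt (fun p : ℂ × ℂ => ‖p.2‖) p := by fun_prop
  have hc3 : ContinuousAt (fun p : ℂ × ℂ => p.2) p := by fun_prop
  have hc4 : ∀ i, ContinuousAt (fun p : ℂ × ℂ => ‖p.2‖ * (dir τ i / p.2).im) p := fun i =>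
    hc2.mul (Complex.continuous_im.continuousAt.comp (continuousAt_const.div hc3 h3))
  filter_upwards [hc1.eventually (lt_mem_nhds h1), hc1.eventually (gt_mem_nhds h2),
    hc3.eventually_ne h3, hc2.eventually (gt_mem_nhds h4),
    (S.toFinite.eventually_all (l := 𝓝 p)).2
      (fun i hi => (hc4 i).eventually (lt_mem_nhds (h5 i hi)))] with q g1 g2 g3 g4 g5
  exact ⟨g1, g2, g3, g4, g5⟩

theorem eventually_eventually_coneGerm {τ : ℂ} {S : Set (Fin 4)} {P : ℂ × ℂ → Prop}
    (h : ∀ᶠ p in coneGerm τ S, P p) : ∀ᶠ p in coneGerm τ S, ∀ᶠ q in 𝓝 p, P q := by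
  intro c hc δ hδ
  obtain ⟨r, hr, h⟩ := h c hc δ hδ
  exact ⟨r, hr, fun p hp => Filter.mem_of_superset ((isOpen_cone τ S c δ r).mem_nhds hp) h⟩

theorem eventually_snd_ne_zero (τ : ℂ) (S : Set (Fin 4)) : ∀ᶠ p in coneGerm τ S, p.2 ≠ 0 :=
  fun _ _ _ _ => ⟨1, one_pos, fun _ hp => hp.2.2.1⟩

theorem eventually_fst_ne_zero (τ : ℂ) (S : Set (Fin 4)) : ∀ᶠ p in coneGerm τ S, p.1 ≠ 0 :=
  fun _ _ _ _ => ⟨1, one_pos, fun _ hp => norm_pos_iff.1 ((Real.exp_pos _).trans hp.1)⟩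

theorem tendsto_snd_coneGerm (τ : ℂ) (S : Set (Fin 4)) :
    Tendsto (fun p : ℂ × ℂ => p.2) (coneGerm τ S) (𝓝 0) := by
  rw [Metric.tendsto_nhds]
  intro ε hε c hc δ hδ
  exact ⟨ε, hε, fun p hp => by simpa using hp.2.2.2.1⟩

theorem abs_re_dir_one_lt {τ : ℂ} (hτ : 0 < τ.im) : |(dir τ 1).re| < 1 := by
  have h := dir_one_im_pos hτ
  have hn := Complex.sq_norm_sub_sq_re (dir τ 1)
  rw [norm_dir] at hn
  rw [← sq_lt_one_iff_abs_lt_one]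
  nlinarith

/-- Two consecutive directions are not opposite. -/
theorem re_dir_mul_conj_dir {τ : ℂ} (hτ : 0 < τ.im) (i : Fin 4) :
    -1 < (dir τ i * (starRingEnd ℂ) (dir τ (i + 1))).re := by
  obtain ⟨h1, h2⟩ := abs_lt.1 (abs_re_dir_one_lt hτ)
  fin_cases i <;> simp [dir_zero, dir_two, dir_three, Fin.add_def] <;> linarith

/-- Two consecutive half planes have a common direction. -/
theorem exists_mem_cone {τ : ℂ} (hτ : 0 < τ.im) (i : Fin 4) : ∃ δ > 0, ∃ w : ℂ, ‖w‖ = 1 ∧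
    ∀ j ∈ ({i, i + 1} : Set (Fin 4)), δ < (dir τ j * w).im := by
  set a := dir τ i with ha
  set b := dir τ (i + 1) with hb
  -- the bisector of the two directions
  set w₀ : ℂ := Complex.I * ((starRingEnd ℂ) a + (starRingEnd ℂ) b) with hw₀
  have hab : 0 < 1 + (a * (starRingEnd ℂ) b).re := by linarith [re_dir_mul_conj_dir hτ i]
  have h1 : (a * w₀).im = 1 + (a * (starRingEnd ℂ) b).re := by
    have : a * w₀ = Complex.I * (1 + a * (starRingEnd ℂ) b) := by
      rw [hw₀, mul_left_comm, mul_add, Complex.mul_conj, Complex.normSq_eq_norm_sq, ha, norm_dir]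
      simp
    rw [this, Complex.I_mul_im]; simp
  have h2 : (b * w₀).im = 1 + (a * (starRingEnd ℂ) b).re := by
    have : b * w₀ = Complex.I * (1 + b * (starRingEnd ℂ) a) := by
      rw [hw₀, mul_left_comm, mul_add, Complex.mul_conj, Complex.normSq_eq_norm_sq, hb, norm_dir]
      simp [add_comm]
    rw [this, Complex.I_mul_im]; simp; ring
  have hw₀n : 0 < ‖w₀‖ := by
    rw [norm_pos_iff]
    intro h0
    rw [h0, mul_zero, Complex.zero_im] at h1
    linarith
  refine ⟨(1 + (a * (starRingEnd ℂ) b).re) / ‖w₀‖ / 2, by positivity, w₀ / ‖w₀‖, ?_, ?_⟩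
  · rw [norm_div, Complex.norm_real, norm_norm, div_self hw₀n.ne']
  · have hj : ∀ j ∈ ({i, i + 1} : Set (Fin 4)),
        (dir τ j * w₀).im = 1 + (a * (starRingEnd ℂ) b).re := by
      rintro j (rfl | rfl)
      exacts [h1, h2]
    intro j hj'
    rw [mul_div_assoc', Complex.div_ofReal_im, hj j hj']
    exact half_lt_self (by positivity)

theorem coneGerm_neBot {τ : ℂ} (hτ : 0 < τ.im) {S : Set (Fin 4)} {i : Fin 4}
    (hS : S ⊆ {i, i + 1}) : (coneGerm τ S).NeBot := by
  obtain ⟨δ, hδ, w, hw, h⟩ := exists_mem_cone hτ i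
  refine ⟨fun hbot => ?_⟩
  have : (∅ : Set (ℂ × ℂ)) ∈ coneGerm τ S := by rw [hbot]; trivial
  obtain ⟨r, hr, h'⟩ := this 1 one_pos δ hδ
  have hw0 : w ≠ 0 := norm_pos_iff.1 (by rw [hw]; exact one_pos)
  have hr2 : (0 : ℝ) < r / 2 := by positivity
  refine h' (a := ((1 : ℂ), ((r / 2 : ℝ) : ℂ) / w)) ⟨by simp, by simp, ?_, ?_, fun j hj => ?_⟩
  · exact div_ne_zero (by exact_mod_cast hr2.ne') hw0
  · simp only [norm_div, hw, Complex.norm_real, Real.norm_of_nonneg hr2.le]; linarith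
  · have e : dir τ j / (((r / 2 : ℝ) : ℂ) / w) = ((r / 2)⁻¹ : ℝ) * (dir τ j * w) := by
      push_cast; field_simp
    simp only [norm_div, hw, Complex.norm_real, Real.norm_of_nonneg hr2.le, e,
      Complex.im_ofReal_mul]
    rw [div_one, mul_inv_cancel_left₀ hr2.ne']
    exact h j (hS hj)

/-- The four half planes cover all directions, with some uniformity. -/
theorem exists_index_cover {τ : ℂ} (hτ : 0 < τ.im) : ∃ δ > 0, ∀ y : ℂ, y ≠ 0 →
    ∃ i, δ < ‖y‖ * (dir τ i / y).im := by
  set d := dir τ 1 with hd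
  have hb : 0 < d.im := dir_one_im_pos hτ
  have hb1 : d.im ≤ 1 := (Complex.im_le_norm d).trans (norm_dir τ 1).le
  have ha : |d.re| ≤ 1 := (abs_re_dir_one_lt hτ).le
  refine ⟨d.im / 4, by positivity, fun y hy => ?_⟩
  have hyn : 0 < ‖y‖ := norm_pos_iff.2 hy
  set w : ℂ := ‖y‖ / y with hw
  have hwn : ‖w‖ = 1 := by rw [hw, norm_div, Complex.norm_real, norm_norm, div_self hyn.ne']
  have key : ∀ i, ‖y‖ * (dir τ i / y).im = (dir τ i * w).im := fun i => by
    rw [← Complex.im_ofReal_mul, hw]; congr 1; ring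
  have hsq : w.re ^ 2 + w.im ^ 2 = 1 := by
    have := Complex.sq_norm_sub_sq_re w
    rw [hwn] at this; linarith
  simp only [key]
  by_contra! hcon
  have h0 := hcon 0
  have h1 := hcon 1
  have h2 := hcon 2
  have h3 := hcon 3
  rw [dir_zero, one_mul] at h0
  rw [dir_two, neg_one_mul, Complex.neg_im] at h2
  rw [dir_three, neg_mul, Complex.neg_im] at h3
  rw [← hd, Complex.mul_im] at h1 h3
  obtain ⟨ha1, ha2⟩ := abs_le.1 ha
  have hx : |w.im| ≤ d.im / 4 := abs_le.2 ⟨by linarith, by linarith⟩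
  have hax : |d.re * w.im| ≤ d.im / 4 := by
    rw [abs_mul]; nlinarith [abs_nonneg w.im, abs_nonneg d.re]
  obtain ⟨e1, e2⟩ := abs_le.1 hax
  have hre : |d.im * w.re| ≤ d.im / 2 := abs_le.2 ⟨by linarith, by linarith⟩
  rw [abs_mul, abs_of_pos hb] at hre
  have hre' : |w.re| ≤ 1 / 2 := by nlinarith
  have hx' : |w.im| ≤ 1 / 4 := by linarith
  have s1 := sq_abs w.re
  have s2 := sq_abs w.im
  nlinarith [abs_nonneg w.re, abs_nonneg w.im]

/-! ### Orders of vanishing along the curve -/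

/-- `g = o(y ^ n)` along the germs of domains `coneGerm τ S`. -/
def Ord (τ : ℂ) (S : Set (Fin 4)) (n : ℤ) (g : ℂ × ℂ → ℂ) : Prop :=
  g =o[coneGerm τ S] (fun p => p.2 ^ n)

/-- `g` vanishes to infinite order along the curve. -/
def Flat (τ : ℂ) (S : Set (Fin 4)) (g : ℂ × ℂ → ℂ) : Prop := ∀ n : ℤ, Ord τ S n g

variable {τ : ℂ} {S T : Set (Fin 4)} {m n : ℤ}

theorem Ord.congr' {g g' : ℂ × ℂ → ℂ} (h : Ord τ S n g) (hg : ∀ᶠ p in coneGerm τ S, g p = g' p) :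
    Ord τ S n g' := IsLittleO.congr' h hg EventuallyEq.rfl

theorem Flat.congr' {g g' : ℂ × ℂ → ℂ} (h : Flat τ S g)
    (hg : ∀ᶠ p in coneGerm τ S, g p = g' p) : Flat τ S g' := fun n => (h n).congr' hg

theorem Ord.add {g h : ℂ × ℂ → ℂ} (hg : Ord τ S n g) (hh : Ord τ S n h) :
    Ord τ S n (fun p => g p + h p) := IsLittleO.add hg hh

theorem Ord.sub {g h : ℂ × ℂ → ℂ} (hg : Ord τ S n g) (hh : Ord τ S n h) :
    Ord τ S n (fun p => g p - h p) := IsLittleO.sub hg hh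

theorem Ord.mul {g h : ℂ × ℂ → ℂ} (hg : Ord τ S m g) (hh : Ord τ S n h) :
    Ord τ S (m + n) (fun p => g p * h p) := by
  refine (IsLittleO.mul hg hh).congr' EventuallyEq.rfl ?_
  filter_upwards [eventually_snd_ne_zero τ S] with p hp
  rw [zpow_add₀ hp]

theorem Ord.mono {g : ℂ × ℂ → ℂ} (hg : Ord τ S n g) (hmn : m ≤ n) : Ord τ S m g := by
  refine IsLittleO.trans_isBigO hg (IsBigO.of_bound 1 ?_)
  have h1 : ∀ᶠ p in coneGerm τ S, ‖p.2‖ < 1 := by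
    simpa using (tendsto_snd_coneGerm τ S).norm.eventually (gt_mem_nhds (by simp))
  filter_upwards [eventually_snd_ne_zero τ S, h1] with p hp hp1
  rw [norm_zpow, norm_zpow, one_mul]
  exact zpow_le_zpow_right_of_le_one₀ (norm_pos_iff.2 hp) hp1.le hmn

theorem ord_zero_iff {g : ℂ × ℂ → ℂ} :
    Ord τ S 0 g ↔ Tendsto g (coneGerm τ S) (𝓝 0) := by
  unfold Ord
  simp only [zpow_zero]
  exact isLittleO_one_iff ℂ

theorem Ord.tendsto {g : ℂ × ℂ → ℂ} (h : Ord τ S n g) (hn : 0 ≤ n) :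
    Tendsto g (coneGerm τ S) (𝓝 0) := ord_zero_iff.1 (h.mono hn)

theorem Ord.const_mul {g : ℂ × ℂ → ℂ} (a : ℂ) (h : Ord τ S n g) :
    Ord τ S n (fun p => a * g p) := IsLittleO.const_mul_left h a

/-- A bound whose constant depends on the cone costs one order. -/
theorem Ord.of_bound {g : ℂ × ℂ → ℂ}
    (h : ∀ c > 0, ∀ δ > 0, ∃ K : ℝ, ∃ r > 0, ∀ p ∈ cone τ S c δ r,
      ‖g p‖ ≤ K * ‖p.2‖ ^ (n + 1)) : Ord τ S n g := by
  refine isLittleO_iff.2 fun ε hε => eventually_coneGerm.2 fun c hc δ hδ => ?_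
  obtain ⟨K, r, hr, hK⟩ := h c hc δ hδ
  have hK1 : 0 < |K| + 1 := by positivity
  refine ⟨min r (ε / (|K| + 1)), lt_min hr (by positivity), fun p hp => ?_⟩
  have hy : 0 < ‖p.2‖ := norm_pos_iff.2 hp.2.2.1
  have h1 := hK p (cone_mono subset_rfl le_rfl le_rfl (min_le_left _ _) hp)
  have h2 : ‖p.2‖ < ε / (|K| + 1) := hp.2.2.2.1.trans_le (min_le_right _ _)
  rw [lt_div_iff₀ hK1] at h2
  rw [zpow_add_one₀ hy.ne'] at h1
  rw [norm_zpow]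
  have hz : 0 < ‖p.2‖ ^ n := zpow_pos hy n
  calc ‖g p‖ ≤ K * (‖p.2‖ ^ n * ‖p.2‖) := h1
    _ ≤ (|K| + 1) * (‖p.2‖ ^ n * ‖p.2‖) := by
      gcongr; linarith [le_abs_self K]
    _ = ‖p.2‖ ^ n * (‖p.2‖ * (|K| + 1)) := by ring
    _ ≤ ‖p.2‖ ^ n * ε := by gcongr
    _ = _ := mul_comm _ _

theorem Flat.sub {g h : ℂ × ℂ → ℂ} (hg : Flat τ S g) (hh : Flat τ S h) :
    Flat τ S (fun p => g p - h p) := fun n => (hg n).sub (hh n)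

theorem Flat.mul_ord {g h : ℂ × ℂ → ℂ} (hg : Flat τ S g) (hh : Ord τ S m h) :
    Flat τ S (fun p => g p * h p) := fun n => by
  have := (hg (n - m)).mul hh
  rwa [sub_add_cancel] at this

theorem Flat.const_mul {g : ℂ × ℂ → ℂ} (a : ℂ) (h : Flat τ S g) :
    Flat τ S (fun p => a * g p) := fun n => (h n).const_mul a

theorem zpow_le_two_zpow_abs {t : ℝ} (h1 : 1 / 2 ≤ t) (h2 : t ≤ 2) (n : ℤ) :
    t ^ n ≤ 2 ^ |n| := by
  rcases le_total 0 n with hn | hn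
  · rw [abs_of_nonneg hn]
    exact zpow_le_zpow_left₀ hn (by linarith) h2
  · rw [abs_of_nonpos hn]
    have : t ^ n = (t⁻¹) ^ (-n) := by rw [inv_zpow, zpow_neg, inv_inv]
    rw [this]
    refine zpow_le_zpow_left₀ (by linarith) (by positivity) ?_
    rw [inv_le_comm₀ (by linarith) (by norm_num)]
    linarith

/-- The polydisc of relative radii `x` around the point `p`. -/
def polyMap (p x : ℂ × ℂ) : ℂ × ℂ := (p.1 + x.1, p.2 * (1 + x.2))

theorem polyMap_zero (p : ℂ × ℂ) : polyMap p 0 = p := by simp [polyMap]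

theorem hasFDerivAt_polyMap (p x : ℂ × ℂ) : HasFDerivAt (polyMap p)
    ((ContinuousLinearMap.fst ℂ ℂ ℂ).prod (p.2 • ContinuousLinearMap.snd ℂ ℂ ℂ)) x := by
  have h1 : HasFDerivAt (fun x : ℂ × ℂ => p.1 + x.1) (ContinuousLinearMap.fst ℂ ℂ ℂ) x :=
    (hasFDerivAt_fst).const_add _
  have h2 : HasFDerivAt (fun x : ℂ × ℂ => p.2 * (1 + x.2))
      (p.2 • ContinuousLinearMap.snd ℂ ℂ ℂ) x :=
    ((hasFDerivAt_snd).const_add _).const_mul _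
  exact h1.prodMk h2

/-- Cauchy estimates: the two partial derivatives of a function of order `n` are of order `n` and
`n - 1`. -/
theorem Ord.partials {G : ℂ × ℂ → ℂ} (hd : ∀ᶠ p in coneGerm τ S, DifferentiableAt ℂ G p)
    (h : Ord τ S n G) :
    Ord τ S n (fun p => fderiv ℂ G p (1, 0)) ∧ Ord τ S (n - 1) (fun p => fderiv ℂ G p (0, 1)) := by
  have key : ∀ ε > 0, ∀ᶠ p in coneGerm τ S,
      ‖fderiv ℂ G p (1, 0)‖ ≤ ε * ‖p.2‖ ^ n ∧
        ‖fderiv ℂ G p (0, 1)‖ ≤ ε * ‖p.2‖ ^ (n - 1) := by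
    intro ε hε c hc δ hδ
    set ρ := polyRadius c δ with hρ
    have hρ0 : 0 < ρ := polyRadius_pos hδ
    set ε' := ε * ρ / (2 * 2 ^ |n|) with hε'
    have hε'0 : 0 < ε' := by positivity
    obtain ⟨r, hr, h1⟩ := (hd.and (isLittleO_iff.1 h hε'0)) (c + 1) (by linarith)
      (δ / 2) (by positivity)
    refine ⟨r / 2, by positivity, fun p hp => ?_⟩
    have hy : 0 < ‖p.2‖ := norm_pos_iff.2 hp.2.2.1
    have hin : ∀ x ∈ Metric.ball (0 : ℂ × ℂ) ρ, polyMap p x ∈ cone τ S (c + 1) (δ / 2) r := by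
      intro x hx
      have := cone_perturb hc hδ hp (mem_ball_zero_iff.1 hx).le
      rwa [mul_div_cancel₀ _ two_ne_zero] at this
    have hbd : ∀ x ∈ Metric.ball (0 : ℂ × ℂ) ρ,
        ‖G (polyMap p x)‖ ≤ ε * ρ / 2 * ‖p.2‖ ^ n := by
      intro x hx
      have hx' : ‖x‖ < ρ := by simpa using hx
      have hx2 : ‖x.2‖ ≤ 1 / 8 :=
        ((norm_snd_le x).trans hx'.le).trans (polyRadius_le c δ)
      refine ((h1 (hin x hx)).2).trans ?_
      have e : ‖(polyMap p x).2 ^ n‖ ≤ ‖p.2‖ ^ n * 2 ^ |n| := by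
        simp only [polyMap]
        rw [mul_zpow, norm_mul, norm_zpow, norm_zpow]
        gcongr
        refine zpow_le_two_zpow_abs ?_ ?_ n
        · have := norm_sub_le (1 + x.2) x.2
          simp only [add_sub_cancel_right, norm_one] at this
          linarith
        · have := norm_add_le 1 x.2
          simp only [norm_one] at this
          linarith
      calc ε' * ‖(polyMap p x).2 ^ n‖ ≤ ε' * (‖p.2‖ ^ n * 2 ^ |n|) := by gcongr
        _ = _ := by rw [hε']; field_simp
    have hdiff : DifferentiableOn ℂ (fun x => G (polyMap p x)) (Metric.ball 0 ρ) := fun x hx =>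
      (((h1 (hin x hx)).1).comp x (hasFDerivAt_polyMap p x).differentiableAt)
        |>.differentiableWithinAt
    have hmaps : Set.MapsTo (fun x => G (polyMap p x)) (Metric.ball 0 ρ)
        (Metric.closedBall (G (polyMap p 0)) (ε * ρ * ‖p.2‖ ^ n)) := by
      intro x hx
      rw [mem_closedBall_iff_norm]
      have := (norm_sub_le (G (polyMap p x)) (G (polyMap p 0))).trans
        (add_le_add (hbd x hx) (hbd 0 (Metric.mem_ball_self hρ0)))
      refine this.trans (le_of_eq (by ring))
    have hnorm := Complex.norm_fderiv_le_div_of_mapsTo_ball hdiff hmaps hρ0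
    have hG : DifferentiableAt ℂ G (polyMap p 0) :=
      (h1 (hin 0 (Metric.mem_ball_self hρ0))).1
    have hcomp := hG.hasFDerivAt.comp (0 : ℂ × ℂ) (hasFDerivAt_polyMap p 0)
    have hfd : fderiv ℂ (fun x => G (polyMap p x)) 0 = _ := hcomp.fderiv
    rw [polyMap_zero] at hfd
    rw [mul_right_comm, mul_div_cancel_right₀ _ hρ0.ne', hfd] at hnorm
    have b1 := (ContinuousLinearMap.le_opNorm _ ((1 : ℂ), (0 : ℂ))).trans
      (mul_le_mul_of_nonneg_right hnorm (norm_nonneg _))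
    have b2 := (ContinuousLinearMap.le_opNorm _ ((0 : ℂ), (1 : ℂ))).trans
      (mul_le_mul_of_nonneg_right hnorm (norm_nonneg _))
    simp only [ContinuousLinearMap.comp_apply, ContinuousLinearMap.prod_apply,
      ContinuousLinearMap.coe_fst', _root_.smul_apply,
      ContinuousLinearMap.coe_snd', Prod.norm_mk, norm_one, norm_zero, smul_eq_mul, mul_zero,
      mul_one, max_eq_left zero_le_one, max_eq_right zero_le_one] at b1 b2
    refine ⟨b1, ?_⟩
    have e : ((0 : ℂ), p.2) = p.2 • ((0 : ℂ), (1 : ℂ)) := by simp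
    rw [e, map_smul, norm_smul] at b2
    rw [zpow_sub_one₀ hy.ne', ← mul_assoc, ← div_eq_mul_inv, le_div_iff₀ hy, mul_comm]
    exact b2
  refine ⟨isLittleO_iff.2 fun ε hε => ?_, isLittleO_iff.2 fun ε hε => ?_⟩
  · filter_upwards [key ε hε] with p hp
    rw [norm_zpow]; exact hp.1
  · filter_upwards [key ε hε] with p hp
    rw [norm_zpow]; exact hp.2

/-! ### Germs of maps and functions along the curve -/

/-- `Φ` is close to `(z, y) ↦ (q z, y)` along the curve. -/
structure NearRot (τ : ℂ) (S : Set (Fin 4)) (q : ℂ) (Φ : ℂ × ℂ → ℂ × ℂ) : Prop where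
  fst : Tendsto (fun p => (Φ p).1 - q * p.1) (coneGerm τ S) (𝓝 0)
  snd : Tendsto (fun p => (Φ p).2 / p.2) (coneGerm τ S) (𝓝 1)

theorem NearRot.mono {q : ℂ} {Φ : ℂ × ℂ → ℂ × ℂ} (h : NearRot τ S q Φ) (hST : S ⊆ T) :
    NearRot τ T q Φ :=
  ⟨h.fst.mono_left (coneGerm_mono hST), h.snd.mono_left (coneGerm_mono hST)⟩

/-- Such a map sends germs of sectorial domains to themselves: the cones depend on `|z|` and on the
argument of `y` only, up to a change of their size. -/
theorem NearRot.tendsto {q : ℂ} (hq : q ≠ 0) {Φ : ℂ × ℂ → ℂ × ℂ} (h : NearRot τ S q Φ)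
    (hST : S ⊆ T) : Tendsto Φ (coneGerm τ T) (coneGerm τ T) := by
  intro s hs c hc δ hδ
  have hqn : 0 < ‖q‖ := norm_pos_iff.2 hq
  set c' := c + |Real.log ‖q‖| with hc'
  have hc'0 : 0 < c' := by positivity
  obtain ⟨r, hr, hs⟩ := hs (c' + 1) (by linarith) (δ / 2) (by positivity)
  have hρ : 0 < polyRadius c' δ := polyRadius_pos hδ
  have h' := h.mono hST
  have e1 := h'.fst.eventually (Metric.ball_mem_nhds _ hρ)
  have e2 := h'.snd.eventually (Metric.ball_mem_nhds _ hρ)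
  obtain ⟨r', hr', h2⟩ := (e1.and e2) c hc δ hδ
  refine ⟨min r' (r / 2), lt_min hr' (by positivity), fun p hp => hs ?_⟩
  obtain ⟨g1, g2⟩ := h2 (cone_mono subset_rfl le_rfl le_rfl (min_le_left _ _) hp)
  rw [dist_eq_norm, sub_zero] at g1
  rw [dist_eq_norm] at g2
  have hp0 : (q * p.1, p.2) ∈ cone τ T c' δ (r / 2) := by
    obtain ⟨h1, h2, h3, h4, h5⟩ := hp
    refine ⟨?_, ?_, h3, h4.trans_le (min_le_right _ _), h5⟩
    · simp only [norm_mul]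
      rw [hc', neg_add, add_comm, Real.exp_add]
      have : Real.exp (-|Real.log ‖q‖|) ≤ ‖q‖ := by
        rw [← Real.le_log_iff_exp_le hqn]; exact neg_abs_le _
      exact mul_lt_mul_of_le_of_lt_of_nonneg_of_pos this h1 (Real.exp_pos _).le hqn
    · simp only [norm_mul]
      rw [hc', add_comm, Real.exp_add]
      have : ‖q‖ ≤ Real.exp |Real.log ‖q‖| := by
        rw [← Real.log_le_iff_le_exp hqn]; exact le_abs_self _
      exact mul_lt_mul_of_le_of_lt_of_nonneg_of_pos this h2 (norm_nonneg _) (Real.exp_pos _)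
  have := cone_perturb hc'0 hδ hp0 (x := ((Φ p).1 - q * p.1, (Φ p).2 / p.2 - 1))
    (max_le g1.le g2.le)
  rw [mul_div_cancel₀ _ two_ne_zero] at this
  convert this using 1
  have := hp.2.2.1
  ext
  · simp
  · simp; field_simp

/-- What holds near every point of the curve holds in the sectors, because the closed annulus
`exp (-c) ≤ |z| ≤ exp c` is compact. -/
theorem eventually_coneGerm_of_nhds {P : ℂ × ℂ → Prop}
    (h : ∀ z : ℂ, z ≠ 0 → ∀ᶠ p in 𝓝 ((z, 0) : ℂ × ℂ), P p) : ∀ᶠ p in coneGerm τ S, P p := by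
  intro c hc δ hδ
  set A : Set ℂ := Metric.closedBall 0 (Real.exp c) ∩ {z | Real.exp (-c) ≤ ‖z‖} with hA
  have hAc : IsCompact A :=
    (isCompact_closedBall 0 _).inter_right (isClosed_le continuous_const continuous_norm)
  have key : ∀ᶠ y in 𝓝 (0 : ℂ), ∀ z ∈ A, P (z, y) := by
    refine hAc.eventually_forall_of_forall_eventually fun z hz => ?_
    have hz0 : z ≠ 0 := norm_pos_iff.1 ((Real.exp_pos _).trans_le hz.2)
    have h1 := h z hz0
    have : Tendsto (fun q : ℂ × ℂ => (q.2, q.1)) (𝓝 ((0 : ℂ), z)) (𝓝 (z, (0 : ℂ))) :=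
      continuous_swap.tendsto _
    exact this.eventually h1
  obtain ⟨r, hr, hr'⟩ := Metric.eventually_nhds_iff.1 key
  refine ⟨r, hr, fun p hp => ?_⟩
  exact hr' (by simpa using hp.2.2.2.1) p.1
    ⟨by simpa using hp.2.1.le, hp.1.le⟩

/-- The order of vanishing on each transversal is attained uniformly, by the Schwarz lemma. -/
theorem ord_of_analytic {G : ℂ × ℂ → ℂ} {N : ℕ} (hG : ∀ z : ℂ, z ≠ 0 → AnalyticAt ℂ G (z, 0))
    (hO : ∀ z : ℂ, z ≠ 0 → (fun y : ℂ => G (z, y)) =O[𝓝 0] (fun y : ℂ => y ^ N)) :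
    Ord τ S ((N : ℤ) - 1) G := by
  have local_bound : ∀ z₀ : ℂ, z₀ ≠ 0 → ∃ K, ∀ᶠ p in 𝓝 ((z₀, 0) : ℂ × ℂ),
      ‖G p‖ ≤ K * ‖p.2‖ ^ N := by
    intro z₀ hz₀
    have h1 := (hG z₀ hz₀).eventually_analyticAt
    have h2 : ∀ᶠ p in 𝓝 ((z₀, 0) : ℂ × ℂ), ‖G p‖ < ‖G (z₀, 0)‖ + 1 :=
      (hG z₀ hz₀).continuousAt.norm.eventually (gt_mem_nhds (by linarith))
    have h3 : ∀ᶠ p in 𝓝 ((z₀, 0) : ℂ × ℂ), p.1 ≠ 0 :=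
      continuousAt_fst.eventually_ne hz₀
    obtain ⟨r, hr, hr'⟩ := Metric.eventually_nhds_iff_ball.1 (h1.and (h2.and h3))
    set M := ‖G (z₀, 0)‖ + 1
    refine ⟨2 * M / r ^ N, Metric.eventually_nhds_iff_ball.2 ⟨r, hr, fun p hp => ?_⟩⟩
    obtain ⟨hp1, hp2⟩ : p.1 ∈ Metric.ball z₀ r ∧ p.2 ∈ Metric.ball (0 : ℂ) r := by
      rwa [← ball_prod_same, Set.mem_prod] at hp
    have hball : ∀ y ∈ Metric.ball (0 : ℂ) r, (p.1, y) ∈ Metric.ball ((z₀, 0) : ℂ × ℂ) r := by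
      intro y hy
      rw [← ball_prod_same, Set.mem_prod]; exact ⟨hp1, hy⟩
    have hM : 0 < M := by positivity
    rcases N with _ | k
    · have := (hr' p hp).2.1
      simp; linarith
    · have hO' := hO p.1 (hr' p hp).2.2
      have h0 : G (p.1, 0) = 0 := by
        obtain ⟨K, hK⟩ := hO'.bound
        simpa using hK.self_of_nhds
      have hd : DifferentiableOn ℂ (fun y => G (p.1, y)) (Metric.ball 0 r) := fun y hy =>
        (((hr' _ (hball y hy)).1.differentiableAt).comp y
          (by fun_prop : DifferentiableAt ℂ (fun y : ℂ => (p.1, y)) y)).differentiableWithinAt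
      have hmaps : Set.MapsTo (fun y => G (p.1, y)) (Metric.ball 0 r)
          (Metric.closedBall (G (p.1, 0)) (2 * M)) := fun y hy => by
        rw [h0, mem_closedBall_zero_iff]
        have := (hr' _ (hball y hy)).2.1
        linarith
      have ho : ((fun y => G (p.1, y)) · - G (p.1, 0)) =o[𝓝 (0 : ℂ)]
          (fun y : ℂ => ‖y - 0‖ ^ k) := by
        simp only [h0, sub_zero]
        refine hO'.trans_isLittleO ?_
        have := (isLittleO_pow_pow (𝕜 := ℂ) (Nat.lt_succ_self k)).norm_right
        simpa using this
      have := Complex.dist_le_mul_div_pow_of_mapsTo_ball_of_isLittleO hd hmaps ho hp2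
      simp only [h0, dist_zero_right] at this
      rwa [div_pow, ← mul_div_assoc, mul_div_right_comm] at this
  refine isLittleO_iff.2 fun ε hε => ?_
  have : ∀ᶠ p in coneGerm τ S, p.2 ≠ 0 → ‖G p‖ ≤ ε * ‖p.2 ^ ((N : ℤ) - 1)‖ := by
    refine eventually_coneGerm_of_nhds fun z hz => ?_
    obtain ⟨K, hK⟩ := local_bound z hz
    have hsmall : ∀ᶠ p in 𝓝 ((z, 0) : ℂ × ℂ), K * ‖p.2‖ < ε := by
      have : ContinuousAt (fun p : ℂ × ℂ => K * ‖p.2‖) (z, 0) := by fun_prop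
      exact this.eventually (gt_mem_nhds (by simpa using hε))
    filter_upwards [hK, hsmall] with p h1 h2 hp
    have hy : 0 < ‖p.2‖ := norm_pos_iff.2 hp
    rw [norm_zpow, zpow_sub_one₀ hy.ne', zpow_natCast]
    calc ‖G p‖ ≤ K * ‖p.2‖ ^ N := h1
      _ = K * ‖p.2‖ * (‖p.2‖ ^ N * ‖p.2‖⁻¹) := by field_simp
      _ ≤ _ := by gcongr
  filter_upwards [this, eventually_snd_ne_zero τ S] with p hp h0 using hp h0

/-- An analytic function of one variable which is `o(t ^ (N - 1))` on a ray has order at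
least `N`. -/
theorem isBigO_pow_of_ray {g : ℂ → ℂ} (hg : AnalyticAt ℂ g 0) {w : ℂ} (hw : ‖w‖ = 1) {N : ℕ}
    (h : ∀ ε > 0, ∀ᶠ t : ℝ in 𝓝[>] 0, t * ‖g (t / w)‖ ≤ ε * t ^ N) :
    g =O[𝓝 0] (fun y : ℂ => y ^ N) := by
  by_cases hz : ∀ᶠ y in 𝓝 (0 : ℂ), g y = 0
  · exact (EventuallyEq.isBigO hz).trans (isBigO_zero _ _)
  obtain ⟨k, f, hf, hf0, hfg⟩ := hg.exists_eventuallyEq_pow_smul_nonzero_iff.2 hz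
  simp only [sub_zero, smul_eq_mul] at hfg
  rcases le_or_gt N k with hk | hk
  · refine EventuallyEq.trans_isBigO hfg ?_
    have h1 : f =O[𝓝 0] (fun y : ℂ => y ^ 0) := by
      simpa using hf.continuousAt.isBigO_one ℂ
    have h2 : (fun y : ℂ => y ^ k) =O[𝓝 0] (fun y : ℂ => y ^ N) := by
      obtain ⟨l, rfl⟩ := Nat.exists_eq_add_of_le hk
      have : (fun y : ℂ => y ^ l) =O[𝓝 0] (fun _ => (1 : ℂ)) :=
        (by fun_prop : ContinuousAt (fun y : ℂ => y ^ l) 0).isBigO_one ℂ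
      simpa [pow_add] using (isBigO_refl (fun y : ℂ => y ^ N) (𝓝 0)).mul this
    simpa using h2.mul h1
  · exfalso
    have hw0 : w ≠ 0 := norm_pos_iff.1 (by rw [hw]; exact one_pos)
    have ht : Tendsto (fun t : ℝ => (t / w : ℂ)) (𝓝[>] 0) (𝓝 0) := by
      have : ContinuousAt (fun t : ℝ => (t / w : ℂ)) 0 := by fun_prop
      have := this.tendsto
      simp only [Complex.ofReal_zero, zero_div] at this
      exact this.mono_left nhdsWithin_le_nhds
    have hlim : Tendsto (fun t : ℝ => ‖f (t / w)‖) (𝓝[>] 0) (𝓝 ‖f 0‖) :=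
      (hf.continuousAt.norm.tendsto).comp ht
    refine hf0 (norm_le_zero_iff.1 (le_of_forall_pos_le_add fun ε hε => ?_))
    rw [zero_add]
    refine le_of_tendsto hlim ?_
    filter_upwards [h ε hε, ht.eventually hfg, Ioo_mem_nhdsGT one_pos] with t h1 h2 h3
    have h3' : 0 < t := h3.1
    rw [h2, norm_mul, norm_pow, norm_div, hw, div_one, Complex.norm_real,
      Real.norm_of_nonneg h3'.le, ← pow_mul_pow_sub t (Nat.succ_le_of_lt hk), pow_succ] at h1
    have h4 : t ^ (N - (k + 1)) ≤ 1 := pow_le_one₀ h3'.le h3.2.le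
    have h5 : 0 < t ^ k * t := by positivity
    refine le_of_mul_le_mul_left ?_ h5
    calc t ^ k * t * ‖f (t / w)‖ ≤ ε * (t ^ k * t * t ^ (N - (k + 1))) := by
          refine le_trans (le_of_eq ?_) h1; ring
      _ ≤ ε * (t ^ k * t * 1) := by gcongr
      _ = t ^ k * t * ε := by ring

theorem eventually_eq_zero_of_forall_isBigO {g : ℂ → ℂ} (hg : AnalyticAt ℂ g 0)
    (h : ∀ N : ℕ, g =O[𝓝 0] (fun y : ℂ => y ^ N)) : ∀ᶠ y in 𝓝 (0 : ℂ), g y = 0 := by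
  by_contra hz
  obtain ⟨k, f, hf, hf0, hfg⟩ := hg.exists_eventuallyEq_pow_smul_nonzero_iff.2 hz
  simp only [sub_zero, smul_eq_mul] at hfg
  obtain ⟨K, hK⟩ := (h (k + 1)).bound
  have hbd : ∀ᶠ y : ℂ in 𝓝[≠] 0, ‖f y‖ ≤ K * ‖y‖ := by
    filter_upwards [hK.filter_mono nhdsWithin_le_nhds, hfg.filter_mono nhdsWithin_le_nhds,
      self_mem_nhdsWithin] with y h1 h2 h3
    have h3 : 0 < ‖y‖ := norm_pos_iff.2 h3
    rw [h2, norm_mul, norm_pow, norm_pow, pow_succ] at h1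
    have h4 : 0 < ‖y‖ ^ k := by positivity
    refine le_of_mul_le_mul_left ?_ h4
    linarith
  have hlim : Tendsto (fun y : ℂ => ‖f y‖) (𝓝[≠] 0) (𝓝 ‖f 0‖) :=
    hf.continuousAt.norm.tendsto.mono_left nhdsWithin_le_nhds
  have hlim0 : Tendsto (fun y : ℂ => K * ‖y‖) (𝓝[≠] 0) (𝓝 0) := by
    have hc : ContinuousAt (fun y : ℂ => K * ‖y‖) 0 := by fun_prop
    have := hc.tendsto
    simp only [norm_zero, mul_zero] at this
    exact this.mono_left nhdsWithin_le_nhds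
  exact hf0 (norm_le_zero_iff.1 (le_of_tendsto_of_tendsto hlim hlim0 hbd))

/-- An order of vanishing in a sector is an order of vanishing along each transversal, for functions
analytic along the curve: it is enough to look along one ray. -/
theorem Ord.isBigO_transversal (hτ : 0 < τ.im) {i : Fin 4} (hS : S ⊆ {i, i + 1})
    {W : ℂ × ℂ → ℂ} {N : ℕ} (h : Ord τ S ((N : ℤ) - 1) W) {z : ℂ} (hz : z ≠ 0)
    (hW : AnalyticAt ℂ W (z, 0)) :
    (fun y : ℂ => W (z, y)) =O[𝓝 0] (fun y : ℂ => y ^ N) := by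
  obtain ⟨δ, hδ, w, hw, hcone⟩ := exists_mem_cone hτ i
  have hg : AnalyticAt ℂ (fun y : ℂ => W (z, y)) 0 :=
    hW.comp_of_eq (by fun_prop : AnalyticAt ℂ (fun y : ℂ => (z, y)) 0) rfl
  have hw0 : w ≠ 0 := norm_pos_iff.1 (by rw [hw]; exact one_pos)
  have hzn : 0 < ‖z‖ := norm_pos_iff.2 hz
  refine isBigO_pow_of_ray hg hw fun ε hε => ?_
  obtain ⟨r, hr, h1⟩ := isLittleO_iff.1 h hε (|Real.log ‖z‖| + 1) (by positivity) δ hδ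
  filter_upwards [Ioo_mem_nhdsGT hr] with t ht
  have hn : ‖(t / w : ℂ)‖ = t := by
    rw [norm_div, hw, div_one, Complex.norm_real, Real.norm_of_nonneg ht.1.le]
  have ht0 : (t : ℂ) ≠ 0 := by exact_mod_cast ht.1.ne'
  have hmem : (z, (t / w : ℂ)) ∈ cone τ S (|Real.log ‖z‖| + 1) δ r := by
    refine ⟨?_, ?_, div_ne_zero ht0 hw0, by rw [hn]; exact ht.2, fun j hj => ?_⟩
    · rw [← Real.lt_log_iff_exp_lt hzn]
      linarith [neg_abs_le (Real.log ‖z‖)]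
    · rw [← Real.log_lt_iff_lt_exp hzn]
      linarith [le_abs_self (Real.log ‖z‖)]
    · rw [hn]
      have e : dir τ j / (t / w : ℂ) = (t⁻¹ : ℝ) * (dir τ j * w) := by
        push_cast; field_simp
      simp only [e, Complex.im_ofReal_mul]
      rw [mul_inv_cancel_left₀ ht.1.ne']
      exact hcone j (hS hj)
  have : ‖W (z, (t / w : ℂ))‖ ≤ ε * ‖(t / w : ℂ) ^ ((N : ℤ) - 1)‖ := h1 hmem
  rw [norm_zpow, hn, zpow_sub_one₀ ht.1.ne', zpow_natCast] at this
  calc t * ‖W (z, (t / w : ℂ))‖ ≤ t * (ε * (t ^ N * t⁻¹)) :=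
        mul_le_mul_of_nonneg_left this ht.1.le
    _ = ε * t ^ N := by have := ht.1.ne'; field_simp

/-- Identity principle: a function analytic along the curve and flat in a sector vanishes. -/
theorem Flat.eventually_eq_zero (hτ : 0 < τ.im) {i : Fin 4} (hS : S ⊆ {i, i + 1})
    {W : ℂ × ℂ → ℂ} (h : Flat τ S W) (hW : ∀ z : ℂ, z ≠ 0 → AnalyticAt ℂ W (z, 0))
    {z : ℂ} (hz : z ≠ 0) : ∀ᶠ p in 𝓝 ((z, 0) : ℂ × ℂ), W p = 0 := by
  have h1 := (hW z hz).eventually_analyticAt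
  have h3 : ∀ᶠ p in 𝓝 ((z, 0) : ℂ × ℂ), p.1 ≠ 0 := continuousAt_fst.eventually_ne hz
  obtain ⟨r, hr, hr'⟩ := Metric.eventually_nhds_iff_ball.1 (h1.and h3)
  refine Metric.eventually_nhds_iff_ball.2 ⟨r, hr, fun p hp => ?_⟩
  obtain ⟨hp1, hp2⟩ : p.1 ∈ Metric.ball z r ∧ p.2 ∈ Metric.ball (0 : ℂ) r := by
    rwa [← ball_prod_same, Set.mem_prod] at hp
  have hball : ∀ y ∈ Metric.ball (0 : ℂ) r, (p.1, y) ∈ Metric.ball ((z, 0) : ℂ × ℂ) r := by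
    intro y hy
    rw [← ball_prod_same, Set.mem_prod]; exact ⟨hp1, hy⟩
  have hp0 : p.1 ≠ 0 := (hr' p hp).2
  have hd : AnalyticOnNhd ℂ (fun y => W (p.1, y)) (Metric.ball 0 r) := fun y hy =>
    ((hr' _ (hball y hy)).1).comp (f := fun y : ℂ => (p.1, y)) (by fun_prop)
  have hev := eventually_eq_zero_of_forall_isBigO (hd 0 (Metric.mem_ball_self hr)) fun N =>
    (h _).isBigO_transversal hτ hS hp0 (hW _ hp0)
  exact hd.eqOn_zero_of_preconnected_of_eventuallyEq_zero (convex_ball 0 r).isPreconnected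
    (Metric.mem_ball_self hr) hev hp2

/-! ### Inversion of sectorial maps -/

/-- A holomorphic self-map of a ball with small image is a contraction of a smaller ball. -/
theorem dist_le_third {N : ℂ × ℂ → ℂ × ℂ} {R : ℝ}
    (hd : DifferentiableOn ℂ N (Metric.ball 0 (4 * R)))
    (hN : ∀ x ∈ Metric.ball (0 : ℂ × ℂ) (4 * R), ‖N x‖ ≤ R / 2) {x x' : ℂ × ℂ} (hR : 0 < R)
    (hx : ‖x‖ ≤ R) (hx' : ‖x'‖ ≤ R) : dist (N x') (N x) ≤ 1 / 3 * dist x' x := by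
  have hsub : Metric.ball x (3 * R) ⊆ Metric.ball 0 (4 * R) :=
    Metric.ball_subset_ball' (by rw [dist_zero_right]; linarith)
  have hmaps : Set.MapsTo N (Metric.ball x (3 * R)) (Metric.closedBall (N x) R) := by
    intro w hw
    rw [mem_closedBall_iff_norm]
    have h1 := hN w (hsub hw)
    have h2 := hN x (hsub (Metric.mem_ball_self (by linarith)))
    exact (norm_sub_le _ _).trans (by linarith)
  have hxx : x' ∈ Metric.ball x (3 * R) := by
    rw [mem_ball_iff_norm]
    exact (norm_sub_le _ _).trans_lt (by linarith)
  have := Complex.dist_le_div_mul_dist_of_mapsTo_ball (hd.mono hsub) hmaps hxx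
  rwa [div_mul_cancel_right₀ hR.ne', ← one_div] at this

/-- A holomorphic self-map of a ball with small image has a fixed point in a smaller ball, by the
contraction principle. -/
theorem exists_fixed_point {N : ℂ × ℂ → ℂ × ℂ} {R : ℝ} (hR : 0 < R)
    (hd : DifferentiableOn ℂ N (Metric.ball 0 (4 * R)))
    (hN : ∀ x ∈ Metric.ball (0 : ℂ × ℂ) (4 * R), ‖N x‖ ≤ R / 2) : ∃ x, ‖x‖ ≤ R ∧ N x = x := by
  have hmem : ∀ x ∈ Metric.closedBall (0 : ℂ × ℂ) R, x ∈ Metric.ball (0 : ℂ × ℂ) (4 * R) :=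
    fun x hx => Metric.closedBall_subset_ball (by linarith) hx
  have hmaps : Set.MapsTo N (Metric.closedBall 0 R) (Metric.closedBall 0 R) := by
    intro x hx
    rw [mem_closedBall_zero_iff]
    exact (hN x (hmem x hx)).trans (by linarith)
  have hcontr : ContractingWith (1 / 3) (hmaps.restrict N _ _) := by
    refine ⟨by rw [← NNReal.coe_lt_coe]; norm_num, LipschitzWith.of_dist_le_mul ?_⟩
    rintro ⟨x, hx⟩ ⟨x', hx'⟩
    have := dist_le_third hd hN hR (mem_closedBall_zero_iff.1 hx') (mem_closedBall_zero_iff.1 hx)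
    rw [Subtype.dist_eq, Subtype.dist_eq]
    simpa using this
  obtain ⟨y, hy, hfix, -⟩ := ContractingWith.exists_fixedPoint'
    Metric.isClosed_closedBall.isComplete hmaps hcontr
    (Metric.mem_closedBall_self hR.le) (edist_ne_top 0 _)
  exact ⟨y, mem_closedBall_zero_iff.1 hy, hfix⟩

/-- An injective endomorphism of `ℂ × ℂ` is invertible. -/
theorem exists_equiv_of_injective {f : ℂ × ℂ →L[ℂ] ℂ × ℂ} (h : ∀ v, f v = 0 → v = 0) :
    ∃ e : (ℂ × ℂ) ≃L[ℂ] ℂ × ℂ, (e : ℂ × ℂ →L[ℂ] ℂ × ℂ) = f := by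
  have hinj : Function.Injective (f : ℂ × ℂ →ₗ[ℂ] ℂ × ℂ) :=
    (injective_iff_map_eq_zero _).2 h
  refine ⟨(LinearEquiv.ofInjectiveEndo _ hinj).toContinuousLinearEquiv, ?_⟩
  ext <;> rfl

/-- Radius of a polydisc around `p` in which an inverse image of `p` is looked for. -/
noncomputable def invRadius (τ : ℂ) (i : Fin 4) (p : ℂ × ℂ) : ℝ :=
  polyRadius (|Real.log ‖p.1‖| + 1) (‖p.2‖ * (dir τ i / p.2).im / 2) / 4

theorem polyRadius_mono {c c' δ δ' : ℝ} (hc : c' ≤ c) (hδ : δ ≤ δ') :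
    polyRadius c δ ≤ polyRadius c' δ' := by
  unfold polyRadius
  gcongr

theorem abs_log_lt_of_mem_cone {c δ r : ℝ} {p : ℂ × ℂ} (hp : p ∈ cone τ S c δ r) :
    |Real.log ‖p.1‖| < c := by
  have h0 : 0 < ‖p.1‖ := (Real.exp_pos _).trans hp.1
  exact abs_lt.2 ⟨(Real.lt_log_iff_exp_lt h0).2 hp.1, (Real.log_lt_iff_lt_exp h0).2 hp.2.1⟩

theorem le_invRadius {i : Fin 4} {c δ r : ℝ} {p : ℂ × ℂ} (hp : p ∈ cone τ {i} c δ r) :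
    polyRadius (c + 1) (δ / 2) / 4 ≤ invRadius τ i p := by
  unfold invRadius
  have h1 := abs_log_lt_of_mem_cone hp
  have h2 := hp.2.2.2.2 i rfl
  gcongr
  exact polyRadius_mono (by linarith) (by linarith)

theorem polyMap_mem_cone {i : Fin 4} {c δ r : ℝ} (hδ : 0 < δ) {p : ℂ × ℂ}
    (hp : p ∈ cone τ {i} c δ r) {x : ℂ × ℂ} (hx : ‖x‖ ≤ 4 * invRadius τ i p) :
    polyMap p x ∈ cone τ {i} (c + 2) (δ / 4) (2 * r) := by
  have h0 : 0 < ‖p.1‖ := (Real.exp_pos _).trans hp.1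
  have h1 := abs_log_lt_of_mem_cone hp
  have h2 := hp.2.2.2.2 i rfl
  have hmem : p ∈ cone τ {i} (|Real.log ‖p.1‖| + 1) (‖p.2‖ * (dir τ i / p.2).im / 2) r := by
    refine ⟨?_, ?_, hp.2.2.1, hp.2.2.2.1, ?_⟩
    · rw [← Real.lt_log_iff_exp_lt h0]
      linarith [neg_abs_le (Real.log ‖p.1‖)]
    · rw [← Real.log_lt_iff_lt_exp h0]
      linarith [le_abs_self (Real.log ‖p.1‖)]
    · rintro j rfl
      linarith
  have := cone_perturb (by positivity) (by linarith) hmem (x := x)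
    (by rw [invRadius] at hx; linarith)
  exact cone_mono subset_rfl (by linarith) (by linarith) le_rfl this

/-- In relative coordinates at `p`, the solutions of `Ψ = p` are the fixed points of this map. -/
noncomputable def newtonMap (Ψ : ℂ × ℂ → ℂ × ℂ) (p x : ℂ × ℂ) : ℂ × ℂ :=
  ((polyMap p x).1 - (Ψ (polyMap p x)).1, ((polyMap p x).2 - (Ψ (polyMap p x)).2) / p.2)

theorem apply_polyMap (Ψ : ℂ × ℂ → ℂ × ℂ) {p : ℂ × ℂ} (hp : p.2 ≠ 0) (x : ℂ × ℂ) :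
    Ψ (polyMap p x) = polyMap p (x - newtonMap Ψ p x) := by
  ext
  · simp [newtonMap, polyMap]; ring
  · simp [newtonMap, polyMap]; field_simp; ring

theorem newtonMap_eq_iff (Ψ : ℂ × ℂ → ℂ × ℂ) {p : ℂ × ℂ} (hp : p.2 ≠ 0) (x : ℂ × ℂ) :
    newtonMap Ψ p x = x ↔ Ψ (polyMap p x) = p := by
  rw [apply_polyMap Ψ hp]
  constructor
  · intro h; rw [h, sub_self, polyMap_zero]
  · intro h
    have h1 := congrArg Prod.fst h
    have h2 := congrArg Prod.snd h
    simp only [polyMap] at h1 h2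
    have e1 : (x - newtonMap Ψ p x).1 = 0 := by simpa using h1
    have e2 : (x - newtonMap Ψ p x).2 = 0 := by
      have : p.2 * (x - newtonMap Ψ p x).2 = 0 := by linear_combination h2
      exact (mul_eq_zero.1 this).resolve_left hp
    have : x - newtonMap Ψ p x = 0 := Prod.ext e1 e2
    exact (sub_eq_zero.1 this).symm

/-- For `Ψ` close to the identity, `newtonMap Ψ p` maps the ball of radius `4 * invRadius τ i p` to
the ball of radius `ρ / 2`, where `ρ` is as small as required and at most `invRadius` near `p`. So
the contraction principle applies to it. -/
theorem eventually_newtonMap_le {i : Fin 4} {Ψ : ℂ × ℂ → ℂ × ℂ}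
    (hd : ∀ᶠ p in coneGerm τ {i}, AnalyticAt ℂ Ψ p) (hΨ : NearRot τ {i} 1 Ψ) {ε : ℝ}
    (hε : 0 < ε) : ∀ᶠ p in coneGerm τ {i}, p.2 ≠ 0 ∧
      ∃ ρ > 0, ρ ≤ ε ∧ (∀ᶠ p' in 𝓝 p, ρ ≤ invRadius τ i p') ∧
      ∀ x ∈ Metric.ball (0 : ℂ × ℂ) (4 * invRadius τ i p), AnalyticAt ℂ Ψ (polyMap p x) ∧
        ‖newtonMap Ψ p x‖ ≤ ρ / 2 := by
  intro c hc δ hδ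
  set ρ := min ε (polyRadius (c + 1) (δ / 2) / 4) with hρ
  have hρ0 : 0 < ρ := lt_min hε (div_pos (polyRadius_pos (by positivity)) (by norm_num))
  have h1 := hΨ.fst.eventually (Metric.ball_mem_nhds _ (half_pos hρ0))
  have h2 := hΨ.snd.eventually (Metric.ball_mem_nhds _ (show 0 < ρ / 4 by positivity))
  obtain ⟨r, hr, h⟩ := (hd.and (h1.and h2)) (c + 2) (by linarith) (δ / 4) (by positivity)
  refine ⟨r / 2, by positivity, fun p hp => ⟨hp.2.2.1, ρ, hρ0, min_le_left _ _, ?_,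
    fun x hx => ?_⟩⟩
  · filter_upwards [(isOpen_cone τ {i} c δ (r / 2)).mem_nhds hp] with p' hp'
    exact (min_le_right _ _).trans (le_invRadius hp')
  · rw [mem_ball_zero_iff] at hx
    have hmem := polyMap_mem_cone hδ hp hx.le
    rw [mul_div_cancel₀ _ two_ne_zero] at hmem
    obtain ⟨g1, g2, g3⟩ := h hmem
    rw [dist_eq_norm] at g2 g3
    refine ⟨g1, max_le ?_ ?_⟩
    · simp only [one_mul, sub_zero] at g2
      rw [← norm_neg, neg_sub] at g2
      exact g2.le
    · have hx2 : ‖x.2‖ ≤ 1 := by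
        have := polyRadius_le (|Real.log ‖p.1‖| + 1) (‖p.2‖ * (dir τ i / p.2).im / 2)
        have h4 : invRadius τ i p ≤ 1 / 32 := by unfold invRadius; linarith
        exact (norm_snd_le x).trans (by linarith)
      have h0 := hmem.2.2.1
      have hp0 := hp.2.2.1
      have hx0 : 1 + x.2 ≠ 0 := right_ne_zero_of_mul h0
      have e : ((polyMap p x).2 - (Ψ (polyMap p x)).2) / p.2
          = -((Ψ (polyMap p x)).2 / (polyMap p x).2 - 1) * (1 + x.2) := by
        rw [show p.2 = (polyMap p x).2 / (1 + x.2) by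
          simp only [polyMap]; field_simp]
        field_simp
        ring
      show ‖((polyMap p x).2 - (Ψ (polyMap p x)).2) / p.2‖ ≤ ρ / 2
      rw [e, norm_mul, norm_neg]
      have : ‖1 + x.2‖ ≤ 2 := (norm_add_le _ _).trans (by rw [norm_one]; linarith)
      calc _ ≤ ρ / 4 * 2 := by gcongr
        _ = _ := by ring

/-- A sectorial holomorphic map which is close to the identity has a sectorial inverse. -/
theorem exists_sectorial_inverse {i : Fin 4} {Ψ : ℂ × ℂ → ℂ × ℂ}
    (hd : ∀ᶠ p in coneGerm τ {i}, AnalyticAt ℂ Ψ p) (hΨ : NearRot τ {i} 1 Ψ) :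
    ∃ Θ : ℂ × ℂ → ℂ × ℂ, NearRot τ {i} 1 Θ ∧ (∀ᶠ p in coneGerm τ {i}, DifferentiableAt ℂ Θ p) ∧
      (∀ᶠ p in coneGerm τ {i}, Ψ (Θ p) = p) ∧ ∀ᶠ p in coneGerm τ {i}, Θ (Ψ p) = p := by
  classical
  set R := invRadius τ i with hR
  let Θ : ℂ × ℂ → ℂ × ℂ := fun p =>
    if h : ∃ x, ‖x‖ ≤ R p ∧ Ψ (polyMap p x) = p then polyMap p h.choose else p
  -- the solutions are unique in the polydisc of radius `R p`
  have main : ∀ ε > 0, ∀ᶠ p in coneGerm τ {i}, p.2 ≠ 0 ∧ ∃ ρ > 0, ρ ≤ ε ∧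
      (∀ᶠ p' in 𝓝 p, ρ ≤ R p') ∧ ∃ x, ‖x‖ ≤ ρ / 2 ∧ Ψ (polyMap p x) = p ∧ Θ p = polyMap p x ∧
        (∀ x', ‖x'‖ ≤ R p → Ψ (polyMap p x') = p → Θ p = polyMap p x') ∧
        AnalyticAt ℂ Ψ (polyMap p x) ∧ ∀ v, fderiv ℂ Ψ (polyMap p x) v = 0 → v = 0 := by
    intro ε hε
    filter_upwards [eventually_newtonMap_le hd hΨ hε] with p ⟨hp0, ρ, hρ, hρε, hρR, hN⟩
    have hρRp : ρ ≤ R p := hρR.self_of_nhds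
    have hRp : 0 < R p := hρ.trans_le hρRp
    have hpoly : ∀ x, DifferentiableAt ℂ (polyMap p) x := fun x =>
      (hasFDerivAt_polyMap p x).differentiableAt
    have hNd : DifferentiableOn ℂ (newtonMap Ψ p) (Metric.ball 0 (4 * R p)) := fun x hx => by
      have h1 : DifferentiableAt ℂ (fun x => Ψ (polyMap p x)) x :=
        ((hN x hx).1.differentiableAt).comp x (hpoly x)
      have h2 := hpoly x
      have h3 : DifferentiableAt ℂ
          (fun x => ((polyMap p x).2 - (Ψ (polyMap p x)).2) / p.2) x := by
        simp only [div_eq_mul_inv]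
        exact (h2.snd.sub h1.snd).mul_const _
      exact ((h2.fst.sub h1.fst).prodMk h3).differentiableWithinAt
    have hNle : ∀ x ∈ Metric.ball (0 : ℂ × ℂ) (4 * R p), ‖newtonMap Ψ p x‖ ≤ R p / 2 :=
      fun x hx => ((hN x hx).2).trans (by linarith)
    have hmem : ∀ x : ℂ × ℂ, ‖x‖ ≤ R p → x ∈ Metric.ball (0 : ℂ × ℂ) (4 * R p) := fun x hx =>
      mem_ball_zero_iff.2 (by linarith)
    obtain ⟨x, hx, hfix⟩ := exists_fixed_point hRp hNd hNle
    have huniq : ∀ x', ‖x'‖ ≤ R p → Ψ (polyMap p x') = p → x' = x := by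
      intro x' hx' h'
      have := dist_le_third hNd hNle hRp hx hx'
      rw [hfix, (newtonMap_eq_iff Ψ hp0 x').2 h'] at this
      have h3 : dist x' x ≤ 0 := by linarith [dist_nonneg (x := x') (y := x)]
      exact dist_le_zero.1 h3
    have hsol : Ψ (polyMap p x) = p := (newtonMap_eq_iff Ψ hp0 x).1 hfix
    have hex : ∃ x, ‖x‖ ≤ R p ∧ Ψ (polyMap p x) = p := ⟨x, hx, hsol⟩
    have hΘ : Θ p = polyMap p x := by
      simp only [Θ, dif_pos hex]
      rw [huniq _ hex.choose_spec.1 hex.choose_spec.2]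
    refine ⟨hp0, ρ, hρ, hρε, hρR, x, ?_, hsol, hΘ, fun x' hx' h' => ?_, (hN x (hmem x hx)).1,
      fun v hv => ?_⟩
    · rw [← hfix]; exact (hN x (hmem x hx)).2
    · rw [hΘ, huniq x' hx' h']
    · -- `Ψ ∘ polyMap p = polyMap p ∘ (id - newtonMap)` and `newtonMap` is a contraction
      have hΨd := (hN x (hmem x hx)).1.differentiableAt
      have hNx : HasFDerivAt (newtonMap Ψ p) (fderiv ℂ (newtonMap Ψ p) x) x :=
        ((hNd x (hmem x hx)).differentiableAt
          (Metric.isOpen_ball.mem_nhds (hmem x hx))).hasFDerivAt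
      have hNn : ‖fderiv ℂ (newtonMap Ψ p) x‖ ≤ 1 / 3 := by
        refine norm_fderiv_le_of_lip' ℂ (by norm_num) ?_
        have hxlt : ‖x‖ < R p := by
          rw [← hfix]
          exact (hNle x (hmem x hx)).trans_lt (by linarith)
        have : Metric.ball (0 : ℂ × ℂ) (R p) ∈ 𝓝 x :=
          Metric.isOpen_ball.mem_nhds (mem_ball_zero_iff.2 hxlt)
        filter_upwards [this] with w hw
        rw [← dist_eq_norm, ← dist_eq_norm]
        exact dist_le_third hNd hNle hRp hx (mem_ball_zero_iff.1 hw).le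
      have e1 := hΨd.hasFDerivAt.comp x (hasFDerivAt_polyMap p x)
      have e2 := (hasFDerivAt_polyMap p (x - newtonMap Ψ p x)).comp x
        ((hasFDerivAt_id x).sub hNx)
      have e3 : Ψ ∘ polyMap p = polyMap p ∘ (fun x => id x - newtonMap Ψ p x) := by
        funext w; exact apply_polyMap Ψ hp0 w
      rw [e3] at e1
      have e4 := e1.unique e2
      set w : ℂ × ℂ := (v.1, v.2 / p.2) with hw
      have e5 := congrArg (fun L => L w) e4
      have e6 : ((ContinuousLinearMap.fst ℂ ℂ ℂ).prod (p.2 • ContinuousLinearMap.snd ℂ ℂ ℂ)) w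
          = v := by
        ext
        · simp [hw]
        · simp [hw]; field_simp
      simp only [ContinuousLinearMap.comp_apply, e6, hv] at e5
      have e7 : w = fderiv ℂ (newtonMap Ψ p) x w := by
        have a1 := congrArg Prod.fst e5
        have a2 := congrArg Prod.snd e5
        simp only [ContinuousLinearMap.prod_apply, ContinuousLinearMap.coe_fst',
          _root_.smul_apply, ContinuousLinearMap.coe_snd', smul_eq_mul, Prod.fst_zero,
          Prod.snd_zero, _root_.sub_apply, ContinuousLinearMap.coe_id', id_eq, Prod.fst_sub,
          Prod.snd_sub] at a1 a2
        refine Prod.ext ?_ ?_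
        · exact sub_eq_zero.1 a1.symm
        · exact sub_eq_zero.1 ((mul_eq_zero.1 a2.symm).resolve_left hp0)
      have e8 : ‖w‖ ≤ 1 / 3 * ‖w‖ := by
        conv_lhs => rw [e7]
        exact (ContinuousLinearMap.le_opNorm _ _).trans (by gcongr)
      have e9 : w = 0 := norm_le_zero_iff.1 (by linarith [norm_nonneg w])
      rw [← e6, e9, map_zero]
  refine ⟨Θ, ⟨?_, ?_⟩, ?_, ?_, ?_⟩
  · rw [Metric.tendsto_nhds]
    intro ε hε
    filter_upwards [main ε hε] with p ⟨hp0, ρ, hρ, hρε, _, x, hx, _, hΘ, _⟩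
    rw [hΘ, dist_zero_right]
    simp only [polyMap, one_mul, add_sub_cancel_left]
    exact ((norm_fst_le x).trans hx).trans_lt (by linarith)
  · rw [Metric.tendsto_nhds]
    intro ε hε
    filter_upwards [main ε hε] with p ⟨hp0, ρ, hρ, hρε, _, x, hx, _, hΘ, _⟩
    rw [hΘ, dist_eq_norm]
    simp only [polyMap]
    rw [mul_div_cancel_left₀ _ hp0, add_sub_cancel_left]
    exact ((norm_snd_le x).trans hx).trans_lt (by linarith)
  · have hnear := eventually_eventually_coneGerm (main 1 one_pos)
    filter_upwards [main 1 one_pos, hnear] with p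
      ⟨hp0, ρ, hρ, hρε, hρR, x, hx, hsol, hΘ, _, han, hinj⟩ hev
    obtain ⟨e, he⟩ := exists_equiv_of_injective hinj
    have hstr : HasStrictFDerivAt Ψ (e : ℂ × ℂ →L[ℂ] ℂ × ℂ) (polyMap p x) := by
      rw [he]; exact han.hasStrictFDerivAt
    set g := hstr.localInverse Ψ e (polyMap p x) with hg
    have hgd : HasStrictFDerivAt g (e.symm : ℂ × ℂ →L[ℂ] ℂ × ℂ) p := by
      have := hstr.to_localInverse
      rwa [hsol] at this
    have hgp : g p = polyMap p x := by
      have := hstr.localInverse_apply_image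
      rwa [hsol] at this
    have hgr : ∀ᶠ p' in 𝓝 p, Ψ (g p') = p' := by
      have := hstr.eventually_right_inverse
      rwa [hsol] at this
    have hcont : ContinuousAt g p := hgd.hasFDerivAt.continuousAt
    -- relative coordinates of the local inverse
    set X : ℂ × ℂ → ℂ × ℂ := fun p' => ((g p').1 - p'.1, (g p').2 / p'.2 - 1) with hX
    have hXc : ContinuousAt X p :=
      (hcont.fst.sub continuousAt_fst).prodMk
        ((hcont.snd.div continuousAt_snd hp0).sub continuousAt_const)
    have hXp : ‖X p‖ < ρ := by
      have : X p = x := by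
        simp only [hX, hgp, polyMap]
        ext
        · simp
        · simp [mul_div_cancel_left₀ _ hp0]
      rw [this]; linarith
    have heq : Θ =ᶠ[𝓝 p] g := by
      filter_upwards [hev, hgr, hXc.norm.eventually (gt_mem_nhds hXp), hρR] with p' h1 h2 h3 h4
      obtain ⟨hp0', ρ', hρ', -, -, x', -, -, -, huniq, -⟩ := h1
      have hpm : polyMap p' (X p') = g p' := by
        simp only [hX, polyMap]
        ext
        · simp
        · simp; field_simp
      have := huniq (X p') (h3.le.trans h4) (by rw [hpm]; exact h2)
      rw [this, hpm]
    exact (hgd.hasFDerivAt.congr_of_eventuallyEq heq).differentiableAt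
  · filter_upwards [main 1 one_pos] with p ⟨_, _, _, _, _, x, _, hsol, hΘ, _⟩
    rw [hΘ, hsol]
  · have ht := hΨ.tendsto one_ne_zero subset_rfl
    intro c hc δ hδ
    set ρ := polyRadius (c + 1 + 1) (δ / 2 / 2) / 4 with hρ
    have hρ0 : 0 < ρ := div_pos (polyRadius_pos (by positivity)) (by norm_num)
    have hρ' : 0 < polyRadius c δ := polyRadius_pos hδ
    -- the relative coordinates of `p` at `Ψ p` tend to zero
    have h1 := hΨ.fst.eventually (Metric.ball_mem_nhds _ (lt_min hρ0 hρ'))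
    have h2 := hΨ.snd.eventually (Metric.ball_mem_nhds _ hρ')
    have h3 : Tendsto (fun p => p.2 / (Ψ p).2) (coneGerm τ {i}) (𝓝 1) := by
      have := hΨ.snd.inv₀ one_ne_zero
      simpa using this
    have h4 := h3.eventually (Metric.ball_mem_nhds _ hρ0)
    obtain ⟨r, hr, h⟩ := (h1.and (h2.and (h4.and (ht.eventually (main 1 one_pos))))) c hc δ hδ
    refine ⟨r, hr, fun p hp => ?_⟩
    obtain ⟨g1, g2, g3, hp0, _, -, -, -, x, -, -, -, huniq, -⟩ := h hp
    rw [dist_eq_norm] at g1 g2 g3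
    simp only [one_mul, sub_zero] at g1
    have hy := hp.2.2.1
    have hmem : Ψ p ∈ cone τ {i} (c + 1) (δ / 2) (2 * r) := by
      have := cone_perturb hc hδ hp (x := ((Ψ p).1 - p.1, (Ψ p).2 / p.2 - 1))
        (max_le (g1.trans_le (min_le_right _ _)).le g2.le)
      convert this using 1
      ext
      · simp
      · simp; field_simp
    have hle := le_invRadius hmem
    set x' : ℂ × ℂ := (p.1 - (Ψ p).1, p.2 / (Ψ p).2 - 1) with hx'
    have hpm : polyMap (Ψ p) x' = p := by
      simp only [hx', polyMap]
      ext
      · simp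
      · simp; field_simp
    have hx'n : ‖x'‖ ≤ R (Ψ p) := by
      refine (max_le ?_ g3.le : ‖x'‖ ≤ ρ).trans hle
      rw [← norm_neg, neg_sub]
      exact (g1.trans_le (min_le_left _ _)).le
    have := huniq x' hx'n (by rw [hpm])
    show Θ (Ψ p) = p
    rw [this, hpm]

/-! ### Algebra of one-forms in two variables -/

theorem wedge_comp (α β : ℂ × ℂ →L[ℂ] ℂ) (L : ℂ × ℂ →L[ℂ] ℂ × ℂ) :
    wedge (α.comp L) (β.comp L) = wedge α β *
      wedge ((ContinuousLinearMap.fst ℂ ℂ ℂ).comp L) ((ContinuousLinearMap.snd ℂ ℂ ℂ).comp L) := by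
  have h : ∀ (γ : ℂ × ℂ →L[ℂ] ℂ) (v : ℂ × ℂ), γ v = v.1 * γ (1, 0) + v.2 * γ (0, 1) := by
    intro γ v
    rw [← smul_eq_mul, ← smul_eq_mul, ← map_smul, ← map_smul, ← map_add]
    simp
  simp only [wedge, ContinuousLinearMap.comp_apply, ContinuousLinearMap.coe_fst',
    ContinuousLinearMap.coe_snd']
  rw [h α (L (1, 0)), h α (L (0, 1)), h β (L (1, 0)), h β (L (0, 1))]
  ring

theorem covector_apply (γ : ℂ × ℂ →L[ℂ] ℂ) (v : ℂ × ℂ) :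
    γ v = v.1 * γ (1, 0) + v.2 * γ (0, 1) := by
  rw [← smul_eq_mul, ← smul_eq_mul, ← map_smul, ← map_smul, ← map_add]
  simp

theorem covector_ext {α β : ℂ × ℂ →L[ℂ] ℂ} (h1 : α (1, 0) = β (1, 0)) (h2 : α (0, 1) = β (0, 1)) :
    α = β :=
  ContinuousLinearMap.ext fun v => by rw [covector_apply α, covector_apply β, h1, h2]

theorem covector_ne_zero {α : ℂ × ℂ →L[ℂ] ℂ} (h : α ≠ 0) : α (1, 0) ≠ 0 ∨ α (0, 1) ≠ 0 := by
  by_contra! hcon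
  exact h (covector_ext (by simpa using hcon.1) (by simpa using hcon.2))

theorem wedge_swap (α β : ℂ × ℂ →L[ℂ] ℂ) : wedge α β = -wedge β α := by
  simp only [wedge]; ring

/-- Two covectors collinear to a third non-zero one are collinear. -/
theorem wedge_eq_zero_of_wedge {α β γ : ℂ × ℂ →L[ℂ] ℂ} (hβ : β ≠ 0) (h1 : wedge α β = 0)
    (h2 : wedge γ β = 0) : wedge α γ = 0 := by
  simp only [wedge] at *
  rcases covector_ne_zero hβ with h | h
  · refine (mul_eq_zero.1 ?_).resolve_left h
    linear_combination γ (1, 0) * h1 - α (1, 0) * h2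
  · refine (mul_eq_zero.1 ?_).resolve_left h
    linear_combination γ (0, 1) * h1 - α (0, 1) * h2

/-- The Jacobian determinant. -/
noncomputable def jac (f : ℂ × ℂ → ℂ × ℂ) (p : ℂ × ℂ) : ℂ :=
  wedge ((ContinuousLinearMap.fst ℂ ℂ ℂ).comp (fderiv ℂ f p))
    ((ContinuousLinearMap.snd ℂ ℂ ℂ).comp (fderiv ℂ f p))

theorem wedge_pullback (f : ℂ × ℂ → ℂ × ℂ) (α β : OneForm) (p : ℂ × ℂ) :
    wedge (pullback f α p) (pullback f β p) = wedge (α (f p)) (β (f p)) * jac f p :=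
  wedge_comp _ _ _

theorem jac_comp {f g : ℂ × ℂ → ℂ × ℂ} {p : ℂ × ℂ} (hg : DifferentiableAt ℂ g (f p))
    (hf : DifferentiableAt ℂ f p) : jac (fun x => g (f x)) p = jac g (f p) * jac f p := by
  unfold jac
  have : fderiv ℂ (fun x => g (f x)) p = _ := fderiv_comp p hg hf
  rw [this, ← ContinuousLinearMap.comp_assoc, ← ContinuousLinearMap.comp_assoc, wedge_comp]

theorem fderiv_injective_of_jac_ne_zero {f : ℂ × ℂ → ℂ × ℂ} {p : ℂ × ℂ} (h : jac f p ≠ 0)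
    (v : ℂ × ℂ) (hv : fderiv ℂ f p v = 0) : v = 0 := by
  have h1 := congrArg Prod.fst hv
  have h2 := congrArg Prod.snd hv
  have e1 := covector_apply ((ContinuousLinearMap.fst ℂ ℂ ℂ).comp (fderiv ℂ f p)) v
  have e2 := covector_apply ((ContinuousLinearMap.snd ℂ ℂ ℂ).comp (fderiv ℂ f p)) v
  simp only [ContinuousLinearMap.comp_apply, ContinuousLinearMap.coe_fst',
    ContinuousLinearMap.coe_snd', h1, h2, Prod.fst_zero, Prod.snd_zero] at e1 e2
  simp only [jac, wedge, ContinuousLinearMap.comp_apply, ContinuousLinearMap.coe_fst',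
    ContinuousLinearMap.coe_snd'] at h
  refine Prod.ext ((mul_eq_zero.1 ?_).resolve_right h) ((mul_eq_zero.1 ?_).resolve_right h)
  · linear_combination (fderiv ℂ f p (0, 1)).1 * e2 - (fderiv ℂ f p (0, 1)).2 * e1
  · linear_combination (fderiv ℂ f p (1, 0)).2 * e1 - (fderiv ℂ f p (1, 0)).1 * e2

theorem pullback_comp {f g : ℂ × ℂ → ℂ × ℂ} {p : ℂ × ℂ} (hg : DifferentiableAt ℂ g (f p))
    (hf : DifferentiableAt ℂ f p) (ω : OneForm) :
    pullback (fun x => g (f x)) ω p = pullback f (pullback g ω) p := by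
  unfold pullback
  have : fderiv ℂ (fun x => g (f x)) p = _ := fderiv_comp p hg hf
  rw [this, ContinuousLinearMap.comp_assoc]

theorem pullback_congr {f g : ℂ × ℂ → ℂ × ℂ} {p : ℂ × ℂ} (h : f =ᶠ[𝓝 p] g) (ω : OneForm) :
    pullback f ω p = pullback g ω p := by
  unfold pullback
  rw [h.fderiv_eq, h.eq_of_nhds]

theorem pullback_congr_form {f : ℂ × ℂ → ℂ × ℂ} {p : ℂ × ℂ} {α β : OneForm}
    (h : α (f p) = β (f p)) : pullback f α p = pullback f β p := by
  unfold pullback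
  rw [h]

/-- The covector `α dX / X + β dY / Y` at a point. -/
noncomputable def logCovec (α β : ℂ) (p : ℂ × ℂ) : ℂ × ℂ →L[ℂ] ℂ :=
  (α / p.1) • ContinuousLinearMap.fst ℂ ℂ ℂ + (β / p.2) • ContinuousLinearMap.snd ℂ ℂ ℂ

theorem logForm_eq (τ u v : ℂ) : logForm τ u v = logCovec ((v - u) * τ) u := rfl

theorem logCovec_fst (α β : ℂ) (p : ℂ × ℂ) : logCovec α β p (1, 0) = α / p.1 := by
  simp [logCovec]

theorem logCovec_snd (α β : ℂ) (p : ℂ × ℂ) : logCovec α β p (0, 1) = β / p.2 := by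
  simp [logCovec]

/-- The form `α(ℓ) dX / X + β(ℓ) dY / Y`, where `ℓ` is the coordinate vanishing on the line
`L_i`. -/
noncomputable def lineForm (i : Fin 4) (α β : ℂ → ℂ) : OneForm :=
  fun p => logCovec (α (lineCoord i p)) (β (lineCoord i p)) p

/-! ### The map from the neighborhood to the torus -/

theorem hasStrictFDerivAt_serreMap (τ : ℂ) {p : ℂ × ℂ} (hp : p.2 ≠ 0) :
    HasStrictFDerivAt (serreMap τ)
      (((-(2 * Real.pi * Complex.I / p.2 ^ 2) * (serreMap τ p).1) •
          ContinuousLinearMap.snd ℂ ℂ ℂ).prod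
        (Complex.exp (2 * Real.pi * Complex.I * τ / p.2) • ContinuousLinearMap.fst ℂ ℂ ℂ
          + (-(2 * Real.pi * Complex.I * τ / p.2 ^ 2) * (serreMap τ p).2) •
            ContinuousLinearMap.snd ℂ ℂ ℂ)) p := by
  have hdiv : ∀ k : ℂ, HasStrictFDerivAt (fun q : ℂ × ℂ => k / q.2)
      ((-(k / p.2 ^ 2)) • ContinuousLinearMap.snd ℂ ℂ ℂ) p := by
    intro k
    have h1 : HasStrictDerivAt (fun y : ℂ => k / y) (-(k / p.2 ^ 2)) p.2 := by
      simp only [div_eq_mul_inv]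
      simpa using (hasStrictDerivAt_inv hp).const_mul k
    exact h1.comp_hasStrictFDerivAt p hasStrictFDerivAt_snd
  have h1 := (hdiv (2 * Real.pi * Complex.I)).cexp
  have h2 := (hasStrictFDerivAt_fst (𝕜 := ℂ) (p := p)).mul (hdiv (2 * Real.pi * Complex.I * τ)).cexp
  have h3 := h1.prodMk h2
  refine h3.congr_fderiv ?_
  ext <;> simp [serreMap] <;> ring

theorem serreMap_fst_ne_zero (τ : ℂ) (p : ℂ × ℂ) : (serreMap τ p).1 ≠ 0 := Complex.exp_ne_zero _

theorem serreMap_snd_ne_zero (τ : ℂ) {p : ℂ × ℂ} (hp : p.1 ≠ 0) : (serreMap τ p).2 ≠ 0 :=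
  mul_ne_zero hp (Complex.exp_ne_zero _)

theorem logCovec_comp_serreMap (τ α β : ℂ) {p : ℂ × ℂ} (hp1 : p.1 ≠ 0) (hp : p.2 ≠ 0) :
    (logCovec α β (serreMap τ p)).comp (fderiv ℂ (serreMap τ) p)
      = (β / p.1) • ContinuousLinearMap.fst ℂ ℂ ℂ
        - (2 * Real.pi * Complex.I * (α + τ * β) / p.2 ^ 2) • ContinuousLinearMap.snd ℂ ℂ ℂ := by
  rw [(hasStrictFDerivAt_serreMap τ hp).hasFDerivAt.fderiv]
  have h1 := serreMap_fst_ne_zero τ p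
  have h2 := serreMap_snd_ne_zero τ hp1
  apply covector_ext
  · simp [logCovec]
    simp [serreMap]
    field_simp
  · simp [logCovec]
    field_simp
    ring

theorem jac_serreMap (τ : ℂ) {p : ℂ × ℂ} (hp : p.2 ≠ 0) :
    jac (serreMap τ) p ≠ 0 := by
  unfold jac
  rw [(hasStrictFDerivAt_serreMap τ hp).hasFDerivAt.fderiv]
  have h1 := serreMap_fst_ne_zero τ p
  have h0 := Complex.two_pi_I_ne_zero
  simp only [wedge, ContinuousLinearMap.comp_apply, ContinuousLinearMap.prod_apply,
    ContinuousLinearMap.coe_fst', ContinuousLinearMap.coe_snd', _root_.smul_apply, smul_eq_mul,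
    mul_zero, _root_.add_apply, mul_one, zero_mul, zero_sub, add_zero, zero_add]
  refine neg_ne_zero.2 (mul_ne_zero (mul_ne_zero (neg_ne_zero.2 (div_ne_zero h0 ?_)) h1)
    (Complex.exp_ne_zero _))
  exact pow_ne_zero _ hp

/-- Growth rate of the coordinate vanishing on `L_i`. -/
noncomputable def rate (τ : ℂ) : Fin 4 → ℝ
  | 0 => 1
  | 1 => ‖τ‖
  | 2 => 1
  | 3 => ‖τ‖

theorem rate_pos (hτ : 0 < τ.im) (i : Fin 4) : 0 < rate τ i := by
  have : 0 < ‖τ‖ := norm_pos_iff.2 fun h => by simp [h] at hτ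
  fin_cases i <;> simp [rate, this]

/-- Exponent of `|z|` in the modulus of the coordinate vanishing on `L_i`. -/
def zExp : Fin 4 → ℤ
  | 0 => 0
  | 1 => 1
  | 2 => 0
  | 3 => -1

/-- The modulus of the coordinate vanishing on `L_i` decays exponentially in `1 / |y|` in the
sector of index `i`. -/
theorem norm_lineCoord_serreMap (τ : ℂ) (i : Fin 4) (p : ℂ × ℂ) :
    ‖lineCoord i (serreMap τ p)‖ =
      ‖p.1‖ ^ zExp i * Real.exp (-(2 * Real.pi * rate τ i * (dir τ i / p.2).im)) := by
  have h1 : (‖τ‖ : ℂ) * (dir τ 1 / p.2) = τ / p.2 := by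
    rw [← mul_div_assoc, norm_mul_dir_one]
  have h3 : (‖τ‖ : ℂ) * (dir τ 3 / p.2) = -(τ / p.2) := by
    rw [← mul_div_assoc, norm_mul_dir_three, neg_div]
  have e1 := congrArg Complex.im h1
  have e3 := congrArg Complex.im h3
  rw [Complex.im_ofReal_mul] at e1 e3
  have hre : ∀ w : ℂ, (2 * Real.pi * Complex.I * w).re = -(2 * Real.pi * w.im) := by
    intro w
    have : 2 * Real.pi * Complex.I * w = ((2 * Real.pi : ℝ) : ℂ) * (Complex.I * w) := by
      push_cast; ring
    rw [this, Complex.re_ofReal_mul, Complex.I_mul_re]; ring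
  fin_cases i
  · simp only [lineCoord, serreMap, zExp, rate, Complex.norm_exp, zpow_zero, one_mul, mul_one,
      dir_zero, Fin.zero_eta, div_eq_mul_inv, hre]
  · simp only [lineCoord, serreMap, zExp, rate, Complex.norm_exp, zpow_one, norm_mul,
      Fin.mk_one]
    rw [mul_div_assoc (2 * Real.pi * Complex.I) τ, hre, mul_assoc (2 * Real.pi), e1]
  · simp only [lineCoord, serreMap, zExp, rate, Complex.norm_exp, zpow_zero, one_mul, mul_one,
      norm_inv, Fin.reduceFinMk, dir_two, div_eq_mul_inv, hre, ← Real.exp_neg, neg_mul,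
      Complex.neg_im, neg_neg, mul_neg]
  · simp only [lineCoord, serreMap, zExp, rate, Complex.norm_exp, zpow_neg_one, norm_mul,
      Fin.reduceFinMk, norm_inv, mul_inv, ← Real.exp_neg]
    rw [mul_div_assoc (2 * Real.pi * Complex.I) τ, hre, mul_assoc (2 * Real.pi), e3,
      Complex.neg_im, mul_neg]

theorem zpow_zExp_le {c x : ℝ} (hc : 0 < c) (h1 : Real.exp (-c) < x) (h2 : x < Real.exp c)
    (i : Fin 4) : x ^ zExp i ≤ Real.exp c := by
  have h3 : x⁻¹ ≤ Real.exp c := by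
    have := inv_anti₀ (Real.exp_pos _) h1.le
    rwa [← Real.exp_neg, neg_neg] at this
  have h4 : 1 ≤ Real.exp c := Real.one_le_exp hc.le
  fin_cases i <;> simp [zExp, h2.le, h3, h4]

/-- Exponential decay is faster than any power of `y`. -/
theorem flat_lineCoord (hτ : 0 < τ.im) (i : Fin 4) :
    Flat τ {i} (fun p => lineCoord i (serreMap τ p)) := by
  have key : ∀ k : ℕ, Ord τ {i} ((k : ℤ)) (fun p => lineCoord i (serreMap τ p)) := by
    intro k
    refine Ord.of_bound fun c hc δ hδ => ?_
    set a := 2 * Real.pi * rate τ i * δ with ha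
    have ha0 : 0 < a := by have := rate_pos hτ i; have := Real.pi_pos; positivity
    refine ⟨Real.exp c * ((k + 1).factorial / a ^ (k + 1)), 1, one_pos, fun p hp => ?_⟩
    have hy : 0 < ‖p.2‖ := norm_pos_iff.2 hp.2.2.1
    have h5 := hp.2.2.2.2 i rfl
    rw [norm_lineCoord_serreMap]
    have h1 := zpow_zExp_le hc hp.1 hp.2.1 i
    have h2 : a / ‖p.2‖ ≤ 2 * Real.pi * rate τ i * (dir τ i / p.2).im := by
      rw [div_le_iff₀ hy, ha, mul_assoc _ _ ‖p.2‖, mul_comm _ ‖p.2‖]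
      have := rate_pos hτ i
      have := Real.pi_pos
      gcongr
    have h3 : Real.exp (-(2 * Real.pi * rate τ i * (dir τ i / p.2).im))
        ≤ (k + 1).factorial / a ^ (k + 1) * ‖p.2‖ ^ (k + 1) := by
      refine (Real.exp_le_exp.2 (neg_le_neg h2)).trans ?_
      have h4 := Real.pow_div_factorial_le_exp (a / ‖p.2‖) (by positivity) (k + 1)
      rw [Real.exp_neg, inv_le_comm₀ (Real.exp_pos _) (by positivity)]
      refine le_trans (le_of_eq ?_) h4
      rw [div_pow]
      field_simp
    have e : ‖p.2‖ ^ ((k : ℤ) + 1) = ‖p.2‖ ^ (k + 1) := by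
      rw [← zpow_natCast]; push_cast; rfl
    rw [e, mul_assoc (Real.exp c)]
    exact mul_le_mul h1 h3 (Real.exp_pos _).le (Real.exp_pos _).le
  intro n
  exact (key n.toNat).mono (Int.self_le_toNat n)

theorem tendsto_serreMap_lineGerm (hτ : 0 < τ.im) (i : Fin 4) :
    Tendsto (serreMap τ) (coneGerm τ {i}) (lineGerm i) := by
  refine tendsto_inf.2 ⟨tendsto_comap_iff.2 ((flat_lineCoord hτ i 0).tendsto le_rfl), ?_⟩
  refine tendsto_principal.2 ?_
  filter_upwards [eventually_fst_ne_zero τ {i}] with p hp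
  exact ⟨serreMap_fst_ne_zero τ p, serreMap_snd_ne_zero τ hp⟩

/-- The neighborhoods of a corner are the intersections of neighborhoods of the two lines through
it. -/
theorem cornerGerm_eq (i : Fin 4) : cornerGerm i = lineGerm i ⊓ lineGerm (i + 1) := by
  have h : ∀ i, cornerGerm i = (comap (lineCoord i) (𝓝 0) ⊓ comap (lineCoord (i + 1)) (𝓝 0))
      ⊓ 𝓟 torus := by
    intro i
    unfold cornerGerm
    rw [show (0 : ℂ × ℂ) = (0, 0) from rfl, nhds_prod_eq, Filter.prod_eq_inf, comap_inf,
      comap_comap, comap_comap]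
    fin_cases i
    · rfl
    · exact congrArg (· ⊓ _) (inf_comm _ _)
    · rfl
    · exact congrArg (· ⊓ _) (inf_comm _ _)
  rw [h, lineGerm, lineGerm, inf_inf_inf_comm, inf_idem]

theorem tendsto_serreMap_cornerGerm (hτ : 0 < τ.im) (i : Fin 4) :
    Tendsto (serreMap τ) (coneGerm τ {i, i + 1}) (cornerGerm i) := by
  rw [cornerGerm_eq]
  exact tendsto_inf.2 ⟨(tendsto_serreMap_lineGerm hτ i).mono_left (coneGerm_mono (by simp)),
    (tendsto_serreMap_lineGerm hτ (i + 1)).mono_left (coneGerm_mono (by simp))⟩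

theorem analyticAt_lineCoord (i : Fin 4) {p : ℂ × ℂ} (hp : p ∈ torus) :
    AnalyticAt ℂ (lineCoord i) p := by
  fin_cases i
  exacts [analyticAt_fst, analyticAt_snd, analyticAt_fst.inv hp.1, analyticAt_snd.inv hp.2]

theorem isOpen_torus : IsOpen torus :=
  (isOpen_ne.preimage continuous_fst).inter (isOpen_ne.preimage continuous_snd)

theorem eventually_eventually_lineGerm {i : Fin 4} {P : ℂ × ℂ → Prop}
    (h : ∀ᶠ p in lineGerm i, P p) : ∀ᶠ p in lineGerm i, ∀ᶠ q in 𝓝 p, P q := by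
  unfold lineGerm at h ⊢
  rw [eventually_inf_principal, eventually_comap] at h ⊢
  filter_upwards [eventually_eventually_nhds.2 h] with x hx
  rintro p rfl hp
  filter_upwards [(analyticAt_lineCoord i hp).continuousAt.eventually hx, isOpen_torus.mem_nhds hp]
    with q h1 h2 using h1 q rfl h2

theorem eventually_torus_lineGerm (i : Fin 4) : ∀ᶠ p in lineGerm i, p ∈ torus :=
  mem_inf_of_right (mem_principal_self _)

/-! ### Functions on cuspidal neighborhoods of a line -/

/-- Cauchy's formula on the annulus `ρ⁻¹ ≤ |t| ≤ ρ` bounds the derivative at `1`. -/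
theorem norm_deriv_le_of_annulus {g : ℂ → ℂ} {ρ : ℝ} (hρ : 2 ≤ ρ)
    (hg : ∀ t : ℂ, ρ⁻¹ / 2 < ‖t‖ → ‖t‖ < 2 * ρ → DifferentiableAt ℂ g t ∧ ‖g t‖ ≤ 1) :
    ‖deriv g 1‖ ≤ 8 / ρ := by
  have hρ0 : 0 < ρ := by linarith
  have hinv : ρ⁻¹ ≤ 1 / 2 := by rw [inv_le_comm₀ hρ0 (by norm_num)]; linarith
  have hinv0 : 0 < ρ⁻¹ := by positivity
  set s : Set ℂ := {t | ρ⁻¹ / 2 < ‖t‖ ∧ ‖t‖ < 2 * ρ} with hs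
  have hso : IsOpen s :=
    (isOpen_lt continuous_const continuous_norm).inter (isOpen_lt continuous_norm continuous_const)
  have h1s : s ∈ 𝓝 (1 : ℂ) := hso.mem_nhds ⟨by rw [norm_one]; linarith, by rw [norm_one]; linarith⟩
  have hgd : DifferentiableOn ℂ g s := fun t ht => (hg t ht.1 ht.2).1.differentiableWithinAt
  set G : ℂ → ℂ := dslope (dslope g 1) 1 with hG
  have hGd : DifferentiableOn ℂ G s := by
    rw [hG, Complex.differentiableOn_dslope h1s, Complex.differentiableOn_dslope h1s]
    exact hgd
  have hGe : ∀ t : ℂ, t ≠ 1 →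
      G t = g t * (t - 1) ^ (-2 : ℤ) - (g 1 * (t - 1) ^ (-2 : ℤ) + deriv g 1 * (t - 1)⁻¹) := by
    intro t ht
    have ht' : t - 1 ≠ 0 := sub_ne_zero.2 ht
    rw [hG, dslope_of_ne _ ht, slope_def_field, dslope_of_ne _ ht, dslope_same, slope_def_field]
    rw [zpow_neg, show (2 : ℤ) = ((2 : ℕ) : ℤ) from rfl, zpow_natCast]
    field_simp
    ring
  have hcircle : (∮ t in C(0, ρ), G t) = ∮ t in C(0, ρ⁻¹), G t := by
    refine Complex.circleIntegral_eq_of_differentiable_on_annulus_off_countable hinv0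
      (by linarith) Set.countable_empty (hGd.continuousOn.mono ?_) fun t ht =>
        (hGd.differentiableAt (hso.mem_nhds ?_))
    · rintro t ⟨h1, h2⟩
      rw [mem_closedBall_zero_iff] at h1
      rw [mem_ball_zero_iff, not_lt] at h2
      exact ⟨by linarith, by linarith⟩
    · obtain ⟨⟨h1, h2⟩, -⟩ := ht
      rw [mem_ball_zero_iff] at h1
      rw [mem_closedBall_zero_iff, not_le] at h2
      exact ⟨by linarith, by linarith⟩
  have hsplit : ∀ R : ℝ, 0 < R → R ≠ 1 → ρ⁻¹ / 2 < R → R < 2 * ρ →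
      (∮ t in C(0, R), G t) = (∮ t in C(0, R), g t * (t - 1) ^ (-2 : ℤ))
        - deriv g 1 * ∮ t in C(0, R), (t - 1)⁻¹ := by
    intro R hR hR1 hR2 hR3
    have hne : ∀ t ∈ Metric.sphere (0 : ℂ) R, t - 1 ≠ 0 := by
      intro t ht h
      rw [mem_sphere_zero_iff_norm, sub_eq_zero.1 h, norm_one] at ht
      exact hR1 ht.symm
    have hc1 : ContinuousOn (fun t : ℂ => (t - 1) ^ (-2 : ℤ)) (Metric.sphere 0 R) := fun t ht =>
      ((by fun_prop : ContinuousAt (fun t : ℂ => t - 1) t).zpow₀ _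
        (Or.inl (hne t ht))).continuousWithinAt
    have hc2 : ContinuousOn (fun t : ℂ => (t - 1)⁻¹) (Metric.sphere 0 R) := fun t ht =>
      ((by fun_prop : ContinuousAt (fun t : ℂ => t - 1) t).inv₀ (hne t ht)).continuousWithinAt
    have hc3 : ContinuousOn g (Metric.sphere 0 R) := hgd.continuousOn.mono fun t ht => by
      rw [mem_sphere_zero_iff_norm] at ht
      exact ⟨by rw [ht]; exact hR2, by rw [ht]; exact hR3⟩
    have e : (∮ t in C(0, R), G t) = ∮ t in C(0, R), (g t * (t - 1) ^ (-2 : ℤ)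
        - (g 1 * (t - 1) ^ (-2 : ℤ) + deriv g 1 * (t - 1)⁻¹)) :=
      circleIntegral.integral_congr hR.le fun t ht => hGe t (sub_ne_zero.1 (hne t ht))
    have i1 : CircleIntegrable (fun t => g t * (t - 1) ^ (-2 : ℤ)) 0 R :=
      (hc3.mul hc1).circleIntegrable hR.le
    have i2 : CircleIntegrable (fun t => g 1 * (t - 1) ^ (-2 : ℤ)) 0 R :=
      (continuousOn_const.mul hc1).circleIntegrable hR.le
    have i3 : CircleIntegrable (fun t => deriv g 1 * (t - 1)⁻¹) 0 R :=
      (continuousOn_const.mul hc2).circleIntegrable hR.le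
    have i4 : CircleIntegrable
        (fun t => g 1 * (t - 1) ^ (-2 : ℤ) + deriv g 1 * (t - 1)⁻¹) 0 R := i2.add i3
    rw [e, circleIntegral.integral_sub i1 i4, circleIntegral.integral_add i2 i3,
      circleIntegral.integral_const_mul,
      circleIntegral.integral_const_mul,
      circleIntegral.integral_sub_zpow_of_ne (by norm_num), mul_zero, zero_add]
  have hout : (∮ t in C(0, ρ), (t - 1)⁻¹) = 2 * Real.pi * Complex.I :=
    circleIntegral.integral_sub_inv_of_mem_ball (by simp; linarith)
  have hin : (∮ t in C(0, ρ⁻¹), ((t : ℂ) - 1)⁻¹) = 0 := by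
    refine DiffContOnCl.circleIntegral_eq_zero hinv0.le
      (DifferentiableOn.diffContOnCl_ball (U := Metric.ball 0 1) (fun t ht => ?_)
        (Metric.closedBall_subset_ball (by linarith)))
    have : t - 1 ≠ 0 := fun h => by
      rw [mem_ball_zero_iff, sub_eq_zero.1 h, norm_one] at ht
      exact lt_irrefl _ ht
    exact ((by fun_prop : DifferentiableAt ℂ (fun t : ℂ => t - 1) t).inv this).differentiableWithinAt
  rw [hsplit ρ hρ0 (by linarith) (by linarith) (by linarith),
    hsplit ρ⁻¹ hinv0 (by linarith) (by linarith) (by linarith), hout, hin, mul_zero,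
    sub_zero, sub_eq_iff_eq_add] at hcircle
  -- the two boundary integrals are small
  have b1 : ‖∮ t in C(0, ρ), g t * (t - 1) ^ (-2 : ℤ)‖ ≤ 2 * Real.pi * ρ * (4 / ρ ^ 2) := by
    refine circleIntegral.norm_integral_le_of_norm_le_const hρ0.le fun t ht => ?_
    rw [mem_sphere_zero_iff_norm] at ht
    have h1 := (hg t (by linarith) (by linarith)).2
    have h2 : ρ / 2 ≤ ‖t - 1‖ := by
      have := norm_sub_norm_le t 1
      rw [ht, norm_one] at this; linarith
    rw [norm_mul, norm_zpow, zpow_neg, show (2 : ℤ) = ((2 : ℕ) : ℤ) from rfl, zpow_natCast]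
    calc ‖g t‖ * (‖t - 1‖ ^ 2)⁻¹ ≤ 1 * ((ρ / 2) ^ 2)⁻¹ := by gcongr
      _ = _ := by field_simp; norm_num
  have b2 : ‖∮ t in C(0, ρ⁻¹), g t * (t - 1) ^ (-2 : ℤ)‖ ≤ 2 * Real.pi * ρ⁻¹ * 4 := by
    refine circleIntegral.norm_integral_le_of_norm_le_const hinv0.le fun t ht => ?_
    rw [mem_sphere_zero_iff_norm] at ht
    have h1 := (hg t (by linarith) (by linarith)).2
    have h2 : 1 / 2 ≤ ‖t - 1‖ := by
      have := norm_sub_norm_le 1 t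
      rw [ht, norm_one, norm_sub_rev] at this; linarith
    rw [norm_mul, norm_zpow, zpow_neg, show (2 : ℤ) = ((2 : ℕ) : ℤ) from rfl, zpow_natCast]
    calc ‖g t‖ * (‖t - 1‖ ^ 2)⁻¹ ≤ 1 * ((1 / 2 : ℝ) ^ 2)⁻¹ := by gcongr
      _ = _ := by norm_num
  have hfin : ‖deriv g 1‖ * (2 * Real.pi) ≤ 2 * Real.pi * (8 / ρ) := by
    have e : deriv g 1 * (2 * Real.pi * Complex.I) = (∮ t in C(0, ρ), g t * (t - 1) ^ (-2 : ℤ))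
        - ∮ t in C(0, ρ⁻¹), g t * (t - 1) ^ (-2 : ℤ) := by
      rw [hcircle]; ring
    have en : ‖deriv g 1 * (2 * Real.pi * Complex.I)‖ = ‖deriv g 1‖ * (2 * Real.pi) := by
      simp [abs_of_pos Real.pi_pos]
    rw [← en, e]
    refine (norm_sub_le _ _).trans ((add_le_add b1 b2).trans (le_of_eq ?_))
    field_simp
    ring
  have hpi := Real.pi_pos
  rw [mul_comm] at hfin
  exact le_of_mul_le_mul_left hfin (by positivity)

/-- Germs of neighborhoods of the punctured line `ℂ* × {0}` with cuspidal ends: for every `K`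
they contain `|ℓ| ^ K < |x| < |ℓ| ^ (-K)` for `ℓ` small. -/
def cuspGerm : Filter (ℂ × ℂ) where
  sets := {s | ∀ K : ℕ, ∃ r > 0, ∀ p : ℂ × ℂ, p.2 ≠ 0 → ‖p.2‖ < r → ‖p.2‖ ^ K < ‖p.1‖ →
    ‖p.1‖ * ‖p.2‖ ^ K < 1 → p ∈ s}
  univ_sets := fun _ => ⟨1, one_pos, fun _ _ _ _ _ => trivial⟩
  sets_of_superset := by
    intro s t hs hst K
    obtain ⟨r, hr, h⟩ := hs K
    exact ⟨r, hr, fun p h1 h2 h3 h4 => hst (h p h1 h2 h3 h4)⟩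
  inter_sets := by
    intro s t hs ht K
    obtain ⟨r, hr, h⟩ := hs K
    obtain ⟨r', hr', h'⟩ := ht K
    exact ⟨min r r', lt_min hr hr', fun p h1 h2 h3 h4 =>
      ⟨h p h1 (h2.trans_le (min_le_left _ _)) h3 h4,
        h' p h1 (h2.trans_le (min_le_right _ _)) h3 h4⟩⟩

theorem eventually_cuspGerm {P : ℂ × ℂ → Prop} : (∀ᶠ p in cuspGerm, P p) ↔
    ∀ K : ℕ, ∃ r > 0, ∀ p : ℂ × ℂ, p.2 ≠ 0 → ‖p.2‖ < r → ‖p.2‖ ^ K < ‖p.1‖ →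
      ‖p.1‖ * ‖p.2‖ ^ K < 1 → P p := Iff.rfl

/-- On a cuspidal neighborhood, the function `f (x, ℓ)` varies with `x` by less than any power
of `ℓ`: its derivative in `x` is estimated on annuli of modulus `|ℓ| ^ N` for all `N`. -/
theorem isBigO_sub_of_cuspGerm {f : ℂ × ℂ → ℂ} (hd : ∀ᶠ p in cuspGerm, DifferentiableAt ℂ f p)
    (hf : ∀ᶠ p in cuspGerm, ‖f p‖ ≤ 1) (u : ℂ) (N : ℕ) :
    (fun l : ℂ => f (Complex.exp u, l) - f (1, l)) =O[𝓝[≠] 0] (fun l : ℂ => l ^ (N + 1)) := by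
  obtain ⟨r, hr, h⟩ := eventually_cuspGerm.1 (hd.and hf) (2 * (N + 1) + 1)
  set A := |u.re| with hA
  have hA0 : 0 ≤ A := abs_nonneg _
  refine IsBigO.of_bound (8 * ‖u‖) ?_
  have ht : Tendsto (fun l : ℂ => ‖l‖ ^ (N + 1)) (𝓝[≠] 0) (𝓝 0) := by
    have : ContinuousAt (fun l : ℂ => ‖l‖ ^ (N + 1)) 0 := by fun_prop
    have := this.tendsto
    simp only [norm_zero, zero_pow (Nat.succ_ne_zero N)] at this
    exact this.mono_left nhdsWithin_le_nhds
  have ht1 : Tendsto (fun l : ℂ => ‖l‖) (𝓝[≠] 0) (𝓝 0) := by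
    simpa using (continuous_norm.tendsto (0 : ℂ)).mono_left nhdsWithin_le_nhds
  filter_upwards [self_mem_nhdsWithin, ht1.eventually (gt_mem_nhds hr),
    ht.eventually (gt_mem_nhds (show (0 : ℝ) < 1 / 2 by norm_num)),
    ht1.eventually (gt_mem_nhds (show (0 : ℝ) < Real.exp (-A) / 2 by positivity))]
    with l hl0 hlr hlN hlA
  have hl : 0 < ‖l‖ := norm_pos_iff.2 hl0
  set η := ‖l‖ ^ (N + 1) with hη
  have hη0 : 0 < η := by positivity
  have hbound : ∀ x t : ℂ, Real.exp (-A) ≤ ‖x‖ → ‖x‖ ≤ Real.exp A → η⁻¹⁻¹ / 2 < ‖t‖ →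
      ‖t‖ < 2 * η⁻¹ → DifferentiableAt ℂ f (x * t, l) ∧ ‖f (x * t, l)‖ ≤ 1 := by
    intro x t hx1 hx2 ht1 ht2
    rw [inv_inv] at ht1
    have e : ‖l‖ ^ (2 * (N + 1) + 1) = η * η * ‖l‖ := by rw [hη]; ring
    refine h (x * t, l) hl0 hlr ?_ ?_
    · simp only [norm_mul]
      rw [e]
      have h1 : η * η * ‖l‖ < η * 1 * (Real.exp (-A) / 2) := by
        gcongr
        linarith
      have h2 : Real.exp (-A) * (η / 2) ≤ ‖x‖ * ‖t‖ := by gcongr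
      linarith
    · simp only [norm_mul]
      rw [e]
      have h1 : ‖x‖ * ‖t‖ ≤ Real.exp A * (2 * η⁻¹) := by gcongr
      calc ‖x‖ * ‖t‖ * (η * η * ‖l‖) ≤ Real.exp A * (2 * η⁻¹) * (η * η * ‖l‖) := by gcongr
        _ = 2 * Real.exp A * η * ‖l‖ := by field_simp
        _ < 2 * Real.exp A * η * (Real.exp (-A) / 2) := by gcongr
        _ = η := by rw [Real.exp_neg]; field_simp
        _ < 1 := by linarith
  -- Lipschitz estimate in the coordinate `w` with `x = exp w`
  set s : Set ℂ := {w | -A ≤ w.re ∧ w.re ≤ A} with hs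
  have hconv : Convex ℝ s :=
    (convex_halfSpace_re_ge (-A)).inter (convex_halfSpace_re_le A)
  have hder : ∀ w ∈ s, DifferentiableAt ℂ (fun w => f (Complex.exp w, l)) w ∧
      ‖deriv (fun w => f (Complex.exp w, l)) w‖ ≤ 8 * η := by
    intro w hw
    have hx1 : Real.exp (-A) ≤ ‖Complex.exp w‖ := by
      rw [Complex.norm_exp]; exact Real.exp_le_exp.2 hw.1
    have hx2 : ‖Complex.exp w‖ ≤ Real.exp A := by
      rw [Complex.norm_exp]; exact Real.exp_le_exp.2 hw.2
    have hρ : 2 ≤ η⁻¹ := by rw [le_inv_comm₀ (by norm_num) hη0]; linarith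
    have h1 := norm_deriv_le_of_annulus (g := fun t => f (Complex.exp w * t, l)) hρ
      (fun t ht1 ht2 => by
        obtain ⟨g1, g2⟩ := hbound _ t hx1 hx2 ht1 ht2
        exact ⟨g1.comp t (by fun_prop :
          DifferentiableAt ℂ (fun t : ℂ => (Complex.exp w * t, l)) t), g2⟩)
    have hf1 : DifferentiableAt ℂ f (Complex.exp w, l) := by
      have := (hbound (Complex.exp w) 1 hx1 hx2 (by rw [norm_one, inv_inv]; linarith)
        (by rw [norm_one]; linarith)).1
      rwa [mul_one] at this
    have hfx : DifferentiableAt ℂ (fun x => f (x, l)) (Complex.exp w) :=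
      hf1.comp (Complex.exp w) (by fun_prop : DifferentiableAt ℂ (fun x : ℂ => (x, l)) _)
    have e1 : HasDerivAt (fun w => f (Complex.exp w, l))
        (deriv (fun x => f (x, l)) (Complex.exp w) * Complex.exp w) w :=
      hfx.hasDerivAt.comp w (Complex.hasDerivAt_exp w)
    have e2 : HasDerivAt (fun t => f (Complex.exp w * t, l))
        (deriv (fun x => f (x, l)) (Complex.exp w) * Complex.exp w) 1 := by
      have hfx' : HasDerivAt (fun x => f (x, l)) (deriv (fun x => f (x, l)) (Complex.exp w))
          (Complex.exp w * 1) := by rw [mul_one]; exact hfx.hasDerivAt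
      have hm : HasDerivAt (fun t : ℂ => Complex.exp w * t) (Complex.exp w) 1 := by
        simpa using (hasDerivAt_id (1 : ℂ)).const_mul (Complex.exp w)
      exact hfx'.comp (1 : ℂ) hm
    refine ⟨e1.differentiableAt, ?_⟩
    rw [e1.deriv, ← e2.deriv]
    rwa [div_inv_eq_mul] at h1
  have h0s : (0 : ℂ) ∈ s := ⟨by simp [hA0], by simp [hA0]⟩
  have hus : u ∈ s := ⟨neg_abs_le _, le_abs_self _⟩
  have := hconv.norm_image_sub_le_of_norm_deriv_le (fun w hw => (hder w hw).1)
    (fun w hw => (hder w hw).2) h0s hus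
  simp only [Complex.exp_zero, sub_zero] at this
  rw [norm_pow, ← hη]
  linarith

/-- A function on a cuspidal neighborhood of the punctured line which tends to zero depends only on
the transverse coordinate, and it is holomorphic in it. -/
theorem exists_analytic_of_cuspGerm {f : ℂ × ℂ → ℂ}
    (hd : ∀ᶠ p in cuspGerm, DifferentiableAt ℂ f p) (hf : Tendsto f cuspGerm (𝓝 0)) :
    ∃ k : ℂ → ℂ, AnalyticAt ℂ k 0 ∧ k 0 = 0 ∧ ∀ᶠ p in cuspGerm, f p = k p.2 := by
  have hf1 : ∀ᶠ p in cuspGerm, ‖f p‖ ≤ 1 := by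
    filter_upwards [hf.norm.eventually (gt_mem_nhds (show ‖(0 : ℂ)‖ < 1 by simp))] with p hp
      using hp.le
  have hcusp : ∀ x : ℂ, x ≠ 0 → Tendsto (fun l : ℂ => (x, l)) (𝓝[≠] 0) cuspGerm := by
    intro x hx s hs
    obtain ⟨r, hr, h⟩ := hs 1
    rw [mem_map]
    have hxn : 0 < ‖x‖ := norm_pos_iff.2 hx
    have ht1 : Tendsto (fun l : ℂ => ‖l‖) (𝓝[≠] 0) (𝓝 0) := by
      simpa using (continuous_norm.tendsto (0 : ℂ)).mono_left nhdsWithin_le_nhds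
    filter_upwards [self_mem_nhdsWithin, ht1.eventually (gt_mem_nhds hr),
      ht1.eventually (gt_mem_nhds hxn), ht1.eventually (gt_mem_nhds (inv_pos.2 hxn))]
      with l h1 h2 h3 h4
    refine h (x, l) h1 h2 (by simpa using h3) ?_
    simp only [pow_one]
    calc ‖x‖ * ‖l‖ < ‖x‖ * ‖x‖⁻¹ := by gcongr
      _ = 1 := mul_inv_cancel₀ hxn.ne'
  -- extension by zero of the restriction to `x` fixed, and of differences of such
  have hext : ∀ (g : ℂ → ℂ) (s : ℝ), 0 < s → (∀ l : ℂ, l ≠ 0 → ‖l‖ < s → DifferentiableAt ℂ g l) →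
      Tendsto g (𝓝[≠] 0) (𝓝 0) →
      DifferentiableOn ℂ (Function.update g 0 0) (Metric.ball 0 s) := by
    intro g s hs hg h0
    refine (Complex.differentiableOn_compl_singleton_and_continuousAt_iff
      (Metric.ball_mem_nhds 0 hs)).1 ⟨fun l hl => ?_, ?_⟩
    · have hl0 : l ≠ 0 := hl.2
      have : Function.update g 0 0 =ᶠ[𝓝 l] g := by
        filter_upwards [isOpen_ne.mem_nhds hl0] with w hw using Function.update_of_ne hw _ _
      exact ((hg l hl0 (by simpa using hl.1)).congr_of_eventuallyEq this).differentiableWithinAt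
    · rw [continuousAt_update_same]; exact h0
  refine ⟨Function.update (fun l => f (1, l)) 0 0, ?_, Function.update_self _ _ _, ?_⟩
  · obtain ⟨r, hr, h⟩ := eventually_cuspGerm.1 hd 1
    have := hext (fun l => f (1, l)) (min r 1) (lt_min hr one_pos) (fun l hl0 hl => ?_)
      (hf.comp (hcusp 1 one_ne_zero))
    · exact this.analyticAt (Metric.ball_mem_nhds 0 (lt_min hr one_pos))
    · have h1 : ‖l‖ < 1 := hl.trans_le (min_le_right _ _)
      exact (h (1, l) hl0 (hl.trans_le (min_le_left _ _)) (by simpa using h1)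
        (by simpa using h1)).comp l (by fun_prop : DifferentiableAt ℂ (fun l : ℂ => ((1 : ℂ), l)) l)
  · refine eventually_cuspGerm.2 fun K => ?_
    obtain ⟨r, hr, h⟩ := eventually_cuspGerm.1 hd (K + 1)
    refine ⟨min r 1, lt_min hr one_pos, fun p hp0 hpr hp1 hp2 => ?_⟩
    rw [Function.update_of_ne hp0]
    set x := p.1 with hx
    set l₀ := p.2 with hl₀
    have hl1 : ‖l₀‖ < 1 := hpr.trans_le (min_le_right _ _)
    have hl0 : 0 < ‖l₀‖ := norm_pos_iff.2 hp0
    have hx0 : x ≠ 0 := by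
      rw [← norm_pos_iff]
      exact (by positivity : (0 : ℝ) ≤ ‖l₀‖ ^ K).trans_lt hp1
    have hxn : 0 < ‖x‖ := norm_pos_iff.2 hx0
    have hle : ‖l₀‖ ^ (K + 1) ≤ ‖l₀‖ ^ K := pow_le_pow_of_le_one hl0.le hl1.le (Nat.le_succ K)
    -- a slightly larger disc on which the segment `{x} × disc` stays in the domain
    obtain ⟨s, hs, hs0⟩ : ∃ s, (s < min r 1 ∧ s ^ (K + 1) < ‖x‖ ∧ ‖x‖ * s ^ (K + 1) < 1) ∧
        ‖l₀‖ < s := by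
      have c1 : ContinuousAt (fun s : ℝ => s ^ (K + 1)) ‖l₀‖ := by fun_prop
      have c2 : ContinuousAt (fun s : ℝ => ‖x‖ * s ^ (K + 1)) ‖l₀‖ := by fun_prop
      have hev : ∀ᶠ s in 𝓝 ‖l₀‖, s < min r 1 ∧ s ^ (K + 1) < ‖x‖ ∧ ‖x‖ * s ^ (K + 1) < 1 :=
        (gt_mem_nhds hpr).and ((c1.eventually (gt_mem_nhds (hle.trans_lt hp1))).and
          (c2.eventually (gt_mem_nhds
            ((mul_le_mul_of_nonneg_left hle hxn.le).trans_lt hp2))))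
      have h2 := (hev.filter_mono nhdsWithin_le_nhds).and
        (self_mem_nhdsWithin : Set.Ioi ‖l₀‖ ∈ 𝓝[>] ‖l₀‖)
      exact h2.exists
    obtain ⟨⟨hs1, hs2, hs3⟩, hs4⟩ : _ ∧ _ := ⟨hs, hs0⟩
    have hspos : 0 < s := hl0.trans hs4
    set g : ℂ → ℂ := fun l => f (x, l) - f (1, l) with hg
    have hgd : ∀ l : ℂ, l ≠ 0 → ‖l‖ < s → DifferentiableAt ℂ g l := by
      intro l hl hls
      have hl1 : ‖l‖ < 1 := (hls.trans hs1).trans_le (min_le_right _ _)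
      have hlr : ‖l‖ < r := (hls.trans hs1).trans_le (min_le_left _ _)
      have hpow : ‖l‖ ^ (K + 1) ≤ s ^ (K + 1) := by gcongr
      have hpow1 : ‖l‖ ^ (K + 1) < 1 := pow_lt_one₀ (norm_nonneg _) hl1 (Nat.succ_ne_zero K)
      have d1 := h (x, l) hl hlr (hpow.trans_lt hs2)
        ((by gcongr : ‖x‖ * ‖l‖ ^ (K + 1) ≤ ‖x‖ * s ^ (K + 1)).trans_lt hs3)
      have d2 := h (1, l) hl hlr (by simpa using hpow1) (by simpa using hpow1)
      exact (d1.comp l (by fun_prop : DifferentiableAt ℂ (fun l : ℂ => (x, l)) l)).sub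
        (d2.comp l (by fun_prop : DifferentiableAt ℂ (fun l : ℂ => ((1 : ℂ), l)) l))
    have hg0 : Tendsto g (𝓝[≠] 0) (𝓝 0) := by
      simpa using (hf.comp (hcusp x hx0)).sub (hf.comp (hcusp 1 one_ne_zero))
    have hG := hext g s hspos hgd hg0
    have hGan : AnalyticOnNhd ℂ (Function.update g 0 0) (Metric.ball 0 s) :=
      hG.analyticOnNhd Metric.isOpen_ball
    have hG0 : ∀ᶠ l in 𝓝 (0 : ℂ), Function.update g 0 0 l = 0 := by
      refine eventually_eq_zero_of_forall_isBigO (hGan 0 (Metric.mem_ball_self hspos)) fun N => ?_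
      have h1 := isBigO_sub_of_cuspGerm hd hf1 (Complex.log x) N
      rw [Complex.exp_log hx0] at h1
      obtain ⟨C, hC⟩ := h1.bound
      rw [eventually_nhdsWithin_iff] at hC
      refine IsBigO.of_bound |C| ?_
      filter_upwards [hC, Metric.ball_mem_nhds (0 : ℂ) one_pos] with l hl hlb
      have hlb : ‖l‖ < 1 := by simpa using hlb
      by_cases h0 : l = 0
      · subst h0; simp; positivity
      · rw [Function.update_of_ne h0]
        refine (hl h0).trans ?_
        rw [norm_pow, norm_pow]
        have : ‖l‖ ^ (N + 1) ≤ ‖l‖ ^ N := pow_le_pow_of_le_one (norm_nonneg _) hlb.le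
          (Nat.le_succ N)
        calc C * ‖l‖ ^ (N + 1) ≤ |C| * ‖l‖ ^ (N + 1) := by gcongr; exact le_abs_self C
          _ ≤ _ := by gcongr
    have := hGan.eqOn_zero_of_preconnected_of_eventuallyEq_zero (convex_ball 0 s).isPreconnected
      (Metric.mem_ball_self hspos) hG0 (show l₀ ∈ Metric.ball 0 s by simpa using hs4)
    rw [Function.update_of_ne hp0] at this
    exact sub_eq_zero.1 this

/-! ### Descent of invariant functions to the lines -/

/-- The iterate of order `k` of the model map. -/
noncomputable def modelIter (τ : ℂ) (k : ℕ) (p : ℂ × ℂ) : ℂ × ℂ :=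
  (Complex.exp (2 * Real.pi * Complex.I * τ) ^ k * p.1, p.2 / (1 - k * p.2))

theorem nearRot_modelIter (τ : ℂ) (S : Set (Fin 4)) (k : ℕ) :
    NearRot τ S (Complex.exp (2 * Real.pi * Complex.I * τ) ^ k) (modelIter τ k) := by
  refine ⟨by simpa [modelIter] using tendsto_const_nhds, ?_⟩
  have h : Tendsto (fun p : ℂ × ℂ => (1 - k * p.2)⁻¹) (coneGerm τ S) (𝓝 1) := by
    have := ((tendsto_snd_coneGerm τ S).const_mul (k : ℂ)).const_sub 1
    simpa using this.inv₀ (by simp)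
  refine h.congr' ?_
  filter_upwards [eventually_snd_ne_zero τ S] with p hp
  simp only [modelIter]
  rw [div_right_comm, div_self hp, one_div]

theorem modelMap_eq_modelIter (τ : ℂ) : modelMap τ = modelIter τ 1 := by
  funext p; simp [modelMap, modelIter]

theorem tendsto_modelIter (τ : ℂ) (S : Set (Fin 4)) (k : ℕ) :
    Tendsto (modelIter τ k) (coneGerm τ S) (coneGerm τ S) :=
  (nearRot_modelIter τ S k).tendsto (pow_ne_zero _ (Complex.exp_ne_zero _)) subset_rfl

theorem eventually_invariant_modelIter {f : ℂ × ℂ → ℂ}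
    (hf : ∀ᶠ p in coneGerm τ S, f (modelMap τ p) = f p) (k : ℕ) :
    ∀ᶠ p in coneGerm τ S, f (modelIter τ k p) = f p := by
  induction k with
  | zero => exact Eventually.of_forall fun p => by simp [modelIter]
  | succ k ih =>
    have h1 : ∀ᶠ p in coneGerm τ S, 1 - (k : ℂ) * p.2 ≠ 0 := by
      have := ((tendsto_snd_coneGerm τ S).const_mul (k : ℂ)).const_sub 1
      exact this.eventually_ne (by simp)
    filter_upwards [ih, (tendsto_modelIter τ S k).eventually hf, h1] with p h2 h3 h4
    rw [← h2, ← h3]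
    congr 1
    simp only [modelMap, modelIter]
    ext
    · simp only; ring
    · simp only
      push_cast
      have e : 1 - p.2 / (1 - k * p.2) = (1 - (k + 1) * p.2) / (1 - k * p.2) := by
        rw [eq_div_iff h4, sub_mul, div_mul_cancel₀ _ h4]; ring
      rw [e, div_div_div_cancel_right₀ h4]

theorem norm_exp_two_pi_I_mul (τ : ℂ) :
    ‖Complex.exp (2 * Real.pi * Complex.I * τ)‖ = Real.exp (-(2 * Real.pi * τ.im)) := by
  rw [Complex.norm_exp]
  congr 1
  have : 2 * Real.pi * Complex.I * τ = ((2 * Real.pi : ℝ) : ℂ) * (Complex.I * τ) := by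
    push_cast; ring
  rw [this, Complex.re_ofReal_mul, Complex.I_mul_re]; ring

theorem two_pi_im_pos (hτ : 0 < τ.im) : 0 < 2 * Real.pi * τ.im := by
  have := Real.pi_pos; positivity

/-- Points with the same image in the torus are exchanged by an iterate of the model map, so that
an invariant function takes the same value at both. -/
theorem eq_of_serreMap_eq (hτ : 0 < τ.im) {f : ℂ × ℂ → ℂ}
    (hf : ∀ᶠ p in coneGerm τ S, f (modelMap τ p) = f p) {c δ : ℝ} (hc : 0 < c) (hδ : 0 < δ) :
    ∃ r > 0, ∀ p ∈ cone τ S c δ r, ∀ p' ∈ cone τ S c δ r,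
      serreMap τ p = serreMap τ p' → f p = f p' := by
  have ha := two_pi_im_pos hτ
  set a := 2 * Real.pi * τ.im with ha'
  set K := ⌈2 * c / a⌉₊ with hK
  have hall : ∀ᶠ p in coneGerm τ S, ∀ k ∈ Finset.range (K + 1), f (modelIter τ k p) = f p :=
    (Finset.eventually_all _).2 fun k _ => eventually_invariant_modelIter hf k
  obtain ⟨r, hr, h⟩ := eventually_coneGerm.1 hall c hc δ hδ
  -- one of the two points is the image of the other by an iterate
  have key : ∀ p ∈ cone τ S c δ r, ∀ p' ∈ cone τ S c δ r, ∀ k : ℕ,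
      p'.1 = Complex.exp (2 * Real.pi * Complex.I * τ) ^ k * p.1 → 1 / p'.2 = 1 / p.2 - k →
      f p' = f p := by
    intro p hp p' hp' k h1 h2
    have hk : k ∈ Finset.range (K + 1) := by
      rw [Finset.mem_range, Nat.lt_succ_iff, hK]
      refine Nat.cast_le.1 (le_trans ?_ (Nat.le_ceil (2 * c / a)))
      rw [le_div_iff₀ ha]
      have e1 : ‖p'.1‖ = Real.exp (-(k * a)) * ‖p.1‖ := by
        rw [h1, norm_mul, norm_pow, norm_exp_two_pi_I_mul, ← Real.exp_nat_mul, ← ha']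
        ring_nf
      have e2 : Real.exp (-c) < Real.exp (-(k * a)) * Real.exp c := by
        refine hp'.1.trans_le ?_
        rw [e1]
        gcongr
        exact hp.2.1.le
      rw [← Real.exp_add, Real.exp_lt_exp] at e2
      linarith
    have e : p' = modelIter τ k p := by
      have hp0 := hp.2.2.1
      have hp0' := hp'.2.2.1
      have h3 : 1 - k * p.2 ≠ 0 := by
        intro h0
        have : 1 / p'.2 = 0 := by
          rw [h2]
          field_simp
          linear_combination h0
        exact one_div_ne_zero hp0' this
      ext
      · exact h1
      · simp only [modelIter]
        rw [← one_div_one_div p'.2, h2]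
        field_simp
    rw [e]
    exact h p hp k hk
  refine ⟨r, hr, fun p hp p' hp' heq => ?_⟩
  have hz : p.1 ≠ 0 := norm_pos_iff.1 ((Real.exp_pos _).trans hp.1)
  have h1 := congrArg Prod.fst heq
  have h2 := congrArg Prod.snd heq
  simp only [serreMap] at h1 h2
  obtain ⟨n, hn⟩ := Complex.exp_eq_exp_iff_exists_int.1 h1
  have hn' : 1 / p.2 = 1 / p'.2 + n := by
    have h0 := Complex.two_pi_I_ne_zero
    have : (2 * Real.pi * Complex.I) * (1 / p.2) = (2 * Real.pi * Complex.I) * (1 / p'.2 + n) := by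
      linear_combination hn
    exact mul_left_cancel₀ h0 this
  have hzz : p'.1 = Complex.exp (n * (2 * Real.pi * Complex.I * τ)) * p.1 := by
    have e : Complex.exp (2 * Real.pi * Complex.I * τ / p.2)
        = Complex.exp (n * (2 * Real.pi * Complex.I * τ)) *
          Complex.exp (2 * Real.pi * Complex.I * τ / p'.2) := by
      rw [← Complex.exp_add]
      congr 1
      rw [div_eq_mul_one_div, hn']
      ring
    rw [e, ← mul_assoc] at h2
    have := mul_right_cancel₀ (Complex.exp_ne_zero _) h2
    rw [← this]; ring
  obtain ⟨k, rfl | rfl⟩ := n.eq_nat_or_neg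
  · refine (key p hp p' hp' k ?_ ?_).symm
    · rw [hzz, ← Complex.exp_nat_mul]; push_cast; rfl
    · rw [hn']; push_cast; ring
  · refine key p' hp' p hp k ?_ ?_
    · rw [hzz, ← Complex.exp_nat_mul, ← mul_assoc, ← Complex.exp_add]
      push_cast
      simp
    · rw [hn']; push_cast; ring

/-- The point of the torus with given coordinates `x` along `L_i` and `ℓ` transverse to it. -/
noncomputable def lineParam : Fin 4 → ℂ × ℂ → ℂ × ℂ
  | 0, q => (q.2, q.1)
  | 1, q => (q.1⁻¹, q.2)
  | 2, q => (q.2⁻¹, q.1⁻¹)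
  | 3, q => (q.1, q.2⁻¹)

theorem lineCoord_lineParam (i : Fin 4) (q : ℂ × ℂ) : lineCoord i (lineParam i q) = q.2 := by
  fin_cases i <;> simp [lineCoord, lineParam]

theorem lineCoord_succ_lineParam (i : Fin 4) (q : ℂ × ℂ) :
    lineCoord (i + 1) (lineParam i q) = q.1 := by
  fin_cases i <;> simp [lineCoord, lineParam, Fin.add_def]

theorem lineParam_lineCoord (i : Fin 4) (p : ℂ × ℂ) :
    lineParam i (lineCoord (i + 1) p, lineCoord i p) = p := by
  fin_cases i <;> simp [lineCoord, lineParam, Fin.add_def]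

theorem lineParam_ne_zero (i : Fin 4) {q : ℂ × ℂ} (h1 : q.1 ≠ 0) (h2 : q.2 ≠ 0) :
    lineParam i q ∈ torus := by
  fin_cases i <;> simp [lineParam, torus, h1, h2]

theorem differentiableAt_lineParam (i : Fin 4) {q : ℂ × ℂ} (h1 : q.1 ≠ 0) (h2 : q.2 ≠ 0) :
    DifferentiableAt ℂ (lineParam i) q := by
  have e1 : DifferentiableAt ℂ (fun q : ℂ × ℂ => q.1⁻¹) q := differentiableAt_fst.inv h1
  have e2 : DifferentiableAt ℂ (fun q : ℂ × ℂ => q.2⁻¹) q := differentiableAt_snd.inv h2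
  fin_cases i
  · exact differentiableAt_snd.prodMk differentiableAt_fst
  · exact e1.prodMk differentiableAt_snd
  · exact e2.prodMk e1
  · exact differentiableAt_fst.prodMk e2

/-- The lift of `p` to the neighborhood with `ξ = 1 / y` equal to `w`, when `exp (2 i π w)` is the
first coordinate of `p`. -/
noncomputable def liftAt (τ w : ℂ) (p : ℂ × ℂ) : ℂ × ℂ :=
  (p.2 * Complex.exp (-(2 * Real.pi * Complex.I * τ * w)), w⁻¹)

theorem serreMap_liftAt (τ : ℂ) {w : ℂ} {p : ℂ × ℂ}
    (h : Complex.exp (2 * Real.pi * Complex.I * w) = p.1) : serreMap τ (liftAt τ w p) = p := by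
  ext
  · simp only [serreMap, liftAt, div_inv_eq_mul, h]
  · simp only [serreMap, liftAt, div_inv_eq_mul]
    rw [mul_assoc, ← Complex.exp_add]
    simp

/-- The logarithm of `X` is determined up to an integer `n`, and a change of `n` multiplies `z` by a
power of `q`; so `z` can be chosen in a fixed annulus. -/
theorem exists_lift (hτ : 0 < τ.im) {p : ℂ × ℂ} (hp : p ∈ torus) :
    ∃ w : ℂ, Complex.exp (2 * Real.pi * Complex.I * w) = p.1 ∧
      |Real.log ‖(liftAt τ w p).1‖| ≤ 2 * Real.pi * τ.im := by
  have ha := two_pi_im_pos hτ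
  set a := 2 * Real.pi * τ.im with ha'
  set w₀ := Complex.log p.1 / (2 * Real.pi * Complex.I) with hw₀
  have h0 := Complex.two_pi_I_ne_zero
  set A := Real.log ‖(liftAt τ w₀ p).1‖ with hA
  set n := round (A / a) with hn
  refine ⟨w₀ - n, ?_, ?_⟩
  · rw [mul_sub, Complex.exp_sub, hw₀, mul_div_cancel₀ _ h0, Complex.exp_log hp.1]
    rw [mul_comm _ (n : ℂ), Complex.exp_int_mul_two_pi_mul_I, div_one]
  · have e1 : (liftAt τ (w₀ - n) p).1
        = (liftAt τ w₀ p).1 * Complex.exp (2 * Real.pi * Complex.I * τ) ^ n := by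
      simp only [liftAt]
      rw [mul_assoc p.2, ← Complex.exp_int_mul, ← Complex.exp_add]
      congr 2
      ring
    have e2 : (liftAt τ w₀ p).1 ≠ 0 := mul_ne_zero hp.2 (Complex.exp_ne_zero _)
    rw [e1, norm_mul, norm_zpow, norm_exp_two_pi_I_mul, Real.log_mul (norm_ne_zero_iff.2 e2)
      (zpow_ne_zero _ (Real.exp_pos _).ne'), Real.log_zpow, Real.log_exp, ← hA, ← ha']
    have h1 := abs_sub_round (A / a)
    rw [← hn] at h1
    have e3 : A + n * -a = (A / a - n) * a := by field_simp; ring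
    rw [e3, abs_mul, abs_of_pos ha]
    nlinarith

/-- A lift of the points of the torus such that `|log |z||` is bounded. -/
noncomputable def liftMap (τ : ℂ) (p : ℂ × ℂ) : ℂ × ℂ :=
  open Classical in
  if h : ∃ w : ℂ, Complex.exp (2 * Real.pi * Complex.I * w) = p.1 ∧
      |Real.log ‖(liftAt τ w p).1‖| ≤ 2 * Real.pi * τ.im then liftAt τ h.choose p else 0

theorem liftMap_spec (hτ : 0 < τ.im) {p : ℂ × ℂ} (hp : p ∈ torus) :
    ∃ w : ℂ, Complex.exp (2 * Real.pi * Complex.I * w) = p.1 ∧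
      |Real.log ‖(liftAt τ w p).1‖| ≤ 2 * Real.pi * τ.im ∧ liftMap τ p = liftAt τ w p := by
  have h := exists_lift hτ hp
  exact ⟨h.choose, h.choose_spec.1, h.choose_spec.2, by rw [liftMap, dif_pos h]⟩

theorem im_dir_mul_conj_dir (hτ : 0 < τ.im) (i : Fin 4) :
    |(dir τ i * (starRingEnd ℂ) (dir τ (i + 1))).im| = (dir τ 1).im := by
  have h := dir_one_im_pos hτ
  fin_cases i <;> simp [dir_zero, dir_two, dir_three, Fin.add_def, abs_of_pos h]

/-- Two consecutive directions are independent over `ℝ`. -/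
theorem norm_mul_im_dir_le (hτ : 0 < τ.im) (i : Fin 4) (w : ℂ) :
    ‖w‖ * (dir τ 1).im ≤ |(dir τ i * w).im| + |(dir τ (i + 1) * w).im| := by
  set a := dir τ i with ha
  set b := dir τ (i + 1) with hb
  -- `w` in terms of its real coordinates `Im (a w)` and `Im (b w)`
  have e : ((a * (starRingEnd ℂ) b).im : ℂ) * w
      = (a * w).im * (starRingEnd ℂ) b - (b * w).im * (starRingEnd ℂ) a := by
    apply Complex.ext <;> simp <;> ring
  have h1 := congrArg norm e
  rw [norm_mul, Complex.norm_real, Real.norm_eq_abs, im_dir_mul_conj_dir hτ] at h1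
  rw [mul_comm, h1]
  refine (norm_sub_le _ _).trans (le_of_eq ?_)
  rw [norm_mul, norm_mul, RCLike.norm_conj, RCLike.norm_conj, ha, hb, norm_dir, norm_dir,
    Complex.norm_real, Complex.norm_real, mul_one, mul_one, Real.norm_eq_abs, Real.norm_eq_abs]

theorem log_norm_lineCoord_serreMap (i : Fin 4) {p : ℂ × ℂ} (hp : p.1 ≠ 0) :
    Real.log ‖lineCoord i (serreMap τ p)‖ =
      zExp i * Real.log ‖p.1‖ - 2 * Real.pi * rate τ i * (dir τ i / p.2).im := by
  have h : 0 < ‖p.1‖ := norm_pos_iff.2 hp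
  rw [norm_lineCoord_serreMap, Real.log_mul (zpow_pos h _).ne' (Real.exp_pos _).ne', Real.log_zpow,
    Real.log_exp]
  ring

theorem abs_zExp_mul_le (i : Fin 4) (x : ℝ) : |(zExp i : ℝ) * x| ≤ |x| := by
  fin_cases i <;> simp [zExp]

/-- A cuspidal domain: `ℓ = p.2` is small, and `p.1` lies between `|ℓ| ^ K` and `|ℓ| ^ (-K)`. -/
def cuspSet (K : ℕ) (r : ℝ) : Set (ℂ × ℂ) :=
  {p | p.2 ≠ 0 ∧ ‖p.2‖ < r ∧ ‖p.2‖ ^ K < ‖p.1‖ ∧ ‖p.1‖ * ‖p.2‖ ^ K < 1}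

theorem isOpen_cuspSet (K : ℕ) (r : ℝ) : IsOpen (cuspSet K r) := by
  have h1 : Continuous fun p : ℂ × ℂ => ‖p.2‖ := by fun_prop
  have h2 : Continuous fun p : ℂ × ℂ => ‖p.1‖ := by fun_prop
  exact (isOpen_ne_fun continuous_snd continuous_const).inter
    ((isOpen_lt h1 continuous_const).inter
      ((isOpen_lt (h1.pow K) h2).inter (isOpen_lt (h2.mul (h1.pow K)) continuous_const)))

theorem mem_cuspGerm {s : Set (ℂ × ℂ)} : s ∈ cuspGerm ↔ ∀ K : ℕ, ∃ r > 0, cuspSet K r ⊆ s := by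
  refine eventually_cuspGerm.trans (forall_congr' fun K => exists_congr fun r => ?_)
  refine and_congr_right fun _ => ⟨fun h p hp => h p hp.1 hp.2.1 hp.2.2.1 hp.2.2.2, ?_⟩
  exact fun h p h1 h2 h3 h4 => h ⟨h1, h2, h3, h4⟩

theorem cusp_bounds_iff {a b : ℝ} (ha : 0 < a) (hb : 0 < b) (K : ℕ) :
    (a ^ K < b ∧ b * a ^ K < 1) ↔ |Real.log b| < K * -Real.log a := by
  have hp : 0 < a ^ K := pow_pos ha K
  rw [← Real.log_lt_log_iff hp hb, ← Real.log_lt_log_iff (mul_pos hb hp) one_pos,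
    Real.log_mul hb.ne' hp.ne', Real.log_pow, Real.log_one, abs_lt]
  constructor
  · rintro ⟨h1, h2⟩; constructor <;> linarith
  · rintro ⟨h1, h2⟩; constructor <;> linarith

/-- The lifts of the points of a cuspidal domain stay in a cone. -/
theorem liftMap_mem_cone (hτ : 0 < τ.im) (i : Fin 4) (K : ℕ) :
    ∃ δ > 0, ∀ r > 0, ∃ r' > 0, ∀ q ∈ cuspSet K r',
      liftMap τ (lineParam i q) ∈ cone τ {i} (2 * Real.pi * τ.im + 1) δ r := by
  have ha := two_pi_im_pos hτ
  set a := 2 * Real.pi * τ.im with ha'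
  set A := 2 * Real.pi * rate τ i with hA
  set B := 2 * Real.pi * rate τ (i + 1) with hB
  have hA0 : 0 < A := by have := rate_pos hτ i; have := Real.pi_pos; positivity
  have hB0 : 0 < B := by have := rate_pos hτ (i + 1); have := Real.pi_pos; positivity
  set s := (dir τ 1).im with hs
  have hs0 : 0 < s := dir_one_im_pos hτ
  set M := (2 / A + (K + 1) / B) / s with hM
  have hM0 : 0 < M := by positivity
  refine ⟨1 / (4 * A * M), by positivity, fun r hr => ?_⟩
  set R := max (2 * a) (2 * A / r) with hR
  refine ⟨min (Real.exp (-R)) 1, lt_min (Real.exp_pos _) one_pos, fun q hq => ?_⟩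
  have hl0 : 0 < ‖q.2‖ := norm_pos_iff.2 hq.1
  have hx0 : 0 < ‖q.1‖ := (pow_pos hl0 K).trans hq.2.2.1
  have ht := lineParam_ne_zero i (norm_pos_iff.1 hx0) hq.1
  obtain ⟨w, hw1, hw2, hw3⟩ := liftMap_spec hτ ht
  rw [hw3]
  set P := lineParam i q with hP
  have hz : (liftAt τ w P).1 ≠ 0 := mul_ne_zero ht.2 (Complex.exp_ne_zero _)
  have h1 := log_norm_lineCoord_serreMap (τ := τ) i hz
  have h2 := log_norm_lineCoord_serreMap (τ := τ) (i + 1) hz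
  rw [serreMap_liftAt τ hw1, hP, lineCoord_lineParam, ← hA] at h1
  rw [serreMap_liftAt τ hw1, hP, lineCoord_succ_lineParam, ← hB] at h2
  rw [← hP] at h1 h2
  have hlift : (liftAt τ w P).2 = w⁻¹ := rfl
  rw [hlift, div_inv_eq_mul] at h1 h2
  set L := -Real.log ‖q.2‖ with hL
  have hLR : R < L := by
    have := Real.log_lt_log hl0 (hq.2.1.trans_le (min_le_left _ _))
    rw [Real.log_exp] at this
    linarith
  have hLa : 2 * a < L := (le_max_left _ _).trans_lt hLR
  have hLr : 2 * A / r < L := (le_max_right _ _).trans_lt hLR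
  have hL0 : 0 < L := by linarith
  have hx : |Real.log ‖q.1‖| < K * L := (cusp_bounds_iff hl0 hx0 K).1 hq.2.2
  have b1 := (abs_zExp_mul_le i (Real.log ‖(liftAt τ w P).1‖)).trans hw2
  have b2 := (abs_zExp_mul_le (i + 1) (Real.log ‖(liftAt τ w P).1‖)).trans hw2
  rw [abs_le] at b1 b2
  rw [abs_lt] at hx
  have c1 : L / 2 ≤ A * (dir τ i * w).im := by linarith
  have c1' : A * (dir τ i * w).im ≤ 2 * L := by linarith
  have c2 : B * |(dir τ (i + 1) * w).im| ≤ (K + 1) * L := by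
    rw [show B * |(dir τ (i + 1) * w).im| = |B * (dir τ (i + 1) * w).im| by
      rw [abs_mul, abs_of_pos hB0], abs_le]
    constructor <;> linarith
  have d1 : L / (2 * A) ≤ (dir τ i * w).im := by
    rw [div_le_iff₀ (by positivity)]; linarith
  have d1' : |(dir τ i * w).im| ≤ 2 / A * L := by
    rw [abs_of_nonneg (le_trans (by positivity) d1), div_mul_eq_mul_div, le_div_iff₀ hA0]
    linarith
  have d2 : |(dir τ (i + 1) * w).im| ≤ (K + 1) / B * L := by
    rw [div_mul_eq_mul_div, le_div_iff₀ hB0]; linarith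
  have hwM : ‖w‖ ≤ M * L := by
    have := norm_mul_im_dir_le hτ i w
    rw [hM, div_mul_eq_mul_div, le_div_iff₀ hs0, add_mul]
    linarith
  have hwn : L / (2 * A) ≤ ‖w‖ := by
    refine d1.trans ((le_abs_self _).trans ((Complex.abs_im_le_norm _).trans ?_))
    rw [norm_mul, norm_dir, one_mul]
  have hw0 : 0 < ‖w‖ := lt_of_lt_of_le (by positivity) hwn
  have hlog := abs_le.1 hw2
  have hzn : 0 < ‖(liftAt τ w P).1‖ := norm_pos_iff.2 hz
  refine ⟨?_, ?_, ?_, ?_, ?_⟩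
  · rw [← Real.lt_log_iff_exp_lt hzn]; linarith
  · rw [← Real.log_lt_iff_lt_exp hzn]; linarith
  · exact inv_ne_zero (norm_pos_iff.1 hw0)
  · rw [hlift, norm_inv, inv_lt_comm₀ hw0 hr]
    refine lt_of_lt_of_le ?_ hwn
    rw [lt_div_iff₀ (by positivity)]
    rw [div_lt_iff₀ hr] at hLr
    rw [inv_mul_lt_iff₀ hr]
    linarith
  · rintro j rfl
    rw [hlift, div_inv_eq_mul, norm_inv, ← div_eq_inv_mul, lt_div_iff₀ hw0]
    refine lt_of_lt_of_le ?_ d1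
    calc 1 / (4 * A * M) * ‖w‖ ≤ 1 / (4 * A * M) * (M * L) := by gcongr
      _ = L / (4 * A) := by field_simp
      _ < L / (2 * A) := by
        apply div_lt_div_of_pos_left hL0 (by positivity); linarith

/-- The lifts of the points of a cuspidal neighborhood of `L_i` lie in the sector of index `i`. -/
theorem tendsto_liftMap (hτ : 0 < τ.im) (i : Fin 4) :
    Tendsto (fun q => liftMap τ (lineParam i q)) cuspGerm (coneGerm τ {i}) := by
  intro s hs
  refine mem_cuspGerm.2 fun K => ?_
  obtain ⟨δ, hδ, h⟩ := liftMap_mem_cone hτ i K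
  obtain ⟨r, hr, hrs⟩ := hs (2 * Real.pi * τ.im + 1)
    (by have := two_pi_im_pos hτ; linarith) δ hδ
  obtain ⟨r', hr', h'⟩ := h r hr
  exact ⟨r', hr', fun q hq => hrs (h' q hq)⟩

/-- The image of a cone in the torus is contained in a cuspidal domain. -/
theorem serreMap_mem_cuspSet (hτ : 0 < τ.im) (i : Fin 4) {c δ : ℝ} (hc : 0 < c) (hδ : 0 < δ) :
    ∃ K : ℕ, ∀ r' > 0, ∃ r > 0, ∀ p ∈ cone τ {i} c δ r,
      (lineCoord (i + 1) (serreMap τ p), lineCoord i (serreMap τ p)) ∈ cuspSet K r' := by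
  set A := 2 * Real.pi * rate τ i with hA
  set B := 2 * Real.pi * rate τ (i + 1) with hB
  have hA0 : 0 < A := by have := rate_pos hτ i; have := Real.pi_pos; positivity
  have hB0 : 0 < B := by have := rate_pos hτ (i + 1); have := Real.pi_pos; positivity
  obtain ⟨K, hK⟩ := exists_nat_gt ((c + B) / (A * δ / 2))
  refine ⟨K, fun r' hr' => ?_⟩
  have hsmall : ∀ᶠ p in coneGerm τ {i}, ‖lineCoord i (serreMap τ p)‖ < r' := by
    have := ((flat_lineCoord hτ i 0).tendsto le_rfl).norm
    rw [norm_zero] at this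
    exact this.eventually (gt_mem_nhds hr')
  obtain ⟨r, hr, h⟩ := eventually_coneGerm.1 hsmall c hc δ hδ
  refine ⟨min r (min 1 (A * δ / (2 * c))), lt_min hr (lt_min one_pos (by positivity)), ?_⟩
  intro p hp
  have hz : p.1 ≠ 0 := norm_pos_iff.1 ((Real.exp_pos _).trans hp.1)
  have hy : 0 < ‖p.2‖ := norm_pos_iff.2 hp.2.2.1
  have ht : serreMap τ p ∈ torus := ⟨serreMap_fst_ne_zero τ p, serreMap_snd_ne_zero τ hz⟩
  have hne : ∀ j, lineCoord j (serreMap τ p) ≠ 0 := by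
    intro j
    fin_cases j <;> simp [lineCoord, ht.1, ht.2]
  have hlog : |Real.log ‖p.1‖| ≤ c := by
    have hzn : 0 < ‖p.1‖ := norm_pos_iff.2 hz
    rw [abs_le]
    exact ⟨((Real.lt_log_iff_exp_lt hzn).2 hp.1).le, ((Real.log_lt_iff_lt_exp hzn).2 hp.2.1).le⟩
  have hy1 : ‖p.2‖ < 1 := hp.2.2.2.1.trans_le ((min_le_right _ _).trans (min_le_left _ _))
  have hy2 : ‖p.2‖ < A * δ / (2 * c) :=
    hp.2.2.2.1.trans_le ((min_le_right _ _).trans (min_le_right _ _))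
  have hδy : δ < ‖p.2‖ * (dir τ i / p.2).im := hp.2.2.2.2 i rfl
  refine ⟨hne i, ?_, (cusp_bounds_iff (norm_pos_iff.2 (hne i))
    (norm_pos_iff.2 (hne (i + 1))) K).2 ?_⟩
  · exact h p (cone_mono subset_rfl le_rfl le_rfl (min_le_left _ _) hp)
  · rw [log_norm_lineCoord_serreMap i hz, log_norm_lineCoord_serreMap (i + 1) hz, ← hA, ← hB]
    have b1 := abs_le.1 ((abs_zExp_mul_le i (Real.log ‖p.1‖)).trans hlog)
    have b2 := (abs_zExp_mul_le (i + 1) (Real.log ‖p.1‖)).trans hlog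
    have b3 : |(dir τ (i + 1) / p.2).im| ≤ 1 / ‖p.2‖ := by
      refine (Complex.abs_im_le_norm _).trans (le_of_eq ?_)
      rw [norm_div, norm_dir]
    have b4 : δ / ‖p.2‖ < (dir τ i / p.2).im := by
      rw [div_lt_iff₀ hy]; linarith
    have b5 : c ≤ A * δ / 2 / ‖p.2‖ := by
      rw [lt_div_iff₀ (by positivity)] at hy2
      rw [le_div_iff₀ hy]
      linarith
    have b6 : A * δ / 2 / ‖p.2‖ ≤
        -((zExp i : ℝ) * Real.log ‖p.1‖ - A * (dir τ i / p.2).im) := by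
      have : A * (δ / ‖p.2‖) ≤ A * (dir τ i / p.2).im := by gcongr
      have e : A * (δ / ‖p.2‖) = A * δ / 2 / ‖p.2‖ + A * δ / 2 / ‖p.2‖ := by ring
      linarith [b1.2]
    have hK0 : (0 : ℝ) < K := lt_trans (by positivity) hK
    calc |(zExp (i + 1) : ℝ) * Real.log ‖p.1‖ - B * (dir τ (i + 1) / p.2).im|
        ≤ |(zExp (i + 1) : ℝ) * Real.log ‖p.1‖| + |B * (dir τ (i + 1) / p.2).im| := abs_sub _ _
      _ ≤ c / ‖p.2‖ + B * (1 / ‖p.2‖) := by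
        rw [abs_mul B, abs_of_pos hB0]
        have : c ≤ c / ‖p.2‖ := le_div_self hc.le hy hy1.le
        gcongr
        exact b2.trans this
      _ = (c + B) / ‖p.2‖ := by ring
      _ < K * (A * δ / 2) / ‖p.2‖ := by
        rw [div_lt_iff₀ (by positivity)] at hK
        gcongr
      _ = K * (A * δ / 2 / ‖p.2‖) := by ring
      _ ≤ _ := by gcongr

theorem tendsto_lineCoord_cuspGerm (hτ : 0 < τ.im) (i : Fin 4) :
    Tendsto (fun p => (lineCoord (i + 1) (serreMap τ p), lineCoord i (serreMap τ p)))
      (coneGerm τ {i}) cuspGerm := by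
  intro s hs c hc δ hδ
  obtain ⟨K, hK⟩ := serreMap_mem_cuspSet hτ i hc hδ
  obtain ⟨r', hr', hs'⟩ := mem_cuspGerm.1 hs K
  obtain ⟨r, hr, h⟩ := hK r' hr'
  exact ⟨r, hr, fun p hp => hs' (h p hp)⟩

theorem differentiableAt_liftAt {w : ℂ × ℂ → ℂ} {P : ℂ × ℂ → ℂ × ℂ} {q : ℂ × ℂ}
    (hw : DifferentiableAt ℂ w q) (hP : DifferentiableAt ℂ P q) (hq : w q ≠ 0) :
    DifferentiableAt ℂ (fun q => liftAt τ (w q) (P q)) q := by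
  have h1 : DifferentiableAt ℂ (fun q => (P q).2) q := hP.snd
  exact (h1.mul ((hw.const_mul (2 * Real.pi * Complex.I * τ)).neg.cexp)).prodMk (hw.inv hq)

/-- A holomorphic function on a sector, invariant by the model map and with limit zero, is a
holomorphic function of the coordinate which vanishes on `L_i`. -/
theorem exists_eq_comp_lineCoord (hτ : 0 < τ.im) (i : Fin 4) {f : ℂ × ℂ → ℂ}
    (hd : ∀ᶠ p in coneGerm τ {i}, DifferentiableAt ℂ f p)
    (hinv : ∀ᶠ p in coneGerm τ {i}, f (modelMap τ p) = f p)
    (hf : Tendsto f (coneGerm τ {i}) (𝓝 0)) :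
    ∃ k : ℂ → ℂ, AnalyticAt ℂ k 0 ∧ k 0 = 0 ∧
      ∀ᶠ p in coneGerm τ {i}, f p = k (lineCoord i (serreMap τ p)) := by
  have hc₀ : 0 < 2 * Real.pi * τ.im + 1 := by have := two_pi_im_pos hτ; linarith
  -- The lift is discontinuous, but by invariance `f ∘ liftMap` does not depend on the choice of
  -- the logarithm, so near a point it may be computed with a holomorphic determination.
  have hdiff : ∀ᶠ q in cuspGerm,
      DifferentiableAt ℂ (fun q => f (liftMap τ (lineParam i q))) q := by
    refine mem_cuspGerm.2 fun K => ?_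
    obtain ⟨δ, hδ, h⟩ := liftMap_mem_cone hτ i K
    obtain ⟨r₁, hr₁, h₁⟩ := eq_of_serreMap_eq hτ hinv hc₀ hδ
    obtain ⟨r₂, hr₂, h₂⟩ := eventually_coneGerm.1 hd _ hc₀ δ hδ
    obtain ⟨r', hr', h'⟩ := h (min r₁ r₂) (lt_min hr₁ hr₂)
    refine ⟨r', hr', fun q₀ hq₀ => ?_⟩
    have hx : q₀.1 ≠ 0 := norm_pos_iff.1 ((pow_nonneg (norm_nonneg _) K).trans_lt hq₀.2.2.1)
    have ht := lineParam_ne_zero i hx hq₀.1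
    obtain ⟨w₀, hw1, -, hw3⟩ := liftMap_spec hτ ht
    have hcone := h' q₀ hq₀
    rw [hw3] at hcone
    have hw0 : w₀ ≠ 0 := by
      have := hcone.2.2.1
      exact fun h0 => this (by simp [liftAt, h0])
    set X₀ := (lineParam i q₀).1 with hX₀
    set w : ℂ × ℂ → ℂ := fun q =>
      w₀ + Complex.log ((lineParam i q).1 / X₀) / (2 * Real.pi * Complex.I) with hw
    have hPd : DifferentiableAt ℂ (lineParam i) q₀ := differentiableAt_lineParam i hx hq₀.1
    have hwd : DifferentiableAt ℂ w q₀ := by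
      have h1 : DifferentiableAt ℂ (fun q => (lineParam i q).1 / X₀) q₀  := by
        simp only [div_eq_mul_inv]
        exact hPd.fst.mul_const _
      have h2 : DifferentiableAt ℂ (fun q => Complex.log ((lineParam i q).1 / X₀)) q₀ := by
        refine h1.clog ?_
        rw [← hX₀, div_self ht.1]
        exact Complex.one_mem_slitPlane
      have h3 : DifferentiableAt ℂ (fun q => Complex.log ((lineParam i q).1 / X₀) *
          (2 * Real.pi * Complex.I)⁻¹) q₀ := h2.mul_const _
      simp only [hw, div_eq_mul_inv] at h3 ⊢
      exact h3.const_add w₀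
    have hwq : w q₀ = w₀ := by
      simp only [hw]
      rw [← hX₀, div_self ht.1]
      simp
    have hσ : DifferentiableAt ℂ (fun q => liftAt τ (w q) (lineParam i q)) q₀ :=
      differentiableAt_liftAt hwd hPd (by rwa [hwq])
    have hσ0 : (fun q => liftAt τ (w q) (lineParam i q)) q₀ = liftAt τ w₀ (lineParam i q₀) := by
      simp only [hwq]
    have hev : (fun q => f (liftMap τ (lineParam i q)))
        =ᶠ[𝓝 q₀] fun q => f (liftAt τ (w q) (lineParam i q)) := by
      have e1 : ∀ᶠ q in 𝓝 q₀, liftAt τ (w q) (lineParam i q) ∈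
          cone τ {i} (2 * Real.pi * τ.im + 1) δ (min r₁ r₂) :=
        hσ.continuousAt.eventually (by rw [hσ0]; exact (isOpen_cone _ _ _ _ _).mem_nhds hcone)
      filter_upwards [e1, (isOpen_cuspSet K r').mem_nhds hq₀] with q h3 h4
      have hxq : q.1 ≠ 0 := norm_pos_iff.1 ((pow_nonneg (norm_nonneg _) K).trans_lt h4.2.2.1)
      have htq := lineParam_ne_zero i hxq h4.1
      obtain ⟨w', hw1', -, hw3'⟩ := liftMap_spec hτ htq
      refine h₁ _ (cone_mono subset_rfl le_rfl le_rfl (min_le_left _ _) (h' q h4)) _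
        (cone_mono subset_rfl le_rfl le_rfl (min_le_left _ _) h3) ?_
      rw [hw3', serreMap_liftAt τ hw1', serreMap_liftAt τ]
      simp only [hw]
      rw [mul_add, mul_div_cancel₀ _ Complex.two_pi_I_ne_zero, Complex.exp_add, hw1,
        Complex.exp_log (div_ne_zero htq.1 ht.1), mul_div_cancel₀ _ ht.1]
    refine DifferentiableAt.congr_of_eventuallyEq ?_ hev
    refine DifferentiableAt.comp q₀ (g := f) ?_ hσ
    rw [hwq]
    exact h₂ _ (cone_mono subset_rfl le_rfl le_rfl (min_le_right _ _) hcone)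
  obtain ⟨k, hk, hk0, h⟩ := exists_analytic_of_cuspGerm hdiff (hf.comp (tendsto_liftMap hτ i))
  refine ⟨k, hk, hk0, ?_⟩
  have h1 := (tendsto_lineCoord_cuspGerm hτ i).eventually h
  -- the lift of the image of `p` is in the orbit of `p` under the model map
  have h2 : ∀ᶠ p in coneGerm τ {i}, f (liftMap τ (serreMap τ p)) = f p := by
    intro c hc δ hδ
    obtain ⟨K, hK⟩ := serreMap_mem_cuspSet hτ i hc hδ
    obtain ⟨δ', hδ', hl⟩ := liftMap_mem_cone hτ i K
    obtain ⟨r, hr, he⟩ := eq_of_serreMap_eq hτ hinv (lt_max_of_lt_left hc) (lt_min hδ hδ')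
      (c := max c (2 * Real.pi * τ.im + 1))
    obtain ⟨r', hr', hl'⟩ := hl r hr
    obtain ⟨r'', hr'', hK'⟩ := hK r' hr'
    refine ⟨min r r'', lt_min hr hr'', fun p hp => ?_⟩
    have hm := hK' p (cone_mono subset_rfl le_rfl le_rfl (min_le_right _ _) hp)
    have hm' := hl' _ hm
    rw [lineParam_lineCoord] at hm'
    refine he _ (cone_mono subset_rfl (le_max_right _ _) (min_le_right _ _) le_rfl hm') _
      (cone_mono subset_rfl (le_max_left _ _) (min_le_left _ _) (min_le_left _ _) hp) ?_
    have ht : serreMap τ p ∈ torus := ⟨serreMap_fst_ne_zero τ p, serreMap_snd_ne_zero τ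
      (norm_pos_iff.1 ((Real.exp_pos _).trans hp.1))⟩
    obtain ⟨w, hw1, -, hw3⟩ := liftMap_spec hτ ht
    rw [hw3, serreMap_liftAt τ hw1]
  filter_upwards [h1, h2] with p h3 h4
  rw [lineParam_lineCoord] at h3
  rw [← h4, h3]

/-! ### Boundedness and approximation along the curve -/

/-- `g` is bounded near the curve on each cone, with a bound that may depend on the cone. -/
def Bdd (τ : ℂ) (S : Set (Fin 4)) (g : ℂ × ℂ → ℂ) : Prop :=
  ∀ c > 0, ∀ δ > 0, ∃ K : ℝ, ∃ r > 0, ∀ p ∈ cone τ S c δ r, ‖g p‖ ≤ K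

theorem Bdd.congr' {g h : ℂ × ℂ → ℂ} (hg : Bdd τ S g) (hh : ∀ᶠ p in coneGerm τ S, g p = h p) :
    Bdd τ S h := by
  intro c hc δ hδ
  obtain ⟨K, r, hr, h1⟩ := hg c hc δ hδ
  obtain ⟨r', hr', h2⟩ := eventually_coneGerm.1 hh c hc δ hδ
  refine ⟨K, min r r', lt_min hr hr', fun p hp => ?_⟩
  rw [← h2 p (cone_mono subset_rfl le_rfl le_rfl (min_le_right _ _) hp)]
  exact h1 p (cone_mono subset_rfl le_rfl le_rfl (min_le_left _ _) hp)

theorem Bdd.add {g h : ℂ × ℂ → ℂ} (hg : Bdd τ S g) (hh : Bdd τ S h) :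
    Bdd τ S (fun p => g p + h p) := by
  intro c hc δ hδ
  obtain ⟨K, r, hr, h1⟩ := hg c hc δ hδ
  obtain ⟨K', r', hr', h2⟩ := hh c hc δ hδ
  refine ⟨K + K', min r r', lt_min hr hr', fun p hp => (norm_add_le _ _).trans (add_le_add ?_ ?_)⟩
  · exact h1 p (cone_mono subset_rfl le_rfl le_rfl (min_le_left _ _) hp)
  · exact h2 p (cone_mono subset_rfl le_rfl le_rfl (min_le_right _ _) hp)

theorem Bdd.mul {g h : ℂ × ℂ → ℂ} (hg : Bdd τ S g) (hh : Bdd τ S h) :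
    Bdd τ S (fun p => g p * h p) := by
  intro c hc δ hδ
  obtain ⟨K, r, hr, h1⟩ := hg c hc δ hδ
  obtain ⟨K', r', hr', h2⟩ := hh c hc δ hδ
  refine ⟨K * K', min r r', lt_min hr hr', fun p hp => ?_⟩
  have e1 := h1 p (cone_mono subset_rfl le_rfl le_rfl (min_le_left _ _) hp)
  have e2 := h2 p (cone_mono subset_rfl le_rfl le_rfl (min_le_right _ _) hp)
  rw [norm_mul]
  exact mul_le_mul e1 e2 (norm_nonneg _) ((norm_nonneg _).trans e1)

theorem bdd_const (a : ℂ) : Bdd τ S (fun _ => a) :=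
  fun _ _ _ _ => ⟨‖a‖, 1, one_pos, fun _ _ => le_rfl⟩

theorem Bdd.const_mul {g : ℂ × ℂ → ℂ} (a : ℂ) (hg : Bdd τ S g) : Bdd τ S (fun p => a * g p) :=
  (bdd_const a).mul hg

theorem Bdd.sub {g h : ℂ × ℂ → ℂ} (hg : Bdd τ S g) (hh : Bdd τ S h) :
    Bdd τ S (fun p => g p - h p) := by
  simpa [sub_eq_add_neg] using hg.add (hh.const_mul (-1))

theorem Bdd.conj {g : ℂ × ℂ → ℂ} (hg : Bdd τ S g) :
    Bdd τ S (fun p => (starRingEnd ℂ) (g p)) := by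
  simpa [Bdd] using hg

theorem Bdd.of_tendsto {g : ℂ × ℂ → ℂ} {a : ℂ} (h : Tendsto g (coneGerm τ S) (𝓝 a)) :
    Bdd τ S g := by
  intro c hc δ hδ
  obtain ⟨r, hr, h1⟩ := eventually_coneGerm.1
    (h.norm.eventually (gt_mem_nhds (show ‖a‖ < ‖a‖ + 1 by linarith))) c hc δ hδ
  exact ⟨‖a‖ + 1, r, hr, fun p hp => (h1 p hp).le⟩

theorem Ord.bdd {g : ℂ × ℂ → ℂ} (h : Ord τ S n g) (hn : 0 ≤ n) : Bdd τ S g :=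
  Bdd.of_tendsto (h.tendsto hn)

theorem Flat.bdd {g : ℂ × ℂ → ℂ} (h : Flat τ S g) : Bdd τ S g := (h 0).bdd le_rfl

theorem Bdd.ord {g : ℂ × ℂ → ℂ} (h : Bdd τ S g) : Ord τ S (-1) g :=
  Ord.of_bound fun c hc δ hδ => by
    obtain ⟨K, r, hr, h1⟩ := h c hc δ hδ
    exact ⟨K, r, hr, fun p hp => by simpa using h1 p hp⟩

theorem Ord.mul_bdd {f g : ℂ × ℂ → ℂ} (hf : Ord τ S n f) (hg : Bdd τ S g) :
    Ord τ S n (fun p => f p * g p) := by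
  refine isLittleO_iff.2 fun ε hε => eventually_coneGerm.2 fun c hc δ hδ => ?_
  obtain ⟨K, r, hr, h1⟩ := hg c hc δ hδ
  have hK : 0 < max K 1 := lt_max_of_lt_right one_pos
  obtain ⟨r', hr', h2⟩ := eventually_coneGerm.1 (isLittleO_iff.1 hf (div_pos hε hK)) c hc δ hδ
  refine ⟨min r r', lt_min hr hr', fun p hp => ?_⟩
  have e1 := h1 p (cone_mono subset_rfl le_rfl le_rfl (min_le_left _ _) hp)
  have e2 := h2 p (cone_mono subset_rfl le_rfl le_rfl (min_le_right _ _) hp)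
  rw [norm_mul]
  calc ‖f p‖ * ‖g p‖ ≤ (ε / max K 1 * ‖p.2 ^ n‖) * max K 1 :=
        mul_le_mul e2 (e1.trans (le_max_left _ _)) (norm_nonneg _) (by positivity)
    _ = ε * ‖p.2 ^ n‖ := by field_simp

theorem Flat.mul_bdd {f g : ℂ × ℂ → ℂ} (hf : Flat τ S f) (hg : Bdd τ S g) :
    Flat τ S (fun p => f p * g p) := fun n => (hf n).mul_bdd hg

/-- A function which is continuous at the points of the curve is bounded. -/
theorem Bdd.of_continuousAt {g : ℂ × ℂ → ℂ} (h : ∀ z : ℂ, z ≠ 0 → ContinuousAt g (z, 0)) :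
    Bdd τ S g := by
  intro c hc δ hδ
  set A : Set ℂ := Metric.closedBall 0 (Real.exp c) ∩ {z | Real.exp (-c) ≤ ‖z‖} with hA
  have hAc : IsCompact A :=
    (isCompact_closedBall 0 _).inter_right (isClosed_le continuous_const continuous_norm)
  have key : ∃ K : ℝ, ∀ᶠ y in 𝓝 (0 : ℂ), ∀ z ∈ A, ‖g (z, y)‖ ≤ K := by
    refine hAc.induction_on (p := fun s => ∃ K : ℝ, ∀ᶠ y in 𝓝 (0 : ℂ), ∀ z ∈ s, ‖g (z, y)‖ ≤ K)
      ⟨0, Eventually.of_forall fun y z hz => hz.elim⟩ ?_ ?_ ?_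
    · rintro s t hst ⟨K, hK⟩
      exact ⟨K, hK.mono fun y hy z hz => hy z (hst hz)⟩
    · rintro s t ⟨K, hK⟩ ⟨K', hK'⟩
      refine ⟨max K K', ?_⟩
      filter_upwards [hK, hK'] with y h1 h2 z hz
      rcases hz with hz | hz
      · exact (h1 z hz).trans (le_max_left _ _)
      · exact (h2 z hz).trans (le_max_right _ _)
    · intro z hz
      have hz0 : z ≠ 0 := norm_pos_iff.1 ((Real.exp_pos _).trans_le hz.2)
      have h1 : ∀ᶠ p in 𝓝 (z, (0 : ℂ)), ‖g p‖ < ‖g (z, 0)‖ + 1 :=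
        (h z hz0).norm.eventually (gt_mem_nhds (by linarith))
      rw [nhds_prod_eq] at h1
      obtain ⟨pa, ha, pb, hb, hab⟩ := eventually_prod_iff.1 h1
      refine ⟨{z | pa z}, mem_nhdsWithin_of_mem_nhds ha, ‖g (z, 0)‖ + 1, ?_⟩
      filter_upwards [hb] with y hy z' hz'
      exact (hab hz' hy).le
  obtain ⟨K, hK⟩ := key
  obtain ⟨r, hr, hr'⟩ := Metric.eventually_nhds_iff.1 hK
  refine ⟨K, r, hr, fun p hp => ?_⟩
  exact hr' (by simpa using hp.2.2.2.1) p.1 ⟨by simpa using hp.2.1.le, hp.1.le⟩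

/-- `f` and `g` are bounded and differ by `o(y ^ n)`. -/
structure Approx (τ : ℂ) (S : Set (Fin 4)) (n : ℤ) (f g : ℂ × ℂ → ℂ) : Prop where
  ord : Ord τ S n (fun p => f p - g p)
  left : Bdd τ S f
  right : Bdd τ S g

theorem Approx.refl {f : ℂ × ℂ → ℂ} (hf : Bdd τ S f) : Approx τ S n f f :=
  ⟨by simp [Ord], hf, hf⟩

theorem Approx.mul {f f' g g' : ℂ × ℂ → ℂ} (hf : Approx τ S n f f') (hg : Approx τ S n g g') :
    Approx τ S n (fun p => f p * g p) (fun p => f' p * g' p) := by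
  refine ⟨?_, hf.left.mul hg.left, hf.right.mul hg.right⟩
  refine ((hf.ord.mul_bdd hg.left).add (hg.ord.mul_bdd hf.right)).congr' ?_
  exact Eventually.of_forall fun p => by ring

theorem Approx.sub {f f' g g' : ℂ × ℂ → ℂ} (hf : Approx τ S n f f') (hg : Approx τ S n g g') :
    Approx τ S n (fun p => f p - g p) (fun p => f' p - g' p) := by
  refine ⟨?_, hf.left.sub hg.left, hf.right.sub hg.right⟩
  refine (hf.ord.sub hg.ord).congr' ?_
  exact Eventually.of_forall fun p => by ring

theorem Approx.const_mul {f g : ℂ × ℂ → ℂ} (a : ℂ) (h : Approx τ S n f g) :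
    Approx τ S n (fun p => a * f p) (fun p => a * g p) :=
  (Approx.refl (bdd_const a)).mul h

/-- The components of two maps and of their differentials approximate each other. -/
structure MapApprox (τ : ℂ) (S : Set (Fin 4)) (n : ℤ) (Φ Φ' : ℂ × ℂ → ℂ × ℂ) : Prop where
  fst : Approx τ S n (fun p => (Φ p).1) (fun p => (Φ' p).1)
  snd : Approx τ S n (fun p => (Φ p).2) (fun p => (Φ' p).2)
  fst_fst : Approx τ S n (fun p => (fderiv ℂ Φ p (1, 0)).1) (fun p => (fderiv ℂ Φ' p (1, 0)).1)
  snd_fst : Approx τ S n (fun p => (fderiv ℂ Φ p (1, 0)).2) (fun p => (fderiv ℂ Φ' p (1, 0)).2)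
  fst_snd : Approx τ S n (fun p => (fderiv ℂ Φ p (0, 1)).1) (fun p => (fderiv ℂ Φ' p (0, 1)).1)
  snd_snd : Approx τ S n (fun p => (fderiv ℂ Φ p (0, 1)).2) (fun p => (fderiv ℂ Φ' p (0, 1)).2)

theorem fderiv_fst_apply {Φ : ℂ × ℂ → ℂ × ℂ} {p : ℂ × ℂ} (h : DifferentiableAt ℂ Φ p)
    (v : ℂ × ℂ) : fderiv ℂ (fun p => (Φ p).1) p v = (fderiv ℂ Φ p v).1 := by
  rw [h.hasFDerivAt.fst.fderiv]; rfl

theorem fderiv_snd_apply {Φ : ℂ × ℂ → ℂ × ℂ} {p : ℂ × ℂ} (h : DifferentiableAt ℂ Φ p)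
    (v : ℂ × ℂ) : fderiv ℂ (fun p => (Φ p).2) p v = (fderiv ℂ Φ p v).2 := by
  rw [h.hasFDerivAt.snd.fderiv]; rfl

/-- Derivatives of small functions are small: by Cauchy's estimate no order is lost in the direction
of the curve, and one order is lost in the transverse direction. -/
theorem ord_partials_sub {Φ Φ' : ℂ × ℂ → ℂ × ℂ}
    (hd : ∀ᶠ p in coneGerm τ S, DifferentiableAt ℂ Φ p)
    (hd' : ∀ᶠ p in coneGerm τ S, DifferentiableAt ℂ Φ' p) :
    (Ord τ S n (fun p => (Φ p).1 - (Φ' p).1) →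
      Ord τ S n (fun p => (fderiv ℂ Φ p (1, 0)).1 - (fderiv ℂ Φ' p (1, 0)).1) ∧
      Ord τ S (n - 1) (fun p => (fderiv ℂ Φ p (0, 1)).1 - (fderiv ℂ Φ' p (0, 1)).1)) ∧
    (Ord τ S n (fun p => (Φ p).2 - (Φ' p).2) →
      Ord τ S n (fun p => (fderiv ℂ Φ p (1, 0)).2 - (fderiv ℂ Φ' p (1, 0)).2) ∧
      Ord τ S (n - 1) (fun p => (fderiv ℂ Φ p (0, 1)).2 - (fderiv ℂ Φ' p (0, 1)).2)) := by
  constructor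
  · intro h
    have h1 := Ord.partials (G := fun p => (Φ p).1 - (Φ' p).1)
      (by filter_upwards [hd, hd'] with p h1 h2 using h1.fst.sub h2.fst) h
    refine ⟨h1.1.congr' ?_, h1.2.congr' ?_⟩ <;> filter_upwards [hd, hd'] with p h1 h2 <;>
    · rw [← fderiv_fst_apply h1, ← fderiv_fst_apply h2, fderiv_fun_sub h1.fst h2.fst]
      rfl
  · intro h
    have h1 := Ord.partials (G := fun p => (Φ p).2 - (Φ' p).2)
      (by filter_upwards [hd, hd'] with p h1 h2 using h1.snd.sub h2.snd) h
    refine ⟨h1.1.congr' ?_, h1.2.congr' ?_⟩ <;> filter_upwards [hd, hd'] with p h1 h2 <;>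
    · rw [← fderiv_snd_apply h1, ← fderiv_snd_apply h2, fderiv_fun_sub h1.snd h2.snd]
      rfl

/-! ### The normalizing maps -/

theorem analyticAt_jet {a b : ℕ → ℂ → ℂ} (ha : ∀ n, ∀ z : ℂ, z ≠ 0 → AnalyticAt ℂ (a n) z)
    (hb : ∀ n, ∀ z : ℂ, z ≠ 0 → AnalyticAt ℂ (b n) z) (N : ℕ) {p : ℂ × ℂ} (hp : p.1 ≠ 0) :
    AnalyticAt ℂ (jet a b N) p := by
  have h : ∀ c : ℕ → ℂ → ℂ, (∀ n, ∀ z : ℂ, z ≠ 0 → AnalyticAt ℂ (c n) z) → ∀ s : Finset ℕ,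
      AnalyticAt ℂ (fun p : ℂ × ℂ => ∑ n ∈ s, c n p.1 * p.2 ^ n) p := by
    intro c hc s
    refine Finset.analyticAt_fun_sum s fun n _ => ?_
    exact ((hc n p.1 hp).comp (f := fun p : ℂ × ℂ => p.1) analyticAt_fst).mul
      (analyticAt_snd.pow n)
  exact (analyticAt_fst.add (h a ha _)).prod (analyticAt_snd.add (h b hb _))

theorem Bdd.of_analyticAt_map {Φ : ℂ × ℂ → ℂ × ℂ} (h : ∀ z : ℂ, z ≠ 0 → AnalyticAt ℂ Φ (z, 0)) :
    Bdd τ S (fun p => (Φ p).1) ∧ Bdd τ S (fun p => (Φ p).2) ∧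
      ∀ v, Bdd τ S (fun p => (fderiv ℂ Φ p v).1) ∧ Bdd τ S (fun p => (fderiv ℂ Φ p v).2) := by
  have h' : ∀ v, ∀ z : ℂ, z ≠ 0 → ContinuousAt (fun p => fderiv ℂ Φ p v) (z, 0) := fun v z hz =>
    (h z hz).fderiv.continuousAt.clm_apply continuousAt_const
  exact ⟨Bdd.of_continuousAt fun z hz => (h z hz).continuousAt.fst,
    Bdd.of_continuousAt fun z hz => (h z hz).continuousAt.snd,
    fun v => ⟨Bdd.of_continuousAt fun z hz => (h' v z hz).fst,
      Bdd.of_continuousAt fun z hz => (h' v z hz).snd⟩⟩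

theorem Bdd.of_sub {f g : ℂ × ℂ → ℂ} (h : Bdd τ S (fun p => f p - g p)) (hg : Bdd τ S g) :
    Bdd τ S f := by
  simpa using h.add hg

section Normalization

variable {F : ℂ × ℂ → ℂ × ℂ} {a b : ℕ → ℂ → ℂ} {Ψ : Fin 4 → ℂ × ℂ → ℂ × ℂ} {u v : ℂ}

theorem IsSectorialNormalization.eventually_analyticAt
    (hΨ : IsSectorialNormalization τ F a b Ψ) (i : Fin 4) :
    ∀ᶠ p in coneGerm τ {i}, AnalyticAt ℂ (Ψ i) p := by
  rw [← sectorFilter_eq]; exact hΨ.holomorphic i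

theorem IsSectorialNormalization.eventually_conj
    (hΨ : IsSectorialNormalization τ F a b Ψ) (i : Fin 4) :
    ∀ᶠ p in coneGerm τ {i}, Ψ i (F p) = modelMap τ (Ψ i p) := by
  rw [← sectorFilter_eq]; exact hΨ.conj i

theorem IsSectorialNormalization.ord_sub_jet (hΨ : IsSectorialNormalization τ F a b Ψ)
    (i : Fin 4) (N : ℕ) :
    Ord τ {i} N (fun p => (Ψ i p).1 - (jet a b N p).1) ∧
      Ord τ {i} N (fun p => (Ψ i p).2 - (jet a b N p).2) := by
  have key : ∀ ε > 0, ∀ᶠ p in coneGerm τ {i}, ‖Ψ i p - jet a b N p‖ ≤ ε * ‖p.2 ^ (N : ℤ)‖ := by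
    intro ε hε
    rw [← sectorFilter_eq]
    intro c hc ε' hε'
    obtain ⟨K, r, hr, h⟩ := hΨ.asymptotic i N c hc ε' hε'
    have hK : 0 < max K 1 := lt_max_of_lt_right one_pos
    refine ⟨min r (ε / max K 1), lt_min hr (div_pos hε hK), fun p hp => ?_⟩
    refine (h p (sector_mono (min_le_left _ _) hp)).trans ?_
    have hy : ‖p.2‖ < ε / max K 1 := by
      obtain ⟨-, -, ρ, θ, h3, h4, -, -, h5⟩ := hp
      rw [h5, norm_mul, Complex.norm_exp_ofReal_mul_I, mul_one, Complex.norm_real,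
        Real.norm_of_nonneg h3.le]
      exact h4.trans_le (min_le_right _ _)
    rw [lt_div_iff₀ hK] at hy
    rw [zpow_natCast, norm_pow, pow_succ]
    calc K * (‖p.2‖ ^ N * ‖p.2‖) ≤ max K 1 * (‖p.2‖ ^ N * ‖p.2‖) := by
          gcongr; exact le_max_left _ _
      _ = ‖p.2‖ ^ N * (‖p.2‖ * max K 1) := by ring
      _ ≤ ‖p.2‖ ^ N * ε := by gcongr
      _ = ε * ‖p.2‖ ^ N := mul_comm _ _
  constructor <;> refine isLittleO_iff.2 fun ε hε => (key ε hε).mono fun p hp => ?_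
  · exact (norm_fst_le (Ψ i p - jet a b N p)).trans hp
  · exact (norm_snd_le (Ψ i p - jet a b N p)).trans hp

theorem IsSectorialNormalization.nearRot (hΨ : IsSectorialNormalization τ F a b Ψ) (i : Fin 4) :
    NearRot τ {i} 1 (Ψ i) := by
  refine ⟨?_, ?_⟩
  · have := (hΨ.ord_sub_jet i 0).1.tendsto (by simp)
    simpa [jet] using this
  · have h := (hΨ.ord_sub_jet i 1).2
    simp only [jet, Finset.Icc_eq_empty_of_lt (show 1 < 2 by norm_num), Finset.sum_empty,
      add_zero, Ord, Nat.cast_one, zpow_one] at h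
    have h1 := h.tendsto_div_nhds_zero.add_const (1 : ℂ)
    rw [zero_add] at h1
    refine h1.congr' ?_
    filter_upwards [eventually_snd_ne_zero τ {i}] with p hp
    field_simp
    ring

theorem IsFormalNormalization.analyticAt_jet (hF : IsFormalNormalization τ F a b) (N : ℕ)
    {p : ℂ × ℂ} (hp : p.1 ≠ 0) : AnalyticAt ℂ (jet a b N) p :=
  EllipticNbhd.analyticAt_jet hF.coeff_fst hF.coeff_snd N hp

theorem IsSectorialNormalization.mapApprox (hF : IsFormalNormalization τ F a b)
    (hΨ : IsSectorialNormalization τ F a b Ψ) (i : Fin 4) (N : ℕ) :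
    MapApprox τ {i} ((N : ℤ) - 1) (Ψ i) (jet a b N) := by
  have hd : ∀ᶠ p in coneGerm τ {i}, DifferentiableAt ℂ (Ψ i) p :=
    (hΨ.eventually_analyticAt i).mono fun p hp => hp.differentiableAt
  have hJ : ∀ N, ∀ᶠ p in coneGerm τ {i}, DifferentiableAt ℂ (jet a b N) p := fun N =>
    (eventually_fst_ne_zero τ {i}).mono fun p hp => (hF.analyticAt_jet N hp).differentiableAt
  have hb : ∀ N, _ := fun N => Bdd.of_analyticAt_map (τ := τ) (S := {i}) (Φ := jet a b N)
    fun z hz => hF.analyticAt_jet N hz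
  have ho := hΨ.ord_sub_jet i
  have hp := fun N : ℕ => (ord_partials_sub (n := N) hd (hJ N)).1 (ho N).1
  have hq := fun N : ℕ => (ord_partials_sub (n := N) hd (hJ N)).2 (ho N).2
  have hN : ((N : ℤ) - 1) ≤ N := by omega
  refine ⟨⟨(ho N).1.mono hN, Bdd.of_sub ((ho 1).1.bdd (by simp)) (hb 1).1, (hb N).1⟩,
    ⟨(ho N).2.mono hN, Bdd.of_sub ((ho 1).2.bdd (by simp)) (hb 1).2.1, (hb N).2.1⟩,
    ⟨(hp N).1.mono hN, Bdd.of_sub ((hp 1).1.bdd (by simp)) ((hb 1).2.2 _).1, ((hb N).2.2 _).1⟩,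
    ⟨(hq N).1.mono hN, Bdd.of_sub ((hq 1).1.bdd (by simp)) ((hb 1).2.2 _).2, ((hb N).2.2 _).2⟩,
    ⟨(hp N).2, Bdd.of_sub ((hp 1).2.bdd (by simp)) ((hb 1).2.2 _).1, ((hb N).2.2 _).1⟩,
    ⟨(hq N).2, Bdd.of_sub ((hq 1).2.bdd (by simp)) ((hb 1).2.2 _).2, ((hb N).2.2 _).2⟩⟩

/-- The differential of a normalizing map is close to the identity. -/
theorem IsSectorialNormalization.tendsto_partials (hΨ : IsSectorialNormalization τ F a b Ψ)
    (i : Fin 4) :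
    Tendsto (fun p => (fderiv ℂ (Ψ i) p (1, 0)).1) (coneGerm τ {i}) (𝓝 1) ∧
      Ord τ {i} 1 (fun p => (fderiv ℂ (Ψ i) p (1, 0)).2) ∧
      Tendsto (fun p => (fderiv ℂ (Ψ i) p (0, 1)).2) (coneGerm τ {i}) (𝓝 1) := by
  have hd : ∀ᶠ p in coneGerm τ {i}, DifferentiableAt ℂ (Ψ i) p :=
    (hΨ.eventually_analyticAt i).mono fun p hp => hp.differentiableAt
  have hid : ∀ᶠ p in coneGerm τ {i}, DifferentiableAt ℂ (fun p : ℂ × ℂ => p) p :=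
    Eventually.of_forall fun p => differentiableAt_id
  have h0 : Ord τ {i} (0 : ℤ) (fun p => (Ψ i p).1 - p.1) := by
    have := (hΨ.ord_sub_jet i 0).1
    simpa [jet] using this
  have h1 : Ord τ {i} (1 : ℤ) (fun p => (Ψ i p).2 - p.2) := by
    have := (hΨ.ord_sub_jet i 1).2
    simpa [jet] using this
  have e1 := ((ord_partials_sub hd hid).1 h0).1.tendsto le_rfl
  have e2 := ((ord_partials_sub hd hid).2 h1).1
  have e3 := ((ord_partials_sub hd hid).2 h1).2.tendsto (by norm_num)
  simp only [fderiv_fun_id, ContinuousLinearMap.id_apply, sub_zero] at e1 e2 e3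
  refine ⟨?_, e2, ?_⟩
  · simpa using e1.add_const (1 : ℂ)
  · simpa using e3.add_const (1 : ℂ)

theorem IsFormalNormalization.nearRot (hF : IsFormalNormalization τ F a b) (S : Set (Fin 4)) :
    NearRot τ S (Complex.exp (2 * Real.pi * Complex.I * τ)) F := by
  constructor
  · have h1 : ∀ z : ℂ, z ≠ 0 → AnalyticAt ℂ
        (fun p => (F p).1 - Complex.exp (2 * Real.pi * Complex.I * τ) * p.1) (z, 0) := fun z hz =>
      (analyticAt_fst.comp (hF.analytic z hz)).sub (analyticAt_const.mul analyticAt_fst)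
    refine (ord_of_analytic (N := 1) h1 fun z hz => ?_).tendsto (by norm_num)
    have h2 : AnalyticAt ℂ (fun y : ℂ => (F (z, y)).1 -
        Complex.exp (2 * Real.pi * Complex.I * τ) * z) 0 :=
      (h1 z hz).comp_of_eq (by fun_prop : AnalyticAt ℂ (fun y : ℂ => (z, y)) 0) rfl
    have h3 := h2.differentiableAt.isBigO_sub
    simpa [hF.on_curve z hz] using h3
  · have h1 : ∀ z : ℂ, z ≠ 0 → AnalyticAt ℂ (fun p => (F p).2 - p.2) (z, 0) := fun z hz =>
      (analyticAt_snd.comp (hF.analytic z hz)).sub analyticAt_snd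
    have h := ord_of_analytic (τ := τ) (S := S) (N := 2) h1 fun z hz => ?_
    · have h2 : Ord τ S 1 (fun p => (F p).2 - p.2) := h
      simp only [Ord, zpow_one] at h2
      have h3 := h2.tendsto_div_nhds_zero.add_const (1 : ℂ)
      rw [zero_add] at h3
      refine h3.congr' ?_
      filter_upwards [eventually_snd_ne_zero τ S] with p hp
      field_simp
      ring
    · have h2 := (hF.conj 1 z hz).norm_left
      have h4 : (fun y : ℂ => (F (z, y)).2 - y / (1 - y)) =O[𝓝 0] (fun y : ℂ => y ^ 2) := by
        refine (IsBigO.of_bound 1 (Eventually.of_forall fun y => ?_)).trans h2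
        rw [one_mul, norm_norm]
        refine le_trans (le_of_eq ?_) (norm_snd_le _)
        simp [jet, modelMap]
      have h5 : (fun y : ℂ => y / (1 - y) - y) =O[𝓝 0] (fun y : ℂ => y ^ 2) := by
        have hc : ContinuousAt (fun y : ℂ => (1 - y)⁻¹) 0 :=
          ((continuous_const.sub continuous_id).continuousAt).inv₀ (by simp)
        have := (isBigO_refl (fun y : ℂ => y ^ 2) (𝓝 0)).mul (hc.isBigO_one ℂ)
        simp only [mul_one] at this
        refine EventuallyEq.trans_isBigO ?_ this
        have hne : ∀ᶠ y : ℂ in 𝓝 0, 1 - y ≠ 0 :=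
          ((continuous_const.sub continuous_id).continuousAt).eventually_ne (by simp)
        filter_upwards [hne] with y hy
        field_simp
        ring
      simpa using h4.add h5

end Normalization

/-! ### Foliations and the sectorial charts -/

/-- The form `z y ^ 2 Π^*(α dX / X + β dY / Y)`, which is holomorphic along the curve. -/
noncomputable def clearedCovec (τ α β : ℂ) (p : ℂ × ℂ) : ℂ × ℂ →L[ℂ] ℂ :=
  (β * p.2 ^ 2) • ContinuousLinearMap.fst ℂ ℂ ℂ
    - (2 * Real.pi * Complex.I * (α + τ * β) * p.1) • ContinuousLinearMap.snd ℂ ℂ ℂ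

theorem pencilForm_eq (τ u v : ℂ) : pencilForm τ u v = clearedCovec τ ((v - u) * τ) u := by
  funext p
  simp only [pencilForm, clearedCovec]
  congr 2
  ring

theorem clearedCovec_comp_apply (τ α β : ℂ) (p : ℂ × ℂ) (L : ℂ × ℂ →L[ℂ] ℂ × ℂ) (w : ℂ × ℂ) :
    (clearedCovec τ α β p).comp L w = β * p.2 ^ 2 * (L w).1
      - 2 * Real.pi * Complex.I * (α + τ * β) * p.1 * (L w).2 := by
  simp [clearedCovec]

theorem clearedCovec_eq_smul (τ α β : ℂ) {p : ℂ × ℂ} (hp1 : p.1 ≠ 0) (hp2 : p.2 ≠ 0) :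
    clearedCovec τ α β p = (p.1 * p.2 ^ 2) •
      (logCovec α β (serreMap τ p)).comp (fderiv ℂ (serreMap τ) p) := by
  rw [logCovec_comp_serreMap τ α β hp1 hp2]
  apply covector_ext
  · simp [clearedCovec]; field_simp
  · simp [clearedCovec]; field_simp

/-- The map `Π` is invariant under the model map, so it is defined on the quotient. -/
theorem serreMap_modelMap (τ : ℂ) {p : ℂ × ℂ} (hp : p.2 ≠ 0) :
    serreMap τ (modelMap τ p) = serreMap τ p := by
  have e : ∀ k : ℂ, k / (p.2 / (1 - p.2)) = k / p.2 - k := fun k => by field_simp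
  ext
  · simp only [serreMap, modelMap, e, Complex.exp_sub, Complex.exp_two_pi_mul_I, div_one]
  · simp only [serreMap, modelMap, e, Complex.exp_sub]
    have := Complex.exp_ne_zero (2 * Real.pi * Complex.I * τ)
    field_simp

theorem wedge_smul_left (c : ℂ) (α β : ℂ × ℂ →L[ℂ] ℂ) : wedge (c • α) β = c * wedge α β := by
  simp only [wedge, _root_.smul_apply, smul_eq_mul]; ring

theorem wedge_smul_right (c : ℂ) (α β : ℂ × ℂ →L[ℂ] ℂ) : wedge α (c • β) = c * wedge α β := by
  simp only [wedge, _root_.smul_apply, smul_eq_mul]; ring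

/-- The Plücker relation. -/
theorem wedge_plucker (α β γ δ : ℂ × ℂ →L[ℂ] ℂ) :
    wedge α γ * wedge β δ - wedge α δ * wedge β γ = wedge α β * wedge γ δ := by
  simp only [wedge]; ring

theorem analyticAt_logCovec (α β : ℂ) {p : ℂ × ℂ} (hp : p ∈ torus) :
    AnalyticAt ℂ (logCovec α β) p := by
  have h1 : AnalyticAt ℂ (fun p : ℂ × ℂ => α / p.1) p := analyticAt_const.div analyticAt_fst hp.1
  have h2 : AnalyticAt ℂ (fun p : ℂ × ℂ => β / p.2) p := analyticAt_const.div analyticAt_snd hp.2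
  exact (h1.smul analyticAt_const).add (h2.smul analyticAt_const)

theorem analyticAt_clm_apply {E G : Type*} [NormedAddCommGroup E] [NormedSpace ℂ E]
    [NormedAddCommGroup G] [NormedSpace ℂ G] [CompleteSpace G] {γ : E → ℂ × ℂ →L[ℂ] G} {p : E}
    (h : AnalyticAt ℂ γ p) (w : ℂ × ℂ) : AnalyticAt ℂ (fun p => γ p w) p :=
  (h.contDiffAt.clm_apply contDiffAt_const).analyticAt

theorem AnalyticAt.wedge {E : Type*} [NormedAddCommGroup E] [NormedSpace ℂ E]
    {α β : E → ℂ × ℂ →L[ℂ] ℂ} {p : E} (hα : AnalyticAt ℂ α p) (hβ : AnalyticAt ℂ β p) :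
    AnalyticAt ℂ (fun p => wedge (α p) (β p)) p := by
  have h := fun w => analyticAt_clm_apply hα w
  have h' := fun w => analyticAt_clm_apply hβ w
  exact ((h _).mul (h' _)).sub ((h _).mul (h' _))

theorem AnalyticAt.pullback {Φ : ℂ × ℂ → ℂ × ℂ} {ω : OneForm} {p : ℂ × ℂ}
    (hΦ : AnalyticAt ℂ Φ p) (hω : AnalyticAt ℂ ω (Φ p)) :
    AnalyticAt ℂ (pullback Φ ω) p := by
  have h1 : AnalyticAt ℂ (fun q => ω (Φ q)) p := AnalyticAt.comp hω hΦ
  exact (h1.contDiffAt.clm_comp hΦ.fderiv.contDiffAt).analyticAt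

section Normalization

variable {F : ℂ × ℂ → ℂ × ℂ} {a b : ℕ → ℂ → ℂ} {Ψ : Fin 4 → ℂ × ℂ → ℂ × ℂ} {u v : ℂ}
  {ω ω' : OneForm} {i : Fin 4}

theorem analyticAt_pencilForm (τ u v : ℂ) (p : ℂ × ℂ) : AnalyticAt ℂ (pencilForm τ u v) p := by
  have h1 : AnalyticAt ℂ (fun p : ℂ × ℂ => u * p.2 ^ 2) p :=
    analyticAt_const.mul (analyticAt_snd.pow 2)
  have h2 : AnalyticAt ℂ (fun p : ℂ × ℂ => 2 * Real.pi * Complex.I * τ * v * p.1) p :=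
    analyticAt_const.mul analyticAt_fst
  exact (h1.smul analyticAt_const).sub (h2.smul analyticAt_const)

theorem Bdd.of_analyticAt_form (h : ∀ z : ℂ, z ≠ 0 → AnalyticAt ℂ ω (z, 0)) (w : ℂ × ℂ) :
    Bdd τ S (fun p => ω p w) :=
  Bdd.of_continuousAt fun z hz => (h z hz).continuousAt.clm_apply continuousAt_const

theorem MapApprox.pullback_pencilForm {Φ Φ' : ℂ × ℂ → ℂ × ℂ} (h : MapApprox τ S n Φ Φ') :
    Approx τ S n (fun p => pullback Φ (pencilForm τ u v) p (1, 0))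
      (fun p => pullback Φ' (pencilForm τ u v) p (1, 0)) ∧
    Approx τ S n (fun p => pullback Φ (pencilForm τ u v) p (0, 1))
      (fun p => pullback Φ' (pencilForm τ u v) p (0, 1)) := by
  simp only [pullback, pencilForm_eq, clearedCovec_comp_apply]
  have h2 := h.snd.mul h.snd
  simp only [← sq] at h2
  exact ⟨((h2.const_mul _).mul h.fst_fst).sub ((h.fst.const_mul _).mul h.snd_fst),
    ((h2.const_mul _).mul h.fst_snd).sub ((h.fst.const_mul _).mul h.snd_snd)⟩

/-- Replacing a sectorial normalization by the jet of order `N` costs an error `o(y ^ (N - 1))`. -/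
theorem approx_wedge_jet (hF : IsFormalNormalization τ F a b)
    (hΨ : IsSectorialNormalization τ F a b Ψ) (hω : ∀ z : ℂ, z ≠ 0 → AnalyticAt ℂ ω (z, 0))
    (i : Fin 4) (N : ℕ) :
    Approx τ {i} ((N : ℤ) - 1) (fun p => wedge (ω p) (pullback (Ψ i) (pencilForm τ u v) p))
      (fun p => wedge (ω p) (pullback (jet a b N) (pencilForm τ u v) p)) := by
  have h := (hΨ.mapApprox hF i N).pullback_pencilForm (u := u) (v := v)
  simp only [wedge]
  exact ((Approx.refl (Bdd.of_analyticAt_form hω _)).mul h.2).sub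
    ((Approx.refl (Bdd.of_analyticAt_form hω _)).mul h.1)

theorem analyticAt_wedge_jet (hF : IsFormalNormalization τ F a b)
    (hω : ∀ z : ℂ, z ≠ 0 → AnalyticAt ℂ ω (z, 0)) (N : ℕ) {z : ℂ} (hz : z ≠ 0) :
    AnalyticAt ℂ (fun p => wedge (ω p) (pullback (jet a b N) (pencilForm τ u v) p)) (z, 0) :=
  AnalyticAt.wedge (hω z hz)
    (AnalyticAt.pullback (hF.analyticAt_jet N hz) (analyticAt_pencilForm τ u v _))

/-- The formal completion is the member of parameter `u / v` of the formal pencil iff, in a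
sector, the foliation is tangent to infinite order to the pull-back of that member of the model
pencil by the sectorial normalization. -/
theorem hasFormalCompletion_iff (hτ : 0 < τ.im) (hF : IsFormalNormalization τ F a b)
    (hΨ : IsSectorialNormalization τ F a b Ψ) (hω : ∀ z : ℂ, z ≠ 0 → AnalyticAt ℂ ω (z, 0))
    (i : Fin 4) :
    HasFormalCompletion τ u v a b ω ↔
      Flat τ {i} (fun p => wedge (ω p) (pullback (Ψ i) (pencilForm τ u v) p)) := by
  have hA := fun N (z : ℂ) (hz : z ≠ 0) =>
    analyticAt_wedge_jet (u := u) (v := v) hF hω N hz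
  constructor
  · intro h k
    have h1 : ∀ N : ℕ, Ord τ {i} ((N : ℤ) - 1)
        (fun p => wedge (ω p) (pullback (Ψ i) (pencilForm τ u v) p)) := by
      intro N
      have e1 := (approx_wedge_jet (u := u) (v := v) hF hΨ hω i N).ord
      have e2 := ord_of_analytic (τ := τ) (S := {i}) (N := N) (hA N) (h N)
      simpa using e1.add e2
    exact (h1 (k + 1).toNat).mono (by have := Int.self_le_toNat (k + 1); omega)
  · intro h N z hz
    have e1 := (approx_wedge_jet (u := u) (v := v) hF hΨ hω i N).ord
    have e2 : Ord τ {i} ((N : ℤ) - 1)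
        (fun p => wedge (ω p) (pullback (jet a b N) (pencilForm τ u v) p)) := by
      simpa using (h ((N : ℤ) - 1)).sub e1
    exact e2.isBigO_transversal (i := i) hτ (by simp) hz (hA N z hz)

theorem IsSectorialNormalization.tendsto_coneGerm
    (hΨ : IsSectorialNormalization τ F a b Ψ) (i : Fin 4) (hi : i ∈ S) :
    Tendsto (Ψ i) (coneGerm τ S) (coneGerm τ S) :=
  (hΨ.nearRot i).tendsto one_ne_zero (Set.singleton_subset_iff.2 hi)

theorem IsFormalNormalization.tendsto_coneGerm (hF : IsFormalNormalization τ F a b)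
    (S : Set (Fin 4)) : Tendsto F (coneGerm τ S) (coneGerm τ S) :=
  (hF.nearRot S).tendsto (Complex.exp_ne_zero _) subset_rfl

theorem IsFormalNormalization.eventually_analyticAt (hF : IsFormalNormalization τ F a b)
    (S : Set (Fin 4)) : ∀ᶠ p in coneGerm τ S, AnalyticAt ℂ F p :=
  eventually_coneGerm_of_nhds fun z hz => (hF.analytic z hz).eventually_analyticAt

theorem IsSectorialNormalization.eventually_ne_zero
    (hΨ : IsSectorialNormalization τ F a b Ψ) (i : Fin 4) :
    ∀ᶠ p in coneGerm τ {i}, (Ψ i p).1 ≠ 0 ∧ (Ψ i p).2 ≠ 0 :=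
  (hΨ.tendsto_coneGerm i (Set.mem_singleton i)).eventually
    ((eventually_fst_ne_zero τ {i}).and (eventually_snd_ne_zero τ {i}))

theorem IsSectorialNormalization.tendsto_chart (hτ : 0 < τ.im)
    (hΨ : IsSectorialNormalization τ F a b Ψ) (i : Fin 4) :
    Tendsto (sectorialChart τ Ψ i) (coneGerm τ {i}) (lineGerm i) :=
  (tendsto_serreMap_lineGerm hτ i).comp (hΨ.tendsto_coneGerm i (Set.mem_singleton i))

theorem IsSectorialNormalization.analyticAt_chart
    (hΨ : IsSectorialNormalization τ F a b Ψ) (i : Fin 4) :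
    ∀ᶠ p in coneGerm τ {i}, AnalyticAt ℂ (sectorialChart τ Ψ i) p := by
  filter_upwards [hΨ.eventually_analyticAt i, hΨ.eventually_ne_zero i] with p h1 h2
  have h3 : AnalyticAt ℂ (serreMap τ) (Ψ i p) := by
    have e : ∀ k : ℂ, AnalyticAt ℂ (fun p : ℂ × ℂ => Complex.exp (k / p.2)) (Ψ i p) := fun k =>
      (analyticAt_const.div analyticAt_snd h2.2).cexp
    exact (e _).prod (analyticAt_fst.mul (e _))
  exact AnalyticAt.comp h3 h1

/-- The sectorial charts are invariant under `F`, so they are charts of the quotient. -/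
theorem IsSectorialNormalization.chart_comp
    (hΨ : IsSectorialNormalization τ F a b Ψ) (i : Fin 4) :
    ∀ᶠ p in coneGerm τ {i}, sectorialChart τ Ψ i (F p) = sectorialChart τ Ψ i p := by
  filter_upwards [hΨ.eventually_conj i, hΨ.eventually_ne_zero i] with p h1 h2
  simp only [sectorialChart]
  rw [h1, serreMap_modelMap τ h2.2]

theorem IsSectorialNormalization.tendsto_jac (hF : IsFormalNormalization τ F a b)
    (hΨ : IsSectorialNormalization τ F a b Ψ) (i : Fin 4) :
    Tendsto (jac (Ψ i)) (coneGerm τ {i}) (𝓝 1) := by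
  obtain ⟨h1, h2, h3⟩ := hΨ.tendsto_partials i
  have h4 := (hΨ.mapApprox hF i 0).fst_snd.left
  have h5 := (h2.mul_bdd h4).tendsto (by norm_num)
  have h6 := (h1.mul h3).sub h5
  simp only [mul_one, sub_zero] at h6
  refine h6.congr fun p => ?_
  simp only [jac, wedge, ContinuousLinearMap.comp_apply, ContinuousLinearMap.coe_fst',
    ContinuousLinearMap.coe_snd']
  ring

theorem IsSectorialNormalization.jac_chart_ne_zero (hF : IsFormalNormalization τ F a b)
    (hΨ : IsSectorialNormalization τ F a b Ψ) (i : Fin 4) :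
    ∀ᶠ p in coneGerm τ {i}, jac (sectorialChart τ Ψ i) p ≠ 0 := by
  filter_upwards [(hΨ.tendsto_jac hF i).eventually_ne one_ne_zero, hΨ.eventually_analyticAt i,
    hΨ.eventually_ne_zero i] with p h1 h2 h3
  have := jac_comp (f := Ψ i) (g := serreMap τ) (p := p)
    (hasStrictFDerivAt_serreMap τ h3.2).hasFDerivAt.differentiableAt h2.differentiableAt
  unfold sectorialChart
  rw [this]
  exact mul_ne_zero (jac_serreMap τ h3.2) h1

/-- The pull-back of a form by a sectorial chart is invariant under the gluing map `F`. -/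
theorem IsSectorialNormalization.pullback_chart_invariant (hF : IsFormalNormalization τ F a b)
    (hΨ : IsSectorialNormalization τ F a b Ψ) (i : Fin 4) (α : OneForm) :
    ∀ᶠ p in coneGerm τ {i}, pullback F (pullback (sectorialChart τ Ψ i) α) p =
      pullback (sectorialChart τ Ψ i) α p ∧ jac F p ≠ 0 := by
  filter_upwards [eventually_eventually_coneGerm (hΨ.chart_comp i),
    (hF.tendsto_coneGerm {i}).eventually (hΨ.analyticAt_chart i),
    hF.eventually_analyticAt {i}, hΨ.jac_chart_ne_zero hF i] with p h1 h2 h3 h4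
  have e := pullback_congr (g := sectorialChart τ Ψ i) h1 α
  rw [pullback_comp h2.differentiableAt h3.differentiableAt] at e
  refine ⟨e, fun h0 => h4 ?_⟩
  have e2 := jac_comp (p := p) h2.differentiableAt h3.differentiableAt
  rw [h0, mul_zero] at e2
  rw [← e2]
  unfold jac
  rw [EventuallyEq.fderiv_eq h1]

/-- The pull-back of the form `α dX / X + β dY / Y` by a sectorial chart, up to a factor. -/
theorem IsSectorialNormalization.cleared_eq (hΨ : IsSectorialNormalization τ F a b Ψ)
    (i : Fin 4) : ∀ᶠ p in coneGerm τ {i}, (Ψ i p).1 * (Ψ i p).2 ^ 2 ≠ 0 ∧ ∀ α β : ℂ,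
      (clearedCovec τ α β (Ψ i p)).comp (fderiv ℂ (Ψ i) p) =
        ((Ψ i p).1 * (Ψ i p).2 ^ 2) •
          (logCovec α β (sectorialChart τ Ψ i p)).comp (fderiv ℂ (sectorialChart τ Ψ i) p) := by
  filter_upwards [hΨ.eventually_analyticAt i, hΨ.eventually_ne_zero i] with p h1 h2
  refine ⟨mul_ne_zero h2.1 (pow_ne_zero _ h2.2), fun α β => ?_⟩
  rw [clearedCovec_eq_smul τ α β h2.1 h2.2]
  have : fderiv ℂ (sectorialChart τ Ψ i) p = _ := fderiv_comp p
    (hasStrictFDerivAt_serreMap τ h2.2).hasFDerivAt.differentiableAt h1.differentiableAt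
  rw [this, ContinuousLinearMap.smul_comp, ContinuousLinearMap.comp_assoc]
  rfl

/-- An invariant holomorphic function on a sector, with limit zero, is a holomorphic function of
the coordinate vanishing on `L_i`, in the sectorial chart. -/
theorem IsSectorialNormalization.exists_eq_comp_chart (hτ : 0 < τ.im)
    (hF : IsFormalNormalization τ F a b)
    (hΨ : IsSectorialNormalization τ F a b Ψ) (i : Fin 4) {f : ℂ × ℂ → ℂ}
    (hd : ∀ᶠ p in coneGerm τ {i}, DifferentiableAt ℂ f p)
    (hinv : ∀ᶠ p in coneGerm τ {i}, f (F p) = f p)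
    (hf : Tendsto f (coneGerm τ {i}) (𝓝 0)) :
    ∃ k : ℂ → ℂ, AnalyticAt ℂ k 0 ∧ k 0 = 0 ∧
      ∀ᶠ p in coneGerm τ {i}, f p = k (lineCoord i (sectorialChart τ Ψ i p)) := by
  obtain ⟨Θ, h1, h2, h3, h4⟩ := exists_sectorial_inverse (hΨ.eventually_analyticAt i) (hΨ.nearRot i)
  have ht : Tendsto Θ (coneGerm τ {i}) (coneGerm τ {i}) := h1.tendsto one_ne_zero subset_rfl
  have hm : Tendsto (modelMap τ) (coneGerm τ {i}) (coneGerm τ {i}) := by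
    rw [modelMap_eq_modelIter]; exact tendsto_modelIter τ {i} 1
  have hs := hΨ.tendsto_coneGerm i (Set.mem_singleton i)
  have hd' : ∀ᶠ p in coneGerm τ {i}, DifferentiableAt ℂ (fun p => f (Θ p)) p := by
    filter_upwards [h2, ht.eventually hd] with p e1 e2
    exact DifferentiableAt.comp p (g := f) e2 e1
  have hinv' : ∀ᶠ p in coneGerm τ {i}, f (Θ (modelMap τ p)) = f (Θ p) := by
    filter_upwards [ht.eventually hinv, ht.eventually (hΨ.eventually_conj i), h3,
      ht.eventually ((hF.tendsto_coneGerm {i}).eventually h4)] with p e1 e2 e3 e4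
    rw [← e1, ← e4, e2, e3]
  obtain ⟨k, hk, hk0, h⟩ := exists_eq_comp_lineCoord hτ i hd' hinv' (hf.comp ht)
  refine ⟨k, hk, hk0, ?_⟩
  filter_upwards [hs.eventually h, h4] with p e1 e2
  rw [e2] at e1
  exact e1

end Normalization

/-! ### Normal form of a convergent foliation in a sector -/

theorem clearedCovec_wedge (τ α β α' β' : ℂ) (p : ℂ × ℂ) :
    wedge (clearedCovec τ α β p) (clearedCovec τ α' β' p) =
      2 * Real.pi * Complex.I * (α * β' - β * α') * (p.1 * p.2 ^ 2) := by
  simp only [wedge, clearedCovec, _root_.sub_apply, _root_.smul_apply, smul_eq_mul,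
    ContinuousLinearMap.coe_fst', ContinuousLinearMap.coe_snd']
  ring

/-- Expansion of a covector in a basis. -/
theorem wedge_mul_apply (α β γ : ℂ × ℂ →L[ℂ] ℂ) (w : ℂ × ℂ) :
    wedge α β * γ w = wedge γ β * α w - wedge γ α * β w := by
  rw [covector_apply α w, covector_apply β w, covector_apply γ w]
  simp only [wedge]; ring

theorem ord_snd_zpow (k : ℤ) : Ord τ S (k - 1) (fun p : ℂ × ℂ => p.2 ^ k) :=
  Ord.of_bound fun _ _ _ _ => ⟨1, 1, one_pos, fun p _ => by simp⟩

theorem bdd_fst_inv : Bdd τ S (fun p => p.1⁻¹) :=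
  Bdd.of_continuousAt fun _ hz => continuousAt_fst.inv₀ hz

section Normalization

variable {F : ℂ × ℂ → ℂ × ℂ} {a b : ℕ → ℂ → ℂ} {Ψ : Fin 4 → ℂ × ℂ → ℂ × ℂ} {u v : ℂ}
  {ω ω' : OneForm} {i : Fin 4}

theorem IsSectorialNormalization.tendsto_fst_div (hΨ : IsSectorialNormalization τ F a b Ψ)
    (i : Fin 4) : Tendsto (fun p => (Ψ i p).1 / p.1) (coneGerm τ {i}) (𝓝 1) := by
  have h1 : Ord τ {i} 0 (fun p => (Ψ i p).1 - p.1) := by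
    have := (hΨ.ord_sub_jet i 0).1
    simpa [jet] using this
  have h2 := ((h1.mul_bdd bdd_fst_inv).tendsto le_rfl).add_const (1 : ℂ)
  rw [zero_add] at h2
  refine h2.congr' ?_
  filter_upwards [eventually_fst_ne_zero τ {i}] with p hp
  field_simp
  ring

/-- The factor `z y ^ 2` of the form `z y ^ 2 Π^*(dX / X ∧ dY / Y)`, pulled back by `Ψ`, is
comparable with `z y ^ 2`. -/
theorem IsSectorialNormalization.ord_inv_jac (hF : IsFormalNormalization τ F a b)
    (hΨ : IsSectorialNormalization τ F a b Ψ) (i : Fin 4) :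
    Ord τ {i} (-3) (fun p => ((Ψ i p).1 * (Ψ i p).2 ^ 2 * jac (Ψ i) p)⁻¹) ∧
      ∀ᶠ p in coneGerm τ {i}, (Ψ i p).1 * (Ψ i p).2 ^ 2 * jac (Ψ i) p ≠ 0 := by
  have h := ((hΨ.tendsto_fst_div i).mul (((hΨ.nearRot i).snd).pow 2)).mul (hΨ.tendsto_jac hF i)
  simp only [one_pow, mul_one] at h
  have h1 := (Bdd.of_tendsto (h.inv₀ one_ne_zero)).mul bdd_fst_inv
  have h2 := (ord_snd_zpow (τ := τ) (S := {i}) (-2)).mul_bdd h1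
  constructor
  · refine h2.congr' ?_
    filter_upwards [eventually_fst_ne_zero τ {i}, eventually_snd_ne_zero τ {i}] with p h3 h4
    rw [zpow_neg, zpow_ofNat]
    field_simp
  · filter_upwards [(hΨ.tendsto_jac hF i).eventually_ne one_ne_zero,
      hΨ.eventually_ne_zero i] with p h3 h4
    exact mul_ne_zero (mul_ne_zero h4.1 (pow_ne_zero _ h4.2)) h3

theorem IsSectorialNormalization.bdd_cleared (hF : IsFormalNormalization τ F a b)
    (hΨ : IsSectorialNormalization τ F a b Ψ) (i : Fin 4) (α β : ℂ) :
    Bdd τ {i} (fun p => (clearedCovec τ α β (Ψ i p)).comp (fderiv ℂ (Ψ i) p) (1, 0)) ∧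
    Bdd τ {i} (fun p => (clearedCovec τ α β (Ψ i p)).comp (fderiv ℂ (Ψ i) p) (0, 1)) := by
  have h := hΨ.mapApprox hF i 0
  simp only [clearedCovec_comp_apply, sq]
  exact ⟨(((h.snd.left.mul h.snd.left).const_mul _).mul h.fst_fst.left).sub
      ((h.fst.left.const_mul _).mul h.snd_fst.left),
    (((h.snd.left.mul h.snd.left).const_mul _).mul h.fst_snd.left).sub
      ((h.fst.left.const_mul _).mul h.snd_snd.left)⟩

/-- Let `L₀`, `L₁` be independent logarithmic forms with constant coefficients. If the foliation
`ω = 0` is tangent to `Π_i^* L₀ = 0` to infinite order, then `(ω ∧ Π_i^* L₀) / (ω ∧ Π_i^* L₁)` is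
flat, because `ω` does not vanish on the curve. -/
theorem IsSectorialNormalization.flat_ratio (hF : IsFormalNormalization τ F a b)
    (hΨ : IsSectorialNormalization τ F a b Ψ) (i : Fin 4)
    (hω : ∀ z : ℂ, z ≠ 0 → AnalyticAt ℂ ω (z, 0)) (hω0 : ∀ z : ℂ, z ≠ 0 → ω (z, 0) ≠ 0)
    {α₀ β₀ α₁ β₁ : ℂ} (hdet : α₀ * β₁ - β₀ * α₁ ≠ 0)
    (hflat : Flat τ {i}
      (fun p => wedge (ω p) ((clearedCovec τ α₀ β₀ (Ψ i p)).comp (fderiv ℂ (Ψ i) p)))) :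
    Flat τ {i} (fun p => wedge (ω p) (pullback (sectorialChart τ Ψ i) (logCovec α₀ β₀) p) /
        wedge (ω p) (pullback (sectorialChart τ Ψ i) (logCovec α₁ β₁) p)) ∧
      ∀ᶠ p in coneGerm τ {i},
        wedge (ω p) (pullback (sectorialChart τ Ψ i) (logCovec α₁ β₁) p) ≠ 0 := by
  set C₀ : OneForm := fun p => (clearedCovec τ α₀ β₀ (Ψ i p)).comp (fderiv ℂ (Ψ i) p) with hC₀
  set C₁ : OneForm := fun p => (clearedCovec τ α₁ β₁ (Ψ i p)).comp (fderiv ℂ (Ψ i) p) with hC₁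
  set D := 2 * Real.pi * Complex.I * (α₀ * β₁ - β₀ * α₁) with hD
  have hD0 : D ≠ 0 := mul_ne_zero Complex.two_pi_I_ne_zero hdet
  -- `Q` is the squared Hermitian norm of `ω`, which is bounded below near the curve
  set Q : ℂ × ℂ → ℂ := fun p =>
    ω p (1, 0) * (starRingEnd ℂ) (ω p (1, 0)) + ω p (0, 1) * (starRingEnd ℂ) (ω p (0, 1)) with hQ
  have hQe : ∀ p, Q p = ((Complex.normSq (ω p (1, 0)) + Complex.normSq (ω p (0, 1)) : ℝ) : ℂ) := by
    intro p
    simp only [hQ, Complex.mul_conj]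
    push_cast; ring
  have hQ0 : ∀ p, ω p ≠ 0 → Q p ≠ 0 := by
    intro p hp
    rw [hQe]
    have n1 := Complex.normSq_nonneg (ω p (1, 0))
    have n2 := Complex.normSq_nonneg (ω p (0, 1))
    rcases covector_ne_zero hp with h | h
    · have := Complex.normSq_pos.2 h
      exact_mod_cast (by linarith : (0 : ℝ) < _).ne'
    · have := Complex.normSq_pos.2 h
      exact_mod_cast (by linarith : (0 : ℝ) < _).ne'
  have hQc : ∀ z : ℂ, z ≠ 0 → ContinuousAt Q (z, 0) := by
    intro z hz
    have h1 : ∀ w, ContinuousAt (fun p => ω p w) (z, 0) := fun w =>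
      (hω z hz).continuousAt.clm_apply continuousAt_const
    have h2 : ∀ w, ContinuousAt (fun p => (starRingEnd ℂ) (ω p w)) (z, 0) := fun w =>
      Complex.continuous_conj.continuousAt.comp (h1 w)
    exact ((h1 _).mul (h2 _)).add ((h1 _).mul (h2 _))
  have hQinv : Bdd τ {i} (fun p => (Q p)⁻¹) :=
    Bdd.of_continuousAt fun z hz => (hQc z hz).inv₀ (hQ0 _ (hω0 z hz))
  have hQne : ∀ᶠ p in coneGerm τ {i}, Q p ≠ 0 := eventually_coneGerm_of_nhds fun z hz =>
    (hQc z hz).eventually_ne (hQ0 _ (hω0 z hz))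
  obtain ⟨hJ, hJ0⟩ := hΨ.ord_inv_jac hF i
  set J : ℂ × ℂ → ℂ := fun p => (Ψ i p).1 * (Ψ i p).2 ^ 2 * jac (Ψ i) p with hJdef
  set R : ℂ × ℂ → ℂ := fun p => (J p)⁻¹ * (D⁻¹ * (Q p)⁻¹) with hR
  have hRo : Ord τ {i} (-3) R := hJ.mul_bdd (hQinv.const_mul _)
  have hbω := fun w => Bdd.of_analyticAt_form (τ := τ) (S := {i}) hω w
  set U : ℂ × ℂ → ℂ := fun p => C₀ p (1, 0) * (starRingEnd ℂ) (ω p (1, 0))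
    + C₀ p (0, 1) * (starRingEnd ℂ) (ω p (0, 1)) with hU
  set V : ℂ × ℂ → ℂ := fun p => C₁ p (1, 0) * (starRingEnd ℂ) (ω p (1, 0))
    + C₁ p (0, 1) * (starRingEnd ℂ) (ω p (0, 1)) with hV
  have hb₀ := hΨ.bdd_cleared hF i α₀ β₀
  have hb₁ := hΨ.bdd_cleared hF i α₁ β₁
  have hUb : Bdd τ {i} U := (hb₀.1.mul (hbω _).conj).add (hb₀.2.mul (hbω _).conj)
  have hVb : Bdd τ {i} V := (hb₁.1.mul (hbω _).conj).add (hb₁.2.mul (hbω _).conj)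
  -- the relation `A U R = 1 + G V R`, where `A = ω ∧ C₁` and `G = ω ∧ C₀` is flat
  have hrel : ∀ᶠ p in coneGerm τ {i},
      1 + wedge (ω p) (C₀ p) * V p * R p = wedge (ω p) (C₁ p) * (U p * R p) := by
    filter_upwards [hJ0, hQne] with p h1 h2
    have hW : wedge (C₀ p) (C₁ p) = D * J p := by
      simp only [hC₀, hC₁]
      rw [wedge_comp, clearedCovec_wedge]
      change D * ((Ψ i p).1 * (Ψ i p).2 ^ 2) * jac (Ψ i) p = D * J p
      simp only [hJdef]
      ring
    have e1 := wedge_mul_apply (C₀ p) (C₁ p) (ω p) (1, 0)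
    have e2 := wedge_mul_apply (C₀ p) (C₁ p) (ω p) (0, 1)
    rw [hW] at e1 e2
    have e3 : D * J p * Q p = wedge (ω p) (C₁ p) * U p - wedge (ω p) (C₀ p) * V p := by
      simp only [hQ, hU, hV]
      linear_combination (starRingEnd ℂ) (ω p (1, 0)) * e1 + (starRingEnd ℂ) (ω p (0, 1)) * e2
    have e4 : D * J p * Q p * R p = 1 := by
      have h1' : J p ≠ 0 := h1
      simp only [hR]; field_simp
    linear_combination e3 * R p - e4
  have hlim : Tendsto (fun p => wedge (ω p) (C₁ p) * (U p * R p)) (coneGerm τ {i}) (𝓝 1) := by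
    have h1 := (((hflat.mul_bdd hVb).mul_ord hRo) 0).tendsto le_rfl
    have h2 := h1.const_add (1 : ℂ)
    rw [add_zero] at h2
    exact h2.congr' hrel
  have hne := hlim.eventually_ne one_ne_zero
  have hT : Flat τ {i} (fun p => wedge (ω p) (C₀ p) / wedge (ω p) (C₁ p)) := by
    have h1 := ((hflat.mul_bdd hUb).mul_ord hRo).mul_bdd (Bdd.of_tendsto (hlim.inv₀ one_ne_zero))
    refine h1.congr' ?_
    filter_upwards [hne] with p hp
    have hA := left_ne_zero_of_mul hp
    have hB := right_ne_zero_of_mul hp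
    have hU0 := left_ne_zero_of_mul hB
    have hR0 := right_ne_zero_of_mul hB
    generalize wedge (ω p) (C₁ p) = A at *
    generalize U p = U at *
    generalize R p = R at *
    field_simp
    rfl
  constructor
  · refine hT.congr' ?_
    filter_upwards [hΨ.cleared_eq i] with p hp
    simp only [hC₀, hC₁, hp.2, wedge_smul_right]
    rw [mul_div_mul_left _ _ hp.1]
    rfl
  · filter_upwards [hΨ.cleared_eq i, hne] with p hp h1 h2
    refine left_ne_zero_of_mul h1 ?_
    simp only [hC₁, hp.2, wedge_smul_right]
    exact mul_eq_zero_of_right _ h2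

/-- A convergent member of the formal pencil is given, in a sector and in the sectorial chart, by
a logarithmic form whose coefficients are holomorphic functions of the coordinate vanishing
on `L_i`; the direction `(α₁, β₁)` of the deviation from constant coefficients is arbitrary. -/
theorem exists_lineForm_of_foliation (hτ : 0 < τ.im) (hF : IsFormalNormalization τ F a b)
    (hΨ : IsSectorialNormalization τ F a b Ψ) (hω : IsFoliation F ω)
    (hc : HasFormalCompletion τ u v a b ω) (i : Fin 4) {α₁ β₁ : ℂ}
    (hdet : (v - u) * τ * β₁ - u * α₁ ≠ 0) :
    ∃ k : ℂ → ℂ, AnalyticAt ℂ k 0 ∧ k 0 = 0 ∧ ∀ᶠ p in coneGerm τ {i},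
      wedge (ω p) (pullback (sectorialChart τ Ψ i)
        (lineForm i (fun l => (v - u) * τ + k l * α₁) (fun l => u + k l * β₁)) p) = 0 := by
  have hflat := (hasFormalCompletion_iff hτ hF hΨ hω.analytic i).1 hc
  rw [pencilForm_eq] at hflat
  obtain ⟨h1, h2⟩ := hΨ.flat_ratio hF i hω.analytic hω.regular hdet hflat
  set L₀ : OneForm := logCovec ((v - u) * τ) u with hL₀
  set L₁ : OneForm := logCovec α₁ β₁ with hL₁
  set P := sectorialChart τ Ψ i with hP
  have htorus : ∀ᶠ p in coneGerm τ {i}, P p ∈ torus :=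
    (hΨ.tendsto_chart hτ i).eventually (eventually_torus_lineGerm i)
  have hωa : ∀ᶠ p in coneGerm τ {i}, AnalyticAt ℂ ω p :=
    eventually_coneGerm_of_nhds fun z hz => (hω.analytic z hz).eventually_analyticAt
  have hd : ∀ᶠ p in coneGerm τ {i}, DifferentiableAt ℂ
      (fun p => wedge (ω p) (pullback P L₀ p) / wedge (ω p) (pullback P L₁ p)) p := by
    filter_upwards [htorus, hωa, hΨ.analyticAt_chart i, h2] with p e1 e2 e3 e4
    exact ((AnalyticAt.wedge e2 (AnalyticAt.pullback e3 (analyticAt_logCovec _ _ e1))).div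
      (AnalyticAt.wedge e2 (AnalyticAt.pullback e3 (analyticAt_logCovec _ _ e1))) e4
      ).differentiableAt
  -- invariance: `F^* ω` is collinear to `ω`, and the factor cancels in the quotient
  have hinv : ∀ᶠ p in coneGerm τ {i},
      wedge (ω (F p)) (pullback P L₀ (F p)) / wedge (ω (F p)) (pullback P L₁ (F p)) =
        wedge (ω p) (pullback P L₀ p) / wedge (ω p) (pullback P L₁ p) := by
    filter_upwards [h2, (hF.tendsto_coneGerm {i}).eventually h2,
      eventually_coneGerm_of_nhds hω.invariant, hΨ.pullback_chart_invariant hF i L₀,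
      hΨ.pullback_chart_invariant hF i L₁] with p e1 e2 e3 e4 e5
    rw [div_eq_div_iff e2 e1]
    have e6 := wedge_plucker (pullback F ω p) (ω p) (pullback P L₀ p) (pullback P L₁ p)
    rw [e3, zero_mul, sub_eq_zero] at e6
    have e7 := wedge_pullback F ω (pullback P L₀) p
    have e8 := wedge_pullback F ω (pullback P L₁) p
    rw [e4.1] at e7
    rw [e5.1] at e8
    rw [e7, e8] at e6
    refine mul_left_cancel₀ e4.2 ?_
    linear_combination e6
  obtain ⟨k, hk, hk0, h⟩ := hΨ.exists_eq_comp_chart hτ hF i hd hinv ((h1 0).tendsto le_rfl)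
  refine ⟨fun l => -k l, hk.neg, by simp [hk0], ?_⟩
  filter_upwards [h, h2] with p e1 e2
  rw [div_eq_iff e2] at e1
  have e3 : pullback P (lineForm i (fun l => (v - u) * τ + -k l * α₁) (fun l => u + -k l * β₁)) p
      = pullback P L₀ p - k (lineCoord i (P p)) • pullback P L₁ p := by
    simp only [pullback, ← ContinuousLinearMap.smul_comp, ← ContinuousLinearMap.sub_comp]
    congr 1
    apply covector_ext
    · simp only [lineForm, logCovec_fst, hL₀, hL₁, _root_.sub_apply, _root_.smul_apply,
        smul_eq_mul]
      ring
    · simp only [lineForm, logCovec_snd, hL₀, hL₁, _root_.sub_apply, _root_.smul_apply,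
        smul_eq_mul]
      ring
  rw [e3]
  have e4 : ∀ (α β γ : ℂ × ℂ →L[ℂ] ℂ), wedge α (β - γ) = wedge α β - wedge α γ := by
    intro α β γ
    simp only [wedge, _root_.sub_apply]; ring
  rw [e4, wedge_smul_right, e1, sub_self]

end Normalization

/-! ### The corners -/

/-- The exponent of `X` in the first coordinate centered at the corner. -/
def signX : Fin 4 → ℤ
  | 0 => 1
  | 1 => -1
  | 2 => -1
  | 3 => 1

/-- The exponent of `Y` in the second coordinate centered at the corner. -/
def signY : Fin 4 → ℤ
  | 0 => 1
  | 1 => 1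
  | 2 => -1
  | 3 => -1

/-- The coordinate vanishing on `L_i`, in the coordinates centered at a corner of `L_i`. -/
def axis : Fin 4 → ℂ × ℂ → ℂ
  | 0, x => x.1
  | 1, x => x.2
  | 2, x => x.1
  | 3, x => x.2

theorem cornerChart_eq (i : Fin 4) (p : ℂ × ℂ) :
    cornerChart i p = (p.1 ^ signX i, p.2 ^ signY i) := by
  fin_cases i <;> simp [cornerChart, signX, signY]

theorem cornerChart_cornerChart (i : Fin 4) (p : ℂ × ℂ) : cornerChart i (cornerChart i p) = p := by
  fin_cases i <;> simp [cornerChart]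

theorem lineCoord_eq_axis (i : Fin 4) (p : ℂ × ℂ) : lineCoord i p = axis i (cornerChart i p) := by
  fin_cases i <;> simp [cornerChart, lineCoord, axis]

theorem lineCoord_succ_eq_axis (i : Fin 4) (p : ℂ × ℂ) :
    lineCoord (i + 1) p = axis (i + 1) (cornerChart i p) := by
  fin_cases i <;> simp [cornerChart, lineCoord, axis, Fin.add_def]

theorem analyticAt_axis (i : Fin 4) (x : ℂ × ℂ) : AnalyticAt ℂ (axis i) x := by
  fin_cases i
  exacts [analyticAt_fst, analyticAt_snd, analyticAt_fst, analyticAt_snd]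

theorem axis_zero (i : Fin 4) : axis i 0 = 0 := by fin_cases i <;> rfl

theorem cornerChart_mem_torus (i : Fin 4) {p : ℂ × ℂ} (hp : p ∈ torus) :
    cornerChart i p ∈ torus := by
  rw [cornerChart_eq]; exact ⟨zpow_ne_zero _ hp.1, zpow_ne_zero _ hp.2⟩

theorem hasFDerivAt_cornerChart (i : Fin 4) {p : ℂ × ℂ} (hp : p ∈ torus) :
    HasFDerivAt (cornerChart i)
      (((signX i * (cornerChart i p).1 / p.1) • ContinuousLinearMap.fst ℂ ℂ ℂ).prod
        ((signY i * (cornerChart i p).2 / p.2) • ContinuousLinearMap.snd ℂ ℂ ℂ)) p := by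
  have h1 : ∀ k : ℤ, HasFDerivAt (fun p : ℂ × ℂ => p.1 ^ k)
      ((k * p.1 ^ k / p.1) • ContinuousLinearMap.fst ℂ ℂ ℂ) p := by
    intro k
    have := (hasDerivAt_zpow k p.1 (Or.inl hp.1)).comp_hasFDerivAt p
      (hasFDerivAt_fst (𝕜 := ℂ) (E := ℂ) (F := ℂ))
    rw [zpow_sub_one₀ hp.1] at this
    simpa [mul_div_assoc, div_eq_mul_inv, Function.comp_def, mul_assoc] using this
  have h2 : ∀ k : ℤ, HasFDerivAt (fun p : ℂ × ℂ => p.2 ^ k)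
      ((k * p.2 ^ k / p.2) • ContinuousLinearMap.snd ℂ ℂ ℂ) p := by
    intro k
    have := (hasDerivAt_zpow k p.2 (Or.inl hp.2)).comp_hasFDerivAt p
      (hasFDerivAt_snd (𝕜 := ℂ) (E := ℂ) (F := ℂ))
    rw [zpow_sub_one₀ hp.2] at this
    simpa [mul_div_assoc, div_eq_mul_inv, Function.comp_def, mul_assoc] using this
  have e : cornerChart i = fun p => (p.1 ^ signX i, p.2 ^ signY i) := funext (cornerChart_eq i)
  rw [e]
  exact (h1 _).prodMk (h2 _)

theorem tendsto_cornerChart (i : Fin 4) : Tendsto (cornerChart i) (cornerGerm i) (𝓝 0) :=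
  tendsto_comap.mono_left inf_le_left

theorem eventually_torus_cornerGerm (i : Fin 4) : ∀ᶠ p in cornerGerm i, p ∈ torus :=
  mem_inf_of_right (mem_principal_self _)

/-- The expression of `(X f, Y g)` in the coordinates centered at a corner, for `f` and `g`
functions of these coordinates. -/
noncomputable def cornerMap (i : Fin 4) (f g : ℂ × ℂ → ℂ) (x : ℂ × ℂ) : ℂ × ℂ :=
  (x.1 * f x ^ signX i, x.2 * g x ^ signY i)

theorem cornerChart_mul (i : Fin 4) (f g : ℂ × ℂ → ℂ) (p : ℂ × ℂ) :
    cornerChart i (p.1 * f (cornerChart i p), p.2 * g (cornerChart i p)) =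
      cornerMap i f g (cornerChart i p) := by
  rw [cornerChart_eq]
  simp only [mul_zpow]
  rw [cornerMap, cornerChart_eq i p]

theorem analyticAt_cornerMap (i : Fin 4) {f g : ℂ × ℂ → ℂ} {x : ℂ × ℂ} (hf : AnalyticAt ℂ f x)
    (hg : AnalyticAt ℂ g x) (hf0 : f x ≠ 0) (hg0 : g x ≠ 0) : AnalyticAt ℂ (cornerMap i f g) x :=
  (analyticAt_fst.mul (hf.zpow hf0)).prod (analyticAt_snd.mul (hg.zpow hg0))

theorem cornerMap_zero (i : Fin 4) (f g : ℂ × ℂ → ℂ) : cornerMap i f g 0 = 0 := by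
  simp [cornerMap]

/-- The numerator of the coefficient of `φ^* θ_i ∧ θ_{i+1}` at a corner, for `φ = (X f, Y g)` and
logarithmic forms `θ_i = α dX / X + β dY / Y`, `θ_{i+1} = α' dX / X + β' dY / Y`. -/
noncomputable def patchNum (i : Fin 4) (f g : ℂ × ℂ → ℂ) (α β α' β' : ℂ → ℂ) (x : ℂ × ℂ) : ℂ :=
  (α (axis i (cornerMap i f g x)) * (1 + signX i * x.1 * fderiv ℂ f x (1, 0) / f x)
      + β (axis i (cornerMap i f g x)) * (signX i * x.1 * fderiv ℂ g x (1, 0) / g x)) *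
      β' (axis (i + 1) x)
    - (α (axis i (cornerMap i f g x)) * (signY i * x.2 * fderiv ℂ f x (0, 1) / f x)
      + β (axis i (cornerMap i f g x)) * (1 + signY i * x.2 * fderiv ℂ g x (0, 1) / g x)) *
      α' (axis (i + 1) x)

theorem analyticAt_patchNum (i : Fin 4) {f g : ℂ × ℂ → ℂ} {α β α' β' : ℂ → ℂ}
    (hf : AnalyticAt ℂ f 0) (hg : AnalyticAt ℂ g 0) (hf0 : f 0 ≠ 0) (hg0 : g 0 ≠ 0)
    (hα : AnalyticAt ℂ α 0) (hβ : AnalyticAt ℂ β 0) (hα' : AnalyticAt ℂ α' 0)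
    (hβ' : AnalyticAt ℂ β' 0) : AnalyticAt ℂ (patchNum i f g α β α' β') 0 := by
  have h1 : AnalyticAt ℂ (fun x => axis i (cornerMap i f g x)) 0 :=
    AnalyticAt.comp (analyticAt_axis i _) (analyticAt_cornerMap i hf hg hf0 hg0)
  have h2 : AnalyticAt ℂ (axis (i + 1)) 0 := analyticAt_axis _ _
  have z1 : axis i (cornerMap i f g 0) = 0 := by rw [cornerMap_zero, axis_zero]
  have z2 : axis (i + 1) 0 = 0 := axis_zero _
  have a1 : AnalyticAt ℂ (fun x => α (axis i (cornerMap i f g x))) 0 := hα.comp_of_eq h1 z1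
  have a2 : AnalyticAt ℂ (fun x => β (axis i (cornerMap i f g x))) 0 := hβ.comp_of_eq h1 z1
  have a3 : AnalyticAt ℂ (fun x => α' (axis (i + 1) x)) 0 := hα'.comp_of_eq h2 z2
  have a4 : AnalyticAt ℂ (fun x => β' (axis (i + 1) x)) 0 := hβ'.comp_of_eq h2 z2
  have b1 := fun w => analyticAt_clm_apply hf.fderiv w
  have b2 := fun w => analyticAt_clm_apply hg.fderiv w
  have c1 : AnalyticAt ℂ (fun x : ℂ × ℂ => (signX i : ℂ) * x.1) 0 :=
    analyticAt_const.mul analyticAt_fst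
  have c2 : AnalyticAt ℂ (fun x : ℂ × ℂ => (signY i : ℂ) * x.2) 0 :=
    analyticAt_const.mul analyticAt_snd
  exact (((a1.mul (analyticAt_const.add ((c1.mul (b1 _)).div hf hf0))).add
    (a2.mul ((c1.mul (b2 _)).div hg hg0))).mul a4).sub
    (((a1.mul ((c2.mul (b1 _)).div hf hf0)).add
    (a2.mul (analyticAt_const.add ((c2.mul (b2 _)).div hg hg0)))).mul a3)

/-- The coefficient of `φ^* θ_i ∧ θ_{i+1}` near a corner, in corner coordinates. -/
theorem wedge_pullback_corner (i : Fin 4) {φ : ℂ × ℂ → ℂ × ℂ} {f g : ℂ × ℂ → ℂ}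
    {α β α' β' : ℂ → ℂ} {p : ℂ × ℂ} (hp : p ∈ torus)
    (hφ : ∀ᶠ p in 𝓝 p, φ p = (p.1 * f (cornerChart i p), p.2 * g (cornerChart i p)))
    (hf : DifferentiableAt ℂ f (cornerChart i p)) (hg : DifferentiableAt ℂ g (cornerChart i p))
    (hf0 : f (cornerChart i p) ≠ 0) (hg0 : g (cornerChart i p) ≠ 0) :
    wedge (pullback φ (lineForm i α β) p) (lineForm (i + 1) α' β' p) =
      patchNum i f g α β α' β' (cornerChart i p) / (p.1 * p.2) := by
  have hc := hasFDerivAt_cornerChart i hp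
  have hfc := hf.hasFDerivAt.comp p hc
  have hgc := hg.hasFDerivAt.comp p hc
  have h1 := ((hasFDerivAt_fst (𝕜 := ℂ) (p := p)).mul hfc).prodMk
    ((hasFDerivAt_snd (𝕜 := ℂ) (p := p)).mul hgc)
  have h2 := h1.congr_of_eventuallyEq (f₁ := φ) hφ
  have e : lineCoord i (φ p) = axis i (cornerMap i f g (cornerChart i p)) := by
    rw [hφ.self_of_nhds, lineCoord_eq_axis, cornerChart_mul]
  simp only [pullback, lineForm, lineCoord_succ_eq_axis]
  rw [h2.fderiv, e, hφ.self_of_nhds]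
  simp only [patchNum]
  generalize α (axis i (cornerMap i f g (cornerChart i p))) = A
  generalize β (axis i (cornerMap i f g (cornerChart i p))) = B
  generalize α' (axis (i + 1) (cornerChart i p)) = A'
  generalize β' (axis (i + 1) (cornerChart i p)) = B'
  rw [covector_apply]
  have hp1 := hp.1
  have hp2 := hp.2
  simp only [wedge, logCovec, ContinuousLinearMap.comp_apply, ContinuousLinearMap.prod_apply,
    ContinuousLinearMap.coe_fst', ContinuousLinearMap.coe_snd', _root_.smul_apply, smul_eq_mul,
    mul_zero, _root_.add_apply, mul_one, zero_mul, add_zero, zero_add, Function.comp_apply]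
  rw [covector_apply (fderiv ℂ f (cornerChart i p)), covector_apply (fderiv ℂ g (cornerChart i p)),
    covector_apply (fderiv ℂ f (cornerChart i p)) (_, signY i * _ / _),
    covector_apply (fderiv ℂ g (cornerChart i p)) (_, signY i * _ / _)]
  field_simp
  ring

theorem differentiableAt_cornerChart (i : Fin 4) {p : ℂ × ℂ} (hp : p ∈ torus) :
    DifferentiableAt ℂ (cornerChart i) p := (hasFDerivAt_cornerChart i hp).differentiableAt

theorem eventually_cornerGerm_iff {i : Fin 4} {P : ℂ × ℂ → Prop} :
    (∀ᶠ p in cornerGerm i, P p) ↔ ∀ᶠ x in 𝓝 (0 : ℂ × ℂ), x ∈ torus → P (cornerChart i x) := by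
  rw [cornerGerm, eventually_inf_principal, eventually_comap]
  refine eventually_congr (Eventually.of_forall fun x => ⟨fun h hx => ?_, fun h p hp hpt => ?_⟩)
  · exact h _ (cornerChart_cornerChart i x) (cornerChart_mem_torus i hx)
  · have := h (hp ▸ cornerChart_mem_torus i hpt)
    rwa [← hp, cornerChart_cornerChart] at this

theorem eventually_eventually_cornerGerm {i : Fin 4} {P : ℂ × ℂ → Prop}
    (h : ∀ᶠ p in cornerGerm i, P p) : ∀ᶠ p in cornerGerm i, ∀ᶠ q in 𝓝 p, P q := by
  rw [eventually_cornerGerm_iff] at h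
  rw [eventually_cornerGerm_iff]
  filter_upwards [eventually_eventually_nhds.2 h] with x hx hxt
  have ht := cornerChart_mem_torus i hxt
  have h1 := (differentiableAt_cornerChart i ht).continuousAt.tendsto
  rw [cornerChart_cornerChart] at h1
  filter_upwards [h1.eventually hx, isOpen_torus.mem_nhds ht] with q h2 h3
  have := h2 (cornerChart_mem_torus i h3)
  rwa [cornerChart_cornerChart] at this

/-- A continuously differentiable map with non-zero Jacobian is open at the point. -/
theorem eventually_nhds_of_jac_ne_zero {Φ : ℂ × ℂ → ℂ × ℂ} {p : ℂ × ℂ} (hΦ : AnalyticAt ℂ Φ p)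
    (hj : jac Φ p ≠ 0) {P : ℂ × ℂ → Prop} (h : ∀ᶠ q in 𝓝 p, P (Φ q)) :
    ∀ᶠ x in 𝓝 (Φ p), P x := by
  obtain ⟨e, he⟩ := exists_equiv_of_injective (fderiv_injective_of_jac_ne_zero hj)
  have h1 : HasStrictFDerivAt Φ (e : ℂ × ℂ →L[ℂ] ℂ × ℂ) p := by
    rw [he]; exact hΦ.hasStrictFDerivAt
  have h2 := h1.map_nhds_eq_of_equiv
  rw [← h2]
  exact h

section Normalization

variable {F : ℂ × ℂ → ℂ × ℂ} {a b : ℕ → ℂ → ℂ} {Ψ φ : Fin 4 → ℂ × ℂ → ℂ × ℂ} {u v : ℂ}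
  {ω ω' : OneForm} {i : Fin 4}

theorem IsSectorialNormalization.tendsto_chart_corner (hτ : 0 < τ.im)
    (hΨ : IsSectorialNormalization τ F a b Ψ) (i : Fin 4) :
    Tendsto (sectorialChart τ Ψ (i + 1)) (coneGerm τ {i, i + 1}) (cornerGerm i) :=
  (tendsto_serreMap_cornerGerm hτ i).comp (hΨ.tendsto_coneGerm (i + 1) (by simp))

theorem IsCocycleOf.eventually_transition (hφ : IsCocycleOf τ Ψ φ) (i : Fin 4) :
    ∀ᶠ p in coneGerm τ {i, i + 1},
      sectorialChart τ Ψ i p = φ i (sectorialChart τ Ψ (i + 1) p) := by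
  refine Eventually.filter_mono ?_ (hφ.transition i)
  rw [sectorFilter_eq, sectorFilter_eq]
  exact le_inf (coneGerm_mono (by simp)) (coneGerm_mono (by simp))

theorem eventually_differentiableAt_of_corner {φ : ℂ × ℂ → ℂ × ℂ} {f g : ℂ × ℂ → ℂ}
    (hf : AnalyticAt ℂ f 0) (hg : AnalyticAt ℂ g 0)
    (hφ : ∀ᶠ p in cornerGerm i, φ p = (p.1 * f (cornerChart i p), p.2 * g (cornerChart i p))) :
    ∀ᶠ p in cornerGerm i, DifferentiableAt ℂ φ p := by
  have hf' := (tendsto_cornerChart i).eventually hf.eventually_analyticAt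
  have hg' := (tendsto_cornerChart i).eventually hg.eventually_analyticAt
  filter_upwards [eventually_eventually_cornerGerm hφ, hf', hg', eventually_torus_cornerGerm i]
    with p h1 h2 h3 h4
  have hc := differentiableAt_cornerChart i h4
  refine DifferentiableAt.congr_of_eventuallyEq ?_ h1
  have e1 : DifferentiableAt ℂ (fun p => f (cornerChart i p)) p :=
    DifferentiableAt.comp p h2.differentiableAt hc
  have e2 : DifferentiableAt ℂ (fun p => g (cornerChart i p)) p :=
    DifferentiableAt.comp p h3.differentiableAt hc
  exact (differentiableAt_fst.mul e1).prodMk (differentiableAt_snd.mul e2)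

/-- If `ω = 0` is given in the sectors by `Π_i^* θ_i = 0`, the forms `θ_i` patch in the image of a
sector, hence near the corner because the image contains an open set. -/
theorem patchNum_eventually_eq_zero (hτ : 0 < τ.im) (hF : IsFormalNormalization τ F a b)
    (hΨ : IsSectorialNormalization τ F a b Ψ) (hφ : IsCocycleOf τ Ψ φ)
    (hω : ∀ᶠ p in coneGerm τ {i, i + 1}, ω p ≠ 0) {α β α' β' : ℂ → ℂ}
    (hα : AnalyticAt ℂ α 0) (hβ : AnalyticAt ℂ β 0) (hα' : AnalyticAt ℂ α' 0)
    (hβ' : AnalyticAt ℂ β' 0)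
    (h1 : ∀ᶠ p in coneGerm τ {i},
      wedge (ω p) (pullback (sectorialChart τ Ψ i) (lineForm i α β) p) = 0)
    (h2 : ∀ᶠ p in coneGerm τ {i + 1},
      wedge (ω p) (pullback (sectorialChart τ Ψ (i + 1)) (lineForm (i + 1) α' β') p) = 0)
    {f g : ℂ × ℂ → ℂ} (hf : AnalyticAt ℂ f 0) (hg : AnalyticAt ℂ g 0) (hf0 : f 0 ≠ 0)
    (hg0 : g 0 ≠ 0) (hfg : ∀ᶠ p in cornerGerm i,
      φ i p = (p.1 * f (cornerChart i p), p.2 * g (cornerChart i p))) :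
    ∀ᶠ x in 𝓝 0, patchNum i f g α β α' β' x = 0 := by
  have hE := analyticAt_patchNum i hf hg hf0 hg0 hα hβ hα' hβ'
  obtain ⟨ρ, hρ, hball⟩ := Metric.eventually_nhds_iff_ball.1 hE.eventually_analyticAt
  set P := sectorialChart τ Ψ (i + 1) with hP
  have le1 : coneGerm τ {i, i + 1} ≤ coneGerm τ {i} := coneGerm_mono (by simp)
  have le2 : coneGerm τ {i, i + 1} ≤ coneGerm τ {i + 1} := coneGerm_mono (by simp)
  have ht := hΨ.tendsto_chart_corner hτ i
  have hdφ := eventually_differentiableAt_of_corner hf hg hfg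
  have w1 : ∀ᶠ p in coneGerm τ {i, i + 1},
      wedge (pullback (φ i) (lineForm i α β) (P p)) (lineForm (i + 1) α' β' (P p)) = 0 := by
    filter_upwards [h1.filter_mono le1, h2.filter_mono le2, hω,
      eventually_eventually_coneGerm (hφ.eventually_transition i), ht.eventually hdφ,
      (hΨ.analyticAt_chart (i + 1)).filter_mono le2,
      (hΨ.jac_chart_ne_zero hF (i + 1)).filter_mono le2] with p e1 e2 e3 e4 e5 e6 e7
    have e8 := pullback_congr (f := sectorialChart τ Ψ i) (g := fun p => φ i (P p)) e4
      (lineForm i α β)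
    rw [pullback_comp e5 e6.differentiableAt] at e8
    have e9 : wedge (pullback P (pullback (φ i) (lineForm i α β)) p)
        (pullback P (lineForm (i + 1) α' β') p) = 0 := by
      rw [← e8]
      refine wedge_eq_zero_of_wedge e3 ?_ ?_
      · rw [wedge_swap, e1, neg_zero]
      · rw [wedge_swap, e2, neg_zero]
    rw [wedge_pullback] at e9
    exact (mul_eq_zero.1 e9).resolve_right e7
  have c1 := (tendsto_cornerChart i).eventually hf.eventually_analyticAt
  have c2 := (tendsto_cornerChart i).eventually hg.eventually_analyticAt
  have c3 := (tendsto_cornerChart i).eventually (hf.continuousAt.eventually_ne hf0)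
  have c4 := (tendsto_cornerChart i).eventually (hg.continuousAt.eventually_ne hg0)
  have c5 := (tendsto_cornerChart i).eventually (Metric.ball_mem_nhds (0 : ℂ × ℂ) hρ)
  have w2 : ∀ᶠ p in coneGerm τ {i, i + 1}, patchNum i f g α β α' β' (cornerChart i (P p)) = 0 := by
    filter_upwards [w1, ht.eventually (c1.and (c2.and (c3.and c4))),
      ht.eventually (eventually_eventually_cornerGerm hfg),
      ht.eventually (eventually_torus_cornerGerm i)] with p e1 e2 e3 e4
    rw [wedge_pullback_corner i e4 e3 e2.1.differentiableAt e2.2.1.differentiableAt e2.2.2.1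
      e2.2.2.2, div_eq_zero_iff] at e1
    exact e1.resolve_right (mul_ne_zero e4.1 e4.2)
  have hne : (coneGerm τ {i, i + 1}).NeBot := coneGerm_neBot hτ subset_rfl
  obtain ⟨p, e1, e2, e3, e4, e5⟩ := ((eventually_eventually_coneGerm w2).and
    (((hΨ.analyticAt_chart (i + 1)).filter_mono le2).and
    (((hΨ.jac_chart_ne_zero hF (i + 1)).filter_mono le2).and
    ((ht.eventually c5).and (ht.eventually (eventually_torus_cornerGerm i)))))).exists
  have w3 := eventually_nhds_of_jac_ne_zero e2 e3
    (P := fun x => patchNum i f g α β α' β' (cornerChart i x) = 0) e1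
  set x₀ := cornerChart i (P p) with hx₀
  have w4 : ∀ᶠ x in 𝓝 x₀, patchNum i f g α β α' β' x = 0 := by
    have hc := (differentiableAt_cornerChart i (cornerChart_mem_torus i e5)).continuousAt.tendsto
    rw [cornerChart_cornerChart] at hc
    filter_upwards [hc.eventually w3] with x hx
    rwa [cornerChart_cornerChart] at hx
  have hon : AnalyticOnNhd ℂ (patchNum i f g α β α' β') (Metric.ball 0 ρ) := hball
  have := hon.eqOn_zero_of_preconnected_of_eventuallyEq_zero (convex_ball 0 ρ).isPreconnected
    e4 w4
  exact Metric.eventually_nhds_iff_ball.2 ⟨ρ, hρ, fun x hx => this hx⟩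

theorem eventually_wedge_of_patchNum {φ : ℂ × ℂ → ℂ × ℂ} {α β α' β' : ℂ → ℂ}
    {f g : ℂ × ℂ → ℂ} (hf : AnalyticAt ℂ f 0) (hg : AnalyticAt ℂ g 0) (hf0 : f 0 ≠ 0)
    (hg0 : g 0 ≠ 0) (hfg : ∀ᶠ p in cornerGerm i,
      φ p = (p.1 * f (cornerChart i p), p.2 * g (cornerChart i p)))
    (h : ∀ᶠ x in 𝓝 0, patchNum i f g α β α' β' x = 0) : ∀ᶠ p in cornerGerm i,
      wedge (pullback φ (lineForm i α β) p) (lineForm (i + 1) α' β' p) = 0 := by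
  have c1 := (tendsto_cornerChart i).eventually hf.eventually_analyticAt
  have c2 := (tendsto_cornerChart i).eventually hg.eventually_analyticAt
  have c3 := (tendsto_cornerChart i).eventually (hf.continuousAt.eventually_ne hf0)
  have c4 := (tendsto_cornerChart i).eventually (hg.continuousAt.eventually_ne hg0)
  filter_upwards [c1, c2, c3, c4, (tendsto_cornerChart i).eventually h,
    eventually_eventually_cornerGerm hfg, eventually_torus_cornerGerm i] with p e1 e2 e3 e4 e5 e6 e7
  rw [wedge_pullback_corner i e7 e6 e1.differentiableAt e2.differentiableAt e3 e4, e5, zero_div]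

/-- The restriction to `L_{i+1}` of the patching relation, when the residue of the second form
along `L_{i+1}` is the only one which does not vanish at the corner: the residue of the first form
transverse to it vanishes identically. -/
theorem eq_zero_of_patchNum {f g : ℂ × ℂ → ℂ} (hf : AnalyticAt ℂ f 0) (hg : AnalyticAt ℂ g 0)
    (hf0 : f 0 ≠ 0) (hg0 : g 0 ≠ 0) {α β α' β' k : ℂ → ℂ} (hk : AnalyticAt ℂ k 0)
    (h : ∀ᶠ x in 𝓝 0, patchNum i f g α β α' β' x = 0)
    (hcase : ((i = 1 ∨ i = 3) ∧ α = k ∧ α' 0 = 0 ∧ β' 0 ≠ 0) ∨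
      ((i = 0 ∨ i = 2) ∧ β = k ∧ β' 0 = 0 ∧ α' 0 ≠ 0)) :
    ∀ᶠ l in 𝓝 0, k l = 0 := by
  -- the coordinate on `L_{i+1}`, and its image by the map, in corner coordinates
  have key : ∀ c : ℂ → ℂ × ℂ, Continuous c → c 0 = 0 → (∀ y, y ≠ 0 → axis i (c y) ≠ 0) →
      (∀ y, patchNum i f g α β α' β' (c y) = 0 → k (axis i (cornerMap i f g (c y))) = 0) →
      ∀ᶠ l in 𝓝 0, k l = 0 := by
    intro c hc hc0 hne hz
    have hct : Tendsto c (𝓝 0) (𝓝 0) := by simpa [hc0] using hc.tendsto 0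
    have hm : Tendsto (fun y => axis i (cornerMap i f g (c y))) (𝓝 0) (𝓝 0) := by
      have h1 : ContinuousAt (fun x => axis i (cornerMap i f g x)) 0 :=
        (AnalyticAt.comp (analyticAt_axis i _)
          (analyticAt_cornerMap i hf hg hf0 hg0)).continuousAt
      have h2 := h1.tendsto
      rw [cornerMap_zero, axis_zero] at h2
      exact h2.comp hct
    have hm' : Tendsto (fun y => axis i (cornerMap i f g (c y))) (𝓝[≠] 0) (𝓝[≠] 0) := by
      refine tendsto_nhdsWithin_iff.2 ⟨hm.mono_left nhdsWithin_le_nhds, ?_⟩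
      have d1 := hct.eventually (hf.continuousAt.eventually_ne hf0)
      have d2 := hct.eventually (hg.continuousAt.eventually_ne hg0)
      filter_upwards [d1.filter_mono nhdsWithin_le_nhds, d2.filter_mono nhdsWithin_le_nhds,
        self_mem_nhdsWithin] with y e1 e2 e3
      have e4 := hne y e3
      fin_cases i
      all_goals
        simp only [axis, cornerMap] at e4 ⊢
        first
        | exact mul_ne_zero e4 (zpow_ne_zero _ e1)
        | exact mul_ne_zero e4 (zpow_ne_zero _ e2)
    rcases hk.eventually_eq_zero_or_eventually_ne_zero with h0 | h0
    · exact h0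
    · exfalso
      have d3 := hm'.eventually h0
      have d4 := (hct.eventually h).filter_mono (nhdsWithin_le_nhds (s := {0}ᶜ))
      obtain ⟨y, e1, e2⟩ := (d3.and d4).exists
      exact e1 (hz y e2)
  rcases hcase with ⟨hi, rfl, h1, h2⟩ | ⟨hi, rfl, h1, h2⟩
  · refine key (fun y => (0, y)) (by fun_prop) rfl ?_ ?_
    · rcases hi with rfl | rfl <;> exact fun y hy => hy
    · intro y hy
      have e : axis (i + 1) ((0, y) : ℂ × ℂ) = 0 := by rcases hi with rfl | rfl <;> rfl
      simp only [patchNum, e, h1, mul_zero, zero_mul, zero_div, add_zero, mul_one, sub_zero] at hy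
      exact (mul_eq_zero.1 hy).resolve_right h2
  · refine key (fun y => (y, 0)) (by fun_prop) rfl ?_ ?_
    · rcases hi with rfl | rfl <;> exact fun y hy => hy
    · intro y hy
      have e : axis (i + 1) ((y, 0) : ℂ × ℂ) = 0 := by rcases hi with rfl | rfl <;> rfl
      simp only [patchNum, e, h1, mul_zero, zero_mul, zero_div, add_zero, mul_one, zero_sub,
        zero_add, neg_eq_zero] at hy
      exact (mul_eq_zero.1 hy).resolve_right h2

end Normalization

/-! ### Closed holomorphic forms along the lines -/

/-- The form `k(ℓ) dℓ`, where `ℓ` is the coordinate vanishing on `L_i`. -/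
noncomputable def axisForm (i : Fin 4) (k : ℂ → ℂ) : OneForm :=
  fun p => k (lineCoord i p) • fderiv ℂ (lineCoord i) p

/-- The linear form `axis i`. -/
noncomputable def axisL : Fin 4 → (ℂ × ℂ →L[ℂ] ℂ)
  | 0 => ContinuousLinearMap.fst ℂ ℂ ℂ
  | 1 => ContinuousLinearMap.snd ℂ ℂ ℂ
  | 2 => ContinuousLinearMap.fst ℂ ℂ ℂ
  | 3 => ContinuousLinearMap.snd ℂ ℂ ℂ

/-- The basis vector of the coordinate `axis i`. -/
def axisVec : Fin 4 → ℂ × ℂ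
  | 0 => (1, 0)
  | 1 => (0, 1)
  | 2 => (1, 0)
  | 3 => (0, 1)

theorem coe_axisL (i : Fin 4) : ⇑(axisL i) = axis i := by
  fin_cases i <;> rfl

theorem covector_eq_axis (i : Fin 4) (γ : ℂ × ℂ →L[ℂ] ℂ) :
    γ = γ (axisVec i) • axisL i + γ (axisVec (i + 1)) • axisL (i + 1) := by
  refine covector_ext ?_ ?_ <;> fin_cases i <;> simp [axisL, axisVec, Fin.add_def]

theorem chart_eq_axisVec (i : Fin 4) (p : ℂ × ℂ) :
    cornerChart i p = lineCoord i p • axisVec i + lineCoord (i + 1) p • axisVec (i + 1) ∧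
    cornerChart (i + 3) p =
      lineCoord i p • axisVec i + (lineCoord (i + 1) p)⁻¹ • axisVec (i + 1) := by
  fin_cases i <;> simp [cornerChart, axisVec, lineCoord, Fin.add_def]

/-- The vectors `ℓ ∂_ℓ` and `w ∂_w`, where `w` is the coordinate vanishing on `L_{i+1}`, in the two
corner charts of `L_i`; the second one changes sign because the charts use `w` and `1 / w`. -/
theorem chart_fields (i : Fin 4) {p : ℂ × ℂ} (hp : p ∈ torus) : ∃ V W : ℂ × ℂ,
    fderiv ℂ (cornerChart i) p V = lineCoord i p • axisVec i ∧
    fderiv ℂ (cornerChart i) p W = lineCoord (i + 1) p • axisVec (i + 1) ∧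
    fderiv ℂ (cornerChart (i + 3)) p V = lineCoord i p • axisVec i ∧
    fderiv ℂ (cornerChart (i + 3)) p W = -(lineCoord (i + 1) p)⁻¹ • axisVec (i + 1) := by
  have h1 := hp.1
  have h2 := hp.2
  rw [(hasFDerivAt_cornerChart i hp).fderiv, (hasFDerivAt_cornerChart (i + 3) hp).fderiv]
  fin_cases i
  · exact ⟨(p.1, 0), (0, p.2), by
      simp [axisVec, lineCoord, signX, signY, cornerChart, h1, h2]⟩
  · exact ⟨(0, p.2), (-p.1, 0), by
      simp [axisVec, lineCoord, Fin.add_def, signX, signY, cornerChart, h1, h2]⟩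
  · exact ⟨(-p.1, 0), (0, -p.2), by
      simp [axisVec, lineCoord, Fin.add_def, signX, signY, cornerChart, h1, h2]⟩
  · exact ⟨(0, -p.2), (p.1, 0), by
      simp [axisVec, lineCoord, Fin.add_def, signX, signY, cornerChart, h1, h2]⟩

theorem fderiv_lineCoord_eq (i : Fin 4) {j : Fin 4} (hj : j = i ∨ j + 1 = i) {p : ℂ × ℂ}
    (hp : p ∈ torus) :
    fderiv ℂ (lineCoord i) p = (axisL i).comp (fderiv ℂ (cornerChart j) p) ∧
      lineCoord i p = axis i (cornerChart j p) := by
  have h : ∀ p, lineCoord i p = axis i (cornerChart j p) := by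
    rcases hj with rfl | rfl
    · exact lineCoord_eq_axis _
    · exact lineCoord_succ_eq_axis _
  refine ⟨?_, h p⟩
  have e : lineCoord i = fun p => axisL i (cornerChart j p) := by
    funext p; rw [h p, coe_axisL]
  rw [e]
  exact ((axisL i).hasFDerivAt.comp p
    (differentiableAt_cornerChart j hp).hasFDerivAt).fderiv

theorem isClosedHolomorphic_axisForm (i : Fin 4) {k : ℂ → ℂ} (hk : AnalyticAt ℂ k 0) :
    IsClosedHolomorphic i (axisForm i k) := by
  intro j hj
  refine ⟨fun x => k (axis i x) • axisL i, fun x hx => ?_, ?_⟩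
  · have hx0 : axis i x = 0 := by
      have : lineCoord i (cornerChart j x) = axis i (cornerChart j (cornerChart j x)) := by
        rcases hj with rfl | rfl
        · exact lineCoord_eq_axis _ _
        · exact lineCoord_succ_eq_axis _ _
      rw [cornerChart_cornerChart] at this
      rw [← this, hx]
    have hkx : AnalyticAt ℂ k (axis i x) := by rwa [hx0]
    refine ⟨(AnalyticAt.comp hkx (analyticAt_axis i x)).smul analyticAt_const, ?_⟩
    have h1 : ∀ᶠ x' in 𝓝 x, AnalyticAt ℂ k (axis i x') :=
      (analyticAt_axis i x).continuousAt.eventually hkx.eventually_analyticAt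
    filter_upwards [h1] with x' h2 v w
    have h3 : HasFDerivAt (fun x => k (axis i x)) ((deriv k (axis i x')) • axisL i) x' := by
      have hd : HasDerivAt k (deriv k (axis i x')) (axisL i x') := by
        rw [coe_axisL]; exact h2.differentiableAt.hasDerivAt
      have := hd.comp_hasFDerivAt x' (axisL i).hasFDerivAt
      have e : (fun x => k (axis i x)) = k ∘ axisL i := by rw [coe_axisL]; rfl
      rw [e]
      exact this
    have h4 := h3.smul_const (axisL i)
    rw [h4.fderiv]
    simp only [ContinuousLinearMap.smulRight_apply, _root_.smul_apply, smul_eq_mul]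
    ring
  · filter_upwards [eventually_torus_lineGerm i] with p hp
    obtain ⟨e1, e2⟩ := fderiv_lineCoord_eq i hj hp
    simp only [axisForm, pullback]
    rw [e1, e2, ContinuousLinearMap.smul_comp]

/-- Liouville's theorem on the lines: a family of functions of `w ∈ ℙ¹`, holomorphic in the two
charts, does not depend on `w`. -/
theorem eq_of_analytic_two_charts {A₀ A₁ : ℂ → ℂ → ℂ}
    (h₀ : ∀ w, AnalyticAt ℂ (Function.uncurry A₀) (0, w))
    (h₁ : ∀ w, AnalyticAt ℂ (Function.uncurry A₁) (0, w))
    (hrel : ∀ᶠ l in 𝓝[≠] (0 : ℂ), ∀ w, w ≠ 0 → A₀ l w = A₁ l w⁻¹) :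
    ∀ᶠ l in 𝓝[≠] (0 : ℂ), ∀ w, w ≠ 0 → A₀ l w = A₀ l 0 := by
  have hK : IsCompact (Metric.closedBall (0 : ℂ) 2) := isCompact_closedBall _ _
  have hev : ∀ A : ℂ → ℂ → ℂ, (∀ w, AnalyticAt ℂ (Function.uncurry A) (0, w)) →
      ∀ᶠ l in 𝓝 (0 : ℂ), ∀ w ∈ Metric.closedBall (0 : ℂ) 2,
        AnalyticAt ℂ (Function.uncurry A) (l, w) := fun A hA =>
    hK.eventually_forall_of_forall_eventually fun w _ => (hA w).eventually_analyticAt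
  filter_upwards [hrel, (hev A₀ h₀).filter_mono nhdsWithin_le_nhds,
    (hev A₁ h₁).filter_mono nhdsWithin_le_nhds] with l e0 e1 e2
  have hd : ∀ A : ℂ → ℂ → ℂ, (∀ w ∈ Metric.closedBall (0 : ℂ) 2,
      AnalyticAt ℂ (Function.uncurry A) (l, w)) → ∀ w ∈ Metric.closedBall (0 : ℂ) 2,
        DifferentiableAt ℂ (A l) w := fun A hA w hw =>
    (hA w hw).differentiableAt.comp w
      (by fun_prop : DifferentiableAt ℂ (fun w : ℂ => (l, w)) w)
  have hb : ∀ A : ℂ → ℂ → ℂ, (∀ w ∈ Metric.closedBall (0 : ℂ) 2,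
      AnalyticAt ℂ (Function.uncurry A) (l, w)) →
      ∃ C, ∀ w ∈ Metric.closedBall (0 : ℂ) 2, ‖A l w‖ ≤ C := fun A hA =>
    hK.exists_bound_of_continuousOn fun w hw => (hd A hA w hw).continuousAt.continuousWithinAt
  obtain ⟨C₀, hC₀⟩ := hb A₀ e1
  obtain ⟨C₁, hC₁⟩ := hb A₁ e2
  set g : ℂ → ℂ := fun w => if ‖w‖ < 2 then A₀ l w else A₁ l w⁻¹ with hg
  have g0 : ∀ w, ‖w‖ < 2 → g w = A₀ l w := fun w hw => if_pos hw
  have g1 : ∀ w, w ≠ 0 → g w = A₁ l w⁻¹ := by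
    intro w hw
    by_cases h : ‖w‖ < 2
    · rw [g0 w h, e0 w hw]
    · exact if_neg h
  have ginv : ∀ w : ℂ, 1 < ‖w‖ → w⁻¹ ∈ Metric.closedBall (0 : ℂ) 2 := by
    intro w hw
    rw [mem_closedBall_zero_iff, norm_inv]
    exact (inv_le_one_of_one_le₀ hw.le).trans one_le_two
  have hgd : Differentiable ℂ g := by
    intro w
    rcases lt_or_ge ‖w‖ 2 with hw | hw
    · refine (hd A₀ e1 w (by simpa using hw.le)).congr_of_eventuallyEq ?_
      filter_upwards [(isOpen_lt continuous_norm continuous_const).mem_nhds hw] with w' hw'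
      exact g0 w' hw'
    · have hw1 : 1 < ‖w‖ := by linarith
      have hw0 : w ≠ 0 := norm_pos_iff.1 (by linarith)
      have : DifferentiableAt ℂ (fun w => A₁ l w⁻¹) w :=
        DifferentiableAt.comp w (hd A₁ e2 w⁻¹ (ginv w hw1)) (differentiableAt_inv hw0)
      refine this.congr_of_eventuallyEq ?_
      filter_upwards [isOpen_ne.mem_nhds hw0] with w' hw'
      exact g1 w' hw'
  have hgb : Bornology.IsBounded (Set.range g) := by
    refine isBounded_iff_forall_norm_le.2 ⟨max C₀ C₁, ?_⟩
    rintro - ⟨w, rfl⟩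
    rcases lt_or_ge ‖w‖ 2 with hw | hw
    · rw [g0 w hw]
      exact (hC₀ w (by simpa using hw.le)).trans (le_max_left _ _)
    · rw [g1 w (norm_pos_iff.1 (by linarith))]
      exact (hC₁ _ (ginv w (by linarith))).trans (le_max_right _ _)
  intro w hw
  have := hgd.apply_eq_apply_of_bounded hgb w 0
  rw [g1 w hw, g0 0 (by simp)] at this
  rw [e0 w hw, this]

theorem eventually_lineGerm_iff {i : Fin 4} {P : ℂ × ℂ → Prop} :
    (∀ᶠ p in lineGerm i, P p) ↔ ∀ᶠ l in 𝓝[≠] (0 : ℂ), ∀ w, w ≠ 0 → P (lineParam i (w, l)) := by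
  rw [lineGerm, eventually_inf_principal, eventually_comap, eventually_nhdsWithin_iff]
  refine eventually_congr (Eventually.of_forall fun l => ⟨fun h hl w hw => ?_, fun h p hp ht => ?_⟩)
  · exact h _ (lineCoord_lineParam i _) (lineParam_ne_zero i hw hl)
  · have hne : ∀ j, lineCoord j p ≠ 0 := by
      intro j
      fin_cases j <;> simp [lineCoord, ht.1, ht.2]
    have := h (hp ▸ hne i) (lineCoord (i + 1) p) (hne _)
    rwa [← hp, lineParam_lineCoord] at this

/-- Along `L_i`, every holomorphic form is `k(ℓ) dℓ`, since `L_i` has no non-zero global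
holomorphic form. -/
theorem IsClosedHolomorphic.exists_axisForm {i : Fin 4} {η : OneForm}
    (h : IsClosedHolomorphic i η) :
    ∃ k : ℂ → ℂ, AnalyticAt ℂ k 0 ∧ ∀ᶠ p in lineGerm i, η p = axisForm i k p := by
  have hj : i + 3 + 1 = i := by fin_cases i <;> rfl
  obtain ⟨η₀, ha₀, he₀⟩ := h i (Or.inl rfl)
  obtain ⟨η₁, ha₁, he₁⟩ := h (i + 3) (Or.inr hj)
  set pt : ℂ → ℂ → ℂ × ℂ := fun l w => l • axisVec i + w • axisVec (i + 1) with hpt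
  have hpta : ∀ q : ℂ × ℂ, AnalyticAt ℂ (fun q : ℂ × ℂ => pt q.1 q.2) q := fun q =>
    (analyticAt_fst.smul analyticAt_const).add (analyticAt_snd.smul analyticAt_const)
  have hline : ∀ j, (j = i ∨ j + 1 = i) → ∀ w, lineCoord i (cornerChart j (pt 0 w)) = 0 := by
    intro j hj w
    have : lineCoord i (cornerChart j (pt 0 w)) =
        axis i (cornerChart j (cornerChart j (pt 0 w))) := by
      rcases hj with rfl | rfl
      · exact lineCoord_eq_axis _ _
      · exact lineCoord_succ_eq_axis _ _
    rw [this, cornerChart_cornerChart]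
    simp only [hpt]
    fin_cases i <;> simp [axis, axisVec, Fin.add_def]
  have hcomp : ∀ (η' : OneForm) (j : Fin 4), (j = i ∨ j + 1 = i) →
      (∀ x : ℂ × ℂ, lineCoord i (cornerChart j x) = 0 →
        AnalyticAt ℂ η' x ∧ ∀ᶠ x' in 𝓝 x, ClosedAt η' x') →
      ∀ v w, AnalyticAt ℂ (fun q : ℂ × ℂ => η' (pt q.1 q.2) v) (0, w) := by
    intro η' j hj ha v w
    refine analyticAt_clm_apply ?_ v
    exact AnalyticAt.comp (f := fun q : ℂ × ℂ => pt q.1 q.2) (x := ((0 : ℂ), w))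
      (ha _ (hline j hj w)).1 (hpta _)
  have hA₀ := hcomp η₀ i (Or.inl rfl) ha₀ (axisVec i)
  have hA₁ := hcomp η₁ (i + 3) (Or.inr hj) ha₁ (axisVec i)
  have hB₀ := hcomp η₀ i (Or.inl rfl) ha₀ (axisVec (i + 1))
  have hB₁ := hcomp η₁ (i + 3) (Or.inr hj) ha₁ (axisVec (i + 1))
  have hrel : ∀ᶠ l in 𝓝[≠] (0 : ℂ), ∀ w, w ≠ 0 →
      η₀ (pt l w) (axisVec i) = η₁ (pt l w⁻¹) (axisVec i) ∧
      w * η₀ (pt l w) (axisVec (i + 1)) = -w⁻¹ * η₁ (pt l w⁻¹) (axisVec (i + 1)) := by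
    have h1 := eventually_lineGerm_iff.1 (he₀.and he₁)
    filter_upwards [h1, self_mem_nhdsWithin] with l h2 hl w hw
    obtain ⟨h3, h4⟩ := h2 w hw
    have ht := lineParam_ne_zero i (q := (w, l)) hw hl
    obtain ⟨V, W, f1, f2, f3, f4⟩ := chart_fields i ht
    obtain ⟨c1, c2⟩ := chart_eq_axisVec i (lineParam i (w, l))
    rw [lineCoord_lineParam, lineCoord_succ_lineParam] at c1 c2
    rw [lineCoord_lineParam] at f1 f3
    rw [lineCoord_succ_lineParam] at f2 f4
    rw [h3] at h4
    have g1 := congrArg (fun L => L V) h4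
    have g2 := congrArg (fun L => L W) h4
    simp only [pullback, ContinuousLinearMap.comp_apply, c1, c2, f1, f2, f3, f4, map_smul,
      smul_eq_mul] at g1 g2
    exact ⟨mul_left_cancel₀ hl g1, g2⟩
  have hconstA := eq_of_analytic_two_charts (A₀ := fun l w => η₀ (pt l w) (axisVec i))
    (A₁ := fun l w => η₁ (pt l w) (axisVec i)) hA₀ hA₁
    (hrel.mono fun l h w hw => (h w hw).1)
  have hconstB := eq_of_analytic_two_charts
    (A₀ := fun l w => w * η₀ (pt l w) (axisVec (i + 1)))
    (A₁ := fun l w => -w * η₁ (pt l w) (axisVec (i + 1)))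
    (fun w => analyticAt_snd.mul (hB₀ w)) (fun w => analyticAt_snd.neg.mul (hB₁ w))
    (hrel.mono fun l h w hw => (h w hw).2)
  refine ⟨fun l => η₀ (pt l 0) (axisVec i), ?_, ?_⟩
  · exact (hA₀ 0).comp_of_eq (f := fun l : ℂ => (l, (0 : ℂ))) (by fun_prop) rfl
  · rw [eventually_lineGerm_iff]
    filter_upwards [hconstA, hconstB, eventually_lineGerm_iff.1 he₀, self_mem_nhdsWithin]
      with l e1 e2 e3 hl w hw
    have ht := lineParam_ne_zero i (q := (w, l)) hw hl
    have e4 := e1 w hw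
    have e5 : η₀ (pt l w) (axisVec (i + 1)) = 0 := by
      have := e2 w hw
      rw [zero_mul] at this
      exact (mul_eq_zero.1 this).resolve_left hw
    obtain ⟨c1, -⟩ := chart_eq_axisVec i (lineParam i (w, l))
    rw [lineCoord_lineParam, lineCoord_succ_lineParam] at c1
    rw [e3 w hw]
    simp only [pullback, axisForm]
    have e6 : η₀ (pt l w) = η₀ (pt l 0) (axisVec i) • axisL i := by
      refine ContinuousLinearMap.ext fun x => ?_
      have := congrArg (fun L => L x) (covector_eq_axis i (η₀ (pt l w)))
      simpa [e4, e5] using this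
    rw [c1, (fderiv_lineCoord_eq i (Or.inl rfl) ht).1, lineCoord_lineParam]
    change (η₀ (pt l w)).comp _ = _
    rw [e6, ContinuousLinearMap.smul_comp]

/-- The coefficient of `dX / X` in `dℓ / ℓ`. -/
def logX : Fin 4 → ℂ
  | 0 => 1
  | 1 => 0
  | 2 => -1
  | 3 => 0

/-- The coefficient of `dY / Y` in `dℓ / ℓ`. -/
def logY : Fin 4 → ℂ
  | 0 => 0
  | 1 => 1
  | 2 => 0
  | 3 => -1

theorem fderiv_lineCoord (i : Fin 4) {p : ℂ × ℂ} (hp : p ∈ torus) :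
    fderiv ℂ (lineCoord i) p = lineCoord i p • logCovec (logX i) (logY i) p := by
  have h1 := hp.1
  have h2 := hp.2
  rw [(fderiv_lineCoord_eq i (Or.inl rfl) hp).1, (hasFDerivAt_cornerChart i hp).fderiv]
  fin_cases i <;> refine covector_ext ?_ ?_ <;>
    simp [axisL, logCovec, logX, logY, lineCoord, cornerChart, signX, signY, h1, h2] <;>
    field_simp

/-- The coefficient of `dX / X` in `(v - u) τ dX / X + u dY / Y + k(ℓ) dℓ`. -/
noncomputable def coeffX (τ u v : ℂ) (i : Fin 4) (k : ℂ → ℂ) (l : ℂ) : ℂ :=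
  (v - u) * τ + logX i * (l * k l)

/-- The coefficient of `dY / Y` in `(v - u) τ dX / X + u dY / Y + k(ℓ) dℓ`. -/
noncomputable def coeffY (u : ℂ) (i : Fin 4) (k : ℂ → ℂ) (l : ℂ) : ℂ :=
  u + logY i * (l * k l)

theorem logForm_add_axisForm (i : Fin 4) (k : ℂ → ℂ) {p : ℂ × ℂ} (hp : p ∈ torus) (u v : ℂ) :
    (logForm τ u v + axisForm i k) p = lineForm i (coeffX τ u v i k) (coeffY u i k) p := by
  rw [Pi.add_apply, axisForm, fderiv_lineCoord i hp, logForm_eq, lineForm]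
  refine covector_ext ?_ ?_
  · simp only [_root_.add_apply, _root_.smul_apply, smul_eq_mul, logCovec_fst, coeffX]; ring
  · simp only [_root_.add_apply, _root_.smul_apply, smul_eq_mul, logCovec_snd, coeffY]; ring

/-! ### From a convergent foliation to logarithmic forms that patch -/

theorem analyticAt_coeffX (τ u v : ℂ) (i : Fin 4) {k : ℂ → ℂ} (hk : AnalyticAt ℂ k 0) :
    AnalyticAt ℂ (coeffX τ u v i k) 0 :=
  analyticAt_const.add (analyticAt_const.mul (analyticAt_id.mul hk))

theorem analyticAt_coeffY (u : ℂ) (i : Fin 4) {k : ℂ → ℂ} (hk : AnalyticAt ℂ k 0) :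
    AnalyticAt ℂ (coeffY u i k) 0 :=
  analyticAt_const.add (analyticAt_const.mul (analyticAt_id.mul hk))

theorem coeffX_zero (τ u v : ℂ) (i : Fin 4) (k : ℂ → ℂ) : coeffX τ u v i k 0 = (v - u) * τ := by
  simp [coeffX]

theorem coeffY_zero (u : ℂ) (i : Fin 4) (k : ℂ → ℂ) : coeffY u i k 0 = u := by simp [coeffY]

/-- The form `(v - u) τ dX / X + u dY / Y` has a non-zero residue, since `τ ≠ 0`. -/
theorem residues_ne_zero (hτ : 0 < τ.im) {u v : ℂ} (huv : (u, v) ≠ (0, 0)) :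
    (v - u) * τ ≠ 0 ∨ u ≠ 0 := by
  have hτ0 : τ ≠ 0 := fun h => by simp [h] at hτ
  by_contra! h
  obtain ⟨h1, h2⟩ := h
  rw [h2, sub_zero] at h1
  exact huv (by rw [h2, (mul_eq_zero.1 h1).resolve_right hτ0])

section Normalization

variable {F : ℂ × ℂ → ℂ × ℂ} {a b : ℕ → ℂ → ℂ} {Ψ φ : Fin 4 → ℂ × ℂ → ℂ × ℂ} {u v : ℂ}
  {ω ω' : OneForm} {i : Fin 4}

theorem DiffCornerOne.diffCorner {φ : ℂ × ℂ → ℂ × ℂ} (h : DiffCornerOne i φ) : DiffCorner i φ := by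
  obtain ⟨f, g, hf, hg, hf0, hg0, h⟩ := h
  exact ⟨f, g, hf, hg, by simp [hf0], by simp [hg0], h⟩

theorem DiffCorner.eventually_mem_torus {φ : ℂ × ℂ → ℂ × ℂ} (h : DiffCorner i φ) :
    ∀ᶠ p in cornerGerm i, φ p ∈ torus := by
  obtain ⟨f, g, hf, hg, hf0, hg0, h⟩ := h
  filter_upwards [h, (tendsto_cornerChart i).eventually (hf.continuousAt.eventually_ne hf0),
    (tendsto_cornerChart i).eventually (hg.continuousAt.eventually_ne hg0),
    eventually_torus_cornerGerm i] with p e1 e2 e3 e4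
  rw [e1]
  exact ⟨mul_ne_zero e4.1 e2, mul_ne_zero e4.2 e3⟩

theorem foliationsPatch_axisForm_iff (hφ : ∀ i, DiffCorner i (φ i)) {κ : Fin 4 → ℂ → ℂ} :
    FoliationsPatch φ (fun i => logForm τ u v + axisForm i (κ i)) ↔
      ∀ i, ∀ᶠ p in cornerGerm i, wedge
        (pullback (φ i) (lineForm i (coeffX τ u v i (κ i)) (coeffY u i (κ i))) p)
        (lineForm (i + 1) (coeffX τ u v (i + 1) (κ (i + 1))) (coeffY u (i + 1) (κ (i + 1))) p)
          = 0 := by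
  refine forall_congr' fun i => eventually_congr ?_
  filter_upwards [(hφ i).eventually_mem_torus, eventually_torus_cornerGerm i] with p h1 h2
  rw [logForm_add_axisForm _ _ h2, pullback_congr_form (logForm_add_axisForm i (κ i) h1 u v)]

theorem pullback_chart_axisForm (hτ : 0 < τ.im) (hΨ : IsSectorialNormalization τ F a b Ψ)
    (i : Fin 4) (k : ℂ → ℂ) : ∀ᶠ p in coneGerm τ {i},
      pullback (sectorialChart τ Ψ i) (logForm τ u v + axisForm i k) p =
        pullback (sectorialChart τ Ψ i)
          (lineForm i (coeffX τ u v i k) (coeffY u i k)) p := by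
  filter_upwards [(hΨ.tendsto_chart hτ i).eventually (eventually_torus_lineGerm i)] with p hp
  exact pullback_congr_form (logForm_add_axisForm i k hp u v)

theorem IsSectorialNormalization.tendsto_lineCoord (hτ : 0 < τ.im)
    (hΨ : IsSectorialNormalization τ F a b Ψ) (i : Fin 4) :
    Tendsto (fun p => lineCoord i (sectorialChart τ Ψ i p)) (coneGerm τ {i}) (𝓝 0) :=
  (tendsto_comap.mono_left inf_le_left).comp (hΨ.tendsto_chart hτ i)

/-- A convergent member of the pencil is given by logarithmic forms `θ_i`, with the prescribed
residues, which patch. If a residue vanishes, the freedom in the choice of `θ_i` along one pair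
of opposite lines is lost, and the patching at the corners has to be used. -/
theorem exists_axisForm_of_foliation (hτ : 0 < τ.im) (huv : (u, v) ≠ (0, 0))
    (hF : IsFormalNormalization τ F a b) (hΨ : IsSectorialNormalization τ F a b Ψ)
    (hφ : IsCocycleOf τ Ψ φ) (hω : IsFoliation F ω) (hc : HasFormalCompletion τ u v a b ω) :
    ∃ κ : Fin 4 → ℂ → ℂ, (∀ i, AnalyticAt ℂ (κ i) 0) ∧
      FoliationsPatch φ (fun i => logForm τ u v + axisForm i (κ i)) := by
  have hω0 : ∀ S, ∀ᶠ p in coneGerm τ S, ω p ≠ 0 := fun S =>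
    eventually_coneGerm_of_nhds fun z hz =>
      (hω.analytic z hz).continuousAt.eventually_ne (hω.regular z hz)
  have hres := residues_ne_zero hτ huv
  -- the direction of the deviation is that of `dℓ / ℓ` unless `θ⁰` is proportional to `dℓ / ℓ`
  have key : ∀ i : Fin 4, ∃ α₁ β₁ : ℂ, (v - u) * τ * β₁ - u * α₁ ≠ 0 ∧
      ((∃ e : ℂ, logX i * e = α₁ ∧ logY i * e = β₁) ∨
      ((i = 1 ∨ i = 3) ∧ (v - u) * τ = 0 ∧ α₁ = 1 ∧ β₁ = 0 ∧ u ≠ 0) ∨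
      ((i = 0 ∨ i = 2) ∧ u = 0 ∧ α₁ = 0 ∧ β₁ = 1 ∧ (v - u) * τ ≠ 0)) := by
    intro i
    by_cases hu : u = 0
    · have h1 : (v - u) * τ ≠ 0 := hres.resolve_right (by simp [hu])
      refine ⟨0, 1, by simpa using h1, ?_⟩
      fin_cases i
      · exact Or.inr (Or.inr (by simp [hu] at h1 ⊢; exact h1))
      · exact Or.inl ⟨1, by simp [logX, logY]⟩
      · exact Or.inr (Or.inr (by simp [hu] at h1 ⊢; exact h1))
      · exact Or.inl ⟨-1, by simp [logX, logY]⟩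
    · by_cases hv : (v - u) * τ = 0
      · refine ⟨1, 0, by simpa using hu, ?_⟩
        fin_cases i
        · exact Or.inl ⟨1, by simp [logX, logY]⟩
        · exact Or.inr (Or.inl (by simp only [hv]; simp [hu]))
        · exact Or.inl ⟨-1, by simp [logX, logY]⟩
        · exact Or.inr (Or.inl (by simp only [hv]; simp [hu]))
      · fin_cases i
        · exact ⟨1, 0, by simpa using hu, Or.inl ⟨1, by simp [logX, logY]⟩⟩
        · exact ⟨0, 1, by simpa using hv, Or.inl ⟨1, by simp [logX, logY]⟩⟩
        · exact ⟨1, 0, by simpa using hu, Or.inl ⟨-1, by simp [logX, logY]⟩⟩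
        · exact ⟨0, 1, by simpa using hv, Or.inl ⟨-1, by simp [logX, logY]⟩⟩
  choose α₁ β₁ hdet hcase using key
  choose k hk hk0 hkω using fun i => exists_lineForm_of_foliation hτ hF hΨ hω hc i (hdet i)
  have hA : ∀ i, AnalyticAt ℂ (fun l => (v - u) * τ + k i l * α₁ i) 0 := fun i =>
    analyticAt_const.add ((hk i).mul analyticAt_const)
  have hB : ∀ i, AnalyticAt ℂ (fun l => u + k i l * β₁ i) 0 := fun i =>
    analyticAt_const.add ((hk i).mul analyticAt_const)
  have hκ : ∀ i, ∃ κ : ℂ → ℂ, AnalyticAt ℂ κ 0 ∧ ∀ᶠ l in 𝓝 (0 : ℂ),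
      coeffX τ u v i κ l = (v - u) * τ + k i l * α₁ i ∧ coeffY u i κ l = u + k i l * β₁ i := by
    intro i
    -- in the degenerate cases, the patching at the corner shows that `k i` vanishes
    have hdeg : (((i = 1 ∨ i = 3) ∧ (v - u) * τ = 0 ∧ α₁ i = 1 ∧ β₁ i = 0 ∧ u ≠ 0) ∨
        ((i = 0 ∨ i = 2) ∧ u = 0 ∧ α₁ i = 0 ∧ β₁ i = 1 ∧ (v - u) * τ ≠ 0)) →
        ∀ᶠ l in 𝓝 0, k i l = 0 := by
      intro hd
      obtain ⟨f, g, hf, hg, hf0, hg0, hfg⟩ := (hφ.tangent i).diffCorner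
      have hp := patchNum_eventually_eq_zero hτ hF hΨ hφ (hω0 _) (hA i) (hB i) (hA (i + 1))
        (hB (i + 1)) (hkω i) (hkω (i + 1)) hf hg hf0 hg0 hfg
      refine eq_zero_of_patchNum hf hg hf0 hg0 (hk i) hp ?_
      rcases hd with ⟨h1, h2, h3, h4, h5⟩ | ⟨h1, h2, h3, h4, h5⟩
      · exact Or.inl ⟨h1, by funext l; simp [h2, h3], by simp [h2, hk0], by simpa [hk0] using h5⟩
      · exact Or.inr ⟨h1, by funext l; simp [h2, h4], by simp [h2, hk0], by simpa [hk0] using h5⟩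
    rcases hcase i with ⟨e, h1, h2⟩ | hd
    · obtain ⟨s, hs⟩ := hk i
      -- `k i` vanishes at the origin, so that `k(ℓ) dℓ / ℓ` is holomorphic
      refine ⟨fun l => e * dslope (k i) 0 l,
        analyticAt_const.mul ⟨_, hs.has_fpower_series_dslope_fslope⟩, ?_⟩
      refine Eventually.of_forall fun l => ?_
      have e1 : l * dslope (k i) 0 l = k i l := by
        have := sub_smul_dslope (k i) 0 l
        simpa [hk0] using this
      rw [← h1, ← h2, ← e1]
      constructor
      · simp only [coeffX]; ring
      · simp only [coeffY]; ring
    · refine ⟨fun _ => 0, analyticAt_const, ?_⟩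
      filter_upwards [hdeg hd] with l hl
      simp [coeffX, coeffY, hl]
  choose κ hκa hκe using hκ
  refine ⟨κ, hκa, ?_⟩
  have hsec : ∀ i, ∀ᶠ p in coneGerm τ {i}, wedge (ω p) (pullback (sectorialChart τ Ψ i)
      (lineForm i (coeffX τ u v i (κ i)) (coeffY u i (κ i))) p) = 0 := by
    intro i
    filter_upwards [hkω i, (hΨ.tendsto_lineCoord hτ i).eventually (hκe i)] with p h1 h2
    rw [← h1]
    congr 1
    refine pullback_congr_form ?_
    simp only [lineForm, h2.1, h2.2]
  rw [foliationsPatch_axisForm_iff fun i => (hφ.tangent i).diffCorner]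
  intro i
  obtain ⟨f, g, hf, hg, hf0, hg0, hfg⟩ := (hφ.tangent i).diffCorner
  exact eventually_wedge_of_patchNum hf hg hf0 hg0 hfg
    (patchNum_eventually_eq_zero hτ hF hΨ hφ (hω0 _) (analyticAt_coeffX τ u v i (hκa i))
      (analyticAt_coeffY u i (hκa i)) (analyticAt_coeffX τ u v _ (hκa _))
      (analyticAt_coeffY u _ (hκa _)) (hsec i) (hsec (i + 1)) hf hg hf0 hg0 hfg)

end Normalization

/-! ### Cocycles preserving a logarithmic foliation -/

section Corners

variable {i : Fin 4} {φ φ' ψ : ℂ × ℂ → ℂ × ℂ} {u v : ℂ}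

theorem DiffCorner.tendsto (h : DiffCorner i φ) : Tendsto φ (cornerGerm i) (cornerGerm i) := by
  have ht := h.eventually_mem_torus
  obtain ⟨f, g, hf, hg, hf0, hg0, h⟩ := h
  refine tendsto_inf.2 ⟨tendsto_comap_iff.2 ?_, tendsto_principal.2 ht⟩
  have h1 := (analyticAt_cornerMap i hf hg hf0 hg0).continuousAt.tendsto
  rw [cornerMap_zero] at h1
  refine (h1.comp (tendsto_cornerChart i)).congr' ?_
  filter_upwards [h] with p hp
  rw [Function.comp_apply, Function.comp_apply, hp, cornerChart_mul]

theorem DiffCorner.eventually_differentiableAt (h : DiffCorner i φ) :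
    ∀ᶠ p in cornerGerm i, DifferentiableAt ℂ φ p := by
  obtain ⟨f, g, hf, hg, hf0, hg0, h⟩ := h
  exact eventually_differentiableAt_of_corner hf hg h

theorem DiffCornerOne.comp (h : DiffCornerOne i φ) (h' : DiffCornerOne i φ') :
    DiffCornerOne i (fun p => φ (φ' p)) := by
  have ht := h'.diffCorner.tendsto
  obtain ⟨f, g, hf, hg, hf0, hg0, h⟩ := h
  obtain ⟨f', g', hf', hg', hf0', hg0', h'⟩ := h'
  have hm := analyticAt_cornerMap i hf' hg' (by simp [hf0']) (by simp [hg0'])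
  have hm0 := cornerMap_zero i f' g'
  refine ⟨fun x => f' x * f (cornerMap i f' g' x), fun x => g' x * g (cornerMap i f' g' x),
    hf'.mul (hf.comp_of_eq hm hm0), hg'.mul (hg.comp_of_eq hm hm0), by simp [hm0, hf0, hf0'],
    by simp [hm0, hg0, hg0'], ?_⟩
  filter_upwards [h', ht.eventually h] with p e1 e2
  rw [e2, e1, cornerChart_mul]
  simp only [mul_assoc]

theorem cornerGerm_le_left (i : Fin 4) : cornerGerm i ≤ lineGerm i := by
  rw [cornerGerm_eq]; exact inf_le_left

theorem cornerGerm_le_right (i : Fin 4) : cornerGerm i ≤ lineGerm (i + 1) := by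
  rw [cornerGerm_eq]; exact inf_le_right

theorem analyticAt_comp_axis (i : Fin 4) {f : ℂ → ℂ} (hf : AnalyticAt ℂ f 0) :
    AnalyticAt ℂ (fun x => f (axis i x)) 0 :=
  hf.comp_of_eq (analyticAt_axis i 0) (axis_zero i)

theorem DiffLine.diffCorner_right (h : DiffLine (i + 1) ψ) : DiffCorner i ψ := by
  obtain ⟨f, g, hf, hg, hf0, hg0, h⟩ := h
  refine ⟨_, _, analyticAt_comp_axis (i + 1) hf, analyticAt_comp_axis (i + 1) hg,
    by rwa [axis_zero], by rwa [axis_zero], ?_⟩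
  filter_upwards [cornerGerm_le_right i h] with p hp
  rw [hp, lineCoord_succ_eq_axis]

theorem DiffLineOne.diffCornerOne_left (h : DiffLineOne i ψ) : DiffCornerOne i ψ := by
  obtain ⟨f, g, hf, hg, hf0, hg0, h⟩ := h
  refine ⟨_, _, analyticAt_comp_axis i hf, analyticAt_comp_axis i hg, by rwa [axis_zero],
    by rwa [axis_zero], ?_⟩
  filter_upwards [cornerGerm_le_left i h] with p hp
  rw [hp, lineCoord_eq_axis]

theorem DiffLineOne.diffCornerOne_right (h : DiffLineOne (i + 1) ψ) : DiffCornerOne i ψ := by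
  obtain ⟨f, g, hf, hg, hf0, hg0, h⟩ := h
  refine ⟨_, _, analyticAt_comp_axis (i + 1) hf, analyticAt_comp_axis (i + 1) hg,
    by rwa [axis_zero], by rwa [axis_zero], ?_⟩
  filter_upwards [cornerGerm_le_right i h] with p hp
  rw [hp, lineCoord_succ_eq_axis]

theorem DiffLineOne.diffLine (h : DiffLineOne i ψ) : DiffLine i ψ := by
  obtain ⟨f, g, hf, hg, hf0, hg0, h⟩ := h
  exact ⟨f, g, hf, hg, by simp [hf0], by simp [hg0], h⟩

theorem DiffLine.torusFlow (h : DiffLine i ψ) (s : ℂ) :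
    DiffLine i (fun p => torusFlow τ s (ψ p)) := by
  obtain ⟨f, g, hf, hg, hf0, hg0, h⟩ := h
  refine ⟨_, _, analyticAt_const.mul hf, analyticAt_const.mul hg,
    mul_ne_zero (Complex.exp_ne_zero (2 * Real.pi * Complex.I * s)) hf0,
    mul_ne_zero (Complex.exp_ne_zero (2 * Real.pi * Complex.I * τ * s)) hg0, ?_⟩
  filter_upwards [h] with p hp
  simp only [EllipticNbhd.torusFlow, hp]
  ext
  · simp only [Pi.mul_apply]; ring
  · simp only [Pi.mul_apply]; ring

/-- The pull-back of a logarithmic form with constant coefficients by `(X f(ℓ), Y g(ℓ))`. -/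
theorem pullback_scale_logForm {f g : ℂ → ℂ} {p : ℂ × ℂ} (hp : p ∈ torus)
    (hψ : ∀ᶠ q in 𝓝 p, ψ q = (q.1 * f (lineCoord i q), q.2 * g (lineCoord i q)))
    (hf : DifferentiableAt ℂ f (lineCoord i p)) (hg : DifferentiableAt ℂ g (lineCoord i p))
    (hf0 : f (lineCoord i p) ≠ 0) (hg0 : g (lineCoord i p) ≠ 0) :
    pullback ψ (logForm τ u v) p = (logForm τ u v + axisForm i (fun l =>
      (v - u) * τ * (deriv f l / f l) + u * (deriv g l / g l))) p := by
  have hc := ((analyticAt_lineCoord i hp).differentiableAt).hasFDerivAt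
  have hfc := hf.hasDerivAt.comp_hasFDerivAt p hc
  have hgc := hg.hasDerivAt.comp_hasFDerivAt p hc
  have h1 := ((hasFDerivAt_fst (𝕜 := ℂ) (p := p)).mul hfc).prodMk
    ((hasFDerivAt_snd (𝕜 := ℂ) (p := p)).mul hgc)
  have h2 := h1.congr_of_eventuallyEq (f₁ := ψ) hψ
  have hp1 := hp.1
  have hp2 := hp.2
  rw [pullback, h2.fderiv, hψ.self_of_nhds, Pi.add_apply, logForm_eq, axisForm]
  refine ContinuousLinearMap.ext fun w => ?_
  simp only [logCovec, ContinuousLinearMap.comp_apply, ContinuousLinearMap.prod_apply,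
    ContinuousLinearMap.coe_fst', ContinuousLinearMap.coe_snd', _root_.smul_apply, smul_eq_mul,
    _root_.add_apply, Function.comp_apply]
  field_simp
  ring

/-- The pull-back of the foliation `(v - u) τ dX / X + u dY / Y = 0` by a germ in `Diff(V_i, L_i)`
is given by the sum of the same logarithmic form and of a closed holomorphic form. -/
theorem DiffLine.exists_pullback (h : DiffLine i ψ) (τ u v : ℂ) : ∃ k : ℂ → ℂ, AnalyticAt ℂ k 0 ∧
    ∀ᶠ p in lineGerm i, DifferentiableAt ℂ ψ p ∧
      pullback ψ (logForm τ u v) p = (logForm τ u v + axisForm i k) p := by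
  obtain ⟨f, g, hf, hg, hf0, hg0, h⟩ := h
  refine ⟨fun l => (v - u) * τ * (deriv f l / f l) + u * (deriv g l / g l),
    (analyticAt_const.mul (hf.deriv.div hf hf0)).add
    (analyticAt_const.mul (hg.deriv.div hg hg0)), ?_⟩
  have ht : Tendsto (lineCoord i) (lineGerm i) (𝓝 0) := tendsto_comap.mono_left inf_le_left
  filter_upwards [eventually_eventually_lineGerm h, eventually_torus_lineGerm i,
    ht.eventually (hf.eventually_analyticAt), ht.eventually (hg.eventually_analyticAt),
    ht.eventually (hf.continuousAt.eventually_ne hf0),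
    ht.eventually (hg.continuousAt.eventually_ne hg0)] with p e1 e2 e3 e4 e5 e6
  refine ⟨?_, pullback_scale_logForm e2 e1 e3.differentiableAt e4.differentiableAt e5 e6⟩
  have hc := (analyticAt_lineCoord i e2).differentiableAt
  exact ((differentiableAt_fst.mul (e3.differentiableAt.comp p hc)).prodMk
    (differentiableAt_snd.mul (e4.differentiableAt.comp p hc))).congr_of_eventuallyEq e1

/-- The map `(X, Y h(ℓ))` or `(X h(ℓ), Y)`, which preserves the coordinate `ℓ = X^{±1}` or
`ℓ = Y^{±1}` vanishing on `L_i`. -/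
noncomputable def shear : Fin 4 → (ℂ → ℂ) → ℂ × ℂ → ℂ × ℂ
  | 0, h, p => (p.1, p.2 * h (lineCoord 0 p))
  | 1, h, p => (p.1 * h (lineCoord 1 p), p.2)
  | 2, h, p => (p.1, p.2 * h (lineCoord 2 p))
  | 3, h, p => (p.1 * h (lineCoord 3 p), p.2)

/-- The residue of `(v - u) τ dX / X + u dY / Y` that `shear i` sees. -/
noncomputable def residue (τ u v : ℂ) : Fin 4 → ℂ
  | 0 => u
  | 1 => (v - u) * τ
  | 2 => u
  | 3 => (v - u) * τ

theorem residue_eq_zero {i : Fin 4} (h : residue τ u v i = 0) :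
    (u = 0 ∧ logY i = 0) ∨ ((v - u) * τ = 0 ∧ logX i = 0) := by
  fin_cases i
  exacts [Or.inl ⟨h, rfl⟩, Or.inr ⟨h, rfl⟩, Or.inl ⟨h, rfl⟩, Or.inr ⟨h, rfl⟩]

theorem shear_shear (i : Fin 4) {h h' : ℂ → ℂ} {p : ℂ × ℂ}
    (hh : h (lineCoord i p) * h' (lineCoord i p) = 1) : shear i h (shear i h' p) = p := by
  rw [mul_comm] at hh
  fin_cases i <;> simp only [shear, lineCoord] at hh ⊢ <;> simp [mul_assoc, hh]

theorem diffLineOne_shear (i : Fin 4) {h : ℂ → ℂ} (hh : AnalyticAt ℂ h 0) (h0 : h 0 = 1) :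
    DiffLineOne i (shear i h) := by
  have h1 : AnalyticAt ℂ (fun _ : ℂ => (1 : ℂ)) 0 := analyticAt_const
  fin_cases i
  · exact ⟨_, _, h1, hh, rfl, h0, by simp [shear]⟩
  · exact ⟨_, _, hh, h1, h0, rfl, by simp [shear]⟩
  · exact ⟨_, _, h1, hh, rfl, h0, by simp [shear]⟩
  · exact ⟨_, _, hh, h1, h0, rfl, by simp [shear]⟩

theorem pullback_shear (i : Fin 4) {h : ℂ → ℂ} {p : ℂ × ℂ} (hp : p ∈ torus)
    (hd : DifferentiableAt ℂ h (lineCoord i p)) (h0 : h (lineCoord i p) ≠ 0) :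
    pullback (shear i h) (logForm τ u v) p = (logForm τ u v + axisForm i (fun l =>
      residue τ u v i * (deriv h l / h l))) p := by
  have h1 : ∀ l : ℂ, DifferentiableAt ℂ (fun _ : ℂ => (1 : ℂ)) l := fun _ =>
    differentiableAt_const _
  fin_cases i
  · rw [pullback_scale_logForm hp (f := fun _ => 1) (by simp [shear]) (h1 _) hd one_ne_zero h0]
    simp [residue]
  · rw [pullback_scale_logForm hp (g := fun _ => 1) (by simp [shear]) hd (h1 _) h0 one_ne_zero]
    simp [residue]
  · rw [pullback_scale_logForm hp (f := fun _ => 1) (by simp [shear]) (h1 _) hd one_ne_zero h0]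
    simp [residue]
  · rw [pullback_scale_logForm hp (g := fun _ => 1) (by simp [shear]) hd (h1 _) h0 one_ne_zero]
    simp [residue]

theorem exists_primitive {k : ℂ → ℂ} (hk : AnalyticAt ℂ k 0) :
    ∃ K : ℂ → ℂ, K 0 = 0 ∧ ∀ᶠ l in 𝓝 (0 : ℂ), HasDerivAt K (k l) l := by
  obtain ⟨r, hr, h⟩ := Metric.eventually_nhds_iff_ball.1 hk.eventually_analyticAt
  have hd : DifferentiableOn ℂ k (Metric.ball 0 r) := fun x hx =>
    (h x hx).differentiableAt.differentiableWithinAt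
  obtain ⟨K, hK⟩ := hd.isExactOn_ball
  refine ⟨fun l => K l - K 0, sub_self _, ?_⟩
  filter_upwards [Metric.ball_mem_nhds (0 : ℂ) hr] with l hl
  exact (hK l hl).sub_const _

/-- Straightening along `L_i`: the foliation `(v - u) τ dX / X + u dY / Y + k(ℓ) dℓ = 0` is
conjugated to `(v - u) τ dX / X + u dY / Y = 0` by a shear. If the residue seen by the shear
vanishes, the two foliations are equal already. -/
theorem exists_shear (hτ : 0 < τ.im) (huv : (u, v) ≠ (0, 0)) (i : Fin 4) {k : ℂ → ℂ}
    (hk : AnalyticAt ℂ k 0) : ∃ h : ℂ → ℂ, AnalyticAt ℂ h 0 ∧ h 0 = 1 ∧ (∀ l, h l ≠ 0) ∧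
      ∀ᶠ p in lineGerm i, DifferentiableAt ℂ (shear i h) p ∧ ∃ c : ℂ,
        pullback (shear i h) (logForm τ u v) p = c • (logForm τ u v + axisForm i k) p := by
  obtain ⟨K, hK0, hK⟩ := exists_primitive hk
  set ρ := residue τ u v i with hρ
  have hKa : AnalyticAt ℂ K 0 := Complex.analyticAt_iff_eventually_differentiableAt.2
    (hK.mono fun l hl => hl.differentiableAt)
  -- for `ρ ≠ 0` the shear adds `ρ dh / h = dK` to the form; for `ρ = 0` it is the identity
  set h : ℂ → ℂ := fun l => Complex.exp (K l / ρ) with hh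
  have hha : AnalyticAt ℂ h 0 := by
    simp only [hh, div_eq_mul_inv]
    exact (hKa.mul analyticAt_const).cexp
  have hh0 : h 0 = 1 := by simp [hh, hK0]
  refine ⟨h, hha, hh0, fun l => Complex.exp_ne_zero _, ?_⟩
  obtain ⟨_, -, hd⟩ := (diffLineOne_shear i hha hh0).diffLine.exists_pullback τ u v
  have ht : Tendsto (lineCoord i) (lineGerm i) (𝓝 0) := tendsto_comap.mono_left inf_le_left
  have hcx : ∀ᶠ p in lineGerm i, (v - u) * τ ≠ 0 → coeffX τ u v i k (lineCoord i p) ≠ 0 := by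
    by_cases h1 : (v - u) * τ = 0
    · exact Eventually.of_forall fun _ h2 => absurd h1 h2
    · refine (ht.eventually ((analyticAt_coeffX τ u v i hk).continuousAt.eventually_ne
        (by rwa [coeffX_zero]))).mono fun p hp _ => hp
  have hcy : ∀ᶠ p in lineGerm i, u ≠ 0 → coeffY u i k (lineCoord i p) ≠ 0 := by
    by_cases h1 : u = 0
    · exact Eventually.of_forall fun _ h2 => absurd h1 h2
    · refine (ht.eventually ((analyticAt_coeffY u i hk).continuousAt.eventually_ne
        (by rwa [coeffY_zero]))).mono fun p hp _ => hp
  filter_upwards [hd, eventually_torus_lineGerm i, ht.eventually hha.eventually_analyticAt,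
    ht.eventually hK, hcx, hcy] with p e1 e2 e3 e4 e5 e6
  refine ⟨e1.1, ?_⟩
  rw [pullback_shear i e2 e3.differentiableAt (Complex.exp_ne_zero _)]
  by_cases hρ0 : ρ = 0
  · have e7 : ∀ l, residue τ u v i * (deriv h l / h l) = 0 := fun l => by
      rw [← hρ, hρ0, zero_mul]
    have e8 : (logForm τ u v + axisForm i fun l => residue τ u v i * (deriv h l / h l)) p =
        logCovec ((v - u) * τ) u p := by
      rw [Pi.add_apply, axisForm]
      simp only [e7]
      rw [logForm_eq]
      refine ContinuousLinearMap.ext fun w => ?_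
      simp
    rw [e8, logForm_add_axisForm i k e2, lineForm]
    rcases residue_eq_zero (hρ.symm.trans hρ0) with ⟨h1, h2⟩ | ⟨h1, h2⟩
    · have h3 := (residues_ne_zero hτ huv).resolve_right (by simp [h1])
      have h4 : coeffY u i k (lineCoord i p) = 0 := by simp [coeffY, h1, h2]
      refine ⟨(v - u) * τ / coeffX τ u v i k (lineCoord i p), covector_ext ?_ ?_⟩
      · rw [_root_.smul_apply, logCovec_fst, logCovec_fst, smul_eq_mul, div_mul_div_cancel₀ (e5 h3)]
      · rw [_root_.smul_apply, logCovec_snd, logCovec_snd, h4, h1]; simp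
    · have h3 := (residues_ne_zero hτ huv).resolve_left (by simp [h1])
      have h4 : coeffX τ u v i k (lineCoord i p) = 0 := by simp [coeffX, h1, h2]
      refine ⟨u / coeffY u i k (lineCoord i p), covector_ext ?_ ?_⟩
      · rw [_root_.smul_apply, logCovec_fst, logCovec_fst, h4, h1]; simp
      · rw [_root_.smul_apply, logCovec_snd, logCovec_snd, smul_eq_mul, div_mul_div_cancel₀ (e6 h3)]
  · refine ⟨1, ?_⟩
    have h5 : HasDerivAt h (h (lineCoord i p) * (k (lineCoord i p) / ρ)) (lineCoord i p) :=
      (e4.div_const ρ).cexp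
    rw [one_smul, Pi.add_apply, Pi.add_apply, axisForm, axisForm, h5.deriv, ← hρ]
    congr 2
    have := Complex.exp_ne_zero (K (lineCoord i p) / ρ)
    simp only [hh]
    field_simp

end Corners

section Cocycles

variable {φ χ ψ : Fin 4 → ℂ × ℂ → ℂ × ℂ} {u v : ℂ}

/-- If logarithmic forms with the residues of `(v - u) τ dX / X + u dY / Y` patch under the cocycle,
straightening them along each line conjugates the cocycle to one which preserves the
logarithmic foliation. -/
theorem exists_preserving_cocycle (hτ : 0 < τ.im) (huv : (u, v) ≠ (0, 0))
    (hφ : ∀ i, DiffCornerOne i (φ i)) {k : Fin 4 → ℂ → ℂ} (hk : ∀ i, AnalyticAt ℂ (k i) 0)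
    (hp : FoliationsPatch φ (fun i => logForm τ u v + axisForm i (k i))) :
    ∃ χ ψ : Fin 4 → ℂ × ℂ → ℂ × ℂ, (∀ i, DiffCornerOne i (χ i)) ∧ (∀ i, DiffLineOne i (ψ i)) ∧
      Conjugates ψ φ χ ∧ PreservesLogFoliation τ u v χ := by
  choose h hh h0 hne hpull using fun i => exists_shear hτ huv i (hk i)
  set ψ : Fin 4 → ℂ × ℂ → ℂ × ℂ := fun i => shear i (h i) with hψ
  set σ : Fin 4 → ℂ × ℂ → ℂ × ℂ := fun i => shear i (fun l => (h i l)⁻¹) with hσ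
  have hψ1 : ∀ i, DiffLineOne i (ψ i) := fun i => diffLineOne_shear i (hh i) (h0 i)
  have hσ1 : ∀ i, DiffLineOne i (σ i) := fun i =>
    diffLineOne_shear i ((hh i).inv (hne i 0)) (by rw [h0, inv_one])
  have hψσ : ∀ i p, ψ i (σ i p) = p := fun i p => shear_shear i (mul_inv_cancel₀ (hne i _))
  have hσψ : ∀ i p, σ i (ψ i p) = p := fun i p => shear_shear i (inv_mul_cancel₀ (hne i _))
  refine ⟨fun i p => ψ i (φ i (σ (i + 1) p)), ψ, fun i => ?_, hψ1, fun i => ?_, fun i => ?_⟩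
  · exact (hψ1 i).diffCornerOne_left.comp ((hφ i).comp (hσ1 (i + 1)).diffCornerOne_right)
  · exact Eventually.of_forall fun p => by simp only [hσψ]
  · have hs := (hσ1 (i + 1)).diffCornerOne_right.diffCorner
    have hf := (hφ i).diffCorner
    have ht := hf.tendsto.comp hs.tendsto
    filter_upwards [hs.eventually_differentiableAt,
      hs.tendsto.eventually hf.eventually_differentiableAt,
      ht.eventually (cornerGerm_le_left i (hpull i)),
      hs.tendsto.eventually (cornerGerm_le_right i (hpull (i + 1))),
      hs.tendsto.eventually (hp i)] with p d1 d2 d3 d4 d5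
    obtain ⟨d3, c, d6⟩ := d3
    obtain ⟨d4, c', d7⟩ := d4
    have e1 : pullback (fun p => ψ i (φ i (σ (i + 1) p))) (logForm τ u v) p =
        pullback (σ (i + 1)) (pullback (φ i) (pullback (ψ i) (logForm τ u v))) p := by
      rw [pullback_comp (f := fun p => φ i (σ (i + 1) p)) (g := ψ i) d3 (d2.comp p d1),
        pullback_comp (f := σ (i + 1)) (g := φ i) d2 d1]
    have e2 : logForm τ u v p = pullback (σ (i + 1)) (pullback (ψ (i + 1)) (logForm τ u v)) p := by
      rw [← pullback_comp d4 d1, pullback_congr (g := id) (Eventually.of_forall (hψσ (i + 1)))]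
      simp [pullback]
    change wedge (pullback (fun p => ψ i (φ i (σ (i + 1) p))) (logForm τ u v) p) _ = 0
    rw [e1, e2, wedge_pullback]
    have e3 : pullback (φ i) (pullback (ψ i) (logForm τ u v)) (σ (i + 1) p) =
        c • pullback (φ i) (logForm τ u v + axisForm i (k i)) (σ (i + 1) p) := by
      simp only [pullback, Function.comp_apply] at d6 ⊢
      rw [d6, ContinuousLinearMap.smul_comp]
    have e4 : pullback (ψ (i + 1)) (logForm τ u v) (σ (i + 1) p) =
      c' • (logForm τ u v + axisForm (i + 1) (k (i + 1))) (σ (i + 1) p) := d7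
    rw [e3, e4, wedge_smul_left, wedge_smul_right, d5]
    simp

/-- The pull-backs by the `ψ_i` of a logarithmic foliation preserved by the conjugate cocycle
patch under the original cocycle. -/
theorem foliationsPatch_of_conjugates (hφ : ∀ i, DiffCorner i (φ i))
    (hχ : ∀ i, DiffCorner i (χ i)) (hψ : ∀ i, DiffLine i (ψ i)) (hc : Conjugates ψ φ χ)
    (hp : PreservesLogFoliation τ u v χ) {k : Fin 4 → ℂ → ℂ}
    (hk : ∀ i, ∀ᶠ p in lineGerm i, DifferentiableAt ℂ (ψ i) p ∧
      pullback (ψ i) (logForm τ u v) p = (logForm τ u v + axisForm i (k i)) p) :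
    FoliationsPatch φ (fun i => logForm τ u v + axisForm i (k i)) := by
  intro i
  have hr := (hψ (i + 1)).diffCorner_right
  filter_upwards [(hφ i).eventually_differentiableAt,
    (hφ i).tendsto.eventually (cornerGerm_le_left i (hk i)), cornerGerm_le_right i (hk (i + 1)),
    eventually_eventually_cornerGerm (hc i),
    hr.tendsto.eventually (hχ i).eventually_differentiableAt, hr.tendsto.eventually (hp i)]
    with p d1 d2 d3 d4 d5 d6
  have e1 := pullback_congr (f := fun p => ψ i (φ i p)) (g := fun p => χ i (ψ (i + 1) p)) d4
    (logForm τ u v)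
  rw [pullback_comp d2.1 d1, pullback_comp d5 d3.1, pullback_congr_form d2.2] at e1
  rw [← d3.2, e1, wedge_pullback, d6, zero_mul]

theorem CocycleEquivOne.cocycleEquiv (h : CocycleEquivOne τ φ χ) : CocycleEquiv φ χ := by
  obtain ⟨s, ψ, h1, h2⟩ := h
  exact ⟨_, fun i => (h1 i).diffLine.torusFlow s, h2⟩

theorem CocycleEquivOne.of_conjugates (h1 : ∀ i, DiffLineOne i (ψ i)) (h2 : Conjugates ψ φ χ) :
    CocycleEquivOne τ φ χ :=
  ⟨0, ψ, h1, by simpa [torusFlow] using h2⟩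

end Cocycles

/-! ### Gluing sectorial functions to a holomorphic function along the curve -/

/-- The functional `f ↦ ∫ ∫ g(s, t) f(e ^ {i s}, e ^ {i t}) ds dt` on continuous functions on the
torus. -/
theorem exists_torus_functional {g : ℝ → ℝ → ℂ} (hg : Continuous (Function.uncurry g)) :
    ∃ Λ : C(Circle × Circle, ℂ) →L[ℂ] ℂ, ∀ f : C(Circle × Circle, ℂ), Λ f =
      ∫ s in (0 : ℝ)..2 * Real.pi, ∫ t in (0 : ℝ)..2 * Real.pi,
        g s t * f (Circle.exp s, Circle.exp t) := by
  have hc : ∀ f : C(Circle × Circle, ℂ),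
      Continuous (Function.uncurry fun s t : ℝ => g s t * f (Circle.exp s, Circle.exp t)) := by
    intro f
    have : Continuous fun q : ℝ × ℝ => f (Circle.exp q.1, Circle.exp q.2) := by fun_prop
    exact hg.mul this
  have hci : ∀ f : C(Circle × Circle, ℂ), Continuous fun s : ℝ =>
      ∫ t in (0 : ℝ)..2 * Real.pi, g s t * f (Circle.exp s, Circle.exp t) := fun f =>
    intervalIntegral.continuous_parametric_intervalIntegral_of_continuous' (hc f) _ _
  have hct : ∀ (f : C(Circle × Circle, ℂ)) (s : ℝ), Continuous fun t : ℝ =>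
      g s t * f (Circle.exp s, Circle.exp t) := fun f s =>
    (hc f).comp (by fun_prop : Continuous fun t : ℝ => (s, t))
  obtain ⟨K, hK⟩ := ((isCompact_Icc (a := (0 : ℝ)) (b := 2 * Real.pi)).prod
    (isCompact_Icc (a := (0 : ℝ)) (b := 2 * Real.pi))).exists_bound_of_continuousOn hg.continuousOn
  have h2π : (0 : ℝ) ≤ 2 * Real.pi := Real.two_pi_pos.le
  have hsub : ∀ s ∈ Set.uIoc (0 : ℝ) (2 * Real.pi), s ∈ Set.Icc (0 : ℝ) (2 * Real.pi) := by
    intro s hs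
    rw [Set.uIoc_of_le h2π] at hs
    exact ⟨hs.1.le, hs.2⟩
  refine ⟨LinearMap.mkContinuous
    { toFun := fun f => ∫ s in (0 : ℝ)..2 * Real.pi, ∫ t in (0 : ℝ)..2 * Real.pi,
        g s t * f (Circle.exp s, Circle.exp t)
      map_add' := fun f f' => ?_
      map_smul' := fun c f => ?_ } (K * |2 * Real.pi - 0| * |2 * Real.pi - 0|) fun f => ?_,
    fun f => rfl⟩
  · rw [← intervalIntegral.integral_add ((hci f).intervalIntegrable _ _)
      ((hci f').intervalIntegrable _ _)]
    refine intervalIntegral.integral_congr fun s _ => ?_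
    rw [← intervalIntegral.integral_add ((hct f s).intervalIntegrable _ _)
      ((hct f' s).intervalIntegrable _ _)]
    refine intervalIntegral.integral_congr fun t _ => ?_
    simp [mul_add]
  · rw [RingHom.id_apply, smul_eq_mul, ← intervalIntegral.integral_const_mul]
    refine intervalIntegral.integral_congr fun s _ => ?_
    rw [← intervalIntegral.integral_const_mul]
    refine intervalIntegral.integral_congr fun t _ => ?_
    simp only [ContinuousMap.smul_apply, smul_eq_mul]
    ring
  · have h1 : ∀ s ∈ Set.uIoc (0 : ℝ) (2 * Real.pi),
        ‖∫ t in (0 : ℝ)..2 * Real.pi, g s t * f (Circle.exp s, Circle.exp t)‖ ≤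
          K * ‖f‖ * |2 * Real.pi - 0| := by
      intro s hs
      refine intervalIntegral.norm_integral_le_of_norm_le_const fun t ht => ?_
      rw [norm_mul]
      have h2 := hK (s, t) ⟨hsub s hs, hsub t ht⟩
      exact mul_le_mul h2 (f.norm_coe_le_norm _) (norm_nonneg _) ((norm_nonneg _).trans h2)
    refine (intervalIntegral.norm_integral_le_of_norm_le_const h1).trans (le_of_eq ?_)
    ring

/-- The Cauchy kernel `(c + r e ^ {i s} - w)⁻¹` depends analytically on `w`, as a continuous
function on the torus. -/
theorem analyticAt_cauchy_kernel {c : ℂ} {r : ℝ} (π : C(Circle × Circle, Circle)) (hr : 0 < r)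
    {E : Type*} [NormedAddCommGroup E] [NormedSpace ℂ E] {w : E → ℂ} {p : E}
    (hw : AnalyticAt ℂ w p) (hwp : w p ∈ Metric.ball c r) :
    ∃ k : E → C(Circle × Circle, ℂ), AnalyticAt ℂ k p ∧
      ∀ᶠ q in 𝓝 p, ∀ x, k q x = (c + r * (π x : ℂ) - w q)⁻¹ := by
  set z : C(Circle × Circle, ℂ) := ⟨fun x => c + r * (π x : ℂ), by fun_prop⟩ with hz
  set d : E → C(Circle × Circle, ℂ) := fun q => z - w q • 1 with hd
  have hda : AnalyticAt ℂ d p := analyticAt_const.sub (hw.smul analyticAt_const)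
  have hu : ∀ q, w q ∈ Metric.ball c r → IsUnit (d q) := by
    intro q hq
    rw [ContinuousMap.isUnit_iff_forall_ne_zero]
    intro x hx
    have h1 : w q - c = r * (π x : ℂ) := by
      simp only [hd, hz, ContinuousMap.sub_apply, ContinuousMap.coe_mk,
        ContinuousMap.smul_apply, ContinuousMap.one_apply, smul_eq_mul, mul_one] at hx
      linear_combination -hx
    have h2 := congrArg norm h1
    rw [norm_mul, Circle.norm_coe, mul_one, Complex.norm_real, Real.norm_of_nonneg hr.le] at h2
    rw [Metric.mem_ball, dist_eq_norm, h2] at hq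
    exact lt_irrefl _ hq
  refine ⟨fun q => Ring.inverse (d q), ?_, ?_⟩
  · obtain ⟨U, hU⟩ := hu p hwp
    have := analyticAt_inverse (𝕜 := ℂ) U
    rw [hU] at this
    exact this.comp hda
  · filter_upwards [hw.continuousAt.preimage_mem_nhds (Metric.isOpen_ball.mem_nhds hwp)] with q hq x
    have h1 := Ring.mul_inverse_cancel _ (hu q hq)
    have h2 := congrArg (fun f : C(Circle × Circle, ℂ) => f x) h1
    simp only [hd, hz, ContinuousMap.mul_apply, ContinuousMap.sub_apply, ContinuousMap.coe_mk,
      ContinuousMap.smul_apply, smul_eq_mul, mul_one, ContinuousMap.one_apply] at h2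
    exact eq_inv_of_mul_eq_one_right h2

/-- A function which is holomorphic in each variable, and continuous on the distinguished boundary
of a polydisc, is analytic. -/
theorem analyticAt_of_separately_differentiable {M : ℂ × ℂ → ℂ} {z₀ y₀ : ℂ} {ρ r : ℝ} (hρ : 0 < ρ)
    (hr : 0 < r)
    (h1 : ∀ z ∈ Metric.closedBall z₀ ρ,
      DifferentiableOn ℂ (fun y => M (z, y)) (Metric.closedBall y₀ r))
    (h2 : ∀ y ∈ Metric.sphere y₀ r,
      DifferentiableOn ℂ (fun z => M (z, y)) (Metric.closedBall z₀ ρ))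
    (hc : ContinuousOn M (Metric.sphere z₀ ρ ×ˢ Metric.sphere y₀ r)) :
    AnalyticAt ℂ M (z₀, y₀) := by
  set g : ℝ → ℝ → ℂ := fun s t => deriv (circleMap y₀ r) s * deriv (circleMap z₀ ρ) t *
    M (circleMap z₀ ρ t, circleMap y₀ r s) with hg
  have hgc : Continuous (Function.uncurry g) := by
    have e1 : Continuous fun q : ℝ × ℝ => M (circleMap z₀ ρ q.2, circleMap y₀ r q.1) := by
      refine hc.comp_continuous (by fun_prop) fun q => ⟨?_, ?_⟩
      · exact circleMap_mem_sphere _ hρ.le _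
      · exact circleMap_mem_sphere _ hr.le _
    have e2 : Continuous fun q : ℝ × ℝ =>
        deriv (circleMap y₀ r) q.1 * deriv (circleMap z₀ ρ) q.2 := by
      simp only [deriv_circleMap]
      fun_prop
    exact e2.mul e1
  obtain ⟨Λ, hΛ⟩ := exists_torus_functional hgc
  obtain ⟨k₁, hk₁, hk₁'⟩ := analyticAt_cauchy_kernel (c := y₀) (r := r) ⟨Prod.fst, continuous_fst⟩
    hr (analyticAt_snd (𝕜 := ℂ) (p := (z₀, y₀))) (Metric.mem_ball_self hr)
  obtain ⟨k₂, hk₂, hk₂'⟩ := analyticAt_cauchy_kernel (c := z₀) (r := ρ) ⟨Prod.snd, continuous_snd⟩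
    hρ (analyticAt_fst (𝕜 := ℂ) (p := (z₀, y₀))) (Metric.mem_ball_self hρ)
  have hA : AnalyticAt ℂ (fun q => (2 * Real.pi * Complex.I)⁻¹ * ((2 * Real.pi * Complex.I)⁻¹ *
      Λ (k₁ q * k₂ q))) (z₀, y₀) :=
    analyticAt_const.mul (analyticAt_const.mul
      ((Λ.analyticAt _).comp (hk₁.mul hk₂)))
  refine hA.congr ?_
  have hb : Metric.ball z₀ ρ ×ˢ Metric.ball y₀ r ∈ 𝓝 (z₀, y₀) :=
    prod_mem_nhds (Metric.ball_mem_nhds _ hρ) (Metric.ball_mem_nhds _ hr)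
  filter_upwards [hk₁', hk₂', hb] with q e1 e2 ⟨e3, e4⟩
  have h0 := Complex.two_pi_I_ne_zero
  have c1 := (h1 q.1 (Metric.ball_subset_closedBall e3)).circleIntegral_sub_inv_smul e4
  have c2 : ∀ y ∈ Metric.sphere y₀ r, _ := fun y hy =>
    (h2 y hy).circleIntegral_sub_inv_smul e3
  rw [hΛ, inv_mul_eq_iff_eq_mul₀ h0, inv_mul_eq_iff_eq_mul₀ h0]
  simp only [smul_eq_mul] at c1 c2
  rw [← c1, circleIntegral, ← intervalIntegral.integral_const_mul]
  refine intervalIntegral.integral_congr fun s _ => ?_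
  have c3 := c2 (circleMap y₀ r s) (circleMap_mem_sphere _ hr.le _)
  simp only [smul_eq_mul]
  rw [← mul_assoc, mul_comm (2 * Real.pi * Complex.I), mul_assoc, mul_left_comm _ _ (M _), ← c3,
    circleIntegral, ← intervalIntegral.integral_const_mul, ← intervalIntegral.integral_const_mul]
  refine intervalIntegral.integral_congr fun t _ => ?_
  simp only [hg, ContinuousMap.mul_apply, e1, e2, ContinuousMap.coe_mk, smul_eq_mul, circleMap,
    Circle.coe_exp]
  ring

/-- Riemann's theorem on removable singularities along the curve. -/
theorem exists_analytic_extension {m : ℂ × ℂ → ℂ}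
    (h : ∀ z : ℂ, z ≠ 0 → ∃ K : ℝ, ∀ᶠ p in 𝓝 ((z, 0) : ℂ × ℂ),
      p.2 ≠ 0 → DifferentiableAt ℂ m p ∧ ‖m p‖ ≤ K) :
    ∃ M : ℂ × ℂ → ℂ, (∀ z : ℂ, z ≠ 0 → AnalyticAt ℂ M (z, 0)) ∧ ∀ p, p.2 ≠ 0 → M p = m p := by
  set M : ℂ × ℂ → ℂ := fun p =>
    Function.update (fun y => m (p.1, y)) 0 (limUnder (𝓝[≠] 0) fun y => m (p.1, y)) p.2 with hM
  have hMm : ∀ p : ℂ × ℂ, p.2 ≠ 0 → M p = m p := fun p hp => by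
    simp only [hM]; rw [Function.update_of_ne hp]
  refine ⟨M, fun z hz => ?_, hMm⟩
  obtain ⟨K, hK⟩ := h z hz
  obtain ⟨ρ, hρ, hball⟩ := Metric.eventually_nhds_iff_ball.1 hK
  have hin : ∀ p : ℂ × ℂ, p.1 ∈ Metric.closedBall z (ρ / 2) → p.2 ∈ Metric.closedBall 0 (ρ / 2) →
      p.2 ≠ 0 → DifferentiableAt ℂ m p ∧ ‖m p‖ ≤ K := by
    intro p h1 h2 h3
    refine hball p ?_ h3
    rw [Metric.mem_ball, Prod.dist_eq]
    rw [Metric.mem_closedBall] at h1 h2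
    exact max_lt (by simp only; linarith) (by simp only; linarith)
  have hd1 : ∀ z' y : ℂ, DifferentiableAt ℂ m (z', y) →
      DifferentiableAt ℂ (fun y => m (z', y)) y := fun z' y h =>
    h.comp y (by fun_prop : DifferentiableAt ℂ (fun y : ℂ => (z', y)) y)
  have hd2 : ∀ z' y : ℂ, DifferentiableAt ℂ m (z', y) →
      DifferentiableAt ℂ (fun z => m (z, y)) z' := fun z' y h =>
    h.comp z' (by fun_prop : DifferentiableAt ℂ (fun z : ℂ => (z, y)) z')
  have hsph : ∀ y ∈ Metric.sphere (0 : ℂ) (ρ / 2), y ≠ 0 := fun y hy =>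
    Metric.ne_of_mem_sphere hy (by positivity)
  refine analyticAt_of_separately_differentiable (half_pos hρ) (half_pos hρ) (fun z' hz' => ?_)
    (fun y hy => ?_) ?_
  · refine Complex.differentiableOn_update_limUnder_of_bddAbove
      (Metric.closedBall_mem_nhds _ (half_pos hρ)) (fun y hy => ?_) ⟨K, ?_⟩
    · exact (hd1 z' y (hin (z', y) hz' hy.1 hy.2).1).differentiableWithinAt
    · rintro - ⟨y, hy, rfl⟩
      exact (hin (z', y) hz' hy.1 hy.2).2
  · intro z' hz'
    have e : (fun z => M (z, y)) = fun z => m (z, y) := funext fun z => hMm (z, y) (hsph y hy)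
    rw [e]
    exact (hd2 z' y (hin (z', y) hz' (Metric.sphere_subset_closedBall hy) (hsph y hy)).1
      ).differentiableWithinAt
  · refine ContinuousOn.congr (f := m) (fun p hp => ?_) fun p hp => hMm p (hsph _ hp.2)
    exact (hin p (Metric.sphere_subset_closedBall hp.1) (Metric.sphere_subset_closedBall hp.2)
      (hsph _ hp.2)).1.continuousAt.continuousWithinAt

/-- Bounded holomorphic functions on the four sectors which agree on the intersections of
consecutive sectors are the restrictions of a function which is holomorphic along the curve. -/
theorem exists_analytic_of_sectors (hτ : 0 < τ.im) {m : Fin 4 → ℂ × ℂ → ℂ}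
    (hd : ∀ i, ∀ᶠ p in coneGerm τ {i}, DifferentiableAt ℂ (m i) p) (hb : ∀ i, Bdd τ {i} (m i))
    (hm : ∀ i, ∀ᶠ p in coneGerm τ {i, i + 1}, m i p = m (i + 1) p) :
    ∃ M : ℂ × ℂ → ℂ, (∀ z : ℂ, z ≠ 0 → AnalyticAt ℂ M (z, 0)) ∧
      ∀ i, ∀ᶠ p in coneGerm τ {i}, M p = m i p := by
  obtain ⟨δ, hδ, hcov⟩ := exists_index_cover hτ
  choose! idx hidx using hcov
  set M₀ : ℂ × ℂ → ℂ := fun p => m (idx p.2) p with hM₀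
  have heq : ∀ i, ∀ᶠ p in coneGerm τ {i}, M₀ p = m i p := by
    intro i c hc δ' hδ'
    have hδ'' : 0 < min δ δ' := lt_min hδ hδ'
    choose r hr hrm using fun j => eventually_coneGerm.1 (hm j) c hc (min δ δ') hδ''
    set r₀ := min (min (r 0) (r 1)) (min (r 2) (r 3)) with hr₀
    have hr₀p : 0 < r₀ := lt_min (lt_min (hr 0) (hr 1)) (lt_min (hr 2) (hr 3))
    have hr₀le : ∀ j, r₀ ≤ r j := by
      intro j
      fin_cases j
      · exact (min_le_left _ _).trans (min_le_left _ _)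
      · exact (min_le_left _ _).trans (min_le_right _ _)
      · exact (min_le_right _ _).trans (min_le_left _ _)
      · exact (min_le_right _ _).trans (min_le_right _ _)
    refine ⟨r₀, hr₀p, fun p hp => ?_⟩
    have hy : p.2 ≠ 0 := hp.2.2.1
    have h1 := hidx p.2 hy
    have h2 := hp.2.2.2.2 i rfl
    have hcone : ∀ j, (j = i ∧ idx p.2 = j + 1) ∨ (j + 1 = i ∧ idx p.2 = j) →
        p ∈ cone τ {j, j + 1} c (min δ δ') (r j) := by
      intro j hj
      refine ⟨hp.1, hp.2.1, hy, hp.2.2.2.1.trans_le (hr₀le j), ?_⟩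
      have h3 : min δ δ' < ‖p.2‖ * (dir τ i / p.2).im := (min_le_right _ _).trans_lt h2
      have h4 : min δ δ' < ‖p.2‖ * (dir τ (idx p.2) / p.2).im := (min_le_left _ _).trans_lt h1
      rintro l (rfl | rfl) <;> rcases hj with ⟨e1, e2⟩ | ⟨e1, e2⟩
      · rwa [e1]
      · rwa [← e2]
      · rwa [← e2]
      · rwa [e1]
    have hcases : idx p.2 = i ∨ idx p.2 = i + 1 ∨ idx p.2 = i + 2 ∨ idx p.2 + 1 = i := by
      have : ∀ i j : Fin 4, j = i ∨ j = i + 1 ∨ j = i + 2 ∨ j + 1 = i := by decide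
      exact this _ _
    change m (idx p.2) p = m i p
    rcases hcases with h | h | h | h
    · rw [h]
    · rw [h]
      exact (hrm i p (hcone i (Or.inl ⟨rfl, h⟩))).symm
    -- opposite sectors are disjoint
    · exfalso
      rw [h, dir_add_two, neg_div, Complex.neg_im] at h1
      linarith
    · have := hrm (idx p.2) p (hcone _ (Or.inr ⟨h, rfl⟩))
      rw [h] at this
      exact this
  have hd₀ : ∀ i, ∀ᶠ p in coneGerm τ {i}, DifferentiableAt ℂ M₀ p := by
    intro i
    filter_upwards [hd i, eventually_eventually_coneGerm (heq i)] with p e1 e2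
    exact e1.congr_of_eventuallyEq e2
  obtain ⟨M, hM, hMM⟩ := exists_analytic_extension (m := M₀) fun z hz => by
    obtain ⟨c, hc, hcz⟩ : ∃ c > 0, Real.exp (-c) < ‖z‖ ∧ ‖z‖ < Real.exp c := by
      refine ⟨|Real.log ‖z‖| + 1, by positivity, ?_, ?_⟩
      · rw [← Real.lt_log_iff_exp_lt (norm_pos_iff.2 hz)]
        linarith [neg_abs_le (Real.log ‖z‖)]
      · rw [← Real.log_lt_iff_lt_exp (norm_pos_iff.2 hz)]
        linarith [le_abs_self (Real.log ‖z‖)]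
    choose r hr hrd using fun j => eventually_coneGerm.1 (hd₀ j) c hc δ hδ
    choose K r' hr' hrb using fun j => ((hb j).congr' ((heq j).mono fun p hp => hp.symm)) c hc δ hδ
    have hK : ∀ j, K j ≤ ∑ l, |K l| := fun j => (le_abs_self _).trans
      (Finset.single_le_sum (f := fun l => |K l|) (fun _ _ => abs_nonneg _) (Finset.mem_univ j))
    refine ⟨∑ l, |K l|, ?_⟩
    have n1 : ∀ᶠ p in 𝓝 ((z, 0) : ℂ × ℂ), Real.exp (-c) < ‖p.1‖ ∧ ‖p.1‖ < Real.exp c := by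
      have := (continuousAt_fst (p := ((z, 0) : ℂ × ℂ))).norm
      exact (this.eventually (lt_mem_nhds hcz.1)).and (this.eventually (gt_mem_nhds hcz.2))
    have n2 : ∀ j, ∀ᶠ p in 𝓝 ((z, 0) : ℂ × ℂ), ‖p.2‖ < min (r j) (r' j) := fun j =>
      (continuousAt_snd (p := ((z, 0) : ℂ × ℂ))).norm.eventually
        (gt_mem_nhds (by simpa using ⟨hr j, hr' j⟩))
    filter_upwards [n1, eventually_all.2 n2] with p e1 e2 e3
    have hcone : p ∈ cone τ {idx p.2} c δ (min (r (idx p.2)) (r' (idx p.2))) :=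
      ⟨e1.1, e1.2, e3, e2 _, fun l hl => by rw [hl]; exact hidx p.2 e3⟩
    exact ⟨hrd _ p (cone_mono subset_rfl le_rfl le_rfl (min_le_left _ _) hcone),
      (hrb _ p (cone_mono subset_rfl le_rfl le_rfl (min_le_right _ _) hcone)).trans (hK _)⟩
  refine ⟨M, hM, fun i => ?_⟩
  filter_upwards [heq i, eventually_snd_ne_zero τ {i}] with p e1 e2
  rw [hMM p e2, e1]

/-! ### From patching logarithmic forms to a convergent foliation -/

theorem axisL_add_smul_apply (j : Fin 4) (c : ℂ) :
    (axisL j + c • axisL (j + 1)) (axisVec j) = 1 ∧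
      (axisL j + c • axisL (j + 1)) (axisVec (j + 1)) = c := by
  fin_cases j <;> simp [axisL, axisVec, Fin.add_def]

theorem wedge_eq_zero_iff_axis (j : Fin 4) (α β : ℂ × ℂ →L[ℂ] ℂ) :
    wedge α β = 0 ↔ α (axisVec j) * β (axisVec (j + 1)) = α (axisVec (j + 1)) * β (axisVec j) := by
  fin_cases j <;> simp only [axisVec, wedge, Fin.add_def] <;> constructor <;> intro h
  all_goals first | linear_combination h | linear_combination -h

theorem flat_of_eventually_eq_zero {g : ℂ × ℂ → ℂ} (h : ∀ᶠ p in coneGerm τ S, g p = 0) :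
    Flat τ S g := fun _ =>
  (isLittleO_zero _ _).congr' (h.mono fun _ hp => hp.symm) EventuallyEq.rfl

theorem Flat.mul_comp_self {f : ℂ × ℂ → ℂ} (hf : Flat τ S f) {k : ℂ → ℂ} (hk : AnalyticAt ℂ k 0) :
    Flat τ S (fun p => f p * k (f p)) :=
  hf.mul_bdd (Bdd.of_tendsto (hk.continuousAt.tendsto.comp ((hf 0).tendsto le_rfl)))

theorem eventually_analyticAt_lineForm (i : Fin 4) {α β : ℂ → ℂ} (hα : AnalyticAt ℂ α 0)
    (hβ : AnalyticAt ℂ β 0) : ∀ᶠ p in lineGerm i, AnalyticAt ℂ (lineForm i α β) p := by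
  have ht : Tendsto (lineCoord i) (lineGerm i) (𝓝 0) := tendsto_comap.mono_left inf_le_left
  filter_upwards [eventually_torus_lineGerm i, ht.eventually hα.eventually_analyticAt,
    ht.eventually hβ.eventually_analyticAt] with p h1 h2 h3
  have hl := analyticAt_lineCoord i h1
  have e1 : AnalyticAt ℂ (fun p => α (lineCoord i p)) p := AnalyticAt.comp h2 hl
  have e2 : AnalyticAt ℂ (fun p => β (lineCoord i p)) p := AnalyticAt.comp h3 hl
  exact ((e1.div analyticAt_fst h1.1).smul analyticAt_const).add
    ((e2.div analyticAt_snd h1.2).smul analyticAt_const)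

section Normalization

variable {F : ℂ × ℂ → ℂ × ℂ} {a b : ℕ → ℂ → ℂ} {Ψ φ : Fin 4 → ℂ × ℂ → ℂ × ℂ} {u v : ℂ}
  {ω ω' : OneForm} {i : Fin 4} {κ : Fin 4 → ℂ → ℂ}

/-- One of the coefficients of the pull-back of the pencil dominates the other one, and is
comparable with `z` (if `v ≠ 0`) or `y ^ 2` (if `v = 0`). -/
theorem IsSectorialNormalization.exists_pivot (hτ : 0 < τ.im) (huv : (u, v) ≠ (0, 0))
    (hF : IsFormalNormalization τ F a b) (hΨ : IsSectorialNormalization τ F a b Ψ) :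
    ∃ (j : Fin 4) (g : ℂ × ℂ → ℂ) (c : ℂ), c ≠ 0 ∧ ∀ i, Ord τ {i} (-3) g ∧
      Tendsto (fun p => g p * pullback (Ψ i) (pencilForm τ u v) p (axisVec j))
        (coneGerm τ {i}) (𝓝 c) ∧
      Bdd τ {i} (fun p => g p * pullback (Ψ i) (pencilForm τ u v) p (axisVec (j + 1))) := by
  have hτ0 : τ ≠ 0 := fun h => by simp [h] at hτ
  simp only [pullback, pencilForm_eq, clearedCovec_comp_apply]
  have e : (v - u) * τ + τ * u = τ * v := by ring
  simp only [e]
  by_cases hv : v = 0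
  · have hu : u ≠ 0 := fun h => huv (by rw [h, hv])
    refine ⟨0, fun p => p.2 ^ (-2 : ℤ), u, hu, fun i => ⟨ord_snd_zpow (-2), ?_, ?_⟩⟩
    · obtain ⟨h1, -, -⟩ := hΨ.tendsto_partials i
      have h := ((((hΨ.nearRot i).snd).pow 2).mul h1).const_mul u
      simp only [one_pow, mul_one] at h
      refine h.congr' ?_
      filter_upwards [eventually_snd_ne_zero τ {i}] with p hp
      simp only [hv, axisVec, mul_zero, zero_mul, sub_zero, zpow_neg, zpow_ofNat]
      field_simp
    · have h1 := (hΨ.mapApprox hF i 0).fst_snd.left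
      have h := ((Bdd.of_tendsto (((hΨ.nearRot i).snd).pow 2)).mul h1).const_mul u
      refine h.congr' ?_
      filter_upwards [eventually_snd_ne_zero τ {i}] with p hp
      simp only [hv, axisVec, mul_zero, zero_mul, sub_zero, zpow_neg, zpow_ofNat, zero_add]
      field_simp
  · refine ⟨1, fun p => p.1⁻¹, -(2 * Real.pi * Complex.I * (τ * v)),
      neg_ne_zero.2 (mul_ne_zero Complex.two_pi_I_ne_zero (mul_ne_zero hτ0 hv)),
      fun i => ⟨bdd_fst_inv.ord.mono (by norm_num), ?_, ?_⟩⟩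
    · obtain ⟨-, -, h3⟩ := hΨ.tendsto_partials i
      have h0 : Tendsto (fun p => (Ψ i p).2) (coneGerm τ {i}) (𝓝 0) :=
        (tendsto_snd_coneGerm τ {i}).comp (hΨ.tendsto_coneGerm i rfl)
      have hs : Ord τ {i} 0 (fun p => u * (Ψ i p).2 ^ 2) := ord_zero_iff.2 (by
        simpa using (h0.pow 2).const_mul u)
      have h4 := ((hs.mul_bdd (hΨ.mapApprox hF i 0).fst_snd.left).mul_bdd bdd_fst_inv).tendsto
        le_rfl
      have h5 := ((hΨ.tendsto_fst_div i).mul h3).const_mul (2 * Real.pi * Complex.I * (τ * v))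
      have h6 := h4.sub h5
      simp only [mul_one, zero_sub] at h6
      refine h6.congr fun p => ?_
      simp only [axisVec]
      ring
    · have h := hΨ.mapApprox hF i 0
      simp only [sq]
      exact bdd_fst_inv.mul ((((h.snd.left.mul h.snd.left).const_mul _).mul h.fst_fst.left).sub
        ((h.fst.left.const_mul _).mul h.snd_fst.left))

/-- The pull-back by a sectorial chart of a logarithmic form with holomorphic coefficients differs
from the pull-back of the pencil by a flat form. -/
theorem flat_cleared_sub (hτ : 0 < τ.im) (hF : IsFormalNormalization τ F a b)
    (hΨ : IsSectorialNormalization τ F a b Ψ) (i : Fin 4) {k : ℂ → ℂ} (hk : AnalyticAt ℂ k 0)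
    (j : Fin 4) :
    Flat τ {i} (fun p => (clearedCovec τ (coeffX τ u v i k (lineCoord i (sectorialChart τ Ψ i p)))
        (coeffY u i k (lineCoord i (sectorialChart τ Ψ i p))) (Ψ i p)).comp
          (fderiv ℂ (Ψ i) p) (axisVec j) -
      pullback (Ψ i) (pencilForm τ u v) p (axisVec j)) := by
  have hl : Flat τ {i} (fun p => lineCoord i (sectorialChart τ Ψ i p)) := fun N => by
    have h1 := (flat_lineCoord hτ i N).comp_tendsto (hΨ.tendsto_coneGerm i rfl)
    refine h1.trans_isBigO ?_
    have h2 := ((hΨ.nearRot i).snd.zpow₀ N (Or.inl one_ne_zero)).isBigO_one ℂ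
    have h3 := h2.mul (isBigO_refl (fun p : ℂ × ℂ => p.2 ^ N) (coneGerm τ {i}))
    refine h3.congr' ?_ (Eventually.of_forall fun p => one_mul _)
    filter_upwards [eventually_snd_ne_zero τ {i}] with p hp
    rw [div_zpow, div_mul_cancel₀ _ (zpow_ne_zero _ hp)]
    rfl
  have hlk := Flat.mul_comp_self hl hk
  have hma := hΨ.mapApprox hF i 0
  have hb : Bdd τ {i} (fun p => (fderiv ℂ (Ψ i) p (axisVec j)).1) ∧
      Bdd τ {i} (fun p => (fderiv ℂ (Ψ i) p (axisVec j)).2) := by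
    fin_cases j
    exacts [⟨hma.fst_fst.left, hma.snd_fst.left⟩, ⟨hma.fst_snd.left, hma.snd_snd.left⟩,
      ⟨hma.fst_fst.left, hma.snd_fst.left⟩, ⟨hma.fst_snd.left, hma.snd_snd.left⟩]
  have h1 := (hlk.mul_bdd ((hma.snd.left.mul hma.snd.left).mul hb.1)).const_mul (logY i)
  have h2 := (hlk.mul_bdd (hma.fst.left.mul hb.2)).const_mul
    (2 * Real.pi * Complex.I * (logX i + τ * logY i))
  refine (h1.sub h2).congr' (Eventually.of_forall fun p => ?_)
  simp only [pullback, pencilForm_eq, clearedCovec_comp_apply, coeffX, coeffY]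
  ring

/-- The foliations `Π_i^* θ_i = 0` and `Π_{i+1}^* θ_{i+1} = 0` agree on the intersection of the
sectors when the forms `θ_i` patch, since `Π_i = φ_{i,i+1} ∘ Π_{i+1}` there. -/
theorem eventually_wedge_charts (hτ : 0 < τ.im) (hΨ : IsSectorialNormalization τ F a b Ψ)
    (hφ : IsCocycleOf τ Ψ φ)
    (hp : FoliationsPatch φ (fun i => logForm τ u v + axisForm i (κ i))) (i : Fin 4) :
    ∀ᶠ p in coneGerm τ {i, i + 1}, wedge
      (pullback (sectorialChart τ Ψ i) (logForm τ u v + axisForm i (κ i)) p)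
      (pullback (sectorialChart τ Ψ (i + 1)) (logForm τ u v + axisForm (i + 1) (κ (i + 1))) p)
        = 0 := by
  have ht := hΨ.tendsto_chart_corner hτ i
  filter_upwards [eventually_eventually_coneGerm (hφ.eventually_transition i),
    ht.eventually (hφ.tangent i).diffCorner.eventually_differentiableAt,
    (hΨ.analyticAt_chart (i + 1)).filter_mono (coneGerm_mono (by simp)), ht.eventually (hp i)]
    with p e1 e2 e3 e4
  rw [pullback_congr (f := sectorialChart τ Ψ i) e1, pullback_comp e2 e3.differentiableAt,
    wedge_pullback, e4, zero_mul]

/-- Logarithmic forms with the residues of `(v - u) τ dX / X + u dY / Y` which patch under the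
cocycle define a holomorphic foliation along the curve, whose formal completion is the member
of the formal pencil. -/
theorem exists_foliation_of_patch (hτ : 0 < τ.im) (huv : (u, v) ≠ (0, 0))
    (hF : IsFormalNormalization τ F a b) (hΨ : IsSectorialNormalization τ F a b Ψ)
    (hφ : IsCocycleOf τ Ψ φ) (hκ : ∀ i, AnalyticAt ℂ (κ i) 0)
    (hp : FoliationsPatch φ (fun i => logForm τ u v + axisForm i (κ i))) :
    ∃ ω : OneForm, IsFoliation F ω ∧ HasFormalCompletion τ u v a b ω ∧
      ∀ i, ∀ᶠ p in coneGerm τ {i}, wedge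
        (pullback (sectorialChart τ Ψ i) (logForm τ u v + axisForm i (κ i)) p) (ω p) = 0 := by
  obtain ⟨j, g, c, hc, hg⟩ := hΨ.exists_pivot hτ huv hF
  set P : Fin 4 → OneForm := fun i =>
    pullback (sectorialChart τ Ψ i) (logForm τ u v + axisForm i (κ i)) with hP
  set C : Fin 4 → OneForm := fun i => pullback (Ψ i) (pencilForm τ u v) with hC
  -- `R i` is proportional to `P i`, and its difference with the pull-back `C i` of the pencil is flat
  set R : Fin 4 → OneForm := fun i p =>
    (clearedCovec τ (coeffX τ u v i (κ i) (lineCoord i (sectorialChart τ Ψ i p)))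
      (coeffY u i (κ i) (lineCoord i (sectorialChart τ Ψ i p))) (Ψ i p)).comp
        (fderiv ℂ (Ψ i) p) with hR
  have hflat : ∀ i l, Flat τ {i} (fun p => R i p (axisVec l) - C i p (axisVec l)) := fun i l =>
    flat_cleared_sub hτ hF hΨ i (hκ i) l
  have hRP : ∀ i, ∀ᶠ p in coneGerm τ {i}, ∃ s : ℂ, s ≠ 0 ∧ R i p = s • P i p := by
    intro i
    filter_upwards [hΨ.cleared_eq i, pullback_chart_axisForm (u := u) (v := v) hτ hΨ i (κ i)]
      with p h1 h2
    refine ⟨_, h1.1, ?_⟩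
    simp only [hR, hP]
    rw [h1.2, h2]
    rfl
  have hpiv : ∀ i, Tendsto (fun p => g p * R i p (axisVec j)) (coneGerm τ {i}) (𝓝 c) := by
    intro i
    have h1 := (((hflat i j).mul_ord (hg i).1) 0).tendsto le_rfl
    have h2 := h1.add (hg i).2.1
    rw [zero_add] at h2
    refine h2.congr fun p => ?_
    simp only [hC]; ring
  have hpiv' : ∀ i, Bdd τ {i} (fun p => g p * R i p (axisVec (j + 1))) := by
    intro i
    refine (((hflat i (j + 1)).mul_ord (hg i).1).bdd.add (hg i).2.2).congr'
      (Eventually.of_forall fun p => ?_)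
    simp only [hC]; ring
  have hR0 : ∀ i, ∀ᶠ p in coneGerm τ {i}, g p ≠ 0 ∧ R i p (axisVec j) ≠ 0 := fun i =>
    ((hpiv i).eventually_ne hc).mono fun p hp =>
      ⟨left_ne_zero_of_mul hp, right_ne_zero_of_mul hp⟩
  have hP0 : ∀ i, ∀ᶠ p in coneGerm τ {i}, P i p (axisVec j) ≠ 0 := by
    intro i
    filter_upwards [hR0 i, hRP i] with p h1 ⟨s, hs, h2⟩ h3
    apply h1.2
    rw [h2, _root_.smul_apply, h3, smul_zero]
  -- the slope of the foliation in each sector, with respect to the dominant coefficient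
  set m : Fin 4 → ℂ × ℂ → ℂ := fun i p => P i p (axisVec (j + 1)) / P i p (axisVec j) with hm
  have hPa : ∀ i, ∀ᶠ p in coneGerm τ {i}, AnalyticAt ℂ (P i) p := by
    intro i
    have h1 := eventually_analyticAt_lineForm i (analyticAt_coeffX τ u v i (hκ i))
      (analyticAt_coeffY u i (hκ i))
    filter_upwards [(hΨ.tendsto_chart hτ i).eventually h1, hΨ.analyticAt_chart i,
      eventually_eventually_coneGerm
        (pullback_chart_axisForm (u := u) (v := v) hτ hΨ i (κ i))] with p e1 e2 e3
    exact (AnalyticAt.pullback e2 e1).congr (EventuallyEq.symm e3)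
  obtain ⟨M, hMa, hMm⟩ := exists_analytic_of_sectors hτ (m := m)
    (fun i => by
      filter_upwards [hPa i, hP0 i] with p e1 e2
      exact ((analyticAt_clm_apply e1 _).div (analyticAt_clm_apply e1 _) e2).differentiableAt)
    (fun i => by
      refine ((hpiv' i).mul (Bdd.of_tendsto ((hpiv i).inv₀ hc))).congr' ?_
      filter_upwards [hR0 i, hRP i, hP0 i] with p e1 ⟨s, hs, e2⟩ e3
      have e4 := e1.1
      simp only [hm, e2, _root_.smul_apply, smul_eq_mul]
      field_simp)
    (fun i => by
      filter_upwards [eventually_wedge_charts hτ hΨ hφ hp i,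
        (hP0 i).filter_mono (coneGerm_mono (by simp)),
        (hP0 (i + 1)).filter_mono (coneGerm_mono (by simp))] with p e1 e2 e3
      rw [wedge_eq_zero_iff_axis j] at e1
      simp only [hm]
      rw [div_eq_div_iff e2 e3, ← e1, mul_comm])
  set ω : OneForm := fun p => axisL j + M p • axisL (j + 1) with hω
  have hωa : ∀ z : ℂ, z ≠ 0 → AnalyticAt ℂ ω (z, 0) := fun z hz =>
    analyticAt_const.add ((hMa z hz).smul analyticAt_const)
  have hPω : ∀ i, ∀ᶠ p in coneGerm τ {i}, wedge (P i p) (ω p) = 0 := by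
    intro i
    filter_upwards [hMm i, hP0 i] with p e1 e2
    rw [wedge_eq_zero_iff_axis j]
    simp only [hω]
    rw [(axisL_add_smul_apply j (M p)).1, (axisL_add_smul_apply j (M p)).2, e1, mul_one]
    simp only [hm]
    field_simp
  refine ⟨ω, ⟨hωa, fun z hz h0 => ?_, fun z hz => ?_⟩, ?_, hPω⟩
  · have := (axisL_add_smul_apply j (M (z, 0))).1
    simp only [hω] at h0
    rw [h0] at this
    simp at this
  -- the foliation is invariant in one sector, hence everywhere by the identity principle
  · refine Flat.eventually_eq_zero hτ (S := {0}) (i := 0) (by simp)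
      (flat_of_eventually_eq_zero ?_) (fun z hz => ?_) hz
    · filter_upwards [hPω 0, (hF.tendsto_coneGerm {0}).eventually (hPω 0),
        hΨ.pullback_chart_invariant hF 0 (logForm τ u v + axisForm 0 (κ 0)), hP0 0]
        with p e1 e2 e3 e4
      have e5 : P 0 p ≠ 0 := fun h => e4 (by simp [h])
      have e6 := wedge_pullback F (P 0) ω p
      rw [e2, zero_mul] at e6
      have e7 : pullback F (P 0) p = P 0 p := e3.1
      rw [e7] at e6
      exact wedge_eq_zero_of_wedge e5 (by rw [wedge_swap, e6, neg_zero])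
        (by rw [wedge_swap, e1, neg_zero])
    · refine AnalyticAt.wedge (AnalyticAt.pullback (hF.analytic z hz) ?_) (hωa z hz)
      rw [hF.on_curve z hz]
      exact hωa _ (mul_ne_zero (Complex.exp_ne_zero _) hz)
  · rw [hasFormalCompletion_iff hτ hF hΨ hωa 0]
    have hb := fun w => Bdd.of_analyticAt_form (τ := τ) (S := {0}) hωa w
    have h1 := ((hflat 0 0).mul_bdd (hb (0, 1))).sub ((hflat 0 1).mul_bdd (hb (1, 0)))
    refine h1.congr' ?_
    filter_upwards [hPω 0, hRP 0] with p e1 ⟨s, hs, e2⟩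
    have e3 : wedge (R 0 p) (ω p) = 0 := by rw [e2, wedge_smul_left, e1, mul_zero]
    simp only [wedge, axisVec] at e3 ⊢
    simp only [hC] at e3 ⊢
    linear_combination e3

/-- A foliation along the curve is determined by its formal completion. -/
theorem wedge_eq_zero_of_hasFormalCompletion (hτ : 0 < τ.im) (huv : (u, v) ≠ (0, 0))
    (hF : IsFormalNormalization τ F a b) (hΨ : IsSectorialNormalization τ F a b Ψ)
    (hω : IsFoliation F ω) (hc : HasFormalCompletion τ u v a b ω) (hω' : IsFoliation F ω')
    (hc' : HasFormalCompletion τ u v a b ω') :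
    ∀ᶠ p in coneGerm τ S, wedge (ω p) (ω' p) = 0 := by
  obtain ⟨j, g, c, hc0, hg⟩ := hΨ.exists_pivot hτ huv hF
  obtain ⟨hg1, hg2, -⟩ := hg 0
  set C : OneForm := pullback (Ψ 0) (pencilForm τ u v) with hC
  have h := (hasFormalCompletion_iff hτ hF hΨ hω.analytic 0).1 hc
  have h' := (hasFormalCompletion_iff hτ hF hΨ hω'.analytic 0).1 hc'
  have hb := Bdd.of_analyticAt_form (τ := τ) (S := {0}) hω.analytic (axisVec j)
  have hb' := Bdd.of_analyticAt_form (τ := τ) (S := {0}) hω'.analytic (axisVec j)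
  refine eventually_coneGerm_of_nhds fun z hz =>
    Flat.eventually_eq_zero hτ (S := {0}) (i := 0) (by simp) ?_
      (fun z hz => AnalyticAt.wedge (hω.analytic z hz) (hω'.analytic z hz)) hz
  have h1 := (((h.mul_bdd hb').sub (h'.mul_bdd hb)).mul_ord hg1).mul_bdd
    (Bdd.of_tendsto (hg2.inv₀ hc0))
  refine h1.congr' ?_
  filter_upwards [hg2.eventually_ne hc0] with p hp
  have e1 := wedge_mul_apply (ω p) (ω' p) (C p) (axisVec j)
  have e2 := left_ne_zero_of_mul hp
  have e3 : C p (axisVec j) ≠ 0 := right_ne_zero_of_mul hp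
  rw [wedge_swap (C p) (ω' p), wedge_swap (C p) (ω p)] at e1
  have e4 : wedge (ω p) (C p) * ω' p (axisVec j) - wedge (ω' p) (C p) * ω p (axisVec j) =
      wedge (ω p) (ω' p) * C p (axisVec j) := by linear_combination -e1
  change (wedge (ω p) (C p) * ω' p (axisVec j) - wedge (ω' p) (C p) * ω p (axisVec j)) * g p *
    (g p * C p (axisVec j))⁻¹ = _
  rw [e4]
  field_simp

/-- The holomorphic foliation whose formal completion is the member of the formal pencil is given
by every family of logarithmic forms with the prescribed residues which patch. -/
theorem eventually_wedge_chart_of_patch (hτ : 0 < τ.im) (huv : (u, v) ≠ (0, 0))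
    (hF : IsFormalNormalization τ F a b) (hΨ : IsSectorialNormalization τ F a b Ψ)
    (hφ : IsCocycleOf τ Ψ φ) (hκ : ∀ i, AnalyticAt ℂ (κ i) 0)
    (hp : FoliationsPatch φ (fun i => logForm τ u v + axisForm i (κ i)))
    (hω : IsFoliation F ω) (hc : HasFormalCompletion τ u v a b ω) (i : Fin 4) :
    ∀ᶠ p in coneGerm τ {i}, wedge
      (pullback (sectorialChart τ Ψ i) (logForm τ u v + axisForm i (κ i)) p) (ω p) = 0 := by
  obtain ⟨ω', hω', hc', h⟩ := exists_foliation_of_patch hτ huv hF hΨ hφ hκ hp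
  have h0 : ∀ᶠ p in coneGerm τ {i}, ω' p ≠ 0 := eventually_coneGerm_of_nhds fun z hz =>
    (hω'.analytic z hz).continuousAt.eventually_ne (hω'.regular z hz)
  filter_upwards [h i, h0, wedge_eq_zero_of_hasFormalCompletion (S := {i}) hτ huv hF hΨ hω hc hω'
    hc'] with p e1 e2 e3
  exact wedge_eq_zero_of_wedge e2 e1 e3

/-- Only the germs of the forms along the lines matter for patching. -/
theorem FoliationsPatch.congr (hφ : ∀ i, DiffCorner i (φ i)) {θ θ' : Fin 4 → OneForm}
    (h : ∀ i, ∀ᶠ p in lineGerm i, θ i p = θ' i p) (hp : FoliationsPatch φ θ) :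
    FoliationsPatch φ θ' := by
  intro i
  filter_upwards [hp i, (hφ i).tendsto.eventually (cornerGerm_le_left i (h i)),
    cornerGerm_le_right i (h (i + 1))] with p e1 e2 e3
  rwa [← e3, ← pullback_congr_form e2]

/-- The closed holomorphic forms in a patching family may be taken of the form `k(ℓ) dℓ`. -/
theorem FoliationsPatch.exists_axisForm (hφ : ∀ i, DiffCorner i (φ i)) {η : Fin 4 → OneForm}
    (hη : ∀ i, IsClosedHolomorphic i (η i))
    (hp : FoliationsPatch φ (fun i => logForm τ u v + η i)) :
    ∃ κ : Fin 4 → ℂ → ℂ, (∀ i, AnalyticAt ℂ (κ i) 0) ∧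
      (∀ i, ∀ᶠ p in lineGerm i, η i p = axisForm i (κ i) p) ∧
      FoliationsPatch φ (fun i => logForm τ u v + axisForm i (κ i)) := by
  choose κ hκ hηκ using fun i => (hη i).exists_axisForm
  exact ⟨κ, hκ, hηκ, hp.congr hφ fun i =>
    (hηκ i).mono fun p e => by simp only [Pi.add_apply, e]⟩

end Normalization

end EllipticNbhd

theorem mainTheorem5 (τ : ℂ) (hτ : 0 < τ.im) (u v : ℂ) (huv : (u, v) ≠ (0, 0))
    (F : ℂ × ℂ → ℂ × ℂ) (a b : ℕ → ℂ → ℂ) (hF : IsFormalNormalization τ F a b)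
    (Ψ : Fin 4 → ℂ × ℂ → ℂ × ℂ) (hΨ : IsSectorialNormalization τ F a b Ψ)
    (φ : Fin 4 → ℂ × ℂ → ℂ × ℂ) (hφ : IsCocycleOf τ Ψ φ) :
    [ FormalFoliationConverges τ u v F a b,
      ∃ η : Fin 4 → OneForm, (∀ i, IsClosedHolomorphic i (η i)) ∧
        FoliationsPatch φ (fun i => logForm τ u v + η i),
      ∃ χ : Fin 4 → ℂ × ℂ → ℂ × ℂ, (∀ i, DiffCorner i (χ i)) ∧ CocycleEquiv φ χ ∧
        PreservesLogFoliation τ u v χ,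
      ∃ χ : Fin 4 → ℂ × ℂ → ℂ × ℂ, (∀ i, DiffCornerOne i (χ i)) ∧ CocycleEquivOne τ φ χ ∧
        PreservesLogFoliation τ u v χ ].TFAE ∧
    ∀ ω : OneForm, IsFoliation F ω → HasFormalCompletion τ u v a b ω →
      (∀ η : Fin 4 → OneForm, (∀ i, IsClosedHolomorphic i (η i)) →
        FoliationsPatch φ (fun i => logForm τ u v + η i) →
        ∀ i, ∀ᶠ p in sectorFilter τ i,
          wedge (pullback (sectorialChart τ Ψ i) (logForm τ u v + η i) p) (ω p) = 0) ∧
      (∀ χ ψ : Fin 4 → ℂ × ℂ → ℂ × ℂ, (∀ i, DiffCorner i (χ i)) → (∀ i, DiffLine i (ψ i)) →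
        Conjugates ψ φ χ → PreservesLogFoliation τ u v χ →
        ∀ i, ∀ᶠ p in sectorFilter τ i,
          wedge (pullback (fun p' => ψ i (sectorialChart τ Ψ i p')) (logForm τ u v) p)
            (ω p) = 0) := by
  have hφ' : ∀ i, DiffCorner i (φ i) := fun i => (hφ.tangent i).diffCorner
  refine ⟨?_, fun ω hω hc => ⟨fun η hη hp i => ?_, fun χ ψ hχ hψ hcj hpr i => ?_⟩⟩
  · tfae_have 1 → 2 := by
      rintro ⟨ω, hω, hc⟩
      obtain ⟨κ, hκ, hp⟩ := exists_axisForm_of_foliation hτ huv hF hΨ hφ hω hc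
      exact ⟨fun i => axisForm i (κ i), fun i => isClosedHolomorphic_axisForm i (hκ i), hp⟩
    tfae_have 2 → 1 := by
      rintro ⟨η, hη, hp⟩
      obtain ⟨κ, hκ, -, hp'⟩ := hp.exists_axisForm hφ' hη
      obtain ⟨ω, hω, hc, -⟩ := exists_foliation_of_patch hτ huv hF hΨ hφ hκ hp'
      exact ⟨ω, hω, hc⟩
    tfae_have 2 → 4 := by
      rintro ⟨η, hη, hp⟩
      obtain ⟨κ, hκ, -, hp'⟩ := hp.exists_axisForm hφ' hη
      obtain ⟨χ, ψ, h1, h2, h3, h4⟩ := exists_preserving_cocycle hτ huv hφ.tangent hκ hp'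
      exact ⟨χ, h1, CocycleEquivOne.of_conjugates h2 h3, h4⟩
    tfae_have 4 → 3 := by
      rintro ⟨χ, h1, h2, h3⟩
      exact ⟨χ, fun i => (h1 i).diffCorner, h2.cocycleEquiv, h3⟩
    tfae_have 3 → 2 := by
      rintro ⟨χ, hχ, ⟨ψ, hψ, hcj⟩, hpr⟩
      choose κ hκ hψκ using fun i => (hψ i).exists_pullback τ u v
      exact ⟨fun i => axisForm i (κ i), fun i => isClosedHolomorphic_axisForm i (hκ i),
        foliationsPatch_of_conjugates hφ' hχ hψ hcj hpr hψκ⟩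
    tfae_finish
  · rw [sectorFilter_eq]
    obtain ⟨κ, hκ, hηκ, hp'⟩ := hp.exists_axisForm hφ' hη
    filter_upwards [eventually_wedge_chart_of_patch hτ huv hF hΨ hφ hκ hp' hω hc i,
      (hΨ.tendsto_chart hτ i).eventually (hηκ i)] with p e1 e2
    rw [← e1]
    congr 1
    exact pullback_congr_form (by simp only [Pi.add_apply, e2])
  · rw [sectorFilter_eq]
    choose κ hκ hψκ using fun i => (hψ i).exists_pullback τ u v
    have hp := foliationsPatch_of_conjugates hφ' hχ hψ hcj hpr hψκ
    filter_upwards [eventually_wedge_chart_of_patch hτ huv hF hΨ hφ hκ hp hω hc i,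
      (hΨ.tendsto_chart hτ i).eventually (hψκ i), hΨ.analyticAt_chart i] with p e1 e2 e3
    rw [pullback_comp e2.1 e3.differentiableAt, pullback_congr_form e2.2, e1]
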